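/- All Lie algebras are finite-dimensional and real. A *symplectic structure* on a Lie algebra $\mathfrak g$ is a non-degenerate skew-symmetric bilinear form $\omega$ on $\mathfrak g$ with $\omega([x,y],z)+\omega([y,z],x)+\omega([z,x],y)=0$ for all $x,y,z\in\mathfrak g$; it is *exact* if $\omega(x,y)=f([x,y])$ for some linear form $f\in\mathfrak g^*$. $\mathfrak g$ is *Frobenius* if it admits a non-degenerate exact $2$-form. $\mathfrak g\neq 0$ is *indecomposable* if it is not the direct sum of two non-zero ideals. Define the following Lie algebras with basis $e_1,\dots,e_8$ (brackets not listed vanish or follow by antisymmetry). In $\mathrm L_{8,3}$ and $\mathrm L_{8,4}^p$, $$[e_1,e_2]=e_3,\ [e_1,e_3]=-e_2,\ [e_2,e_3]=e_1,$$ $$[e_1,e_4]=\tfrac12e_7,\ [e_1,e_5]=\tfrac12e_6,\ [e_1,e_6]=-\tfrac12e_5,\ [e_1,e_7]=-\tfrac12e_4,$$ $$[e_2,e_4]=\tfrac12e_5,\ [e_2,e_5]=-\tfrac12e_4,\ [e_2,e_6]=\tfrac12e_7,\ [e_2,e_7]=-\tfrac12e_6,$$ $$[e_3,e_4]=\tfrac12e_6,\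 [e_3,e_5]=-\tfrac12e_7,\ [e_3,e_6]=-\tfrac12e_4,\ [e_3,e_7]=\tfrac12e_5.$$ In all the others, $[e_1,e_2]=2e_2,\ [e_1,e_3]=-2e_3,\ [e_2,e_3]=e_1$; in all of these except $\mathrm L_{8,20}$, $[e_1,e_4]=e_4,\ [e_1,e_5]=-e_5,\ [e_2,e_5]=e_4,\ [e_3,e_4]=e_5$; and in $\mathrm L_{8,16},\mathrm L_{8,17}^p,\mathrm L_{8,18}^p$ moreover $[e_1,e_6]=e_6,\ [e_1,e_7]=-e_7,\ [e_2,e_7]=e_6,\ [e_3,e_6]=e_7$. In $\mathrm L_{8,20}$, $$[e_1,e_4]=3e_4,\ [e_1,e_5]=e_5,\ [e_1,e_6]=-e_6,\ [e_1,e_7]=-3e_7,$$ $$[e_2,e_5]=3e_4,\ [e_2,e_6]=2e_5,\ [e_2,e_7]=e_6,\ [e_3,e_4]=e_5,\ [e_3,e_5]=2e_6,\ [e_3,e_6]=3e_7.$$ The brackets with $e_8$ are: - $\mathrm L_{8,3}$ and $\mathrm L_{8,20}$: $[e_i,e_8]=e_i$ for $i=4,5,6,7$. - $\mathrm L_{8,4}^p$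 and $\mathrm L_{8,18}^p$: $[e_4,e_8]=pe_4-e_6,\ [e_5,e_8]=pe_5-e_7,\ [e_6,e_8]=e_4+pe_6,\ [e_7,e_8]=e_5+pe_7$. - In the remaining ones $[e_4,e_8]=e_4,\ [e_5,e_8]=e_5$, and - $\mathrm L_{8,7}^{p,q}$: $[e_6,e_8]=pe_6,\ [e_7,e_8]=qe_7$; - $\mathrm L_{8,8}^{p}$: $[e_6,e_8]=pe_6,\ [e_7,e_8]=e_6+pe_7$; - $\mathrm L_{8,9}^{p,q}$: $[e_6,e_8]=pe_6-qe_7,\ [e_7,e_8]=qe_6+pe_7$; - $\mathrm L_{8,16}$: $[e_6,e_8]=e_4+e_6,\ [e_7,e_8]=e_5+e_7$; - $\mathrm L_{8,17}^{p}$: $[e_6,e_8]=pe_6,\ [e_7,e_8]=pe_7$. **Proposition.** An eight-dimensional Lie algebra is indecomposable, non-solvable and admits a symplectic structure if and only if it is isomorphic to one of $$\mathrm L_{8,3},\ \mathrm L_{8,4}^{p}\,(p\neq0),\ \mathrm L_{8,7}^{p,-p}\,(p\ne0),\ \mathrm L_{8,8}^0,\ \mathrm L_{8,9}^{0,q}\,(q\neq0),\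 \mathrm L_{8,16},\ \mathrm L_{8,17}^{p}\,(-1<p\le1),\ \mathrm L_{8,18}^{p}\,(p>0),\ \mathrm L_{8,20}.$$ In addition: - $\mathrm L_{8,3}$, $\mathrm L_{8,4}^{p}$ $(p\neq0)$, $\mathrm L_{8,16}$, $\mathrm L_{8,17}^{p}$ $(-1<p\le1)$, $\mathrm L_{8,18}^{p}$ $(p>0)$ and $\mathrm L_{8,20}$ are Frobenius. Every symplectic structure on any of these other than $\mathrm L_{8,17}^0$ is exact, whereas $\mathrm L_{8,17}^0$ also admits a symplectic structure that is not exact. - $\mathrm L_{8,7}^{p,-p}$ $(p\ne0)$, $\mathrm L_{8,8}^0$ and $\mathrm L_{8,9}^{0,q}$ $(q\neq0)$ are not Frobenius. -/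

import Mathlib

universe u

namespace SympLie

noncomputable section

section General

variable (g : Type u) [LieRing g] [LieAlgebra ℝ g]

/-- A real Lie algebra is indecomposable if it is nonzero and is not the direct sum of two nonzero
ideals. -/
def IsIndecomposable : Prop :=
  Nontrivial g ∧ ∀ I J : LieIdeal ℝ g, IsCompl I J → I = ⊥ ∨ J = ⊥

variable {g}

/-- A symplectic form: a non-degenerate skew-symmetric bilinear form which is a 2-cocycle for the
Chevalley-Eilenberg differential with trivial real coefficients. -/
structure IsSymplectic (ω : LinearMap.BilinForm ℝ g) : Prop where
  alt : ∀ x, ω x x = 0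
  nondegenerate : ω.Nondegenerate
  closed : ∀ x y z, ω ⁅x, y⁆ z + ω ⁅y, z⁆ x + ω ⁅z, x⁆ y = 0

/-- A 2-form is exact if it is the differential of a linear form `f`, i.e. (up to replacing
`f` by `-f`) it is `(x, y) ↦ f ⁅x, y⁆`. -/
def IsExactForm (ω : LinearMap.BilinForm ℝ g) : Prop :=
  ∃ f : Module.Dual ℝ g, ∀ x y, ω x y = f ⁅x, y⁆

variable (g)

/-- The Lie algebra admits a symplectic form. -/
def AdmitsSymplectic : Prop := ∃ ω : LinearMap.BilinForm ℝ g, IsSymplectic ω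

/-- A Frobenius Lie algebra: one admitting a non-degenerate exact 2-form. -/
def IsFrobenius : Prop :=
  ∃ ω : LinearMap.BilinForm ℝ g, ω.Nondegenerate ∧ IsExactForm ω

end General

/-! ### Eight-dimensional Lie algebras given by a table of brackets -/

/-- The standard basis `e 1, …, e 8` of `ℝ⁸` (indexed from 1). -/
def e (k : ℕ) : Fin 8 → ℝ := fun i => if (i : ℕ) + 1 = k then 1 else 0

/-- The alternating bilinear product on `ℝ⁸` with `[e i, e j] = c i j` for `1 ≤ i < j ≤ 8`
(see `tableBracket_e`). Only the values `c i j` with `1 ≤ i < j ≤ 8` matter. -/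
def tableBracket (c : ℕ → ℕ → Fin 8 → ℝ) (x y : Fin 8 → ℝ) : Fin 8 → ℝ :=
  ∑ i : Fin 8, ∑ j : Fin 8,
    if i < j then (x i * y j - x j * y i) • c ((i : ℕ) + 1) ((j : ℕ) + 1) else 0

/-- A table of brackets `[e i, e j] = c i j`, `i < j`, satisfying the Jacobi identity. -/
structure Table where
  c : ℕ → ℕ → Fin 8 → ℝ
  jacobi : ∀ x y z : Fin 8 → ℝ,
    tableBracket c x (tableBracket c y z) =
      tableBracket c (tableBracket c x y) z + tableBracket c y (tableBracket c x z)

theorem tableBracket_self (c : ℕ → ℕ → Fin 8 → ℝ) (x : Fin 8 → ℝ) : tableBracket c x x = 0 := by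
  simp [tableBracket, mul_comm]

theorem tableBracket_add_left (c : ℕ → ℕ → Fin 8 → ℝ) (x y z : Fin 8 → ℝ) :
    tableBracket c (x + y) z = tableBracket c x z + tableBracket c y z := by
  simp only [tableBracket, ← Finset.sum_add_distrib]
  refine Finset.sum_congr rfl fun i _ => Finset.sum_congr rfl fun j _ => ?_
  split_ifs
  · rw [← add_smul]; congr 1; simp only [Pi.add_apply]; ring
  · simp

theorem tableBracket_add_right (c : ℕ → ℕ → Fin 8 → ℝ) (x y z : Fin 8 → ℝ) :
    tableBracket c x (y + z) = tableBracket c x y + tableBracket c x z := by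
  simp only [tableBracket, ← Finset.sum_add_distrib]
  refine Finset.sum_congr rfl fun i _ => Finset.sum_congr rfl fun j _ => ?_
  split_ifs
  · rw [← add_smul]; congr 1; simp only [Pi.add_apply]; ring
  · simp

theorem tableBracket_smul_right (c : ℕ → ℕ → Fin 8 → ℝ) (t : ℝ) (x y : Fin 8 → ℝ) :
    tableBracket c x (t • y) = t • tableBracket c x y := by
  simp only [tableBracket, Finset.smul_sum]
  refine Finset.sum_congr rfl fun i _ => Finset.sum_congr rfl fun j _ => ?_
  split_ifs
  · rw [smul_smul]; congr 1; simp only [Pi.smul_apply, smul_eq_mul]; ring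
  · simp

theorem tableBracket_eq (c : ℕ → ℕ → Fin 8 → ℝ) (x y : Fin 8 → ℝ) :
    tableBracket c x y =
      (x 0 * y 1 - x 1 * y 0) • c 1 2 +
      (x 0 * y 2 - x 2 * y 0) • c 1 3 +
      (x 0 * y 3 - x 3 * y 0) • c 1 4 +
      (x 0 * y 4 - x 4 * y 0) • c 1 5 +
      (x 0 * y 5 - x 5 * y 0) • c 1 6 +
      (x 0 * y 6 - x 6 * y 0) • c 1 7 +
      (x 0 * y 7 - x 7 * y 0) • c 1 8 +
      (x 1 * y 2 - x 2 * y 1) • c 2 3 +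
      (x 1 * y 3 - x 3 * y 1) • c 2 4 +
      (x 1 * y 4 - x 4 * y 1) • c 2 5 +
      (x 1 * y 5 - x 5 * y 1) • c 2 6 +
      (x 1 * y 6 - x 6 * y 1) • c 2 7 +
      (x 1 * y 7 - x 7 * y 1) • c 2 8 +
      (x 2 * y 3 - x 3 * y 2) • c 3 4 +
      (x 2 * y 4 - x 4 * y 2) • c 3 5 +
      (x 2 * y 5 - x 5 * y 2) • c 3 6 +
      (x 2 * y 6 - x 6 * y 2) • c 3 7 +
      (x 2 * y 7 - x 7 * y 2) • c 3 8 +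
      (x 3 * y 4 - x 4 * y 3) • c 4 5 +
      (x 3 * y 5 - x 5 * y 3) • c 4 6 +
      (x 3 * y 6 - x 6 * y 3) • c 4 7 +
      (x 3 * y 7 - x 7 * y 3) • c 4 8 +
      (x 4 * y 5 - x 5 * y 4) • c 5 6 +
      (x 4 * y 6 - x 6 * y 4) • c 5 7 +
      (x 4 * y 7 - x 7 * y 4) • c 5 8 +
      (x 5 * y 6 - x 6 * y 5) • c 6 7 +
      (x 5 * y 7 - x 7 * y 5) • c 6 8 +
      (x 6 * y 7 - x 7 * y 6) • c 7 8 := by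
  simp [tableBracket, Fin.sum_univ_eight]
  abel

/-- The brackets of basis vectors are the ones in the table. -/
theorem tableBracket_e (c : ℕ → ℕ → Fin 8 → ℝ) (i j : Fin 8) (h : i < j) :
    tableBracket c (e ((i : ℕ) + 1)) (e ((j : ℕ) + 1)) = c ((i : ℕ) + 1) ((j : ℕ) + 1) := by
  unfold tableBracket
  rw [Finset.sum_eq_single i, Finset.sum_eq_single j]
  · have h1 : (i : ℕ) ≠ j := fun hh => h.ne (Fin.ext hh)
    simp [e, h, h1]
  · intro k _ hk
    have h1 : (k : ℕ) ≠ j := fun hh => hk (Fin.ext hh)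
    have h2 : (i : ℕ) ≠ j := fun hh => h.ne (Fin.ext hh)
    simp [e, h1, h2]
  · simp
  · intro k _ hk
    refine Finset.sum_eq_zero fun l _ => ?_
    have h1 : (k : ℕ) ≠ i := fun hh => hk (Fin.ext hh)
    split_ifs with hkl
    · by_cases h2 : (l : ℕ) = i
      · have h3 : (k : ℕ) ≠ j := by
          have a1 : (k : ℕ) < l := hkl
          have a2 : (i : ℕ) < j := h
          omega
        simp [e, h1, h3]
      · simp [e, h1, h2]
    · rfl
  · simp

/-- The underlying vector space `ℝ⁸` of the Lie algebra given by a table. -/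
def Table.Carrier (_T : Table) : Type := Fin 8 → ℝ

instance : CoeSort Table Type := ⟨Table.Carrier⟩

instance (T : Table) : AddCommGroup T.Carrier := inferInstanceAs (AddCommGroup (Fin 8 → ℝ))

instance (T : Table) : Module ℝ T.Carrier := inferInstanceAs (Module ℝ (Fin 8 → ℝ))

instance (T : Table) : LieRing T.Carrier where
  bracket x y := tableBracket T.c x y
  add_lie := tableBracket_add_left T.c
  lie_add := tableBracket_add_right T.c
  lie_self := tableBracket_self T.c
  leibniz_lie := T.jacobi

instance (T : Table) : LieAlgebra ℝ T.Carrier where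
  lie_smul := tableBracket_smul_right T.c

/-! ### The tables

All unlisted brackets `[e i, e j]` with `i < j` vanish. -/

/-- `so(3) = ⟨e 1, e 2, e 3⟩` acting on `⟨e 4, e 5, e 6, e 7⟩` by its irreducible real
four-dimensional representation. -/
def so3Table : ℕ → ℕ → Fin 8 → ℝ
  | 1, 2 => e 3
  | 1, 3 => -e 2
  | 2, 3 => e 1
  | 1, 4 => (1 / 2 : ℝ) • e 7
  | 1, 5 => (1 / 2 : ℝ) • e 6
  | 1, 6 => -(1 / 2 : ℝ) • e 5
  | 1, 7 => -(1 / 2 : ℝ) • e 4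
  | 2, 4 => (1 / 2 : ℝ) • e 5
  | 2, 5 => -(1 / 2 : ℝ) • e 4
  | 2, 6 => (1 / 2 : ℝ) • e 7
  | 2, 7 => -(1 / 2 : ℝ) • e 6
  | 3, 4 => (1 / 2 : ℝ) • e 6
  | 3, 5 => -(1 / 2 : ℝ) • e 7
  | 3, 6 => -(1 / 2 : ℝ) • e 4
  | 3, 7 => (1 / 2 : ℝ) • e 5
  | _, _ => 0

/-- `sl(2, ℝ) = ⟨e 1, e 2, e 3⟩` acting on `⟨e 4, e 5⟩` by its standard representation. -/
def sl2Table : ℕ → ℕ → Fin 8 → ℝ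
  | 1, 2 => (2 : ℝ) • e 2
  | 1, 3 => -(2 : ℝ) • e 3
  | 2, 3 => e 1
  | 1, 4 => e 4
  | 1, 5 => -e 5
  | 2, 5 => e 4
  | 3, 4 => e 5
  | _, _ => 0

/-- `sl(2, ℝ) = ⟨e 1, e 2, e 3⟩` acting on both `⟨e 4, e 5⟩` and `⟨e 6, e 7⟩` by its standard
representation. -/
def sl2Table' : ℕ → ℕ → Fin 8 → ℝ
  | 1, 6 => e 6
  | 1, 7 => -e 7
  | 2, 7 => e 6
  | 3, 6 => e 7
  | i, j => sl2Table i j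

/-- The brackets of `L_{8,3}`. -/
def L3Brackets : ℕ → ℕ → Fin 8 → ℝ
  | 4, 8 => e 4
  | 5, 8 => e 5
  | 6, 8 => e 6
  | 7, 8 => e 7
  | i, j => so3Table i j

theorem L3_formula (x y : Fin 8 → ℝ) :
    tableBracket L3Brackets x y = ![(x 1 * y 2 - x 2 * y 1),
      (-(x 0 * y 2 - x 2 * y 0)),
      (x 0 * y 1 - x 1 * y 0),
      (-1/2) * (x 0 * y 6 - x 6 * y 0) + (-1/2) * (x 1 * y 4 - x 4 * y 1) + (-1/2) * (x 2 * y 5 - x 5 * y 2) + (x 3 * y 7 - x 7 * y 3),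
      (-1/2) * (x 0 * y 5 - x 5 * y 0) + (1/2) * (x 1 * y 3 - x 3 * y 1) + (1/2) * (x 2 * y 6 - x 6 * y 2) + (x 4 * y 7 - x 7 * y 4),
      (1/2) * (x 0 * y 4 - x 4 * y 0) + (-1/2) * (x 1 * y 6 - x 6 * y 1) + (1/2) * (x 2 * y 3 - x 3 * y 2) + (x 5 * y 7 - x 7 * y 5),
      (1/2) * (x 0 * y 3 - x 3 * y 0) + (1/2) * (x 1 * y 5 - x 5 * y 1) + (-1/2) * (x 2 * y 4 - x 4 * y 2) + (x 6 * y 7 - x 7 * y 6),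
      0] := by
  rw [tableBracket_eq]
  simp only [L3Brackets, so3Table]
  ext k
  fin_cases k <;> simp [e] <;> ring

/-- The Lie algebra with these brackets. -/
def L3 : Table where
  c := L3Brackets
  jacobi x y z := by
    simp only [L3_formula]
    ext k
    fin_cases k <;> simp <;> ring

/-- The brackets of `L_{8,4}^p`. -/
def L4Brackets (p : ℝ) : ℕ → ℕ → Fin 8 → ℝ
  | 4, 8 => p • e 4 - e 6
  | 5, 8 => p • e 5 - e 7
  | 6, 8 => e 4 + p • e 6
  | 7, 8 => e 5 + p • e 7
  | i, j => so3Table i j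

theorem L4_formula (p : ℝ) (x y : Fin 8 → ℝ) :
    tableBracket (L4Brackets p) x y = ![(x 1 * y 2 - x 2 * y 1),
      (-(x 0 * y 2 - x 2 * y 0)),
      (x 0 * y 1 - x 1 * y 0),
      (-1/2) * (x 0 * y 6 - x 6 * y 0) + (-1/2) * (x 1 * y 4 - x 4 * y 1) + (-1/2) * (x 2 * y 5 - x 5 * y 2) + (p) * (x 3 * y 7 - x 7 * y 3) + (x 5 * y 7 - x 7 * y 5),
      (-1/2) * (x 0 * y 5 - x 5 * y 0) + (1/2) * (x 1 * y 3 - x 3 * y 1) + (1/2) * (x 2 * y 6 - x 6 * y 2) + (p) * (x 4 * y 7 - x 7 * y 4) + (x 6 * y 7 - x 7 * y 6),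
      (1/2) * (x 0 * y 4 - x 4 * y 0) + (-1/2) * (x 1 * y 6 - x 6 * y 1) + (1/2) * (x 2 * y 3 - x 3 * y 2) + (-(x 3 * y 7 - x 7 * y 3)) + (p) * (x 5 * y 7 - x 7 * y 5),
      (1/2) * (x 0 * y 3 - x 3 * y 0) + (1/2) * (x 1 * y 5 - x 5 * y 1) + (-1/2) * (x 2 * y 4 - x 4 * y 2) + (-(x 4 * y 7 - x 7 * y 4)) + (p) * (x 6 * y 7 - x 7 * y 6),
      0] := by
  rw [tableBracket_eq]
  simp only [L4Brackets, so3Table]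
  ext k
  fin_cases k <;> simp [e] <;> ring

/-- The Lie algebra with these brackets. -/
def L4 (p : ℝ) : Table where
  c := L4Brackets p
  jacobi x y z := by
    simp only [L4_formula]
    ext k
    fin_cases k <;> simp <;> ring

/-- The brackets of `L_{8,7}^{p,q}`. -/
def L7Brackets (p q : ℝ) : ℕ → ℕ → Fin 8 → ℝ
  | 4, 8 => e 4
  | 5, 8 => e 5
  | 6, 8 => p • e 6
  | 7, 8 => q • e 7
  | i, j => sl2Table i j

theorem L7_formula (p q : ℝ) (x y : Fin 8 → ℝ) :
    tableBracket (L7Brackets p q) x y = ![(x 1 * y 2 - x 2 * y 1),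
      (2) * (x 0 * y 1 - x 1 * y 0),
      (-2) * (x 0 * y 2 - x 2 * y 0),
      (x 0 * y 3 - x 3 * y 0) + (x 1 * y 4 - x 4 * y 1) + (x 3 * y 7 - x 7 * y 3),
      (-(x 0 * y 4 - x 4 * y 0)) + (x 2 * y 3 - x 3 * y 2) + (x 4 * y 7 - x 7 * y 4),
      (p) * (x 5 * y 7 - x 7 * y 5),
      (q) * (x 6 * y 7 - x 7 * y 6),
      0] := by
  rw [tableBracket_eq]
  simp only [L7Brackets, sl2Table]
  ext k
  fin_cases k <;> simp [e] <;> ring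

/-- The Lie algebra with these brackets. -/
def L7 (p q : ℝ) : Table where
  c := L7Brackets p q
  jacobi x y z := by
    simp only [L7_formula]
    ext k
    fin_cases k <;> simp <;> ring

/-- The brackets of `L_{8,8}^p`. -/
def L8Brackets (p : ℝ) : ℕ → ℕ → Fin 8 → ℝ
  | 4, 8 => e 4
  | 5, 8 => e 5
  | 6, 8 => p • e 6
  | 7, 8 => e 6 + p • e 7
  | i, j => sl2Table i j

theorem L8_formula (p : ℝ) (x y : Fin 8 → ℝ) :
    tableBracket (L8Brackets p) x y = ![(x 1 * y 2 - x 2 * y 1),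
      (2) * (x 0 * y 1 - x 1 * y 0),
      (-2) * (x 0 * y 2 - x 2 * y 0),
      (x 0 * y 3 - x 3 * y 0) + (x 1 * y 4 - x 4 * y 1) + (x 3 * y 7 - x 7 * y 3),
      (-(x 0 * y 4 - x 4 * y 0)) + (x 2 * y 3 - x 3 * y 2) + (x 4 * y 7 - x 7 * y 4),
      (p) * (x 5 * y 7 - x 7 * y 5) + (x 6 * y 7 - x 7 * y 6),
      (p) * (x 6 * y 7 - x 7 * y 6),
      0] := by
  rw [tableBracket_eq]
  simp only [L8Brackets, sl2Table]
  ext k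
  fin_cases k <;> simp [e] <;> ring

/-- The Lie algebra with these brackets. -/
def L8 (p : ℝ) : Table where
  c := L8Brackets p
  jacobi x y z := by
    simp only [L8_formula]
    ext k
    fin_cases k <;> simp <;> ring

/-- The brackets of `L_{8,9}^{p,q}`. -/
def L9Brackets (p q : ℝ) : ℕ → ℕ → Fin 8 → ℝ
  | 4, 8 => e 4
  | 5, 8 => e 5
  | 6, 8 => p • e 6 - q • e 7
  | 7, 8 => q • e 6 + p • e 7
  | i, j => sl2Table i j

theorem L9_formula (p q : ℝ) (x y : Fin 8 → ℝ) :
    tableBracket (L9Brackets p q) x y = ![(x 1 * y 2 - x 2 * y 1),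
      (2) * (x 0 * y 1 - x 1 * y 0),
      (-2) * (x 0 * y 2 - x 2 * y 0),
      (x 0 * y 3 - x 3 * y 0) + (x 1 * y 4 - x 4 * y 1) + (x 3 * y 7 - x 7 * y 3),
      (-(x 0 * y 4 - x 4 * y 0)) + (x 2 * y 3 - x 3 * y 2) + (x 4 * y 7 - x 7 * y 4),
      (p) * (x 5 * y 7 - x 7 * y 5) + (q) * (x 6 * y 7 - x 7 * y 6),
      (-q) * (x 5 * y 7 - x 7 * y 5) + (p) * (x 6 * y 7 - x 7 * y 6),
      0] := by
  rw [tableBracket_eq]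
  simp only [L9Brackets, sl2Table]
  ext k
  fin_cases k <;> simp [e] <;> ring

/-- The Lie algebra with these brackets. -/
def L9 (p q : ℝ) : Table where
  c := L9Brackets p q
  jacobi x y z := by
    simp only [L9_formula]
    ext k
    fin_cases k <;> simp <;> ring

/-- The brackets of `L_{8,16}`. -/
def L16Brackets : ℕ → ℕ → Fin 8 → ℝ
  | 4, 8 => e 4
  | 5, 8 => e 5
  | 6, 8 => e 4 + e 6
  | 7, 8 => e 5 + e 7
  | i, j => sl2Table' i j

theorem L16_formula (x y : Fin 8 → ℝ) :
    tableBracket L16Brackets x y = ![(x 1 * y 2 - x 2 * y 1),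
      (2) * (x 0 * y 1 - x 1 * y 0),
      (-2) * (x 0 * y 2 - x 2 * y 0),
      (x 0 * y 3 - x 3 * y 0) + (x 1 * y 4 - x 4 * y 1) + (x 3 * y 7 - x 7 * y 3) + (x 5 * y 7 - x 7 * y 5),
      (-(x 0 * y 4 - x 4 * y 0)) + (x 2 * y 3 - x 3 * y 2) + (x 4 * y 7 - x 7 * y 4) + (x 6 * y 7 - x 7 * y 6),
      (x 0 * y 5 - x 5 * y 0) + (x 1 * y 6 - x 6 * y 1) + (x 5 * y 7 - x 7 * y 5),
      (-(x 0 * y 6 - x 6 * y 0)) + (x 2 * y 5 - x 5 * y 2) + (x 6 * y 7 - x 7 * y 6),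
      0] := by
  rw [tableBracket_eq]
  simp only [L16Brackets, sl2Table', sl2Table]
  ext k
  fin_cases k <;> simp [e] <;> ring

/-- The Lie algebra with these brackets. -/
def L16 : Table where
  c := L16Brackets
  jacobi x y z := by
    simp only [L16_formula]
    ext k
    fin_cases k <;> simp <;> ring

/-- The brackets of `L_{8,17}^p`. -/
def L17Brackets (p : ℝ) : ℕ → ℕ → Fin 8 → ℝ
  | 4, 8 => e 4
  | 5, 8 => e 5
  | 6, 8 => p • e 6
  | 7, 8 => p • e 7
  | i, j => sl2Table' i j

theorem L17_formula (p : ℝ) (x y : Fin 8 → ℝ) :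
    tableBracket (L17Brackets p) x y = ![(x 1 * y 2 - x 2 * y 1),
      (2) * (x 0 * y 1 - x 1 * y 0),
      (-2) * (x 0 * y 2 - x 2 * y 0),
      (x 0 * y 3 - x 3 * y 0) + (x 1 * y 4 - x 4 * y 1) + (x 3 * y 7 - x 7 * y 3),
      (-(x 0 * y 4 - x 4 * y 0)) + (x 2 * y 3 - x 3 * y 2) + (x 4 * y 7 - x 7 * y 4),
      (x 0 * y 5 - x 5 * y 0) + (x 1 * y 6 - x 6 * y 1) + (p) * (x 5 * y 7 - x 7 * y 5),
      (-(x 0 * y 6 - x 6 * y 0)) + (x 2 * y 5 - x 5 * y 2) + (p) * (x 6 * y 7 - x 7 * y 6),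
      0] := by
  rw [tableBracket_eq]
  simp only [L17Brackets, sl2Table', sl2Table]
  ext k
  fin_cases k <;> simp [e] <;> ring

/-- The Lie algebra with these brackets. -/
def L17 (p : ℝ) : Table where
  c := L17Brackets p
  jacobi x y z := by
    simp only [L17_formula]
    ext k
    fin_cases k <;> simp <;> ring

/-- The brackets of `L_{8,18}^p`. -/
def L18Brackets (p : ℝ) : ℕ → ℕ → Fin 8 → ℝ
  | 4, 8 => p • e 4 - e 6
  | 5, 8 => p • e 5 - e 7
  | 6, 8 => e 4 + p • e 6
  | 7, 8 => e 5 + p • e 7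
  | i, j => sl2Table' i j

theorem L18_formula (p : ℝ) (x y : Fin 8 → ℝ) :
    tableBracket (L18Brackets p) x y = ![(x 1 * y 2 - x 2 * y 1),
      (2) * (x 0 * y 1 - x 1 * y 0),
      (-2) * (x 0 * y 2 - x 2 * y 0),
      (x 0 * y 3 - x 3 * y 0) + (x 1 * y 4 - x 4 * y 1) + (p) * (x 3 * y 7 - x 7 * y 3) + (x 5 * y 7 - x 7 * y 5),
      (-(x 0 * y 4 - x 4 * y 0)) + (x 2 * y 3 - x 3 * y 2) + (p) * (x 4 * y 7 - x 7 * y 4) + (x 6 * y 7 - x 7 * y 6),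
      (x 0 * y 5 - x 5 * y 0) + (x 1 * y 6 - x 6 * y 1) + (-(x 3 * y 7 - x 7 * y 3)) + (p) * (x 5 * y 7 - x 7 * y 5),
      (-(x 0 * y 6 - x 6 * y 0)) + (x 2 * y 5 - x 5 * y 2) + (-(x 4 * y 7 - x 7 * y 4)) + (p) * (x 6 * y 7 - x 7 * y 6),
      0] := by
  rw [tableBracket_eq]
  simp only [L18Brackets, sl2Table', sl2Table]
  ext k
  fin_cases k <;> simp [e] <;> ring

/-- The Lie algebra with these brackets. -/
def L18 (p : ℝ) : Table where
  c := L18Brackets p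
  jacobi x y z := by
    simp only [L18_formula]
    ext k
    fin_cases k <;> simp <;> ring

/-- The brackets of `L_{8,20}`: `sl(2, ℝ)` acts on `⟨e 4, e 5, e 6, e 7⟩` by its irreducible
four-dimensional representation. -/
def L20Brackets : ℕ → ℕ → Fin 8 → ℝ
  | 1, 2 => (2 : ℝ) • e 2
  | 1, 3 => -(2 : ℝ) • e 3
  | 2, 3 => e 1
  | 1, 4 => (3 : ℝ) • e 4
  | 1, 5 => e 5
  | 1, 6 => -e 6
  | 1, 7 => -(3 : ℝ) • e 7
  | 2, 5 => (3 : ℝ) • e 4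
  | 2, 6 => (2 : ℝ) • e 5
  | 2, 7 => e 6
  | 3, 4 => e 5
  | 3, 5 => (2 : ℝ) • e 6
  | 3, 6 => (3 : ℝ) • e 7
  | 4, 8 => e 4
  | 5, 8 => e 5
  | 6, 8 => e 6
  | 7, 8 => e 7
  | _, _ => 0

theorem L20_formula (x y : Fin 8 → ℝ) :
    tableBracket L20Brackets x y = ![(x 1 * y 2 - x 2 * y 1),
      (2) * (x 0 * y 1 - x 1 * y 0),
      (-2) * (x 0 * y 2 - x 2 * y 0),
      (3) * (x 0 * y 3 - x 3 * y 0) + (3) * (x 1 * y 4 - x 4 * y 1) + (x 3 * y 7 - x 7 * y 3),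
      (x 0 * y 4 - x 4 * y 0) + (2) * (x 1 * y 5 - x 5 * y 1) + (x 2 * y 3 - x 3 * y 2) + (x 4 * y 7 - x 7 * y 4),
      (-(x 0 * y 5 - x 5 * y 0)) + (x 1 * y 6 - x 6 * y 1) + (2) * (x 2 * y 4 - x 4 * y 2) + (x 5 * y 7 - x 7 * y 5),
      (-3) * (x 0 * y 6 - x 6 * y 0) + (3) * (x 2 * y 5 - x 5 * y 2) + (x 6 * y 7 - x 7 * y 6),
      0] := by
  rw [tableBracket_eq]
  simp only [L20Brackets]
  ext k
  fin_cases k <;> simp [e] <;> ring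

/-- The Lie algebra with these brackets. -/
def L20 : Table where
  c := L20Brackets
  jacobi x y z := by
    simp only [L20_formula]
    ext k
    fin_cases k <;> simp <;> ring

end

end SympLie

/-! The core is a rigidity fact: a unimodular symplectic Lie algebra contains no non-zero semisimple
subalgebra `s`. For unimodular `g` the determinant of `ω + t dh` does not depend on `t`, because its
logarithmic derivative is a multiple of the trace of some `ad y`; so `ω + dh` is non-degenerate for
every linear form `h`. On the other hand `x ↦ ω(x, ·)` is a 1-cocycle of `s` with values in the dual
of `g`, and Whitehead's lemma produces an `h` for which `ω + dh` kills `s`.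

Hence a non-solvable symplectic `g` has non-zero `tr ∘ ad`. This form vanishes on a Levi factor `s`,
so it lives on the radical; Weyl's theorem gives a vector `t` of the radical that commutes with `s`
and has non-zero trace, and the trace-zero part `n` of the radical satisfies `dim s + dim n = 7`.
Indecomposability forces `s` to act non-trivially on `n`, and since no semisimple algebra has
dimension 1, 2 or 4, one gets `dim s = 3` and `dim n = 4`. Split `n` into the invariants and a
complement `W`. Dimensions 0 and 1 of `W` would make the action trivial, and dimension 3 is excluded
by symplectic reduction, which returns to the rigidity fact. So `dim W` is 2 or 4.

The Levi factor is `sl(2)` or `so(3)`. If `W = n`, then `n` is the irreducible `sl(2)`-module of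
dimension four, twice the standard module, or the quaternions. In each case minus the identity of
the simply connected group acts by −1 on `n` and by +1 on brackets of elements of `n`, so `n` is
abelian and everything is encoded in the endomorphism that `t` induces: a scalar, a real two by two
matrix, or a quaternion, of non-zero trace. Normal forms up to conjugation and scaling of `t` give
`L20`; `L16`, `L17`, `L18`; and `L3`, `L4`. If `dim W = 2`, the invariants form a three-dimensional
algebra; `ω` and indecomposability make it a plane with zero bracket extended by a vector `u` acting
on the plane with trace zero and not by zero, and the normal forms are `L7`, `L8`, `L9`.

For the converse, an ideal splitting must leave the simple factor on one side, and the other side is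
then confined to a small abelian subspace. Exactness holds because the derivation induced by `e 8`
on `⟨e 4, …, e 7⟩` satisfies a quadratic equation whose roots have no pairwise sum zero; this fails
exactly for `L17 0`. The algebras `L7`, `L8`, `L9` are not Frobenius because two independent vectors
have non-zero bracket with `e 8` only, so that some combination of them lies in the kernel of any
exact form. -/

namespace SympLie

open LieModule LinearMap Module
open scoped Matrix TensorProduct

set_option linter.unusedSectionVars false

/-! ### Whitehead's first lemma. -/

section Whitehead

variable {K L M : Type*} [Field K] [LieRing L] [LieAlgebra K L]
  [AddCommGroup M] [Module K M] [LieRingModule L M] [LieModule K L M]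

/-- A linear map `c : L → M` is a 1-cocycle of the Lie algebra `L` with values in `M`. -/
def IsOneCocycle (c : L →ₗ[K] M) : Prop := ∀ x y, c ⁅x, y⁆ = ⁅x, c y⁆ - ⁅y, c x⁆

/-- The tensor `∑ b i ⊗ d i` of a basis and its dual basis is invariant: since `B` is invariant, the
matrices of `ad x` in the two bases are negative transposes of each other. -/
theorem sum_lie_basis_dualBasis [FiniteDimensional K L] {B : LinearMap.BilinForm K L}
    (hB : B.Nondegenerate) (hs : LinearMap.BilinForm.IsSymm B) (hinv : ∀ x y z : L, B ⁅x, y⁆ z = - B y ⁅x, z⁆)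
    {ι : Type*} [Fintype ι] [DecidableEq ι] (b : Basis ι K L) (β : L →ₗ[K] L →ₗ[K] M) (x : L) :
    ∑ i, β ⁅x, b i⁆ (B.dualBasis hB b i) + ∑ i, β (b i) ⁅x, B.dualBasis hB b i⁆ = 0 := by
  set d := B.dualBasis hB b
  have h1 (y : L) : y = ∑ j, B y (b j) • d j := by
    conv_lhs => rw [← d.sum_repr y]
    simp only [d, LinearMap.BilinForm.dualBasis_repr_apply]
  have h2 (y : L) : y = ∑ j, B y (d j) • b j := by
    conv_lhs => rw [← b.sum_repr y]
    refine Finset.sum_congr rfl fun j _ => ?_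
    congr 1
    conv_rhs => rw [← b.sum_repr y]
    simp only [d, map_sum, map_smul, LinearMap.sum_apply, LinearMap.smul_apply, smul_eq_mul,
      LinearMap.BilinForm.apply_dualBasis_right hB hs, mul_ite, mul_one, mul_zero]
    simp
  have e1 : ∑ i, β ⁅x, b i⁆ (d i) = ∑ i, ∑ j, B ⁅x, b i⁆ (d j) • β (b j) (d i) := by
    refine Finset.sum_congr rfl fun i _ => ?_
    conv_lhs => rw [h2 ⁅x, b i⁆]
    simp
  have e2 : ∑ i, β (b i) ⁅x, d i⁆ = ∑ i, ∑ j, B ⁅x, d i⁆ (b j) • β (b i) (d j) := by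
    refine Finset.sum_congr rfl fun i _ => ?_
    conv_lhs => rw [h1 ⁅x, d i⁆]
    simp
  rw [e1, e2, Finset.sum_comm, ← Finset.sum_add_distrib]
  refine Finset.sum_eq_zero fun i _ => ?_
  rw [← Finset.sum_add_distrib]
  refine Finset.sum_eq_zero fun j _ => ?_
  rw [← add_smul, hinv, hs.eq, neg_add_cancel, zero_smul]

/-- The Casimir operator `C` of the trace form commutes with `L` and has trace `dim L ≠ 0`, so it is
invertible on an irreducible module. The cocycle identity gives `C (c x) = ⁅x, ∑ ⁅b i, c (d i)⁆⁆`,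
and `C` can be cancelled. -/
theorem exists_eq_lie_of_traceForm_nondegenerate [CharZero K] [FiniteDimensional K L]
    [FiniteDimensional K M] [Nontrivial L] [IsIrreducible K L M]
    (hB : (traceForm K L M).Nondegenerate) {c : L →ₗ[K] M} (hc : IsOneCocycle c) :
    ∃ m : M, ∀ x, c x = ⁅x, m⁆ := by
  classical
  set B := traceForm K L M with hBdef
  let b := finBasis K L
  let d := LinearMap.BilinForm.dualBasis B hB b
  have hs : LinearMap.BilinForm.IsSymm B := ⟨fun x y => traceForm_comm K L M x y⟩
  have hinv : ∀ x y z : L, B ⁅x, y⁆ z = - B y ⁅x, z⁆ := fun x y z => by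
    rw [← lie_skew, map_neg, LinearMap.neg_apply, traceForm_apply_lie_apply]
  let C : Module.End K M := ∑ i, toEnd K L M (b i) * toEnd K L M (d i)
  have hCm (m : M) : C m = ∑ i, ⁅b i, ⁅d i, m⁆⁆ := by simp [C]
  have hC (x : L) (m : M) : ⁅x, C m⁆ = C ⁅x, m⁆ := by
    have key := sum_lie_basis_dualBasis hB hs hinv b
      (LinearMap.mk₂ K (fun y z => ⁅y, ⁅z, m⁆⁆) (by simp) (by simp) (by simp) (by simp)) x
    simp only [LinearMap.mk₂_apply] at key
    rw [hCm, hCm, lie_sum]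
    rw [← Finset.sum_add_distrib] at key
    rw [← sub_eq_zero, ← Finset.sum_sub_distrib, ← key]
    refine Finset.sum_congr rfl fun i _ => ?_
    rw [leibniz_lie x (b i), leibniz_lie x (d i), lie_add]
    abel
  -- Each summand of `C` has trace `B (b i) (d i) = 1`.
  have htr : LinearMap.trace K M C = finrank K L := by
    have : ∀ i, LinearMap.trace K M (toEnd K L M (b i) * toEnd K L M (d i)) = 1 := fun i => by
      have := LinearMap.BilinForm.apply_dualBasis_right hB hs b i i
      rw [if_pos rfl] at this
      rw [← this]; rfl
    rw [map_sum]
    simp [this]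
  have hC0 : C ≠ 0 := fun h => by
    rw [h, map_zero] at htr
    have : finrank K L ≠ 0 := finrank_pos.ne'
    exact this (by exact_mod_cast htr.symm)
  let N : LieSubmodule K L M :=
    { LinearMap.ker C with
      lie_mem := fun {x m} hm => by
        simp only [AddSubsemigroup.mem_carrier, AddSubmonoid.mem_toSubsemigroup,
          Submodule.mem_toAddSubmonoid, LinearMap.mem_ker] at hm ⊢
        rw [← hC, hm, lie_zero] }
  have hN : N = ⊥ := by
    by_contra h
    have := (IsSimpleOrder.eq_bot_or_eq_top N).resolve_left h
    apply hC0
    ext m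
    have : m ∈ N := this ▸ LieSubmodule.mem_top m
    exact this
  have hinj : Function.Injective C := by
    rw [← LinearMap.ker_eq_bot, eq_bot_iff]
    intro m hm
    have : m ∈ N := hm
    rw [hN] at this
    simpa using this
  obtain ⟨D, hD⟩ : ∃ m, C m = ∑ i, ⁅b i, c (d i)⁆ :=
    (LinearMap.injective_iff_surjective.mp hinj) _
  refine ⟨D, fun x => hinj ?_⟩
  rw [← hC, hD]
  have key := sum_lie_basis_dualBasis hB hs hinv b
      (LinearMap.mk₂ K (fun y z => ⁅y, c z⁆) (by simp) (by simp) (by simp) (by simp)) x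
  simp only [LinearMap.mk₂_apply] at key
  rw [hCm, lie_sum, ← sub_eq_zero, ← Finset.sum_sub_distrib, ← neg_eq_zero, ← key,
    ← Finset.sum_add_distrib, ← Finset.sum_neg_distrib]
  refine Finset.sum_congr rfl fun i _ => ?_
  rw [leibniz_lie x (b i), hc x (d i), lie_sub]
  abel

/-- By invariance, brackets of elements orthogonal to the derived ideal are orthogonal to
everything. The Killing complement is therefore an abelian ideal, hence zero. -/
theorem lie_top_top_eq_top_of_isKilling [FiniteDimensional K L] [LieAlgebra.IsKilling K L] :
    ⁅(⊤ : LieIdeal K L), (⊤ : LieIdeal K L)⁆ = ⊤ := by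
  set I := ⁅(⊤ : LieIdeal K L), (⊤ : LieIdeal K L)⁆ with hI
  have hc := I.isCompl_killingCompl
  have hab : IsLieAbelian I.killingCompl := by
    rw [LieSubmodule.lie_abelian_iff_lie_self_eq_bot, LieSubmodule.lie_eq_bot_iff]
    intro x hx y hy
    refine (LieAlgebra.IsKilling.killingForm_nondegenerate K L).1 _ fun z => ?_
    rw [LieIdeal.mem_killingCompl] at hx
    rw [traceForm_apply_lie_apply, traceForm_comm]
    exact hx _ (LieSubmodule.lie_mem_lie (LieSubmodule.mem_top _) (LieSubmodule.mem_top _))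
  rw [LieAlgebra.IsKilling.ideal_eq_bot_of_isLieAbelian I.killingCompl] at hc
  exact eq_top_of_isCompl_bot hc

theorem IsOneCocycle.eq_zero_of_isTrivial [FiniteDimensional K L] [LieAlgebra.IsKilling K L]
    [IsTrivial L M] {c : L →ₗ[K] M} (hc : IsOneCocycle c) (x : L) : c x = 0 := by
  have hx : x ∈ ⁅(⊤ : LieIdeal K L), (⊤ : LieIdeal K L)⁆ := by
    rw [lie_top_top_eq_top_of_isKilling]; exact LieSubmodule.mem_top x
  rw [← LieSubmodule.mem_toSubmodule, LieSubmodule.lieIdeal_oper_eq_linear_span'] at hx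
  induction hx using Submodule.span_induction with
  | mem x hx =>
    obtain ⟨y, -, z, -, rfl⟩ := hx
    rw [hc y z, trivial_lie_zero, trivial_lie_zero, sub_zero]
  | zero => simp
  | add x y _ _ hx hy => simp [hx, hy]
  | smul a x _ hx => simp [hx]

/-- The trace form of `M` may be degenerate because of the kernel `I` of the action. On the Killing
complement `J` of `I` the action is faithful and still irreducible, and Cartan's criterion makes the
trace form of `J` non-degenerate, so the Casimir argument applies to `J`. -/
theorem exists_eq_lie_of_isIrreducible [CharZero K] [FiniteDimensional K L]
    [LieAlgebra.IsKilling K L] [FiniteDimensional K M] [IsIrreducible K L M]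
    {c : L →ₗ[K] M} (hc : IsOneCocycle c) : ∃ m : M, ∀ x, c x = ⁅x, m⁆ := by
  set I : LieIdeal K L := LieModule.ker K L M with hI
  have hI0 : ∀ x ∈ I, ∀ m : M, ⁅x, m⁆ = 0 := fun x hx m => (LieModule.mem_ker K L M _).mp hx m
  set J : LieIdeal K L := I.killingCompl with hJ
  have hIJ : IsCompl I J := I.isCompl_killingCompl
  have hdec (x : L) : ∃ i ∈ I, ∃ j ∈ J, i + j = x := by
    have : x ∈ I ⊔ J := hIJ.sup_eq_top ▸ LieSubmodule.mem_top x
    exact (LieSubmodule.mem_sup I J x).mp this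
  have hcomm : ∀ x ∈ I, ∀ y ∈ J, ⁅x, y⁆ = 0 := fun x hx y hy => by
    have h1 : ⁅x, y⁆ ∈ I ⊓ J := ⟨lie_mem_left K L I x y hx, lie_mem_right K L J x y hy⟩
    rw [hIJ.inf_eq_bot] at h1
    simpa using h1
  rcases subsingleton_or_nontrivial J with hJs | hJn
  · have : IsTrivial L M := ⟨fun x m => by
      obtain ⟨i, hi, j, hj, rfl⟩ := hdec x
      have : (⟨j, hj⟩ : J) = 0 := Subsingleton.elim _ _
      have hj0 : j = 0 := congrArg Subtype.val this
      rw [hj0, add_zero, hI0 i hi]⟩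
    exact ⟨0, fun x => by simp [hc.eq_zero_of_isTrivial x]⟩
  have hirr : IsIrreducible K J M := by
    have := nontrivial_of_isIrreducible K L M
    refine LieModule.IsIrreducible.mk fun N hN => ?_
    let N' : LieSubmodule K L M :=
      { N with
        lie_mem := fun {x m} hm => by
          obtain ⟨i, hi, j, hj, rfl⟩ := hdec x
          rw [add_lie, hI0 i hi, zero_add]
          exact N.lie_mem (x := (⟨j, hj⟩ : J)) hm }
    have hN' : N' = ⊤ := (IsSimpleOrder.eq_bot_or_eq_top N').resolve_left fun h => hN <| by
      rw [LieSubmodule.eq_bot_iff] at h ⊢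
      exact h
    rw [eq_top_iff]
    intro m _
    have : m ∈ N' := hN' ▸ LieSubmodule.mem_top m
    exact this
  -- The radical of the trace form; the aim is that it meets `J` trivially.
  let k : LieIdeal K L :=
    { LinearMap.ker (traceForm K L M) with
      lie_mem := fun {x m} hm => by
        simp only [AddSubsemigroup.mem_carrier, AddSubmonoid.mem_toSubsemigroup,
          Submodule.mem_toAddSubmonoid, LinearMap.mem_ker] at hm ⊢
        ext z
        rw [← lie_skew, map_neg, LinearMap.neg_apply, traceForm_apply_lie_apply, hm]
        simp }
  have hk : ∀ x, x ∈ k ↔ ∀ z, traceForm K L M x z = 0 := fun x =>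
    ⟨fun h z => by
      have : traceForm K L M x = 0 := h
      rw [this]; rfl, fun h => LinearMap.ext h⟩
  have hnil : LieModule.IsNilpotent (LieAlgebra.derivedSeries K k 1) M := by
    apply isNilpotent_derivedSeries_of_traceForm_eq_zero
    ext ⟨x, hx⟩ ⟨y, hy⟩
    exact (hk x).mp hx y
  -- By Cartan's criterion `⁅k, k⁆` acts nilpotently and so has a non-zero common null vector. Its
  -- null vectors form a submodule, which is all of `M` by irreducibility.
  have hkk : ∀ x ∈ k, ∀ y ∈ k, ∀ m : M, ⁅⁅x, y⁆, m⁆ = 0 := by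
    have := nontrivial_of_isIrreducible K L M
    let T : LieSubmodule K L M :=
      { carrier := {m | ∀ x ∈ k, ∀ y ∈ k, ⁅⁅x, y⁆, m⁆ = 0}
        add_mem' := fun {a b} ha hb x hx y hy => by rw [lie_add, ha x hx y hy, hb x hx y hy, add_zero]
        zero_mem' := fun x _ y _ => lie_zero _
        smul_mem' := fun t a ha x hx y hy => by rw [lie_smul, ha x hx y hy, smul_zero]
        lie_mem := fun {z m} hm x hx y hy => by
          have h1 : ⁅⁅x, y⁆, z⁆ = ⁅⁅x, z⁆, y⁆ + ⁅x, ⁅y, z⁆⁆ := by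
            rw [lie_lie x y z, ← lie_skew y ⁅x, z⁆]; abel
          rw [leibniz_lie, hm x hx y hy, lie_zero, add_zero, h1, add_lie,
            hm _ (lie_mem_left K L k x z hx) _ hy, hm _ hx _ (lie_mem_left K L k y z hy), add_zero] }
    have hT : T = ⊤ := (IsSimpleOrder.eq_bot_or_eq_top T).resolve_left fun h => by
      have := LieModule.nontrivial_max_triv_of_isNilpotent K (LieAlgebra.derivedSeries K k 1) M
      obtain ⟨⟨m, hm⟩, hm0⟩ := exists_ne (0 : maxTrivSubmodule K (LieAlgebra.derivedSeries K k 1) M)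
      have hmT : m ∈ T := fun x hx y hy => by
        have hxy : ⁅(⟨x, hx⟩ : k), (⟨y, hy⟩ : k)⁆ ∈ LieAlgebra.derivedSeries K k 1 :=
          LieSubmodule.lie_mem_lie (LieSubmodule.mem_top _) (LieSubmodule.mem_top _)
        exact (LieModule.mem_maxTrivSubmodule _ _ _ m).mp hm ⟨_, hxy⟩
      rw [h, LieSubmodule.mem_bot] at hmT
      exact hm0 (Subtype.ext hmT)
    intro x hx y hy m
    have : m ∈ T := hT ▸ LieSubmodule.mem_top m
    exact this x hx y hy
  have hkJ : k ⊓ J = ⊥ := by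
    have hab : IsLieAbelian (k ⊓ J : LieIdeal K L) := by
      rw [LieSubmodule.lie_abelian_iff_lie_self_eq_bot, LieSubmodule.lie_eq_bot_iff]
      rintro x ⟨hx, hxJ⟩ y ⟨hy, hyJ⟩
      have h1 : ⁅x, y⁆ ∈ I ⊓ J :=
        ⟨(LieModule.mem_ker K L M _).mpr (hkk x hx y hy), lie_mem_right K L J x y hyJ⟩
      rw [hIJ.inf_eq_bot] at h1
      simpa using h1
    exact LieAlgebra.IsKilling.ideal_eq_bot_of_isLieAbelian _
  have hB : (traceForm K J M).Nondegenerate := by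
    refine (LieModule.traceForm_isSymm K J M).isRefl.nondegenerate_iff_separatingLeft.mpr ?_
    rintro ⟨x, hx⟩ h
    have hxk : x ∈ k ⊓ J := by
      refine ⟨(hk x).mpr fun z => ?_, hx⟩
      obtain ⟨i, hi, j, hj, rfl⟩ := hdec z
      have h1 : traceForm K L M x i = 0 := by
        have : toEnd K L M i = 0 := LinearMap.ext fun m => hI0 i hi m
        rw [traceForm_apply_apply, this, LinearMap.comp_zero, map_zero]
      rw [map_add, h1, zero_add]
      exact h ⟨j, hj⟩
    rw [hkJ, LieSubmodule.mem_bot] at hxk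
    exact Subtype.ext hxk
  obtain ⟨m, hm⟩ := exists_eq_lie_of_traceForm_nondegenerate hB
    (c := c ∘ₗ J.toSubmodule.subtype) (fun x y => hc x y)
  have hm' : ∀ j ∈ J, c j = ⁅j, m⁆ := fun j hj => hm ⟨j, hj⟩
  have hnt : ∃ j ∈ J, ∃ m' : M, ⁅j, m'⁆ ≠ 0 := by
    by_contra! hcon
    obtain ⟨⟨j, hj⟩, hj0⟩ := exists_ne (0 : J)
    have : j ∈ I ⊓ J := ⟨(LieModule.mem_ker K L M _).mpr (hcon j hj), hj⟩
    rw [hIJ.inf_eq_bot] at this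
    exact hj0 (Subtype.ext (by simpa using this))
  have hinv : ∀ m' : M, (∀ j ∈ J, ⁅j, m'⁆ = 0) → m' = 0 := by
    let T : LieSubmodule K L M :=
      { carrier := {m | ∀ j ∈ J, ⁅j, m⁆ = 0}
        add_mem' := fun {a b} ha hb x hx => by rw [lie_add, ha x hx, hb x hx, add_zero]
        zero_mem' := fun x _ => lie_zero _
        smul_mem' := fun t a ha x hx => by rw [lie_smul, ha x hx, smul_zero]
        lie_mem := fun {z m} hm x hx => by
          rw [leibniz_lie, hm x hx, lie_zero, add_zero, hm _ (lie_mem_left K L J x z hx)] }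
    have hT : T = ⊥ := (IsSimpleOrder.eq_bot_or_eq_top T).resolve_right fun h => by
      obtain ⟨j, hj, m', hm'⟩ := hnt
      have : m' ∈ T := h ▸ LieSubmodule.mem_top m'
      exact hm' (this j hj)
    intro m' h
    have : m' ∈ T := h
    rw [hT] at this
    simpa using this
  refine ⟨m, fun x => ?_⟩
  obtain ⟨i, hi, j, hj, rfl⟩ := hdec x
  -- For `y ∈ J` the cocycle identity at the commuting pair `i`, `y` reduces to `⁅y, c i⁆ = 0`, and
  -- `M` has no `J`-invariants.
  have hci : c i = 0 := hinv _ fun y hy => by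
    have h1 := hc i y
    rw [hcomm i hi y hy, hI0 i hi, map_zero, zero_sub, eq_comm, neg_eq_zero] at h1
    exact h1
  rw [map_add, add_lie, hI0 i hi, hci, hm' j hj]

/-- **Whitehead's first lemma**: every 1-cocycle of a Lie algebra with non-degenerate Killing form
with values in a finite-dimensional module is a coboundary. -/
theorem IsOneCocycle.exists_eq_lie [CharZero K] [FiniteDimensional K L]
    [LieAlgebra.IsKilling K L] [FiniteDimensional K M]
    {c : L →ₗ[K] M} (hc : IsOneCocycle c) : ∃ m : M, ∀ x, c x = ⁅x, m⁆ := by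
  induction hn : finrank K M using Nat.strong_induction_on generalizing M with
  | _ n ih =>
  rcases subsingleton_or_nontrivial M with hs | hM
  · exact ⟨0, fun x => Subsingleton.elim _ _⟩
  by_cases hirr : ∀ N : LieSubmodule K L M, N ≠ ⊥ → N = ⊤
  · have := LieModule.IsIrreducible.mk hirr
    exact exists_eq_lie_of_isIrreducible hc
  push Not at hirr
  obtain ⟨N, hN0, hN1⟩ := hirr
  have hN0' : N.toSubmodule ≠ ⊥ := by simpa using hN0
  have hN1' : N.toSubmodule ≠ ⊤ := by simpa using hN1
  have hNt : finrank K N < n := hn ▸ Submodule.finrank_lt hN1'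
  have hq : finrank K (M ⧸ N) < n := by
    have h1 : finrank K (M ⧸ N) + finrank K N = finrank K M :=
      N.toSubmodule.finrank_quotient_add_finrank
    have h2 : 0 < finrank K N := by
      have := Submodule.one_le_finrank_iff.mpr hN0'
      exact this
    omega
  -- Solve modulo a proper submodule `N`, lift the solution, and solve again for the remaining
  -- cocycle, which takes values in `N`.
  obtain ⟨m', hm'⟩ := ih _ hq (M := M ⧸ N) (c := N.toSubmodule.mkQ ∘ₗ c) (fun x y => by
    change LieSubmodule.Quotient.mk (c ⁅x, y⁆) = _
    rw [hc x y]
    rfl) rfl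
  obtain ⟨m, rfl⟩ := LieSubmodule.Quotient.surjective_mk' N m'
  have hmem (x : L) : c x - ⁅x, m⁆ ∈ N := by
    have : (LieSubmodule.Quotient.mk (c x) : M ⧸ N) = LieSubmodule.Quotient.mk ⁅x, m⁆ := hm' x
    exact (Submodule.Quotient.eq N.toSubmodule).mp this
  let c' : L →ₗ[K] N :=
    { toFun := fun x => ⟨c x - ⁅x, m⁆, hmem x⟩
      map_add' := fun x y => Subtype.ext <| by
        simp only [map_add, add_lie, LieSubmodule.coe_add]; abel
      map_smul' := fun t x => Subtype.ext <| by
        simp only [map_smul, smul_lie, LieSubmodule.coe_smul, RingHom.id_apply, smul_sub] }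
  have hc' (x : L) : (c' x : M) = c x - ⁅x, m⁆ := rfl
  obtain ⟨n', hn'⟩ := ih _ hNt (M := N) (c := c') (fun x y => Subtype.ext <| by
    change (c' ⁅x, y⁆ : M) = ⁅x, (c' y : M)⁆ - ⁅y, (c' x : M)⁆
    simp only [hc', hc x y, lie_sub, lie_lie]
    abel) rfl
  refine ⟨m + n', fun x => ?_⟩
  have := congrArg Subtype.val (hn' x)
  rw [hc'] at this
  rw [lie_add, ← sub_eq_iff_eq_add']
  exact this

end Whitehead

/-! ### Weyl's theorem on complete reducibility. -/

section Weyl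

variable {K L M : Type*} [Field K] [CharZero K] [LieRing L] [LieAlgebra K L]
  [FiniteDimensional K L] [LieAlgebra.IsKilling K L]
  [AddCommGroup M] [Module K M] [LieRingModule L M] [LieModule K L M] [FiniteDimensional K M]

/-- **Weyl's theorem**: a finite-dimensional module over a Lie algebra with non-degenerate Killing
form is semisimple. -/
theorem exists_isCompl_lieSubmodule (N : LieSubmodule K L M) :
    ∃ N' : LieSubmodule K L M, IsCompl N N' := by
  obtain ⟨N₀, hN₀⟩ := N.toSubmodule.exists_isCompl
  let π : M →ₗ[K] M := N.toSubmodule.subtype ∘ₗ N.toSubmodule.projectionOnto N₀ hN₀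
  have hπN (m : M) : π m ∈ N := (N.toSubmodule.projectionOnto N₀ hN₀ m).2
  have hπ (m : M) (hm : m ∈ N) : π m = m := by
    have := Submodule.projectionOnto_apply_left hN₀ ⟨m, hm⟩
    simp only [π, LinearMap.comp_apply]
    exact congrArg Subtype.val this
  -- An arbitrary linear projection `π` onto `N` fails to be equivariant by the cocycle `x ↦ ⁅x,
  -- π⁆`, whose values map `M` into `N` and kill `N`. Correcting `π` by an element of this module
  -- keeps it a projection onto `N`, and the kernel of the equivariant one is the complement.
  let Q : LieSubmodule K L (M →ₗ[K] M) :=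
    { carrier := {φ | (∀ m, φ m ∈ N) ∧ ∀ m ∈ N, φ m = 0}
      add_mem' := fun {a b} ha hb => ⟨fun m => N.add_mem (ha.1 m) (hb.1 m), fun m hm => by
        rw [LinearMap.add_apply, ha.2 m hm, hb.2 m hm, add_zero]⟩
      zero_mem' := ⟨fun m => N.zero_mem, fun m _ => rfl⟩
      smul_mem' := fun t a ha => ⟨fun m => N.smul_mem t (ha.1 m), fun m hm => by
        rw [LinearMap.smul_apply, ha.2 m hm, smul_zero]⟩
      lie_mem := fun {x φ} hφ => ⟨fun m => by
        rw [LieHom.lie_apply]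
        exact N.sub_mem (N.lie_mem (hφ.1 m)) (hφ.1 _), fun m hm => by
        rw [LieHom.lie_apply, hφ.2 m hm, hφ.2 _ (N.lie_mem hm), lie_zero, sub_zero]⟩ }
  have hmem (x : L) : ⁅x, π⁆ ∈ Q := ⟨fun m => by
    rw [LieHom.lie_apply]
    exact N.sub_mem (N.lie_mem (hπN m)) (hπN _), fun m hm => by
    rw [LieHom.lie_apply, hπ m hm, hπ _ (N.lie_mem hm), sub_self]⟩
  let c : L →ₗ[K] Q :=
    { toFun := fun x => ⟨⁅x, π⁆, hmem x⟩
      map_add' := fun x y => Subtype.ext (add_lie x y π)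
      map_smul' := fun t x => Subtype.ext (smul_lie t x π) }
  have hc : IsOneCocycle c := fun x y => Subtype.ext (lie_lie x y π)
  obtain ⟨⟨φ, hφ⟩, h⟩ := hc.exists_eq_lie
  have hρ (x : L) : ⁅x, π - φ⁆ = 0 := by
    have : ⁅x, π⁆ = ⁅x, φ⁆ := congrArg Subtype.val (h x)
    rw [lie_sub, this, sub_self]
  have hρ' (x : L) (m : M) : (π - φ) ⁅x, m⁆ = ⁅x, (π - φ) m⁆ := by
    have := congrArg (fun f => f m) (hρ x)
    simp only [LieHom.lie_apply, LinearMap.zero_apply] at this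
    exact (sub_eq_zero.mp this).symm
  have hρN (m : M) : (π - φ) m ∈ N := N.sub_mem (hπN m) (hφ.1 m)
  have hρid (m : M) (hm : m ∈ N) : (π - φ) m = m := by
    rw [LinearMap.sub_apply, hπ m hm, hφ.2 m hm, sub_zero]
  refine ⟨{ LinearMap.ker (π - φ) with
    lie_mem := fun {x m} hm => ?_ }, ?_⟩
  · have h1 : (π - φ) m = 0 := hm
    change (π - φ) ⁅x, m⁆ = 0
    rw [hρ', h1, lie_zero]
  · rw [← LieSubmodule.isCompl_toSubmodule]
    constructor
    · rw [Submodule.disjoint_def]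
      intro m hm hm'
      have h1 : (π - φ) m = 0 := hm'
      rw [← hρid m hm, h1]
    · rw [codisjoint_iff, eq_top_iff]
      intro m _
      refine Submodule.mem_sup.mpr ⟨(π - φ) m, hρN m, m - (π - φ) m, ?_, by abel⟩
      change (π - φ) (m - (π - φ) m) = 0
      rw [map_sub, hρid _ (hρN m), sub_self]

/-- Relative complements of invariant subspaces. -/
theorem exists_relative_compl_lieSubmodule {A B : LieSubmodule K L M} (h : A ≤ B) :
    ∃ C : LieSubmodule K L M, C ≤ B ∧ A ⊔ C = B ∧ A ⊓ C = ⊥ := by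
  obtain ⟨A', hA'⟩ := exists_isCompl_lieSubmodule A
  refine ⟨A' ⊓ B, inf_le_right, ?_, ?_⟩
  · rw [← sup_inf_assoc_of_le A' h, hA'.sup_eq_top, top_inf_eq]
  · rw [← inf_assoc, hA'.inf_eq_bot, bot_inf_eq]

end Weyl

/-! ### Levi's theorem. -/

section Levi

variable {K : Type*} [Field K]

/-- The map induced between the kernels of two morphisms to the same Lie algebra. -/
def kerMap {L₁ L₂ S : Type*} [LieRing L₁] [LieAlgebra K L₁] [LieRing L₂] [LieAlgebra K L₂]
    [LieRing S] [LieAlgebra K S] (f : L₁ →ₗ⁅K⁆ L₂) (π₁ : L₁ →ₗ⁅K⁆ S) (π₂ : L₂ →ₗ⁅K⁆ S)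
    (h : ∀ x, π₂ (f x) = π₁ x) : π₁.ker →ₗ⁅K⁆ π₂.ker where
  toFun x := ⟨f x, (LieHom.mem_ker ..).mpr <| by rw [h]; exact (LieHom.mem_ker ..).mp x.2⟩
  map_add' x y := Subtype.ext <| by simp
  map_smul' t x := Subtype.ext <| by simp
  map_lie' {x y} := Subtype.ext <| by simp

/-- A morphism vanishing on an ideal factors through the quotient. -/
def quotientLift {L S : Type*} [LieRing L] [LieAlgebra K L] [LieRing S] [LieAlgebra K S]
    (π : L →ₗ⁅K⁆ S) (I : LieIdeal K L) (h : I ≤ π.ker) : (L ⧸ I) →ₗ⁅K⁆ S :=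
  { I.toSubmodule.liftQ (π : L →ₗ[K] S) (fun _ hx => (LieHom.mem_ker ..).mp (h hx)) with
    map_lie' := fun {x y} => by
      obtain ⟨x, rfl⟩ := LieSubmodule.Quotient.surjective_mk' I x
      obtain ⟨y, rfl⟩ := LieSubmodule.Quotient.surjective_mk' I y
      exact π.map_lie x y }

theorem quotientLift_mk {L S : Type*} [LieRing L] [LieAlgebra K L] [LieRing S] [LieAlgebra K S]
    (π : L →ₗ⁅K⁆ S) (I : LieIdeal K L) (h : I ≤ π.ker) (x : L) :
    quotientLift π I h (LieSubmodule.Quotient.mk x : L ⧸ I) = π x := rfl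

theorem eq_bot_of_lie_self_eq_self {L : Type*} [LieRing L] [LieAlgebra K L] (I : LieIdeal K L)
    [hI : LieAlgebra.IsSolvable I] (h : ⁅I, I⁆ = I) : I = ⊥ := by
  have key : ∀ k, LieAlgebra.derivedSeriesOfIdeal K L k I = I := by
    intro k
    induction k with
    | zero => rfl
    | succ k ih => rw [LieAlgebra.derivedSeriesOfIdeal_succ, ih, h]
  obtain ⟨k, hk⟩ := LieAlgebra.IsSolvable.solvable K I
  rw [LieIdeal.derivedSeries_eq_bot_iff, key] at hk
  exact hk

/-- Both the module and the cocycle factor through `S`. A linear section `τ` of `π` transports them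
to `S`; its failure to preserve brackets lies in the kernel and is invisible to `V` and to `c`. -/
theorem IsOneCocycle.exists_eq_lie_of_surjective [CharZero K] {S : Type*} [LieRing S]
    [LieAlgebra K S] [FiniteDimensional K S] [LieAlgebra.IsKilling K S]
    {L : Type*} [LieRing L] [LieAlgebra K L]
    {V : Type*} [AddCommGroup V] [Module K V] [LieRingModule L V] [LieModule K L V]
    [FiniteDimensional K V] (π : L →ₗ⁅K⁆ S) (hπ : Function.Surjective π)
    (hV : ∀ x ∈ π.ker, ∀ v : V, ⁅x, v⁆ = 0) {c : L →ₗ[K] V} (hc : IsOneCocycle c)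
    (hc0 : ∀ x ∈ π.ker, c x = 0) : ∃ v : V, ∀ x, c x = ⁅x, v⁆ := by
  obtain ⟨τ, hτ⟩ := (π : L →ₗ[K] S).exists_rightInverse_of_surjective
    (LinearMap.range_eq_top.mpr hπ)
  have hτ' (s : S) : π (τ s) = s := LinearMap.congr_fun hτ s
  have hker (s t : S) : τ ⁅s, t⁆ - ⁅τ s, τ t⁆ ∈ π.ker := by
    rw [LieHom.mem_ker, map_sub, LieHom.map_lie, hτ', hτ', hτ', sub_self]
  let _ : LieRingModule S V :=
    { bracket := fun s v => ⁅τ s, v⁆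
      add_lie := fun s t v => by
        rw [map_add, add_lie]
      lie_add := fun s v w => lie_add (τ s) v w
      leibniz_lie := fun s t v => by
        change ⁅τ s, ⁅τ t, v⁆⁆ = ⁅τ ⁅s, t⁆, v⁆ + ⁅τ t, ⁅τ s, v⁆⁆
        have := hV _ (hker s t) v
        rw [sub_lie, sub_eq_zero] at this
        rw [this, leibniz_lie] }
  have hact (s : S) (v : V) : ⁅s, v⁆ = ⁅τ s, v⁆ := rfl
  let _ : LieModule K S V :=
    { smul_lie := fun t s v => by rw [hact, hact, map_smul, smul_lie]
      lie_smul := fun t s v => by rw [hact, hact, lie_smul] }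
  obtain ⟨v, hv⟩ := IsOneCocycle.exists_eq_lie (K := K) (L := S) (M := V) (c := c ∘ₗ τ)
    (fun s t => by
      have := hc0 _ (hker s t)
      rw [map_sub, sub_eq_zero] at this
      rw [LinearMap.comp_apply, this, hc, hact, hact]
      rfl)
  refine ⟨v, fun x => ?_⟩
  have hx : x - τ (π x) ∈ π.ker := by rw [LieHom.mem_ker, map_sub, hτ', sub_self]
  have h1 := hc0 _ hx
  have h2 := hV _ hx v
  rw [map_sub, sub_eq_zero] at h1
  rw [sub_lie, sub_eq_zero] at h2
  rw [h1, h2]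
  exact hv (π x)

/-- **Levi's theorem**: a surjective morphism with solvable kernel onto a Lie algebra with
non-degenerate Killing form has a section. -/
theorem exists_lieHom_rightInverse [CharZero K] {S : Type*} [LieRing S]
    [LieAlgebra K S] [FiniteDimensional K S] [LieAlgebra.IsKilling K S]
    {L : Type*} [LieRing L] [LieAlgebra K L] [FiniteDimensional K L]
    (π : L →ₗ⁅K⁆ S) (hπ : Function.Surjective π) (hs : LieAlgebra.IsSolvable π.ker) :
    ∃ σ : S →ₗ⁅K⁆ L, ∀ s, π (σ s) = s := by
  induction hn : finrank K L using Nat.strong_induction_on generalizing L with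
  | _ n ih =>
  -- Induction on the dimension: a section may be sought inside any proper subalgebra that still
  -- maps onto `S`.
  have hsub (H : LieSubalgebra K L) (hH : H ≠ ⊤) (hHs : ∀ s, ∃ x ∈ H, π x = s) :
      ∃ σ : S →ₗ⁅K⁆ L, ∀ s, π (σ s) = s := by
    have hlt : finrank K H < n := hn ▸ Submodule.finrank_lt (s := H.toSubmodule) (by simpa using hH)
    have hsol : LieAlgebra.IsSolvable (π.comp H.incl).ker := by
      have hinj : Function.Injective (kerMap H.incl (π.comp H.incl) π (fun _ => rfl)) := by
        intro x y h
        have := congrArg Subtype.val h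
        exact Subtype.ext (Subtype.ext this)
      exact hinj.lieAlgebra_isSolvable
    obtain ⟨σ, hσ⟩ := ih _ hlt (π.comp H.incl)
      (fun s => by obtain ⟨x, hx, h⟩ := hHs s; exact ⟨⟨x, hx⟩, h⟩) hsol rfl
    exact ⟨H.incl.comp σ, hσ⟩
  set r := π.ker with hr
  by_cases hrr : ⁅r, r⁆ = ⊥
  swap
  · have hle : ⁅r, r⁆ ≤ π.ker := LieSubmodule.lie_le_left _ _
    set a : LieIdeal K L := ⁅r, r⁆ with ha
    have hlt : finrank K (L ⧸ a) < n := by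
      have h1 : finrank K (L ⧸ a) + finrank K a = finrank K L :=
        a.toSubmodule.finrank_quotient_add_finrank
      have h2 : 0 < finrank K a :=
        (Submodule.one_le_finrank_iff (S := a.toSubmodule)).mpr (by simpa using hrr)
      omega
    have hsol : LieAlgebra.IsSolvable (quotientLift π a hle).ker := by
      let q : L →ₗ⁅K⁆ L ⧸ a :=
        { (LieSubmodule.Quotient.mk' a : L →ₗ[K] L ⧸ a) with
          map_lie' := fun {x y} => rfl }
      have hsurj : Function.Surjective (kerMap q π (quotientLift π a hle) (fun _ => rfl)) := by
        rintro ⟨x, hx⟩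
        obtain ⟨x, rfl⟩ := LieSubmodule.Quotient.surjective_mk' a x
        exact ⟨⟨x, hx⟩, rfl⟩
      exact hsurj.lieAlgebra_isSolvable
    obtain ⟨σ, hσ⟩ := ih _ hlt (quotientLift π a hle)
      (fun s => by obtain ⟨x, rfl⟩ := hπ s; exact ⟨LieSubmodule.Quotient.mk x, rfl⟩) hsol rfl
    -- The preimage in `L` of a Levi factor of `L ⧸ ⁅r, r⁆`. It is everything only if `r = ⁅r, r⁆`,
    -- which a non-zero solvable ideal cannot satisfy.
    let H : LieSubalgebra K L :=
      { carrier := {x | ∃ s, σ s = (LieSubmodule.Quotient.mk x : L ⧸ a)}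
        add_mem' := by
          rintro x y ⟨s, hs⟩ ⟨t, ht⟩
          exact ⟨s + t, by rw [map_add, hs, ht]; rfl⟩
        zero_mem' := ⟨0, by rw [map_zero]; rfl⟩
        smul_mem' := by
          rintro t x ⟨s, hs⟩
          exact ⟨t • s, by rw [map_smul, hs]; rfl⟩
        lie_mem' := by
          rintro x y ⟨s, hs⟩ ⟨t, ht⟩
          exact ⟨⁅s, t⁆, by rw [LieHom.map_lie, hs, ht]; rfl⟩ }
    refine hsub H (fun hH => ?_) fun s => ?_
    · apply hrr
      have : r = ⊥ := by
        refine eq_bot_of_lie_self_eq_self r (le_antisymm hle fun x hx => ?_)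
        have hxH : x ∈ H := hH ▸ LieSubalgebra.mem_top x
        obtain ⟨s, hs⟩ := hxH
        have h1 := hσ s
        rw [hs, quotientLift_mk, (LieHom.mem_ker ..).mp hx] at h1
        rw [← h1, map_zero] at hs
        exact LieSubmodule.Quotient.mk_eq_zero'.mp hs.symm
      rw [ha, this, LieSubmodule.bot_lie]
    · obtain ⟨x, hx⟩ := LieSubmodule.Quotient.surjective_mk' a (σ s)
      refine ⟨x, ⟨s, hx.symm⟩, ?_⟩
      have h1 := hσ s
      rw [← hx] at h1
      exact h1
  have hab : ∀ x ∈ r, ∀ y ∈ r, ⁅x, y⁆ = 0 := by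
    rw [LieSubmodule.lie_eq_bot_iff] at hrr
    exact hrr
  have hrl : ∀ x, ∀ y ∈ r, ⁅x, y⁆ ∈ r := fun x y hy => lie_mem_right K L r x y hy
  have hrl' : ∀ x, ∀ y ∈ r, ⁅y, x⁆ ∈ r := fun x y hy => lie_mem_left K L r y x hy
  obtain ⟨r₀, hr₀⟩ := r.toSubmodule.exists_isCompl
  let ρ : L →ₗ[K] L := r.toSubmodule.subtype ∘ₗ r.toSubmodule.projectionOnto r₀ hr₀
  have hρr (x : L) : ρ x ∈ r := (r.toSubmodule.projectionOnto r₀ hr₀ x).2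
  have hρ (x : L) (hx : x ∈ r) : ρ x = x :=
    congrArg Subtype.val (Submodule.projectionOnto_apply_left hr₀ ⟨x, hx⟩)
  -- Now `r` is abelian. The projection `ρ` onto `r` is moved by `x` to `⁅x, ρ⁆`, an element of this
  -- module. For `x ∈ r` that element is `-ad x`, so modulo the operators `ad b` with `b ∈ r` the
  -- cocycle descends to `S`.
  let N : LieSubmodule K L (L →ₗ[K] L) :=
    { carrier := {φ | (∀ x, φ x ∈ r) ∧ ∀ x ∈ r, φ x = 0}
      add_mem' := fun {a b} ha hb => ⟨fun m => r.add_mem (ha.1 m) (hb.1 m), fun m hm => by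
        rw [LinearMap.add_apply, ha.2 m hm, hb.2 m hm, add_zero]⟩
      zero_mem' := ⟨fun m => r.zero_mem, fun m _ => rfl⟩
      smul_mem' := fun t a ha => ⟨fun m => r.smul_mem t (ha.1 m), fun m hm => by
        rw [LinearMap.smul_apply, ha.2 m hm, smul_zero]⟩
      lie_mem := fun {x φ} hφ => ⟨fun m => by
        rw [LieHom.lie_apply]
        exact r.sub_mem (hrl _ _ (hφ.1 m)) (hφ.1 _), fun m hm => by
        rw [LieHom.lie_apply, hφ.2 m hm, hφ.2 _ (hrl _ _ hm), lie_zero, sub_zero]⟩ }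
  let adr : r →ₗ[K] N :=
    { toFun := fun b => ⟨(LieAlgebra.ad K L b : L →ₗ[K] L),
        fun x => hrl' _ _ b.2, fun x hx => hab _ b.2 _ hx⟩
      map_add' := fun x y => Subtype.ext (by simp)
      map_smul' := fun t x => Subtype.ext (by simp) }
  let P : LieSubmodule K L N :=
    { LinearMap.range adr with
      lie_mem := fun {x m} hm => by
        obtain ⟨b, rfl⟩ := hm
        refine ⟨⟨⁅x, (b : L)⁆, hrl _ _ b.2⟩, Subtype.ext (LinearMap.ext fun y => ?_)⟩
        change ⁅⁅x, (b : L)⁆, y⁆ = ⁅x, ⁅(b : L), y⁆⁆ - ⁅(b : L), ⁅x, y⁆⁆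
        rw [lie_lie] }
  have hmem (x : L) : ⁅x, ρ⁆ ∈ N := ⟨fun m => by
    rw [LieHom.lie_apply]
    exact r.sub_mem (hrl _ _ (hρr m)) (hρr _), fun m hm => by
    rw [LieHom.lie_apply, hρ m hm, hρ _ (hrl _ _ hm), sub_self]⟩
  let c₀ : L →ₗ[K] N :=
    { toFun := fun x => ⟨⁅x, ρ⁆, hmem x⟩
      map_add' := fun x y => Subtype.ext (add_lie x y ρ)
      map_smul' := fun t x => Subtype.ext (smul_lie t x ρ) }
  let c : L →ₗ[K] N ⧸ P := P.toSubmodule.mkQ ∘ₗ c₀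
  have hc : IsOneCocycle c := fun x y => by
    have h0 : c₀ ⁅x, y⁆ = ⁅x, c₀ y⁆ - ⁅y, c₀ x⁆ := Subtype.ext (lie_lie x y ρ)
    change LieSubmodule.Quotient.mk (c₀ ⁅x, y⁆) = _
    rw [h0]
    rfl
  have hc0 : ∀ x ∈ r, c x = 0 := fun b hb => by
    refine LieSubmodule.Quotient.mk_eq_zero'.mpr ⟨⟨-b, r.neg_mem hb⟩, Subtype.ext <|
      LinearMap.ext fun y => ?_⟩
    change ⁅-b, y⁆ = ⁅b, ρ⁆ y
    rw [LieHom.lie_apply, hab _ hb _ (hρr y), hρ _ (hrl' _ _ hb), zero_sub, neg_lie]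
  have hV : ∀ x ∈ r, ∀ v : N ⧸ P, ⁅x, v⁆ = 0 := fun b hb v => by
    obtain ⟨v, rfl⟩ := LieSubmodule.Quotient.surjective_mk' P v
    have : ⁅b, v⁆ = 0 := Subtype.ext <| LinearMap.ext fun y => by
      change ⁅b, (v : L →ₗ[K] L)⁆ y = 0
      rw [LieHom.lie_apply, hab _ hb _ (v.2.1 y), v.2.2 _ (hrl' _ _ hb), sub_zero]
    rw [← LieModuleHom.map_lie, this, map_zero]
  obtain ⟨v, hv⟩ := hc.exists_eq_lie_of_surjective π hπ hV hc0
  obtain ⟨φ, rfl⟩ := LieSubmodule.Quotient.surjective_mk' P v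
  -- After the correction every `⁅x, ρ'⁆` equals some `ad b` with `b ∈ r`, and `x + b` then fixes
  -- `ρ'`. So the stabiliser of `ρ'` maps onto `S`; if it is all of `L`, then `r` is central and
  -- `ker ρ'` is a subalgebra complementary to `r`.
  set ρ' : L →ₗ[K] L := ρ - (φ : L →ₗ[K] L) with hρ'
  have hρ'r (x : L) : ρ' x ∈ r := r.sub_mem (hρr x) (φ.2.1 x)
  have hρ'id (x : L) (hx : x ∈ r) : ρ' x = x := by
    rw [hρ', LinearMap.sub_apply, hρ x hx, φ.2.2 x hx, sub_zero]
  have hP (x : L) : ∃ b ∈ r, ∀ y, ⁅x, ρ'⁆ y = ⁅b, y⁆ := by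
    have h1 : (LieSubmodule.Quotient.mk (c₀ x) : N ⧸ P) = LieSubmodule.Quotient.mk ⁅x, φ⁆ := hv x
    obtain ⟨b, hb⟩ := (Submodule.Quotient.eq P.toSubmodule).mp h1
    refine ⟨b, b.2, fun y => ?_⟩
    have h2 := LinearMap.congr_fun (congrArg Subtype.val hb) y
    rw [hρ', lie_sub]
    exact h2.symm
  have hbr (b : L) (hb : b ∈ r) (y : L) : ⁅b, ρ'⁆ y = - ⁅b, y⁆ := by
    rw [LieHom.lie_apply, hab _ hb _ (hρ'r y), hρ'id _ (hrl' _ _ hb), zero_sub]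
  let H : LieSubalgebra K L :=
    { carrier := {x | ⁅x, ρ'⁆ = 0}
      add_mem' := fun {x y} hx hy => by
        change ⁅x + y, ρ'⁆ = 0
        rw [add_lie, hx, hy, add_zero]
      zero_mem' := zero_lie _
      smul_mem' := fun t x hx => by
        change ⁅t • x, ρ'⁆ = 0
        rw [smul_lie, hx, smul_zero]
      lie_mem' := fun {x y} hx hy => by
        change ⁅⁅x, y⁆, ρ'⁆ = 0
        rw [lie_lie, hx, hy, lie_zero, lie_zero, sub_zero] }
  by_cases hH : H = ⊤
  swap
  · refine hsub H hH fun s => ?_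
    obtain ⟨x, rfl⟩ := hπ s
    obtain ⟨b, hb, hbx⟩ := hP x
    refine ⟨x + b, ?_, by rw [map_add, (LieHom.mem_ker ..).mp hb, add_zero]⟩
    change ⁅x + b, ρ'⁆ = 0
    ext y
    rw [add_lie, LinearMap.add_apply, hbx, hbr b hb, add_neg_cancel, LinearMap.zero_apply]
  have hH' (x : L) : ⁅x, ρ'⁆ = 0 := by
    have : x ∈ H := hH ▸ LieSubalgebra.mem_top x
    exact this
  have hcent (b : L) (hb : b ∈ r) (y : L) : ⁅b, y⁆ = 0 := by
    have := hbr b hb y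
    rw [hH', LinearMap.zero_apply, eq_comm, neg_eq_zero] at this
    exact this
  have hρ'lie (x y : L) : ρ' ⁅x, y⁆ = 0 := by
    have := LinearMap.congr_fun (hH' x) y
    rw [LieHom.lie_apply, ← lie_skew, hcent _ (hρ'r y), neg_zero, zero_sub, LinearMap.zero_apply,
      neg_eq_zero] at this
    exact this
  let H' : LieSubalgebra K L :=
    { LinearMap.ker ρ' with
      lie_mem' := fun {x y} _ _ => hρ'lie x y }
  by_cases hH'' : H' = ⊤
  swap
  · refine hsub H' hH'' fun s => ?_
    obtain ⟨x, rfl⟩ := hπ s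
    refine ⟨x - ρ' x, ?_, by rw [map_sub, (LieHom.mem_ker ..).mp (hρ'r x), sub_zero]⟩
    change ρ' (x - ρ' x) = 0
    rw [map_sub, hρ'id _ (hρ'r x), sub_self]
  have hinj : Function.Injective π := by
    rw [← LieHom.ker_eq_bot, LieSubmodule.eq_bot_iff]
    intro x hx
    have : x ∈ H' := hH'' ▸ LieSubalgebra.mem_top x
    rw [← hρ'id x hx]
    exact this
  exact ⟨(LieEquiv.ofBijective π ⟨hinj, hπ⟩).symm,
    fun s => (LieEquiv.ofBijective π ⟨hinj, hπ⟩).apply_symm_apply s⟩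

end Levi

/-! ### Symplectic forms on unimodular Lie algebras. -/

section Unimodular

variable {g : Type*} [LieRing g] [LieAlgebra ℝ g]

theorem IsSymplectic.neg_apply {ω : LinearMap.BilinForm ℝ g} (hω : IsSymplectic ω) (x y : g) :
    - ω x y = ω y x := LinearMap.IsAlt.neg (B := ω) hω.alt x y

theorem IsSymplectic.apply_lie {ω : LinearMap.BilinForm ℝ g} (hω : IsSymplectic ω) (x y z : g) :
    ω y ⁅x, z⁆ = ω ⁅y, x⁆ z + ω x ⁅y, z⁆ := by
  have h1 := hω.closed x z y
  have h2 : ω ⁅z, y⁆ x = ω x ⁅y, z⁆ := by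
    rw [← hω.neg_apply x, ← lie_skew, map_neg, neg_neg]
  have h3 := hω.neg_apply ⁅x, z⁆ y
  linarith

/-- The exact 2-form defined by a linear form. -/
def exactForm (h : Module.Dual ℝ g) : LinearMap.BilinForm ℝ g :=
  LinearMap.mk₂ ℝ (fun x y => h ⁅x, y⁆) (by simp) (by simp) (by simp) (by simp)

theorem exactForm_apply (h : Module.Dual ℝ g) (x y : g) : exactForm h x y = h ⁅x, y⁆ := rfl

/-- Jacobi's formula: the polynomial `Q(t) = det (A + t B)` has zero derivative wherever it does not
vanish, so `Q Q' = 0` and `Q` is a non-zero constant. -/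
theorem det_add_smul_ne_zero {n : Type*} [Fintype n] [DecidableEq n] (A B : Matrix n n ℝ)
    (hA : A.det ≠ 0) (h : ∀ t : ℝ, (A + t • B).det ≠ 0 → ((A + t • B)⁻¹ * B).trace = 0) (t : ℝ) :
    (A + t • B).det ≠ 0 := by
  have heval (A B : Matrix n n ℝ) (s : ℝ) :
      (Matrix.det (A.map Polynomial.C + (Polynomial.X : Polynomial ℝ) • B.map Polynomial.C)).eval s
        = (A + s • B).det := by
    rw [← Polynomial.coe_evalRingHom, RingHom.map_det]
    congr 1
    ext i j
    simp
    ring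
  set Q : Polynomial ℝ :=
    Matrix.det (A.map Polynomial.C + (Polynomial.X : Polynomial ℝ) • B.map Polynomial.C) with hQ
  have hQ0 : Q ≠ 0 := fun h0 => hA <| by
    have := heval A B 0
    rw [← hQ, h0] at this
    simpa using this.symm
  have hder (t : ℝ) (ht : Q.eval t ≠ 0) : Q.derivative.eval t = 0 := by
    rw [hQ, heval] at ht
    set M := (A + t • B)⁻¹ * B with hM
    have hcomp : Q.comp (Polynomial.X + Polynomial.C t) = Polynomial.C (A + t • B).det *
        Matrix.det (1 + (Polynomial.X : Polynomial ℝ) • M.map Polynomial.C) := by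
      refine Polynomial.funext fun s => ?_
      have h1 : (1 : Matrix n n (Polynomial ℝ)) = (1 : Matrix n n ℝ).map Polynomial.C := by simp
      rw [Polynomial.eval_comp, Polynomial.eval_mul, h1, heval, heval, Polynomial.eval_C,
        ← Matrix.det_mul, mul_add, mul_one, hM, Matrix.mul_smul,
        Matrix.mul_nonsing_inv_cancel_left _ _ (isUnit_iff_ne_zero.mpr ht)]
      congr 1
      simp [add_smul]
      abel
    have h2 := congrArg (fun q => (Polynomial.derivative q).eval 0) hcomp
    simp only [Polynomial.derivative_comp, Polynomial.derivative_mul, Polynomial.derivative_C,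
      zero_mul, zero_add, Polynomial.eval_mul, Polynomial.eval_C,
      Matrix.derivative_det_one_add_X_smul, Polynomial.eval_comp] at h2
    rw [h t ht, mul_zero] at h2
    simpa using h2
  have hQd : Q * Q.derivative = 0 := Polynomial.funext fun s => by
    rw [Polynomial.eval_mul, Polynomial.eval_zero]
    by_cases hs : Q.eval s = 0
    · rw [hs, zero_mul]
    · rw [hder s hs, mul_zero]
  have hd : Q.derivative = 0 := (mul_eq_zero.mp hQd).resolve_left hQ0
  have hdeg := Polynomial.derivative_eq_zero.mp hd
  obtain ⟨a, ha⟩ := Polynomial.natDegree_eq_zero.mp hdeg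
  have e0 := heval A B 0
  have e1 := heval A B t
  rw [← hQ, ← ha, Polynomial.eval_C] at e0 e1
  rw [← e1, e0]
  simpa using hA

/-- Let `W` be the Gram matrix of `ω + t dh` at a value of `t` where this form is non-degenerate. If
the form represents `h` by a vector `y`, closedness says that `dh` is the derivative of the form
along `ad y`. Hence `W⁻¹ B` has trace `2 tr (ad y) = 0`, and the determinant is constant in `t`. -/
theorem IsSymplectic.add_exactForm_nondegenerate [FiniteDimensional ℝ g]
    {ω : LinearMap.BilinForm ℝ g} (hω : IsSymplectic ω)
    (htr : ∀ x : g, LinearMap.trace ℝ g (LieAlgebra.ad ℝ g x) = 0) (h : Module.Dual ℝ g) :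
    (ω + exactForm h).Nondegenerate := by
  classical
  let b := finBasis ℝ g
  let A := LinearMap.BilinForm.toMatrix b ω
  let B := LinearMap.BilinForm.toMatrix b (exactForm h)
  have hAB (t : ℝ) : A + t • B = LinearMap.BilinForm.toMatrix b (ω + t • exactForm h) := by
    simp [A, B]
  suffices ((A + (1 : ℝ) • B).det ≠ 0) by
    rw [hAB, one_smul] at this
    exact (LinearMap.BilinForm.nondegenerate_iff_det_ne_zero b).mpr this
  refine det_add_smul_ne_zero A B
    ((LinearMap.BilinForm.nondegenerate_iff_det_ne_zero b).mp hω.nondegenerate) (fun t ht => ?_) 1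
  have hu : IsUnit (A + t • B).det := isUnit_iff_ne_zero.mpr ht
  rw [hAB] at ht hu
  have hnd := (LinearMap.BilinForm.nondegenerate_iff_det_ne_zero b).mpr ht
  have hs : IsSymplectic (ω + t • exactForm h) :=
    { alt := fun x => by simp [exactForm_apply, hω.alt]
      nondegenerate := hnd
      closed := fun x y z => by
        have h1 := hω.closed x y z
        have h2 := congrArg h (lie_jacobi x y z)
        simp only [LinearMap.add_apply, LinearMap.smul_apply, exactForm_apply, smul_eq_mul]
        rw [← lie_skew x, ← lie_skew y ⁅z, x⁆, ← lie_skew z ⁅x, y⁆, map_add, map_add] at h2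
        simp only [map_neg, map_zero] at h2
        linear_combination h1 - t * h2 }
  obtain ⟨y, hy⟩ := (LinearMap.BilinForm.toDual _ hnd).surjective h
  have hy' : ∀ z, (ω + t • exactForm h) y z = h z := fun z =>
    LinearMap.congr_fun hy z
  have hB : B = (LinearMap.toMatrix b b (LieAlgebra.ad ℝ g y))ᵀ * (A + t • B) +
      (A + t • B) * LinearMap.toMatrix b b (LieAlgebra.ad ℝ g y) := by
    rw [hAB, ← LinearMap.BilinForm.toMatrix_compLeft, ← LinearMap.BilinForm.toMatrix_compRight,
      ← map_add]
    refine congrArg (LinearMap.BilinForm.toMatrix b) (LinearMap.ext fun x => LinearMap.ext fun z => ?_)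
    rw [exactForm_apply, ← hy', hs.apply_lie]
    rfl
  rw [← hAB] at hu
  have hinv : (A + t • B)⁻¹ * B = (A + t • B)⁻¹ *
      ((LinearMap.toMatrix b b (LieAlgebra.ad ℝ g y))ᵀ * (A + t • B)) +
      LinearMap.toMatrix b b (LieAlgebra.ad ℝ g y) := by
    conv_lhs => enter [2]; rw [hB]
    rw [mul_add, Matrix.nonsing_inv_mul_cancel_left _ _ hu]
  rw [hinv, Matrix.trace_add, Matrix.trace_mul_comm, Matrix.mul_assoc,
    Matrix.mul_nonsing_inv _ hu, mul_one, Matrix.trace_transpose, ← LinearMap.trace_eq_matrix_trace,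
    htr, add_zero]

/-- A unimodular symplectic Lie algebra has no semisimple subalgebra. -/
theorem IsSymplectic.subsingleton_of_isKilling [FiniteDimensional ℝ g]
    {ω : LinearMap.BilinForm ℝ g} (hω : IsSymplectic ω)
    (htr : ∀ x : g, LinearMap.trace ℝ g (LieAlgebra.ad ℝ g x) = 0)
    (s : LieSubalgebra ℝ g) [LieAlgebra.IsKilling ℝ s] : Subsingleton s := by
  -- Closedness of `ω` is the cocycle identity for `x ↦ ω(x, ·)`. A primitive `h` makes `ω + dh`
  -- vanish on `s × g`.
  let c : s →ₗ[ℝ] Module.Dual ℝ g := ω ∘ₗ s.toSubmodule.subtype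
  have hc : IsOneCocycle c := fun x y => by
    ext z
    have h1 := hω.apply_lie (x : g) (y : g) z
    have h2 : ω ⁅(x : g), (y : g)⁆ z = - ω ⁅(y : g), (x : g)⁆ z := by
      rw [← lie_skew, map_neg, LinearMap.neg_apply]
    change ω ⁅(x : g), (y : g)⁆ z = (⁅x, c y⁆ : Module.Dual ℝ g) z - (⁅y, c x⁆ : Module.Dual ℝ g) z
    rw [Module.Dual.lie_apply, Module.Dual.lie_apply]
    change ω ⁅(x : g), (y : g)⁆ z = - ω (y : g) ⁅(x : g), z⁆ - - ω (x : g) ⁅(y : g), z⁆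
    linarith
  obtain ⟨h, hh⟩ := hc.exists_eq_lie
  refine ⟨fun x y => ?_⟩
  suffices ∀ x : s, x = 0 by rw [this x, this y]
  intro x
  refine Subtype.ext ((hω.add_exactForm_nondegenerate htr h).1 (x : g) fun z => ?_)
  have h1 := LinearMap.congr_fun (hh x) z
  rw [Module.Dual.lie_apply] at h1
  rw [LinearMap.add_apply, LinearMap.add_apply, exactForm_apply]
  change ω (x : g) z = - h ⁅(x : g), z⁆ at h1
  rw [h1, neg_add_cancel]

end Unimodular

/-! ### Semisimple Lie algebras of small dimension and their modules. -/

section Killing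

variable {K L : Type*} [Field K] [LieRing L] [LieAlgebra K L]

/-- The preimage of an abelian ideal is an extension of abelian by solvable, hence solvable and
contained in the radical. -/
theorem hasTrivialRadical_quotient_radical [FiniteDimensional K L] :
    LieAlgebra.HasTrivialRadical K (L ⧸ LieAlgebra.radical K L) := by
  rw [LieAlgebra.hasTrivialRadical_iff_no_abelian_ideals]
  set r := LieAlgebra.radical K L
  intro I hI
  have hII : ∀ x ∈ I, ∀ y ∈ I, ⁅x, y⁆ = 0 := by
    rw [LieSubmodule.lie_abelian_iff_lie_self_eq_bot, LieSubmodule.lie_eq_bot_iff] at hI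
    exact hI
  let J : LieIdeal K L :=
    { I.toSubmodule.comap r.toSubmodule.mkQ with
      lie_mem := fun {x y} hy => lie_mem_right K _ I (LieSubmodule.Quotient.mk x) _ hy }
  have hJ : ⁅J, J⁆ ≤ r := by
    rw [LieSubmodule.lieIdeal_oper_eq_span, LieSubmodule.lieSpan_le]
    rintro _ ⟨⟨x, hx⟩, ⟨y, hy⟩, rfl⟩
    exact LieSubmodule.Quotient.mk_eq_zero'.mp (hII _ hx _ hy)
  have hJs : LieAlgebra.IsSolvable J := by
    have hr : LieAlgebra.IsSolvable r := inferInstance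
    obtain ⟨k, hk⟩ := LieAlgebra.IsSolvable.solvable K r
    rw [LieIdeal.derivedSeries_eq_bot_iff] at hk
    refine LieAlgebra.IsSolvable.mk (R := K) (k := k + 1) ?_
    rw [LieIdeal.derivedSeries_eq_bot_iff, LieAlgebra.derivedSeriesOfIdeal_add, eq_bot_iff, ← hk]
    exact LieAlgebra.derivedSeriesOfIdeal_le hJ le_rfl
  have hJr : J ≤ r := (LieAlgebra.LieIdeal.solvable_iff_le_radical K L J).mp hJs
  rw [LieSubmodule.eq_bot_iff]
  intro x hx
  obtain ⟨x, rfl⟩ := LieSubmodule.Quotient.surjective_mk' r x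
  exact LieSubmodule.Quotient.mk_eq_zero'.mpr (hJr hx)

/-- The Killing form of an ideal is the restriction of the ambient one, and the ideal is
complemented by its orthogonal. -/
theorem isKilling_lieIdeal [FiniteDimensional K L] [LieAlgebra.IsKilling K L] (I : LieIdeal K L) :
    LieAlgebra.IsKilling K I := by
  constructor
  rw [LieSubmodule.eq_bot_iff]
  rintro ⟨x, hx⟩ h
  rw [LieIdeal.mem_killingCompl] at h
  refine Subtype.ext ((LieAlgebra.IsKilling.killingForm_nondegenerate K L).1 _ fun z => ?_)
  have hz : z ∈ I ⊔ I.killingCompl := I.isCompl_killingCompl.sup_eq_top ▸ LieSubmodule.mem_top z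
  obtain ⟨i, hi, j, hj, rfl⟩ := (LieSubmodule.mem_sup _ _ z).mp hz
  have h1 := h ⟨i, hi⟩ (LieSubmodule.mem_top _)
  rw [traceForm_comm] at h1
  have h2 : killingForm K I ⟨x, hx⟩ ⟨i, hi⟩ = killingForm K L x i := by
    rw [LieIdeal.killingForm_eq]; rfl
  have h3 := (LieIdeal.mem_killingCompl K L I).mp hj x hx
  rw [map_add, ← h2, h3, add_zero]
  exact h1

variable [FiniteDimensional K L] [LieAlgebra.IsKilling K L]

theorem mem_span_lie (x : L) : x ∈ Submodule.span K {z : L | ∃ x y : L, ⁅x, y⁆ = z} := by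
  have hx : x ∈ ⁅(⊤ : LieIdeal K L), (⊤ : LieIdeal K L)⁆ := by
    rw [lie_top_top_eq_top_of_isKilling]; exact LieSubmodule.mem_top x
  rw [← LieSubmodule.mem_toSubmodule, LieSubmodule.lieIdeal_oper_eq_linear_span'] at hx
  refine Submodule.span_mono ?_ hx
  rintro _ ⟨y, -, z, -, rfl⟩
  exact ⟨y, z, rfl⟩

theorem eq_zero_of_forall_lie {V : Type*} [AddCommGroup V] [Module K V] (f : L →ₗ[K] V)
    (h : ∀ x y : L, f ⁅x, y⁆ = 0) (x : L) : f x = 0 := by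
  have : Submodule.span K {z : L | ∃ x y : L, ⁅x, y⁆ = z} ≤ LinearMap.ker f := by
    rw [Submodule.span_le]
    rintro _ ⟨x, y, rfl⟩
    exact h x y
  exact this (mem_span_lie x)

theorem killing_lie_left (x y z : L) : killingForm K L ⁅x, y⁆ z = killingForm K L x ⁅y, z⁆ :=
  traceForm_apply_lie_apply K L L x y z

theorem killing_lie_self (x y : L) : killingForm K L ⁅x, y⁆ y = 0 := by
  rw [killing_lie_left, lie_self, map_zero]

theorem killing_lie_self' (x y : L) : killingForm K L ⁅x, y⁆ x = 0 := by
  rw [← lie_skew, map_neg, LinearMap.neg_apply, killing_lie_self, neg_zero]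

theorem subsingleton_of_forall_lie_eq_zero (K : Type*) {L : Type*} [Field K] [LieRing L]
    [LieAlgebra K L] [FiniteDimensional K L] [LieAlgebra.IsKilling K L] (h : ∀ x y : L, ⁅x, y⁆ = 0) : Subsingleton L := by
  have : IsLieAbelian L := ⟨h⟩
  exact (LieAlgebra.IsKilling.isLieAbelian_iff_subsingleton K L).mp this

theorem subsingleton_of_basis_lie_eq_zero {ι : Type*} (b : Basis ι K L)
    (h : ∀ i j, ⁅b i, b j⁆ = 0) : Subsingleton L := by
  refine subsingleton_of_forall_lie_eq_zero K fun x y => ?_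
  have h1 : (LieAlgebra.ad K L : L →ₗ[K] Module.End K L) = 0 := by
    refine b.ext fun i => ?_
    refine b.ext fun j => ?_
    exact h i j
  exact LinearMap.congr_fun (LinearMap.congr_fun h1 x) y

theorem finrank_ne_one_of_isKilling : finrank K L ≠ 1 := fun h => by
  let b := finBasisOfFinrankEq K L h
  have := subsingleton_of_basis_lie_eq_zero b fun i j => by
    rw [Subsingleton.elim i j, lie_self]
  rw [finrank_zero_of_subsingleton] at h
  omega

/-- By invariance `⁅x, y⁆` is Killing-orthogonal to `x` and to `y`, which here span everything. -/
theorem finrank_ne_two_of_isKilling : finrank K L ≠ 2 := fun h => by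
  let b := finBasisOfFinrankEq K L h
  have h01 : ⁅b 0, b 1⁆ = 0 := by
    refine (LieAlgebra.IsKilling.killingForm_nondegenerate K L).1 _ fun z => ?_
    have : killingForm K L ⁅b 0, b 1⁆ = 0 := by
      refine b.ext fun i => ?_
      fin_cases i
      · exact killing_lie_self' _ _
      · exact killing_lie_self _ _
    rw [this]; rfl
  have := subsingleton_of_basis_lie_eq_zero b fun i j => by
    fin_cases i <;> fin_cases j
    · exact lie_self _
    · exact h01
    · change ⁅b 1, b 0⁆ = 0
      rw [← lie_skew, h01, neg_zero]
    · exact lie_self _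
  rw [finrank_zero_of_subsingleton] at h
  omega

/-- There is no four-dimensional semisimple Lie algebra: an alternating 3-form on a
four-dimensional space is degenerate. -/
theorem finrank_ne_four_of_isKilling : finrank K L ≠ 4 := fun h => by
  let b := finBasisOfFinrankEq K L h
  obtain ⟨φ, hφ₀⟩ : ∃ φ : Fin 4 → Fin 4 → Fin 4 → K,
      ∀ i j k, φ i j k = killingForm K L ⁅b i, b j⁆ (b k) := ⟨_, fun _ _ _ => rfl⟩
  have a12 (i j k) : φ i j k = - φ j i k := by
    rw [hφ₀, hφ₀]; rw [← lie_skew, map_neg, LinearMap.neg_apply]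
  have a23 (i j k) : φ i j k = - φ i k j := by
    rw [hφ₀, hφ₀]; rw [killing_lie_left, killing_lie_left, ← lie_skew, map_neg]
  have cyc (i j k) : φ i j k = φ j k i := by rw [a12, a23, neg_neg]
  have z1 (i k) : φ i i k = 0 := by simp [hφ₀]
  have z2 (i k) : φ i k k = 0 := hφ₀ i k k ▸ killing_lie_self _ _
  have z3 (i k) : φ i k i = 0 := hφ₀ i k i ▸ killing_lie_self' _ _
  -- An alternating 3-form on a four-dimensional space is the contraction of the volume form with a
  -- vector. This is that vector, and contracting `φ` with it gives zero.
  let v : L := φ 1 2 3 • b 0 - φ 0 2 3 • b 1 + φ 0 1 3 • b 2 - φ 0 1 2 • b 3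
  have hv (i j : Fin 4) : killingForm K L ⁅b i, b j⁆ v = 0 := by
    have e : killingForm K L ⁅b i, b j⁆ v = φ 1 2 3 * φ i j 0 - φ 0 2 3 * φ i j 1 +
        φ 0 1 3 * φ i j 2 - φ 0 1 2 * φ i j 3 := by
      simp [v, hφ₀]
    rw [e]
    let f : Fin 4 → Fin 4 → K := fun i j => φ 1 2 3 * φ i j 0 - φ 0 2 3 * φ i j 1 +
        φ 0 1 3 * φ i j 2 - φ 0 1 2 * φ i j 3
    change f i j = 0
    have e01 : φ 0 2 1 = - φ 0 1 2 := a23 0 2 1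
    have e02 : φ 0 3 1 = - φ 0 1 3 := a23 0 3 1
    have e03 : φ 0 3 2 = - φ 0 2 3 := a23 0 3 2
    have e12 : φ 1 2 0 = φ 0 1 2 := (cyc 0 1 2).symm
    have e13 : φ 1 3 0 = φ 0 1 3 := (cyc 0 1 3).symm
    have e13' : φ 1 3 2 = - φ 1 2 3 := a23 1 3 2
    have e23 : φ 2 3 0 = φ 0 2 3 := (cyc 0 2 3).symm
    have e23' : φ 2 3 1 = φ 1 2 3 := (cyc 1 2 3).symm
    have lt01 : f 0 1 = 0 := by simp only [f, z2, z3]; ring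
    have lt02 : f 0 2 = 0 := by simp only [f, z2, z3, e01]; ring
    have lt03 : f 0 3 = 0 := by simp only [f, z2, z3, e02, e03]; ring
    have lt12 : f 1 2 = 0 := by simp only [f, z2, z3, e12]; ring
    have lt13 : f 1 3 = 0 := by simp only [f, z2, z3, e13, e13']; ring
    have lt23 : f 2 3 = 0 := by simp only [f, z2, z3, e23, e23']; ring
    have anti (i j) : f i j = - f j i := by
      simp only [f, a12 i j]; ring
    fin_cases i <;> fin_cases j <;>
      first
        | exact lt01 | exact lt02 | exact lt03 | exact lt12 | exact lt13 | exact lt23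
        | exact (anti _ _).trans (neg_eq_zero.mpr lt01)
        | exact (anti _ _).trans (neg_eq_zero.mpr lt02)
        | exact (anti _ _).trans (neg_eq_zero.mpr lt03)
        | exact (anti _ _).trans (neg_eq_zero.mpr lt12)
        | exact (anti _ _).trans (neg_eq_zero.mpr lt13)
        | exact (anti _ _).trans (neg_eq_zero.mpr lt23)
        | (simp [f, z1])
  -- Being in the kernel of the 3-form `κ(⁅·, ·⁆, ·)` means being central.
  have hv0 : v = 0 := by
    have h1 (y : L) : ⁅y, v⁆ = 0 := by
      refine (LieAlgebra.IsKilling.killingForm_nondegenerate K L).2 _ fun x => ?_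
      rw [← killing_lie_left]
      have h2 : (LinearMap.mk₂ K (fun x y : L => killingForm K L ⁅x, y⁆ v)
          (by simp) (by simp) (by simp) (by simp)) = 0 := by
        refine b.ext fun i => b.ext fun j => ?_
        exact hv i j
      exact LinearMap.congr_fun (LinearMap.congr_fun h2 x) y
    have h2 : v ∈ LieAlgebra.center K L := (LieModule.mem_maxTrivSubmodule K L L v).mpr h1
    rw [LieAlgebra.center_eq_bot] at h2
    simpa using h2
  have hc (i : Fin 4) : b.repr v i = 0 := by rw [hv0]; simp
  have c0 := hc 0
  have c1 := hc 1
  have c2 := hc 2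
  have c3 := hc 3
  simp [v] at c0 c1 c2 c3
  have key (a b c : Fin 4) (h : φ a b c = 0) : φ b c a = 0 ∧ φ c a b = 0 ∧ φ b a c = 0 ∧
      φ a c b = 0 ∧ φ c b a = 0 :=
    ⟨by rw [← cyc, h], by rw [cyc, h], by rw [a12, h, neg_zero], by rw [a23, h, neg_zero],
      by rw [a12, ← cyc, h, neg_zero]⟩
  have hφ (i j k) : φ i j k = 0 := by
    obtain ⟨k1, k2, k3, k4, k5⟩ := key _ _ _ c0
    obtain ⟨l1, l2, l3, l4, l5⟩ := key _ _ _ c1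
    obtain ⟨m1, m2, m3, m4, m5⟩ := key _ _ _ c2
    obtain ⟨n1, n2, n3, n4, n5⟩ := key _ _ _ c3
    fin_cases i <;> fin_cases j <;> fin_cases k <;>
      first | exact z1 _ _ | exact z2 _ _ | exact z3 _ _ | assumption
  have := subsingleton_of_basis_lie_eq_zero b fun i j => by
    refine (LieAlgebra.IsKilling.killingForm_nondegenerate K L).1 _ fun z => ?_
    have : killingForm K L ⁅b i, b j⁆ = 0 := b.ext fun k => (hφ₀ i j k).symm.trans (hφ i j k)
    rw [this]; rfl
  rw [finrank_zero_of_subsingleton] at h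
  omega

variable {M : Type*} [AddCommGroup M] [Module K M] [LieRingModule L M] [LieModule K L M]

theorem trace_toEnd_eq_zero (x : L) : LinearMap.trace K M (toEnd K L M x) = 0 :=
  eq_zero_of_forall_lie (LinearMap.trace K M ∘ₗ (toEnd K L M : L →ₗ[K] Module.End K M))
    (fun x y => by simp) x

/-- Endomorphisms of a line commute, so brackets act by zero, and `L` is spanned by brackets. -/
theorem lie_eq_zero_of_finrank_le_one [FiniteDimensional K M] (h : finrank K M ≤ 1) (x : L)
    (m : M) : ⁅x, m⁆ = 0 := by
  obtain ⟨v, hv⟩ := finrank_le_one_iff.mp h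
  suffices toEnd K L M x = 0 by
    have := LinearMap.congr_fun this m
    simpa using this
  refine eq_zero_of_forall_lie (toEnd K L M : L →ₗ[K] Module.End K M) (fun x y => ?_) x
  refine LinearMap.ext fun m => ?_
  obtain ⟨c, rfl⟩ := hv m
  obtain ⟨a, ha⟩ := hv ⁅x, v⁆
  obtain ⟨b, hb⟩ := hv ⁅y, v⁆
  change ⁅⁅x, y⁆, c • v⁆ = 0
  rw [lie_smul, lie_lie, ← hb, ← ha, lie_smul, lie_smul, ← hb, ← ha, smul_smul, smul_smul,
    mul_comm, sub_self, smul_zero]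

end Killing

/-! ### The Levi decomposition of a non-solvable symplectic Lie algebra and its dimensions. -/

section Structure

variable {g : Type*} [LieRing g] [LieAlgebra ℝ g]

/-- The trace of the adjoint representation, as a linear form. -/
noncomputable def traceAd (g : Type*) [LieRing g] [LieAlgebra ℝ g] : g →ₗ[ℝ] ℝ :=
  LinearMap.trace ℝ g ∘ₗ (LieAlgebra.ad ℝ g : g →ₗ[ℝ] Module.End ℝ g)

theorem traceAd_apply (x : g) : traceAd g x = LinearMap.trace ℝ g (LieAlgebra.ad ℝ g x) := rfl

theorem traceAd_lie (x y : g) : traceAd g ⁅x, y⁆ = 0 := by simp [traceAd]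

/-- Two complementary commuting subalgebras of an indecomposable Lie algebra: one of them is
zero. -/
theorem IsIndecomposable.eq_bot_or_eq_bot (hg : IsIndecomposable g) (A B : Submodule ℝ g)
    (hAB : IsCompl A B) (hA : ∀ x ∈ A, ∀ y ∈ A, ⁅x, y⁆ ∈ A) (hB : ∀ x ∈ B, ∀ y ∈ B, ⁅x, y⁆ ∈ B)
    (h : ∀ x ∈ A, ∀ y ∈ B, ⁅x, y⁆ = 0) : A = ⊥ ∨ B = ⊥ := by
  have hdec (x : g) : ∃ a ∈ A, ∃ b ∈ B, a + b = x :=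
    Submodule.mem_sup.mp (hAB.sup_eq_top ▸ Submodule.mem_top)
  let I : LieIdeal ℝ g :=
    { A with
      lie_mem := fun {x y} hy => by
        obtain ⟨a, ha, b, hb, rfl⟩ := hdec x
        have h1 : ⁅b, y⁆ = 0 := by rw [← lie_skew, h y hy b hb, neg_zero]
        rw [add_lie, h1, add_zero]
        exact hA a ha y hy }
  let J : LieIdeal ℝ g :=
    { B with
      lie_mem := fun {x y} hy => by
        obtain ⟨a, ha, b, hb, rfl⟩ := hdec x
        rw [add_lie, h a ha y hy, zero_add]
        exact hB b hb y hy }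
  have hIJ : IsCompl I J := by
    rw [← LieSubmodule.isCompl_toSubmodule]
    exact hAB
  refine (hg.2 I J hIJ).imp (fun h => ?_) (fun h => ?_)
  · exact (LieSubmodule.toSubmodule_eq_bot I).mpr h
  · exact (LieSubmodule.toSubmodule_eq_bot J).mpr h

/-- A Levi decomposition `g = s ⋉ (n ⋊ ℝ t)` of a non-unimodular Lie algebra, where `n` is the
unimodular part of the radical and `t` commutes with the Levi factor `s`. -/
structure LeviData (s : LieSubalgebra ℝ g) (n : LieIdeal ℝ g) (t : g) : Prop where
  killing : LieAlgebra.IsKilling ℝ s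
  nontrivial : Nontrivial s
  solvable : LieAlgebra.IsSolvable n
  lie_t : ∀ x ∈ s, ⁅x, t⁆ = 0
  trace_t : traceAd g t ≠ 0
  trace_n : ∀ x ∈ n, traceAd g x = 0
  disjoint : ∀ x ∈ s, x ∈ n → x = 0
  spans : ∀ x : g, ∃ a ∈ s, ∃ b ∈ n, ∃ c : ℝ, x = a + b + c • t
  finrank_eq : finrank ℝ s + finrank ℝ n + 1 = finrank ℝ g

/-- An ideal, as a module over a subalgebra. -/
def idealRestrict (s : LieSubalgebra ℝ g) (I : LieIdeal ℝ g) : LieSubmodule ℝ s g :=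
  { I.toSubmodule with
    lie_mem := fun {x y} hy => lie_mem_right ℝ g I (x : g) y hy }

theorem traceAd_eq_zero_of_isKilling [FiniteDimensional ℝ g] (s : LieSubalgebra ℝ g)
    [LieAlgebra.IsKilling ℝ s] (x : g) (hx : x ∈ s) : traceAd g x = 0 :=
  eq_zero_of_forall_lie (K := ℝ) (L := s) (traceAd g ∘ₗ s.toSubmodule.subtype)
    (fun x y => traceAd_lie (x : g) (y : g)) ⟨x, hx⟩

/-- The rigidity fact rules out unimodularity, and `tr ∘ ad` vanishes on the Levi factor, so it is
non-zero on the radical `r` and its kernel `n` there has codimension one. A Levi-stable complement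
of `n` in `r` supplies `t`. -/
theorem exists_leviData [FiniteDimensional ℝ g] (hsol : ¬ LieAlgebra.IsSolvable g)
    {ω : LinearMap.BilinForm ℝ g} (hω : IsSymplectic ω) :
    ∃ (s : LieSubalgebra ℝ g) (n : LieIdeal ℝ g) (t : g), LeviData s n t := by
  set r := LieAlgebra.radical ℝ g with hr
  have := hasTrivialRadical_quotient_radical (K := ℝ) (L := g)
  have hK : LieAlgebra.IsKilling ℝ (g ⧸ r) := inferInstance
  let π : g →ₗ⁅ℝ⁆ g ⧸ r :=
    { (LieSubmodule.Quotient.mk' r : g →ₗ[ℝ] g ⧸ r) with map_lie' := fun {x y} => rfl }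
  have hπ (x : g) : π x = LieSubmodule.Quotient.mk x := rfl
  have hπs : Function.Surjective π := LieSubmodule.Quotient.surjective_mk' r
  have hπr (x : g) : π x = 0 ↔ x ∈ r := LieSubmodule.Quotient.mk_eq_zero'
  have hker : π.ker = r := by
    ext x
    rw [LieHom.mem_ker, hπr]
  obtain ⟨σ, hσ⟩ := exists_lieHom_rightInverse π hπs (by rw [hker]; infer_instance)
  have hσi : Function.Injective σ := Function.LeftInverse.injective hσ
  set s : LieSubalgebra ℝ g := σ.range with hs
  have hsK : LieAlgebra.IsKilling ℝ s := (LieEquiv.ofInjective σ hσi).isKilling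
  have hcompl : IsCompl s.toSubmodule r.toSubmodule := by
    constructor
    · rw [Submodule.disjoint_def]
      rintro _ ⟨x, rfl⟩ hx
      have := hσ x
      rw [(hπr (σ x)).mpr hx] at this
      change σ x = 0
      rw [← this, map_zero]
    · rw [codisjoint_iff, eq_top_iff]
      intro x _
      refine Submodule.mem_sup.mpr ⟨σ (π x), ⟨π x, rfl⟩, x - σ (π x), ?_, by abel⟩
      refine (hπr _).mp ?_
      rw [map_sub, hσ, sub_self]
  have hsn : Nontrivial s := by
    by_contra hcon
    rw [not_nontrivial_iff_subsingleton] at hcon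
    have hsb : s.toSubmodule = ⊥ := (Submodule.eq_bot_iff _).mpr fun x hx =>
      congrArg Subtype.val (Subsingleton.elim (⟨x, hx⟩ : s) 0)
    rw [hsb] at hcompl
    have hrt : r = ⊤ := by
      rw [← LieSubmodule.toSubmodule_inj]
      exact eq_top_of_bot_isCompl hcompl
    apply hsol
    have : LieAlgebra.IsSolvable (⊤ : LieIdeal ℝ g) := hrt ▸ LieAlgebra.radicalIsSolvable ℝ g
    exact (LieAlgebra.solvable_iff_equiv_solvable (LieIdeal.topEquiv (R := ℝ) (L := g))).mp this
  have htr : ∃ x, traceAd g x ≠ 0 := by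
    by_contra! hcon
    have := hω.subsingleton_of_isKilling hcon s
    exact not_subsingleton s this
  have hdec (x : g) : ∃ a ∈ s, ∃ b ∈ r, a + b = x :=
    Submodule.mem_sup.mp (hcompl.sup_eq_top ▸ Submodule.mem_top : x ∈ s.toSubmodule ⊔ r.toSubmodule)
  let n : LieIdeal ℝ g :=
    { r.toSubmodule ⊓ LinearMap.ker (traceAd g) with
      lie_mem := fun {x y} hy => ⟨lie_mem_right ℝ g r x y hy.1, traceAd_lie x y⟩ }
  have hnr : n ≤ r := fun x hx => hx.1
  obtain ⟨C, hCr, hnC, hnC'⟩ := exists_relative_compl_lieSubmodule (K := ℝ) (L := s)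
    (A := idealRestrict s n) (B := idealRestrict s r) hnr
  -- Brackets have trace zero, so `⁅s, C⁆` lies in `n ⊓ C = 0`.
  have hCs (x : g) (hx : x ∈ s) (y : g) (hy : y ∈ C) : ⁅x, y⁆ = 0 := by
    have h1 : ⁅x, y⁆ ∈ C := C.lie_mem (x := (⟨x, hx⟩ : s)) hy
    have h2 : ⁅x, y⁆ ∈ idealRestrict s n ⊓ C := ⟨⟨hCr h1, traceAd_lie x y⟩, h1⟩
    rw [hnC'] at h2
    simpa using h2
  obtain ⟨t, htC, htt⟩ : ∃ t ∈ C, traceAd g t ≠ 0 := by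
    obtain ⟨x, hx⟩ := htr
    obtain ⟨a, ha, b, hb, rfl⟩ := hdec x
    rw [map_add, traceAd_eq_zero_of_isKilling s a ha, zero_add] at hx
    have hb' : b ∈ idealRestrict s n ⊔ C := by rw [hnC]; exact hb
    obtain ⟨c, hc, t, ht, rfl⟩ := (LieSubmodule.mem_sup _ _ b).mp hb'
    refine ⟨t, ht, ?_⟩
    have h0 : traceAd g c = 0 := hc.2
    rw [map_add, h0, zero_add] at hx
    exact hx
  have htr : t ∈ r := hCr htC
  have hns : n.toSubmodule ⊔ Submodule.span ℝ {t} = r.toSubmodule := by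
    refine le_antisymm (sup_le hnr ((Submodule.span_singleton_le_iff_mem _ _).mpr htr)) fun x hx => ?_
    refine Submodule.mem_sup.mpr ⟨x - (traceAd g x / traceAd g t) • t,
      ⟨r.sub_mem hx (r.smul_mem _ htr), ?_⟩, (traceAd g x / traceAd g t) • t,
      Submodule.smul_mem _ _ (Submodule.mem_span_singleton_self t), by abel⟩
    change traceAd g _ = 0
    rw [map_sub, map_smul, smul_eq_mul, div_mul_cancel₀ _ htt, sub_self]
  have hni : n.toSubmodule ⊓ Submodule.span ℝ {t} = ⊥ := by
    rw [Submodule.eq_bot_iff]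
    rintro x ⟨hx, hxt⟩
    obtain ⟨c, rfl⟩ := Submodule.mem_span_singleton.mp hxt
    have h1 : traceAd g (c • t) = 0 := hx.2
    rw [map_smul, smul_eq_mul, mul_eq_zero] at h1
    rw [h1.resolve_right htt, zero_smul]
  have ht0 : t ≠ 0 := fun h => htt (by rw [h, map_zero])
  refine ⟨s, n, t, hsK, hsn, LieAlgebra.le_solvable_ideal_solvable hnr inferInstance,
    fun x hx => hCs x hx t htC, htt, fun x hx => hx.2, fun x hx hxn => ?_, fun x => ?_, ?_⟩
  · exact (Submodule.disjoint_def.mp hcompl.disjoint) x hx (hnr hxn)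
  · obtain ⟨a, ha, b, hb, rfl⟩ := hdec x
    have hb' : b ∈ n.toSubmodule ⊔ Submodule.span ℝ {t} := by rw [hns]; exact hb
    obtain ⟨c, hc, d, hd, rfl⟩ := Submodule.mem_sup.mp hb'
    obtain ⟨e, rfl⟩ := Submodule.mem_span_singleton.mp hd
    exact ⟨a, ha, c, hc, e, by abel⟩
  · have h1 := Submodule.finrank_add_eq_of_isCompl hcompl
    have h2 := Submodule.finrank_sup_add_finrank_inf_eq n.toSubmodule (Submodule.span ℝ {t})
    rw [hns, hni, finrank_bot, finrank_span_singleton ht0] at h2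
    have h3 : finrank ℝ s.toSubmodule = finrank ℝ s := rfl
    have h4 : finrank ℝ n.toSubmodule = finrank ℝ n := rfl
    omega

variable {s : LieSubalgebra ℝ g} {n : LieIdeal ℝ g} {t : g}

theorem LeviData.lie_t_mem (_ : LeviData s n t) (x : g) (hx : x ∈ n) : ⁅t, x⁆ ∈ n :=
  lie_mem_right ℝ g n t x hx

/-- In an indecomposable Lie algebra the Levi factor acts non-trivially. -/
theorem LeviData.exists_lie_ne_zero [FiniteDimensional ℝ g] (h : LeviData s n t)
    (hg : IsIndecomposable g) : ∃ x ∈ s, ∃ y ∈ n, ⁅x, y⁆ ≠ 0 := by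
  by_contra! hcon
  have hsK := h.killing
  have hnt : ∀ x ∈ n.toSubmodule ⊔ Submodule.span ℝ {t}, ∃ b ∈ n, ∃ c : ℝ, x = b + c • t :=
    fun x hx => by
      obtain ⟨b, hb, c, hc, rfl⟩ := Submodule.mem_sup.mp hx
      obtain ⟨c, rfl⟩ := Submodule.mem_span_singleton.mp hc
      exact ⟨b, hb, c, rfl⟩
  have key := hg.eq_bot_or_eq_bot s.toSubmodule (n.toSubmodule ⊔ Submodule.span ℝ {t}) ?_
    (fun x hx y hy => s.lie_mem hx hy) ?_ ?_
  · rcases key with h1 | h1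
    · have := h.nontrivial
      obtain ⟨x, hx⟩ := exists_ne (0 : s)
      have : (x : g) ∈ s.toSubmodule := x.2
      rw [h1, Submodule.mem_bot] at this
      exact hx (Subtype.ext this)
    · have : t ∈ n.toSubmodule ⊔ Submodule.span ℝ {t} :=
        Submodule.mem_sup_right (Submodule.mem_span_singleton_self t)
      rw [h1, Submodule.mem_bot] at this
      exact h.trace_t (by rw [this, map_zero])
  · constructor
    · rw [Submodule.disjoint_def]
      intro x hx hx'
      obtain ⟨b, hb, c, rfl⟩ := hnt x hx'
      have h1 := traceAd_eq_zero_of_isKilling s _ hx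
      rw [map_add, h.trace_n b hb, zero_add, map_smul, smul_eq_mul, mul_eq_zero] at h1
      have hc := h1.resolve_right h.trace_t
      subst hc
      rw [zero_smul, add_zero] at hx ⊢
      exact h.disjoint b hx hb
    · rw [codisjoint_iff, eq_top_iff]
      intro x _
      obtain ⟨a, ha, b, hb, c, rfl⟩ := h.spans x
      rw [add_assoc]
      exact Submodule.add_mem_sup ha (Submodule.add_mem_sup hb
        (Submodule.smul_mem _ _ (Submodule.mem_span_singleton_self t)))
  · intro x hx y hy
    obtain ⟨b, hb, c, rfl⟩ := hnt x hx
    obtain ⟨b', hb', c', rfl⟩ := hnt y hy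
    refine Submodule.mem_sup_left ?_
    simp only [add_lie, lie_add, smul_lie, lie_smul, lie_self, smul_zero, add_zero]
    have h1 := lie_mem_right ℝ g n b b' hb'
    have h2 := lie_mem_right ℝ g n t b' hb'
    have h3 := lie_mem_left ℝ g n b t hb
    exact n.add_mem (n.add_mem h1 (n.smul_mem _ h2)) (n.smul_mem _ h3)
  · intro x hx y hy
    obtain ⟨b, hb, c, rfl⟩ := hnt y hy
    rw [lie_add, hcon x hx b hb, lie_smul, h.lie_t x hx, smul_zero, add_zero]

/-- The dimensions of a Levi factor and of the unimodular part of the radical of an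
eight-dimensional indecomposable Lie algebra. -/
theorem LeviData.finrank_eq_three [FiniteDimensional ℝ g] (h : LeviData s n t)
    (hg : IsIndecomposable g) (hdim : finrank ℝ g = 8) : finrank ℝ s = 3 ∧ finrank ℝ n = 4 := by
  have hsK := h.killing
  obtain ⟨x, hx, y, hy, hxy⟩ := h.exists_lie_ne_zero hg
  let N := idealRestrict s n
  have hNn : finrank ℝ N = finrank ℝ n := rfl
  have h0 : ∃ x : s, ∃ y : N, ⁅x, y⁆ ≠ 0 :=
    ⟨⟨x, hx⟩, ⟨y, hy⟩, fun h => hxy (congrArg Subtype.val h)⟩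
  have hn1 : ¬ finrank ℝ n ≤ 1 := fun hle => by
    obtain ⟨x, y, hxy⟩ := h0
    exact hxy (lie_eq_zero_of_finrank_le_one (K := ℝ) hle x y)
  have hs0 : 0 < finrank ℝ s := by
    have := h.nontrivial
    exact finrank_pos
  have hs1 := finrank_ne_one_of_isKilling (K := ℝ) (L := s)
  have hs2 := finrank_ne_two_of_isKilling (K := ℝ) (L := s)
  have hs4 := finrank_ne_four_of_isKilling (K := ℝ) (L := s)
  have hsum := h.finrank_eq
  -- With `dim s + dim n = 7` and `dim n ≥ 2`, the missing dimensions 1, 2 and 4 leave only 3 and 5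
  -- for `s`.
  suffices finrank ℝ s ≠ 5 by omega
  intro hs5
  have hn2 : finrank ℝ N = 2 := by rw [hNn]; omega
  -- If `dim n = 2`, the complement of the kernel `J` embeds into the trace-zero endomorphisms of a
  -- plane. It then has dimension exactly 3, and `J` would be semisimple of dimension 2.
  set J : LieIdeal ℝ s := LieModule.ker ℝ s N with hJ
  have hc := J.isCompl_killingCompl
  have hJK := isKilling_lieIdeal J
  have hJK' := isKilling_lieIdeal J.killingCompl
  have hJ1 := finrank_ne_one_of_isKilling (K := ℝ) (L := J.killingCompl)
  have hJ2 := finrank_ne_two_of_isKilling (K := ℝ) (L := J.killingCompl)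
  have hJ2' := finrank_ne_two_of_isKilling (K := ℝ) (L := J)
  have hsum : finrank ℝ J + finrank ℝ J.killingCompl = finrank ℝ s :=
    Submodule.finrank_add_eq_of_isCompl ((LieSubmodule.isCompl_toSubmodule).mpr hc)
  have hJ0 : finrank ℝ J.killingCompl ≠ 0 := fun h0' => by
    have h1 : J.killingCompl.toSubmodule = ⊥ := Submodule.finrank_eq_zero.mp h0'
    have h2 : J.killingCompl = ⊥ := (LieSubmodule.toSubmodule_eq_bot _).mp h1
    rw [h2] at hc
    obtain ⟨x, y, hxy⟩ := h0
    have hx : x ∈ J := eq_top_of_isCompl_bot hc ▸ LieSubmodule.mem_top x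
    exact hxy ((LieModule.mem_ker ℝ s N x).mp hx y)
  have hJ3 : finrank ℝ J.killingCompl ≤ 3 := by
    let f : J.killingCompl →ₗ[ℝ] LinearMap.ker (LinearMap.trace ℝ N) :=
      LinearMap.codRestrict _ ((toEnd ℝ s N : s →ₗ[ℝ] Module.End ℝ N) ∘ₗ
        J.killingCompl.toSubmodule.subtype) (fun x => trace_toEnd_eq_zero (x : s))
    have hf : Function.Injective f := by
      rw [injective_iff_map_eq_zero]
      rintro ⟨x, hx⟩ h
      have h1 : toEnd ℝ s N x = 0 := congrArg Subtype.val h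
      have h2 : x ∈ J ⊓ J.killingCompl := ⟨(LieModule.mem_ker ℝ s N x).mpr fun m =>
        LinearMap.congr_fun h1 m, hx⟩
      rw [hc.inf_eq_bot] at h2
      exact Subtype.ext (by simpa using h2)
    have h1 := LinearMap.finrank_le_finrank_of_injective hf
    have h2 := LinearMap.finrank_range_add_finrank_ker (LinearMap.trace ℝ N)
    have h3 : finrank ℝ (N →ₗ[ℝ] N) = 4 := by
      rw [Module.finrank_linearMap, hn2]
    have h4 : 0 < finrank ℝ (LinearMap.range (LinearMap.trace ℝ N)) := by
      rw [Module.finrank_pos_iff, Submodule.nontrivial_iff_ne_bot, Ne, LinearMap.range_eq_bot]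
      intro h5
      have h6 : LinearMap.trace ℝ N LinearMap.id = 0 := by rw [h5]; rfl
      rw [LinearMap.trace_id, hn2] at h6
      norm_num at h6
    rw [h3] at h2
    omega
  omega

end Structure

/-! ### Modules without invariant vectors. -/

section NoInvariants

variable {K L M : Type*} [Field K] [CharZero K] [LieRing L] [LieAlgebra K L]
  [FiniteDimensional K L] [LieAlgebra.IsKilling K L]
  [AddCommGroup M] [Module K M] [LieRingModule L M] [LieModule K L M] [FiniteDimensional K M]

theorem finrank_lieSubmodule_ne_one {W : LieSubmodule K L M}
    (hW : ∀ m ∈ W, (∀ x : L, ⁅x, m⁆ = 0) → m = 0) : finrank K W ≠ 1 := fun h => by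
  have hz := finrank_pos_iff_exists_ne_zero (R := K) (M := W) |>.mp (by omega)
  obtain ⟨m, hm⟩ := hz
  refine hm (Subtype.ext (hW m m.2 fun x => ?_))
  exact congrArg Subtype.val (lie_eq_zero_of_finrank_le_one (K := K) h.le x m)

theorem finrank_add_finrank_of_compl {A B C : LieSubmodule K L M} (h1 : A ⊔ C = B)
    (h2 : A ⊓ C = ⊥) : finrank K A + finrank K C = finrank K B := by
  have h := Submodule.finrank_sup_add_finrank_inf_eq A.toSubmodule C.toSubmodule
  rw [← LieSubmodule.sup_toSubmodule, ← LieSubmodule.inf_toSubmodule, h1, h2,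
    LieSubmodule.bot_toSubmodule, finrank_bot] at h
  exact h.symm

/-- A three-dimensional module without invariants is irreducible. -/
theorem eq_bot_or_eq_of_finrank_eq_three {W : LieSubmodule K L M} (h3 : finrank K W = 3)
    (hW : ∀ m ∈ W, (∀ x : L, ⁅x, m⁆ = 0) → m = 0) (P : LieSubmodule K L M) (hP : P ≤ W) :
    P = ⊥ ∨ P = W := by
  obtain ⟨Q, hQ, h1, h2⟩ := exists_relative_compl_lieSubmodule hP
  have hs := finrank_add_finrank_of_compl h1 h2
  have hP1 := finrank_lieSubmodule_ne_one (W := P) fun m hm => hW m (hP hm)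
  have hQ1 := finrank_lieSubmodule_ne_one (W := Q) fun m hm => hW m (hQ hm)
  have hPW : finrank K P ≤ finrank K W := Submodule.finrank_mono hP
  rcases Nat.eq_zero_or_pos (finrank K P) with h | h
  · left
    exact (LieSubmodule.toSubmodule_eq_bot P).mp (Submodule.finrank_eq_zero.mp h)
  · right
    have h4 : finrank K P = finrank K W := by omega
    exact LieSubmodule.toSubmodule_injective (Submodule.eq_of_le_of_finrank_eq hP h4)

/-- A submodule without invariants is generated by the elements `⁅x, m⁆`. -/
theorem le_span_lie {W : LieSubmodule K L M}
    (hW : ∀ m ∈ W, (∀ x : L, ⁅x, m⁆ = 0) → m = 0) (p : Submodule K M)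
    (hp : ∀ x : L, ∀ m ∈ W, ⁅x, m⁆ ∈ p) : W.toSubmodule ≤ p := by
  have hle : ⁅(⊤ : LieIdeal K L), W⁆ ≤ W := LieSubmodule.lie_le_right _ _
  obtain ⟨Q, hQ, h1, h2⟩ := exists_relative_compl_lieSubmodule hle
  have hQ0 : Q = ⊥ := by
    rw [LieSubmodule.eq_bot_iff]
    intro m hm
    refine hW m (hQ hm) fun x => ?_
    have : ⁅x, m⁆ ∈ ⁅(⊤ : LieIdeal K L), W⁆ ⊓ Q :=
      ⟨LieSubmodule.lie_mem_lie (LieSubmodule.mem_top x) (hQ hm), Q.lie_mem hm⟩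
    rw [h2] at this
    simpa using this
  rw [hQ0, sup_bot_eq] at h1
  rw [← h1, LieSubmodule.lieIdeal_oper_eq_linear_span', Submodule.span_le]
  rintro _ ⟨x, -, m, hm, rfl⟩
  exact hp x m hm

end NoInvariants

/-! ### Real eigenvalues in odd dimension. -/

section Real

/-- A monic real cubic takes both signs. This replaces Schur's lemma over the complex numbers for
three-dimensional irreducible modules. -/
theorem exists_eigenvector_of_finrank_eq_three {V : Type*} [AddCommGroup V] [Module ℝ V]
    [FiniteDimensional ℝ V] (h3 : finrank ℝ V = 3) (D : Module.End ℝ V) :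
    ∃ (a : ℝ) (v : V), v ≠ 0 ∧ D v = a • v := by
  set p := D.charpoly with hp
  have hm : p.Monic := LinearMap.charpoly_monic D
  have hd : p.natDegree = 3 := by rw [hp, LinearMap.charpoly_natDegree, h3]
  have hpos : (0 : WithBot ℕ) < p.degree := by
    rw [Polynomial.degree_eq_natDegree hm.ne_zero, hd]; norm_num
  have h1 := p.tendsto_atTop_of_leadingCoeff_nonneg hpos (by rw [hm.leadingCoeff]; norm_num)
  have h2 : Filter.Tendsto (fun x => Polynomial.eval x (p.comp (-Polynomial.X))) Filter.atTop
      Filter.atBot := by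
    have hl : (p.comp (-Polynomial.X)).leadingCoeff = -1 := by
      rw [Polynomial.leadingCoeff_comp (by simp), hm.leadingCoeff, hd]
      simp
      norm_num
    have hn : (p.comp (-Polynomial.X)).natDegree = 3 := by
      rw [Polynomial.natDegree_comp, hd]; simp
    refine Polynomial.tendsto_atBot_of_leadingCoeff_nonpos _ ?_ (by rw [hl]; norm_num)
    have : p.comp (-Polynomial.X) ≠ 0 := fun h => by rw [h] at hn; simp at hn
    rw [Polynomial.degree_eq_natDegree this, hn]; norm_num
  obtain ⟨x, hx⟩ := (h1.eventually (Filter.eventually_gt_atTop 0)).exists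
  obtain ⟨y, hy⟩ := (h2.eventually (Filter.eventually_lt_atBot 0)).exists
  simp only [Polynomial.eval_comp, Polynomial.eval_neg, Polynomial.eval_X] at hy
  obtain ⟨a, ha⟩ := mem_range_of_exists_le_of_exists_ge (p.continuous) ⟨-y, hy.le⟩ ⟨x, hx.le⟩
  have hev : D.HasEigenvalue a := by
    rw [Module.End.hasEigenvalue_iff_isRoot_charpoly]
    exact ha
  obtain ⟨v, hv⟩ := hev.exists_hasEigenvector
  exact ⟨a, v, hv.2, hv.apply_eq_smul⟩

end Real

/-! ### The non-trivial part of the radical does not have dimension three. -/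

section Structure

variable {g : Type*} [LieRing g] [LieAlgebra ℝ g] [FiniteDimensional ℝ g]

/-- Restricted to the centraliser of `y`, the form `ω(y, ·)` vanishes on brackets. Repeatedly used
to show that invariant vectors are orthogonal to perfect pieces. -/
theorem IsSymplectic.apply_lie_eq_zero {ω : LinearMap.BilinForm ℝ g} (hω : IsSymplectic ω)
    {y a b : g} (ha : ⁅y, a⁆ = 0) (hb : ⁅y, b⁆ = 0) : ω y ⁅a, b⁆ = 0 := by
  rw [hω.apply_lie, ha, hb, map_zero, LinearMap.zero_apply, map_zero, add_zero]

theorem IsSymplectic.eq_zero_of_forall {ω : LinearMap.BilinForm ℝ g} (hω : IsSymplectic ω)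
    {y : g} (h : ∀ x, ω y x = 0) : y = 0 := hω.nondegenerate.1 y h

variable {s : LieSubalgebra ℝ g} {n : LieIdeal ℝ g} {t : g}

theorem IsSymplectic.apply_eq_zero_of_commute {ω : LinearMap.BilinForm ℝ g} (hω : IsSymplectic ω)
    [LieAlgebra.IsKilling ℝ s] {y : g} (hy : ∀ x ∈ s, ⁅x, y⁆ = 0) (x : g) (hx : x ∈ s) :
    ω y x = 0 := by
  have hy' (x : g) (hx : x ∈ s) : ⁅y, x⁆ = 0 := by rw [← lie_skew, hy x hx, neg_zero]
  exact eq_zero_of_forall_lie (K := ℝ) (L := s) (ω y ∘ₗ s.toSubmodule.subtype)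
    (fun a b => hω.apply_lie_eq_zero (hy' a a.2) (hy' b b.2)) ⟨x, hx⟩

theorem IsSymplectic.apply_eq_zero_of_commute' {ω : LinearMap.BilinForm ℝ g}
    (hω : IsSymplectic ω) [LieAlgebra.IsKilling ℝ s] {W : LieSubmodule ℝ s g}
    (hW : ∀ m ∈ W, (∀ x : s, ⁅x, m⁆ = 0) → m = 0) {y : g} (hy : ∀ x ∈ s, ⁅x, y⁆ = 0)
    (hyW : ∀ w ∈ W, ⁅y, w⁆ = 0) (w : g) (hw : w ∈ W) : ω y w = 0 := by
  have hy' (x : g) (hx : x ∈ s) : ⁅y, x⁆ = 0 := by rw [← lie_skew, hy x hx, neg_zero]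
  exact le_span_lie hW (LinearMap.ker (ω y))
    (fun x m hm => hω.apply_lie_eq_zero (hy' x x.2) (hyW m hm)) hw

/-- The Levi factor, a three-dimensional abelian module without invariants and a commuting vector
cannot make up a symplectic Lie algebra. -/
theorem LeviData.false_of_commute (h : LeviData s n t) {ω : LinearMap.BilinForm ℝ g}
    (hω : IsSymplectic ω) {W : LieSubmodule ℝ s g} (hWn : W ≤ idealRestrict s n)
    (hW : ∀ m ∈ W, (∀ x : s, ⁅x, m⁆ = 0) → m = 0) (hWW : ∀ w ∈ W, ∀ w' ∈ W, ⁅w, w'⁆ = 0)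
    {b : g} (hbs : ∀ x ∈ s, ⁅x, b⁆ = 0) (hb0 : b ≠ 0) (hbW : ∀ w ∈ W, ⁅b, w⁆ = 0)
    (hspan : ∀ x ∈ n, ∃ w ∈ W, ∃ c : ℝ, x = w + c • b) : False := by
  have hsK := h.killing
  have hωs := hω.apply_eq_zero_of_commute hbs
  have hωW := hω.apply_eq_zero_of_commute' hW hbs hbW
  -- Since `b` is orthogonal to `s`, to `W` and to itself, only `t` can pair with it. So `b^⊥ = s ⊕
  -- W ⊕ ℝ b`, and `s ⊕ W` is a model of the symplectic reduction `b^⊥ / b`.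
  have hbt : ω b t ≠ 0 := fun h0 => by
    refine hb0 (hω.eq_zero_of_forall fun x => ?_)
    obtain ⟨a, ha, y, hy, c, rfl⟩ := h.spans x
    obtain ⟨w, hw, d, rfl⟩ := hspan y hy
    simp only [map_add, map_smul, h0, hωs a ha, hωW w hw, hω.alt, smul_zero, add_zero]
  have hws (x : g) (hx : x ∈ s) (w : g) (hw : w ∈ W) : ⁅x, w⁆ ∈ W := W.lie_mem (x := (⟨x, hx⟩ : s)) hw
  let A : LieSubalgebra ℝ g :=
    { s.toSubmodule ⊔ W.toSubmodule with
      lie_mem' := fun {x y} hx hy => by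
        obtain ⟨a, ha, w, hw, rfl⟩ := Submodule.mem_sup.mp hx
        obtain ⟨a', ha', w', hw', rfl⟩ := Submodule.mem_sup.mp hy
        rw [add_lie, lie_add, lie_add, hWW w hw w' hw', add_zero, add_assoc, ← lie_skew w a']
        exact Submodule.add_mem_sup (s.lie_mem ha ha')
          (W.add_mem (hws a ha w' hw') (W.neg_mem (hws a' ha' w hw))) }
  have hAm (x : g) : x ∈ A ↔ ∃ a ∈ s, ∃ w ∈ W, a + w = x := Submodule.mem_sup
  have hsA : s ≤ A := fun x hx => (hAm x).mpr ⟨x, hx, 0, W.zero_mem, add_zero x⟩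
  have hWA (x : g) (hx : x ∈ W) : x ∈ A := (hAm x).mpr ⟨0, s.zero_mem, x, hx, zero_add x⟩
  let ωA : LinearMap.BilinForm ℝ A := ω.restrict A.toSubmodule
  have hωA (x y : A) : ωA x y = ω x y := rfl
  have hbA : b ∉ A := fun hb => by
    have hbn : b ∈ W → b = 0 := fun hb => hW b hb fun x => hbs x x.2
    obtain ⟨a, ha, w, hw, hab⟩ := (hAm b).mp hb
    have h1 : ∀ x ∈ s, ⁅x, a⁆ = 0 := fun x hx => by
      have h2 := hbs x hx
      rw [← hab, lie_add] at h2
      refine h.disjoint _ (s.lie_mem hx ha) ?_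
      rw [add_eq_zero_iff_eq_neg.mp h2]
      exact n.neg_mem (hWn (hws x hx w hw))
    have h3 : (⟨a, ha⟩ : s) ∈ LieAlgebra.center ℝ s :=
      (LieModule.mem_maxTrivSubmodule ℝ s s _).mpr fun x => Subtype.ext (h1 x x.2)
    rw [LieAlgebra.center_eq_bot, LieSubmodule.mem_bot] at h3
    have h4 : a = 0 := congrArg Subtype.val h3
    rw [h4, zero_add] at hab
    exact hb0 (hbn (hab ▸ hw))
  have hsymp : IsSymplectic ωA :=
    { alt := fun x => hω.alt x
      closed := fun x y z => hω.closed x y z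
      nondegenerate := by
        have hrefl : ωA.IsRefl := LinearMap.IsAlt.isRefl (fun x => hω.alt x)
        refine (LinearMap.IsRefl.nondegenerate_iff_separatingLeft hrefl).mpr ?_
        rintro ⟨x, hx⟩ hxA
        have hxA' : ∀ y ∈ A, ω x y = 0 := fun y hy => hxA ⟨y, hy⟩
        -- Subtracting this multiple of `b` cancels the pairing of `x` with `t` and leaves the other
        -- pairings at zero.
        have h1 : x - (ω x t / ω b t) • b = 0 := by
          have hbx : ω x b = 0 := by
            obtain ⟨a, ha, w, hw, rfl⟩ := (hAm x).mp hx
            rw [← hω.neg_apply, map_add, hωs a ha, hωW w hw, add_zero, neg_zero]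
          refine hω.eq_zero_of_forall fun y => ?_
          obtain ⟨a, ha, y, hy, c, rfl⟩ := h.spans y
          obtain ⟨w, hw, d, rfl⟩ := hspan y hy
          simp only [map_add, map_smul, map_sub, LinearMap.sub_apply, LinearMap.smul_apply,
            hωs a ha, hωW w hw, hω.alt, hxA' a (hsA ha), hxA' w (hWA w hw), hbx, smul_eq_mul,
            mul_zero, add_zero, div_mul_cancel₀ _ hbt, sub_self]
        by_cases hc : ω x t / ω b t = 0
        · rw [hc, zero_smul, sub_zero] at h1
          exact Subtype.ext h1
        · refine absurd ?_ hbA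
          have h2 := sub_eq_zero.mp h1
          generalize ω x t / ω b t = d at hc h2
          have : b = d⁻¹ • x := by
            rw [h2, smul_smul, inv_mul_cancel₀ hc, one_smul]
          rw [this]
          exact A.smul_mem _ hx }
  -- `A` is unimodular because `s` is perfect and `W` is spanned by brackets with `s`. This
  -- contradicts the rigidity fact.
  have htr : ∀ x : A, traceAd A x = 0 := by
    rintro ⟨x, hx⟩
    obtain ⟨a, ha, w, hw, rfl⟩ := (hAm x).mp hx
    have e : (⟨a + w, hx⟩ : A) = ⟨a, hsA ha⟩ + ⟨w, hWA w hw⟩ := rfl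
    have e1 : traceAd A ⟨a, hsA ha⟩ = 0 :=
      eq_zero_of_forall_lie (K := ℝ) (L := s)
        (traceAd A ∘ₗ (LieSubalgebra.inclusion hsA : s →ₗ[ℝ] A))
        (fun x y => by
          rw [LinearMap.comp_apply, LieHom.coe_toLinearMap, LieHom.map_lie]
          exact traceAd_lie _ _) ⟨a, ha⟩
    have e2 : w ∈ (LinearMap.ker (traceAd A)).map A.toSubmodule.subtype :=
      le_span_lie hW ((LinearMap.ker (traceAd A)).map A.toSubmodule.subtype)
      (fun x m hm => Submodule.mem_map.mpr ⟨⁅(⟨x, hsA x.2⟩ : A), (⟨m, hWA m hm⟩ : A)⁆,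
        traceAd_lie _ _, rfl⟩) hw
    obtain ⟨w', hw', hww⟩ := e2
    have e3 : w' = ⟨w, hWA w hw⟩ := Subtype.ext hww
    rw [e, map_add, e1, zero_add, ← e3]
    exact hw'
  have hinj : Function.Injective (LieSubalgebra.inclusion hsA) := fun x y hxy =>
    Subtype.ext (congrArg (fun z : A => (z : g)) hxy)
  have hK : LieAlgebra.IsKilling ℝ (LieSubalgebra.inclusion hsA).range :=
    (LieEquiv.ofInjective _ hinj).isKilling
  have hsub := hsymp.subsingleton_of_isKilling htr (LieSubalgebra.inclusion hsA).range
  have hsn := h.nontrivial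
  have := (LieEquiv.ofInjective _ hinj).injective.subsingleton
  exact not_subsingleton s this

/-- The Levi factor of a symplectic Lie algebra cannot act on the unimodular part of the radical
with a three-dimensional non-trivial part. -/
theorem LeviData.finrank_ne_three (h : LeviData s n t) {ω : LinearMap.BilinForm ℝ g}
    (hω : IsSymplectic ω) (hn : finrank ℝ n = 4) {W : LieSubmodule ℝ s g}
    (hWn : W ≤ idealRestrict s n) (hW : ∀ m ∈ W, (∀ x : s, ⁅x, m⁆ = 0) → m = 0)
    {V : LieSubmodule ℝ s g} (hV : ∀ m, m ∈ V ↔ m ∈ n ∧ ∀ x ∈ s, ⁅x, m⁆ = 0)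
    (hVW : V ⊔ W = idealRestrict s n) (hVW' : V ⊓ W = ⊥) : finrank ℝ W ≠ 3 := fun h3 => by
  have hsK := h.killing
  have hVr : finrank ℝ V = 1 := by
    have := finrank_add_finrank_of_compl hVW hVW'
    have e : finrank ℝ (idealRestrict s n) = finrank ℝ n := rfl
    omega
  obtain ⟨⟨b, hbV⟩, hb0, hbspan⟩ := finrank_eq_one_iff'.mp hVr
  have hb0 : b ≠ 0 := fun hb => hb0 (Subtype.ext hb)
  have hVb (x : g) (hx : x ∈ V) : ∃ c : ℝ, c • b = x := by
    obtain ⟨c, hc⟩ := hbspan ⟨x, hx⟩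
    exact ⟨c, congrArg Subtype.val hc⟩
  obtain ⟨hbn, hbs⟩ := (hV b).mp hbV
  have hspan (x : g) (hx : x ∈ n) : ∃ w ∈ W, ∃ c : ℝ, x = w + c • b := by
    have hx' : x ∈ V ⊔ W := by rw [hVW]; exact hx
    obtain ⟨v, hv, w, hw, rfl⟩ := (LieSubmodule.mem_sup _ _ x).mp hx'
    obtain ⟨c, rfl⟩ := hVb v hv
    exact ⟨w, hw, c, add_comm _ _⟩
  have hws (x : g) (hx : x ∈ s) (w : g) (hw : w ∈ W) : ⁅x, w⁆ ∈ W := W.lie_mem (x := (⟨x, hx⟩ : s)) hw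
  have hirr := eq_bot_or_eq_of_finrank_eq_three h3 hW
  have hW0 : ∃ w ∈ W, w ≠ 0 := by
    have : 0 < finrank ℝ W := by omega
    obtain ⟨w, hw⟩ := finrank_pos_iff_exists_ne_zero.mp this
    exact ⟨w, w.2, fun h => hw (Subtype.ext h)⟩
  have hcomm (x : g) (hx : x ∈ s) (y : g) : ⁅x, ⁅b, y⁆⁆ = ⁅b, ⁅x, y⁆⁆ := by
    rw [leibniz_lie, hbs x hx, zero_lie, zero_add]
  set n' : LieIdeal ℝ g := ⁅n, n⁆ with hn'
  have hn'n : n' ≤ n := LieSubmodule.lie_le_left _ _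
  have hnsol := h.solvable
  have hn'ne : n' ≠ n := fun he => by
    have := eq_bot_of_lie_self_eq_self n he
    obtain ⟨w, hw, hw0⟩ := hW0
    have hw' : w ∈ n := hWn hw
    rw [this] at hw'
    exact hw0 (by simpa using hw')
  -- By irreducibility `⁅n, n⁆` either meets `W` trivially or contains it.
  rcases hirr (W ⊓ idealRestrict s n') inf_le_left with hP | hP
  · -- `⁅n, n⁆` consists of invariants
    have hn'V : ∀ y ∈ n', y ∈ V := by
      have hle : finrank ℝ (idealRestrict s n') ≤ 1 := by
        have h1 := Submodule.finrank_sup_add_finrank_inf_eq W.toSubmodule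
          (idealRestrict s n').toSubmodule
        rw [← LieSubmodule.inf_toSubmodule, hP, LieSubmodule.bot_toSubmodule, finrank_bot] at h1
        have h2 : finrank ℝ ↥(W.toSubmodule ⊔ (idealRestrict s n').toSubmodule) ≤
          finrank ℝ n.toSubmodule := Submodule.finrank_mono (sup_le hWn hn'n)
        have h3' : finrank ℝ n.toSubmodule = finrank ℝ n := rfl
        have h4 : finrank ℝ W.toSubmodule = finrank ℝ W := rfl
        have h5 : finrank ℝ (idealRestrict s n').toSubmodule = finrank ℝ (idealRestrict s n') := rfl
        omega
      intro y hy
      refine (hV y).mpr ⟨hn'n hy, fun x hx => ?_⟩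
      exact congrArg Subtype.val (lie_eq_zero_of_finrank_le_one (K := ℝ) hle (⟨x, hx⟩ : s)
        (⟨y, hy⟩ : idealRestrict s n'))
    have hbr (x y : g) (hx : x ∈ n) (hy : y ∈ n) (z : g) (hz : z ∈ s) : ⁅z, ⁅x, y⁆⁆ = 0 :=
      ((hV _).mp (hn'V _ (LieSubmodule.lie_mem_lie hx hy))).2 z hz
    have hbW : ∀ w ∈ W, ⁅b, w⁆ = 0 := fun w hw =>
      le_span_lie hW (LinearMap.ker (LieAlgebra.ad ℝ g b)) (fun x m hm => by
        change ⁅b, ⁅(x : g), m⁆⁆ = 0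
        rw [← hcomm x x.2, hbr b m hbn (hWn hm) x x.2]) hw
    refine h.false_of_commute hω hWn hW ?_ hbs hb0 hbW hspan
    -- The radical of the `s`-invariant alternating form `W × W → ℝ b` given by the bracket. It is 0
    -- or `W`, and it cannot be 0 in odd dimension.
    let R : LieSubmodule ℝ s g :=
      { carrier := {w | w ∈ W ∧ ∀ w' ∈ W, ⁅w, w'⁆ = 0}
        add_mem' := fun {x y} hx hy => ⟨W.add_mem hx.1 hy.1, fun w' hw' => by
          rw [add_lie, hx.2 w' hw', hy.2 w' hw', add_zero]⟩
        zero_mem' := ⟨W.zero_mem, fun w' _ => zero_lie w'⟩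
        smul_mem' := fun c x hx => ⟨W.smul_mem c hx.1, fun w' hw' => by
          rw [smul_lie, hx.2 w' hw', smul_zero]⟩
        lie_mem := fun {x w} hw => ⟨W.lie_mem hw.1, fun w' hw' => by
          change ⁅⁅(x : g), w⁆, w'⁆ = 0
          rw [lie_lie, hbr w w' (hWn hw.1) (hWn hw') x x.2, hw.2 _ (hws x x.2 w' hw'), sub_zero]⟩ }
    rcases hirr R (fun x hx => hx.1) with hR | hR
    swap
    · intro w hw w' hw'
      rw [← hR] at hw
      exact hw.2 w' hw'
    exfalso
    let e := finBasisOfFinrankEq ℝ W h3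
    have hβ (i j : Fin 3) : ∃ c : ℝ, c • b = ⁅(e i : g), (e j : g)⁆ :=
      hVb _ (hn'V _ (LieSubmodule.lie_mem_lie (hWn (e i).2) (hWn (e j).2)))
    obtain ⟨p, hp⟩ := hβ 0 1
    obtain ⟨q, hq⟩ := hβ 0 2
    obtain ⟨r, hr⟩ := hβ 1 2
    have hp' : ⁅(e 1 : g), (e 0 : g)⁆ = -(p • b) := by rw [hp, lie_skew]
    have hq' : ⁅(e 2 : g), (e 0 : g)⁆ = -(q • b) := by rw [hq, lie_skew]
    have hr' : ⁅(e 2 : g), (e 1 : g)⁆ = -(r • b) := by rw [hr, lie_skew]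
    have hmemR (v : W) (h0 : ⁅(v : g), (e 0 : g)⁆ = 0) (h1 : ⁅(v : g), (e 1 : g)⁆ = 0)
        (h2 : ⁅(v : g), (e 2 : g)⁆ = 0) : v = 0 := by
      have : (v : g) ∈ R := ⟨v.2, fun w' hw' => by
        have hs := e.sum_repr ⟨w', hw'⟩
        have hs' := congrArg (fun z : W => (z : g)) hs
        simp only [Fin.sum_univ_three] at hs'
        change _ = w' at hs'
        rw [← hs']
        change ⁅(v : g), _ • (e 0 : g) + _ • (e 1 : g) + _ • (e 2 : g)⁆ = 0
        rw [lie_add, lie_add, lie_smul, lie_smul, lie_smul, h0, h1, h2]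
        simp⟩
      rw [hR] at this
      exact Subtype.ext (by simpa using this)
    -- The kernel vector of an alternating form on a three-dimensional space with values `p`, `q`,
    -- `r`. If it vanishes, then `q = r = 0` and `e 2` is in the kernel.
    have hv0 := hmemR (r • e 0 - q • e 1 + p • e 2)
      (by
        change ⁅r • (e 0 : g) - q • (e 1 : g) + p • (e 2 : g), (e 0 : g)⁆ = 0
        rw [add_lie, sub_lie, smul_lie, smul_lie, smul_lie, lie_self, hp', hq']; module)
      (by
        change ⁅r • (e 0 : g) - q • (e 1 : g) + p • (e 2 : g), (e 1 : g)⁆ = 0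
        rw [add_lie, sub_lie, smul_lie, smul_lie, smul_lie, lie_self, ← hp, hr']; module)
      (by
        change ⁅r • (e 0 : g) - q • (e 1 : g) + p • (e 2 : g), (e 2 : g)⁆ = 0
        rw [add_lie, sub_lie, smul_lie, smul_lie, smul_lie, lie_self, ← hq, ← hr]; module)
    have hr0 : r = 0 := by
      have := congrArg (fun z => e.repr z 0) hv0
      simpa using this
    have hq0 : q = 0 := by
      have := congrArg (fun z => e.repr z 1) hv0
      simpa using this
    rw [hq0, zero_smul] at hq'
    rw [hr0, zero_smul] at hr'
    have := hmemR (e 2) (by rw [hq', neg_zero]) (by rw [hr', neg_zero]) (lie_self _)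
    exact e.ne_zero 2 this
  · -- `⁅n, n⁆ = W`
    have hWn' : W ≤ idealRestrict s n' := by rw [← hP]; exact inf_le_right
    have hn'W : ∀ x, x ∈ n' ↔ x ∈ W := by
      have h1 : finrank ℝ n'.toSubmodule < finrank ℝ n.toSubmodule :=
        Submodule.finrank_lt_finrank_of_lt (lt_of_le_of_ne hn'n fun he =>
          hn'ne (LieSubmodule.toSubmodule_injective he))
      have h2 : W.toSubmodule = n'.toSubmodule := by
        refine Submodule.eq_of_le_of_finrank_le hWn' ?_
        have h3' : finrank ℝ n.toSubmodule = finrank ℝ n := rfl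
        have h4 : finrank ℝ W.toSubmodule = finrank ℝ W := rfl
        omega
      intro x
      change x ∈ n'.toSubmodule ↔ x ∈ W.toSubmodule
      rw [h2]
    have hWW : ∀ w ∈ W, ∀ w' ∈ W, ⁅w, w'⁆ = 0 := by
      set n'' : LieIdeal ℝ g := ⁅n', n'⁆ with hn''
      have hn''n : n'' ≤ n' := LieSubmodule.lie_le_left _ _
      have hsol' : LieAlgebra.IsSolvable n' := LieAlgebra.le_solvable_ideal_solvable hn'n hnsol
      have hb : n'' = ⊥ := by
        rcases hirr (idealRestrict s n'') (fun x hx => (hn'W x).mp (hn''n hx)) with h1 | h1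
        · rw [LieSubmodule.eq_bot_iff]
          intro x hx
          have : x ∈ idealRestrict s n'' := hx
          rw [h1] at this
          simpa using this
        · exfalso
          have h2 : n'' = n' := by
            ext x
            rw [hn'W, ← h1]
            rfl
          have := eq_bot_of_lie_self_eq_self n' h2
          obtain ⟨w, hw, hw0⟩ := hW0
          have hw' := (hn'W w).mpr hw
          rw [this] at hw'
          exact hw0 (by simpa using hw')
      intro w hw w' hw'
      rw [hn'', LieSubmodule.lie_eq_bot_iff] at hb
      exact hb w ((hn'W w).mpr hw) w' ((hn'W w').mpr hw')
    have hbmem (w : g) (hw : w ∈ W) : ⁅b, w⁆ ∈ W :=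
      (hn'W _).mp (lie_mem_right ℝ g n' b w ((hn'W w).mpr hw))
    -- `ad b` commutes with `s` and has a real eigenvalue on `W`; the eigenspace is a submodule, so
    -- `b` acts on `W` by a scalar `a`.
    let D : Module.End ℝ W :=
      (LieAlgebra.ad ℝ g b : g →ₗ[ℝ] g).restrict (p := W.toSubmodule) (q := W.toSubmodule) hbmem
    obtain ⟨a, v, hv0, hv⟩ := exists_eigenvector_of_finrank_eq_three h3 D
    let R : LieSubmodule ℝ s g :=
      { carrier := {w | w ∈ W ∧ ⁅b, w⁆ = a • w}
        add_mem' := fun {x y} hx hy => ⟨W.add_mem hx.1 hy.1, by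
          rw [lie_add, hx.2, hy.2, smul_add]⟩
        zero_mem' := ⟨W.zero_mem, by rw [lie_zero, smul_zero]⟩
        smul_mem' := fun c x hx => ⟨W.smul_mem c hx.1, by
          rw [lie_smul, hx.2, smul_comm]⟩
        lie_mem := fun {x w} hw => ⟨W.lie_mem hw.1, by
          change ⁅b, ⁅(x : g), w⁆⁆ = a • ⁅(x : g), w⁆
          rw [← hcomm x x.2, hw.2, lie_smul]⟩ }
    have hRW : R = W := by
      refine (hirr R (fun x hx => hx.1)).resolve_left fun hR => hv0 ?_
      have : (v : g) ∈ R := ⟨v.2, congrArg Subtype.val hv⟩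
      rw [hR] at this
      exact Subtype.ext (by simpa using this)
    have hbw (w : g) (hw : w ∈ W) : ⁅b, w⁆ = a • w := by
      rw [← hRW] at hw
      exact hw.2
    suffices ha : a = 0 from
      h.false_of_commute hω hWn hW hWW hbs hb0 (fun w hw => by rw [hbw w hw, ha, zero_smul]) hspan
    obtain ⟨c, hc⟩ : ∃ c : ℝ, c • b = ⁅t, b⁆ := by
      refine hVb _ ((hV _).mpr ⟨h.lie_t_mem b hbn, fun x hx => ?_⟩)
      rw [leibniz_lie, h.lie_t x hx, zero_lie, hbs x hx, lie_zero, add_zero]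
    -- If `b` commutes with `t`, the trace of `ad b` is `3 a`, and it is zero because `b ∈ n`. If
    -- not, `b` is a multiple of `⁅t, b⁆`, which acts on `W` as the commutator of `ad t` with a
    -- scalar.
    by_cases hc0 : c = 0
    · have hbt : ⁅b, t⁆ = 0 := by rw [← lie_skew, ← hc, hc0, zero_smul, neg_zero]
      have hmem : ∀ x, (LieAlgebra.ad ℝ g b) x ∈ W.toSubmodule := fun x => by
        obtain ⟨y, hy, z, hz, d, rfl⟩ := h.spans x
        obtain ⟨w, hw, d', rfl⟩ := hspan z hz
        have : ⁅b, y⁆ = 0 := by rw [← lie_skew, hbs y hy, neg_zero]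
        change ⁅b, y + (w + d' • b) + d • t⁆ ∈ W
        rw [lie_add, lie_add, lie_add, lie_smul, lie_smul, lie_self, hbt, this, hbw w hw]
        simpa using W.smul_mem a hw
      have h1 := LinearMap.trace_restrict_eq_of_forall_mem W.toSubmodule (LieAlgebra.ad ℝ g b) hmem
      have h2 : (LieAlgebra.ad ℝ g b).restrict (fun x _ => hmem x) =
          a • (LinearMap.id : W.toSubmodule →ₗ[ℝ] W.toSubmodule) :=
        LinearMap.ext fun w => Subtype.ext (hbw w w.2)
      rw [h2, map_smul, LinearMap.trace_id] at h1
      have h3' := h.trace_n b hbn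
      rw [traceAd_apply, ← h1] at h3'
      have h4 : finrank ℝ W.toSubmodule = 3 := h3
      rw [h4] at h3'
      simpa using h3'
    · obtain ⟨w, hw, hw0⟩ := hW0
      have htw : ⁅t, w⁆ ∈ W := (hn'W _).mp (lie_mem_right ℝ g n' t w ((hn'W w).mpr hw))
      have h1 : ⁅⁅t, b⁆, w⁆ = 0 := by
        rw [lie_lie, hbw w hw, hbw _ htw, lie_smul, sub_self]
      rw [← hc, smul_lie, hbw w hw, smul_smul, smul_eq_zero, mul_eq_zero] at h1
      exact (h1.resolve_right hw0).resolve_left hc0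

end Structure

/-! ### Three-dimensional real simple Lie algebras. -/

section RealSimple

variable {L : Type*} [LieRing L] [LieAlgebra ℝ L]

/-- The relations of the standard basis of `sl(2, ℝ)`. -/
structure IsSl2Basis (h e f : L) : Prop where
  lie_h_e : ⁅h, e⁆ = (2 : ℝ) • e
  lie_h_f : ⁅h, f⁆ = -(2 : ℝ) • f
  lie_e_f : ⁅e, f⁆ = h
  spans : ∀ x : L, ∃ a b c : ℝ, x = a • h + b • e + c • f

/-- The relations of the standard basis of `so(3)`. -/
structure IsSo3Basis (x₁ x₂ x₃ : L) : Prop where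
  lie_1_2 : ⁅x₁, x₂⁆ = x₃
  lie_1_3 : ⁅x₁, x₃⁆ = -x₂
  lie_2_3 : ⁅x₂, x₃⁆ = x₁
  spans : ∀ x : L, ∃ a b c : ℝ, x = a • x₁ + b • x₂ + c • x₃

/-- The square of `ad x` on `⟨y, z⟩` is the positive scalar `m² = -A C`, so `ad x` has the
eigenvectors `y ∓ (m / C) z` with eigenvalues `±m`. Rescale `x` to make these ±2, and one
eigenvector to normalise their bracket. -/
theorem exists_isSl2Basis_of_mul_neg {x y z : L} {A B C : ℝ} (hxy : ⁅x, y⁆ = A • z)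
    (hyz : ⁅y, z⁆ = B • x) (hzx : ⁅z, x⁆ = C • y) (hB : B ≠ 0) (hAC : A * C < 0)
    (hs : ∀ w : L, ∃ a b c : ℝ, w = a • x + b • y + c • z) : ∃ h e f : L, IsSl2Basis h e f := by
  obtain ⟨m, hm, hmm⟩ : ∃ m : ℝ, 0 < m ∧ m * m = -(A * C) :=
    ⟨√(-(A * C)), Real.sqrt_pos.mpr (by linarith), Real.mul_self_sqrt (by linarith)⟩
  have hA : A ≠ 0 := fun h => by simp [h] at hAC
  have hC : C ≠ 0 := fun h => by simp [h] at hAC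
  have hm0 := hm.ne'
  have hxz : ⁅x, z⁆ = (-C) • y := by rw [← lie_skew, hzx, neg_smul]
  have hzy : ⁅z, y⁆ = (-B) • x := by rw [← lie_skew, hyz, neg_smul]
  have hA' : A = -(m * m) / C := by rw [hmm]; field_simp
  refine ⟨(2 / m) • x, y + (-m / C) • z, (-1 / (2 * (-m / C) * B * (m / 2))) • (y - (-m / C) • z),
    ?_, ?_, ?_, fun w => ?_⟩
  · simp only [smul_lie, lie_add, lie_smul, hxy, hxz, hA']
    match_scalars <;> field_simp
  · simp only [smul_lie, lie_sub, lie_smul, hxy, hxz, hA']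
    match_scalars <;> field_simp
  · simp only [lie_smul, lie_sub, add_lie, smul_lie, lie_self, hyz, hzy]
    match_scalars
    field_simp
    ring
  · obtain ⟨a, b, c, rfl⟩ := hs w
    refine ⟨a * m / 2, (b - c * (C / m)) / 2,
      (b + c * (C / m)) / 2 * (-(2 * (-m / C) * B * (m / 2))), ?_⟩
    match_scalars <;> field_simp <;> ring

/-- All three constants have the same sign, so real rescalings bring them to 1. -/
theorem exists_isSo3Basis_of_mul_pos {x y z : L} {A B C : ℝ} (hxy : ⁅x, y⁆ = A • z)
    (hyz : ⁅y, z⁆ = B • x) (hzx : ⁅z, x⁆ = C • y) (hAB : 0 < A * B) (hAC : 0 < A * C)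
    (hs : ∀ w : L, ∃ a b c : ℝ, w = a • x + b • y + c • z) :
    ∃ x₁ x₂ x₃ : L, IsSo3Basis x₁ x₂ x₃ := by
  have hA : A ≠ 0 := fun h => by simp [h] at hAC
  have hC : C ≠ 0 := fun h => by simp [h] at hAC
  have hB : B ≠ 0 := fun h => by simp [h] at hAB
  have hxz : ⁅x, z⁆ = (-C) • y := by rw [← lie_skew, hzx, neg_smul]
  obtain ⟨p, hp, hpp⟩ : ∃ p : ℝ, 0 < p ∧ p * p = A * C :=
    ⟨√(A * C), Real.sqrt_pos.mpr hAC, Real.mul_self_sqrt hAC.le⟩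
  obtain ⟨q, hq, hqq⟩ : ∃ q : ℝ, 0 < q ∧ q * q = A * B :=
    ⟨√(A * B), Real.sqrt_pos.mpr hAB, Real.mul_self_sqrt hAB.le⟩
  have hp0 := hp.ne'
  have hq0 := hq.ne'
  have e1 : p * p / A = C := by rw [hpp]; field_simp
  have e2 : q * q / A = B := by rw [hqq]; field_simp
  refine ⟨(1 / p) • x, (1 / q) • y, (A / (p * q)) • z, ?_, ?_, ?_, fun w => ?_⟩
  · simp only [smul_lie, lie_smul, hxy, smul_smul]
    congr 1
    field_simp
  · simp only [smul_lie, lie_smul, hxz, smul_smul, ← neg_smul]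
    congr 1
    rw [← e1]
    field_simp
  · simp only [smul_lie, lie_smul, hyz, smul_smul]
    congr 1
    rw [← e2]
    field_simp
  · obtain ⟨a, b, c, rfl⟩ := hs w
    refine ⟨a * p, b * q, c * (p * q / A), ?_⟩
    simp only [smul_smul]
    congr 3 <;> field_simp

/-- A three-dimensional real Lie algebra with non-degenerate Killing form is `sl(2, ℝ)` or
`so(3)`. -/
theorem exists_isSl2Basis_or_isSo3Basis [LieAlgebra.IsKilling ℝ L] (h3 : finrank ℝ L = 3) :
    (∃ h e f : L, IsSl2Basis h e f) ∨ ∃ x₁ x₂ x₃ : L, IsSo3Basis x₁ x₂ x₃ := by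
  have : FiniteDimensional ℝ L := FiniteDimensional.of_finrank_pos (by omega)
  obtain ⟨v', hv'⟩ := LinearMap.BilinForm.exists_orthogonal_basis
    (B := killingForm ℝ L) ((LieModule.traceForm_isSymm ℝ L L))
  obtain ⟨v, hv⟩ : ∃ v : Basis (Fin 3) ℝ L, (killingForm ℝ L).iIsOrtho v :=
    ⟨v'.reindex (finCongr h3), fun i j hij => by
      simp only [Basis.coe_reindex]
      exact hv' (fun h => hij ((finCongr h3).symm.injective h))⟩
  have hd (i : Fin 3) : killingForm ℝ L (v i) (v i) ≠ 0 :=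
    hv.not_isOrtho_basis_self_of_nondegenerate (LieAlgebra.IsKilling.killingForm_nondegenerate ℝ L) i
  have ho (i j : Fin 3) (hij : i ≠ j) : killingForm ℝ L (v i) (v j) = 0 := hv hij
  have hs (w : L) : ∃ a b c : ℝ, w = a • v 0 + b • v 1 + c • v 2 :=
    ⟨v.repr w 0, v.repr w 1, v.repr w 2, by
      conv_lhs => rw [← v.sum_repr w, Fin.sum_univ_three]⟩
  -- In a Killing-orthogonal basis `⁅v i, v j⁆` is orthogonal to `v i` and `v j`, hence a multiple
  -- of `v k`. The numerators are one number `D` by invariance, so the signs of the structure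
  -- constants are those of the diagonal of the Killing form, up to a common sign.
  have key (i j k : Fin 3) (hij : i ≠ j) (hik : i ≠ k) (hjk : j ≠ k) :
      ⁅v i, v j⁆ = (killingForm ℝ L ⁅v i, v j⁆ (v k) / killingForm ℝ L (v k) (v k)) • v k := by
    have h0 : ∀ l, killingForm ℝ L
        (⁅v i, v j⁆ - (killingForm ℝ L ⁅v i, v j⁆ (v k) / killingForm ℝ L (v k) (v k)) • v k)
        (v l) = 0 := by
      intro l
      rw [map_sub, map_smul, LinearMap.sub_apply, LinearMap.smul_apply]
      obtain rfl | rfl | rfl : l = i ∨ l = j ∨ l = k := by omega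
      · rw [killing_lie_self', ho _ _ hik.symm]; simp
      · rw [killing_lie_self, ho _ _ hjk.symm]; simp
      · rw [smul_eq_mul, div_mul_cancel₀ _ (hd l), sub_self]
    refine sub_eq_zero.mp ((LieAlgebra.IsKilling.killingForm_nondegenerate ℝ L).1 _ fun y => ?_)
    obtain ⟨a, b, c, rfl⟩ := hs y
    simp only [map_add, map_smul, h0, smul_zero, add_zero]
  set D := killingForm ℝ L ⁅v 0, v 1⁆ (v 2) with hD
  have h12 : killingForm ℝ L ⁅v 1, v 2⁆ (v 0) = D := by
    rw [hD, killing_lie_left (v 0), LieModule.traceForm_comm]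
  have h20 : killingForm ℝ L ⁅v 2, v 0⁆ (v 1) = D := by
    rw [hD, killing_lie_left, LieModule.traceForm_comm]
  have k01 := key 0 1 2 (by decide) (by decide) (by decide)
  have k12 := key 1 2 0 (by decide) (by decide) (by decide)
  have k20 := key 2 0 1 (by decide) (by decide) (by decide)
  rw [← hD] at k01
  rw [h12] at k12
  rw [h20] at k20
  have hD0 : D ≠ 0 := by
    intro hD0
    rw [hD0, zero_div, zero_smul] at k01 k12 k20
    have k10 : ⁅v 1, v 0⁆ = 0 := by rw [← lie_skew, k01, neg_zero]
    have k21 : ⁅v 2, v 1⁆ = 0 := by rw [← lie_skew, k12, neg_zero]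
    have k02 : ⁅v 0, v 2⁆ = 0 := by rw [← lie_skew, k20, neg_zero]
    have := subsingleton_of_basis_lie_eq_zero v fun i j => by
      fin_cases i <;> fin_cases j <;> first | assumption | exact lie_self _
    have := finrank_zero_of_subsingleton (R := ℝ) (M := L)
    omega
  have hs1 (w : L) : ∃ a b c : ℝ, w = a • v 1 + b • v 2 + c • v 0 := by
    obtain ⟨a, b, c, rfl⟩ := hs w
    exact ⟨b, c, a, by abel⟩
  have hs2 (w : L) : ∃ a b c : ℝ, w = a • v 2 + b • v 0 + c • v 1 := by
    obtain ⟨a, b, c, rfl⟩ := hs w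
    exact ⟨c, a, b, by abel⟩
  have ha : D / killingForm ℝ L (v 2) (v 2) ≠ 0 := div_ne_zero hD0 (hd 2)
  have hb : D / killingForm ℝ L (v 0) (v 0) ≠ 0 := div_ne_zero hD0 (hd 0)
  have hc : D / killingForm ℝ L (v 1) (v 1) ≠ 0 := div_ne_zero hD0 (hd 1)
  rcases lt_or_gt_of_ne (mul_ne_zero ha hc) with h1 | h1
  · exact Or.inl (exists_isSl2Basis_of_mul_neg k01 k12 k20 hb h1 hs)
  rcases lt_or_gt_of_ne (mul_ne_zero hb ha) with h2 | h2
  · exact Or.inl (exists_isSl2Basis_of_mul_neg k12 k20 k01 hc h2 hs1)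
  · exact Or.inr (exists_isSo3Basis_of_mul_pos k01 k12 k20 (by linarith) h1 hs)

end RealSimple

/-! ### Primitive vectors for `sl(2)` over an arbitrary field of characteristic zero. -/

section HighestWeight

variable {K L M : Type*} [Field K] [CharZero K] [LieRing L] [LieAlgebra K L]
  [AddCommGroup M] [Module K M] [LieRingModule L M] [LieModule K L M] [FiniteDimensional K M]
  {h e f : L}

theorem lie_h_pow_toEnd_e (t : IsSl2Triple h e f) (k : ℕ) (m : M) :
    ⁅h, (toEnd K L M e ^ k) m⁆ =
      (toEnd K L M e ^ k) ⁅h, m⁆ + (2 * k : K) • (toEnd K L M e ^ k) m := by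
  induction k with
  | zero => simp
  | succ k ih =>
    rw [pow_succ', Module.End.mul_apply, toEnd_apply_apply, leibniz_lie, t.lie_h_e_smul K, ih,
      smul_lie, lie_add, lie_smul, Module.End.mul_apply, toEnd_apply_apply]
    push_cast
    module

/-- Non-zero powers of `e` would be eigenvectors of the commutator with `h` for the distinct
eigenvalues `2k`, hence independent in a finite-dimensional space. -/
theorem exists_pow_toEnd_eq_zero (K : Type*) {L : Type*} (M : Type*) [Field K] [CharZero K]
    [LieRing L] [LieAlgebra K L] [AddCommGroup M] [Module K M] [LieRingModule L M]
    [LieModule K L M] [FiniteDimensional K M] {h e f : L} (t : IsSl2Triple h e f) :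
    ∃ k, toEnd K L M e ^ k = 0 := by
  by_contra! hcon
  let T : Module.End K (Module.End K M) :=
    LinearMap.mulLeft K (toEnd K L M h) - LinearMap.mulRight K (toEnd K L M h)
  have hli : LinearIndependent K (fun k : ℕ => toEnd K L M e ^ k) := by
    refine T.eigenvectors_linearIndependent' (fun k : ℕ => (2 * k : K)) ?_ _ fun k => ⟨?_, hcon k⟩
    · intro a b hab
      simpa using hab
    · rw [Module.End.mem_eigenspace_iff]
      ext m
      simp only [T, LinearMap.sub_apply, LinearMap.mulLeft_apply, LinearMap.mulRight_apply,
        Module.End.mul_apply, toEnd_apply_apply, lie_h_pow_toEnd_e t, LinearMap.smul_apply]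
      abel
  have := hli.finite
  exact not_finite ℕ

theorem lie_f_pow_toEnd_e (t : IsSl2Triple h e f) {m : M} (hm : ⁅f, m⁆ = 0) (k : ℕ) :
    ⁅f, (toEnd K L M e ^ (k + 1)) m⁆ =
      (-(k + 1 : K)) • (⁅h, (toEnd K L M e ^ k) m⁆ - (k : K) • (toEnd K L M e ^ k) m) := by
  have hfe : ⁅f, e⁆ = -h := by rw [← lie_skew, t.lie_e_f]
  induction k with
  | zero =>
    simp [leibniz_lie f, hfe, hm]
  | succ k ih =>
    have h2 : ⁅e, ⁅h, (toEnd K L M e ^ k) m⁆⁆ =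
        ⁅h, (toEnd K L M e ^ (k + 1)) m⁆ - (2 : K) • (toEnd K L M e ^ (k + 1)) m := by
      rw [pow_succ', Module.End.mul_apply, toEnd_apply_apply, leibniz_lie h, t.lie_h_e_smul K,
        smul_lie]
      abel
    rw [pow_succ', Module.End.mul_apply, toEnd_apply_apply, leibniz_lie f, hfe, ih, lie_smul,
      lie_sub, h2, lie_smul, neg_lie, ← toEnd_apply_apply K L M e ((toEnd K L M e ^ k) m),
      ← Module.End.mul_apply, ← pow_succ']
    push_cast
    module

/-- No eigenvalue of `h` is assumed. Let `n + 1` be the least exponent for which `e^(n+1)` kills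
`ker f`, and take `m ∈ ker f` with `e^n m ≠ 0`. Applying `f` to `e^(n+1) m = 0` shows that `e^n m`
has weight `n`. -/
theorem exists_hasPrimitiveVectorWith (K : Type*) {L : Type*} (M : Type*) [Field K] [CharZero K]
    [LieRing L] [LieAlgebra K L] [AddCommGroup M] [Module K M] [LieRingModule L M]
    [LieModule K L M] [FiniteDimensional K M] {h e f : L} (t : IsSl2Triple h e f) [Nontrivial M] :
    ∃ (m : M) (n : ℕ), t.HasPrimitiveVectorWith m (n : K) := by
  classical
  have hex : ∃ k, ∀ m : M, ⁅f, m⁆ = 0 → (toEnd K L M e ^ k) m = 0 := by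
    obtain ⟨k, hk⟩ := exists_pow_toEnd_eq_zero K M t
    exact ⟨k, fun m _ => by rw [hk, LinearMap.zero_apply]⟩
  have hker : ∃ m : M, m ≠ 0 ∧ ⁅f, m⁆ = 0 := by
    by_contra! hcon
    obtain ⟨k, hk⟩ := exists_pow_toEnd_eq_zero K M t.symm
    obtain ⟨m, hm⟩ := exists_ne (0 : M)
    have : ∀ j, (toEnd K L M f ^ j) m ≠ 0 := by
      intro j
      induction j with
      | zero => simpa using hm
      | succ j ih =>
        rw [pow_succ', Module.End.mul_apply, toEnd_apply_apply]
        exact hcon _ ih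
    exact this k (by rw [hk, LinearMap.zero_apply])
  obtain ⟨n, hn⟩ : ∃ n, Nat.find hex = n + 1 := by
    refine Nat.exists_eq_succ_of_ne_zero fun h0 => ?_
    obtain ⟨m, hm, hm'⟩ := hker
    have := Nat.find_spec hex m hm'
    rw [h0] at this
    exact hm (by simpa using this)
  have h1 := Nat.find_spec hex
  have h2 := Nat.find_min hex (m := n) (by omega)
  rw [hn] at h1
  push Not at h2
  obtain ⟨m, hm, hm'⟩ := h2
  refine ⟨(toEnd K L M e ^ n) m, n, hm', ?_, ?_⟩
  · have h3 := lie_f_pow_toEnd_e (K := K) t hm n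
    rw [h1 m hm, lie_zero, eq_comm, smul_eq_zero, sub_eq_zero] at h3
    exact h3.resolve_left (neg_ne_zero.mpr (Nat.cast_add_one_ne_zero n))
  · have := h1 m hm
    rwa [pow_succ', Module.End.mul_apply, toEnd_apply_apply] at this

theorem linearIndependent_pow_toEnd_f (t : IsSl2Triple h e f) {m : M} {n : ℕ}
    (P : t.HasPrimitiveVectorWith m (n : K)) :
    LinearIndependent K (fun k : Fin (n + 1) => (toEnd K L M f ^ (k : ℕ)) m) := by
  refine (toEnd K L M h).eigenvectors_linearIndependent' (fun k : Fin (n + 1) => (n - 2 * k : K))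
    ?_ _ fun k => ⟨?_, ?_⟩
  · intro a b hab
    ext
    simpa using hab
  · rw [Module.End.mem_eigenspace_iff, toEnd_apply_apply]
    exact P.lie_h_pow_toEnd_f k
  · exact P.pow_toEnd_f_ne_zero_of_eq_nat rfl (Nat.lt_succ_iff.mp k.2)

/-- The submodule generated by a primitive vector. -/
def primitiveSubmodule (t : IsSl2Triple h e f) {m : M} {n : ℕ}
    (P : t.HasPrimitiveVectorWith m (n : K))
    (hs : ∀ x : L, ∃ a b c : K, x = a • h + b • e + c • f) : LieSubmodule K L M :=
  { Submodule.span K (Set.range fun k : Fin (n + 1) => (toEnd K L M f ^ (k : ℕ)) m) with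
    lie_mem := fun {x y} hy => by
      have hmem (k : ℕ) : (toEnd K L M f ^ k) m ∈
          Submodule.span K (Set.range fun k : Fin (n + 1) => (toEnd K L M f ^ (k : ℕ)) m) := by
        by_cases hk : k < n + 1
        · exact Submodule.subset_span ⟨⟨k, hk⟩, rfl⟩
        · have : (toEnd K L M f ^ k) m = 0 := by
            obtain ⟨j, rfl⟩ := Nat.exists_eq_add_of_le (not_lt.mp hk)
            rw [add_comm, pow_add, Module.End.mul_apply, P.pow_toEnd_f_eq_zero_of_eq_nat rfl,
              map_zero]
          rw [this]
          exact Submodule.zero_mem _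
      change toEnd K L M x y ∈ _
      refine Submodule.span_induction (p := fun y _ => toEnd K L M x y ∈ _) ?_ ?_ ?_ ?_ hy
      · rintro _ ⟨k, rfl⟩
        obtain ⟨a, b, c, rfl⟩ := hs x
        simp only [toEnd_apply_apply, add_lie, smul_lie]
        refine Submodule.add_mem _ (Submodule.add_mem _ (Submodule.smul_mem _ _ ?_)
          (Submodule.smul_mem _ _ ?_)) (Submodule.smul_mem _ _ ?_)
        · rw [P.lie_h_pow_toEnd_f]
          exact Submodule.smul_mem _ _ (hmem _)
        · rcases Nat.eq_zero_or_pos (k : ℕ) with h0 | h0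
          · rw [h0, pow_zero, Module.End.one_apply, P.lie_e]
            exact Submodule.zero_mem _
          · obtain ⟨j, hj⟩ := Nat.exists_eq_add_of_lt h0
            rw [zero_add] at hj
            rw [hj, P.lie_e_pow_succ_toEnd_f]
            exact Submodule.smul_mem _ _ (hmem _)
        · rw [← toEnd_apply_apply K L M f, ← Module.End.mul_apply, ← pow_succ']
          exact hmem _
      · rw [map_zero]
        exact Submodule.zero_mem _
      · intro a b _ _ ha hb
        rw [map_add]
        exact Submodule.add_mem _ ha hb
      · intro c a _ ha
        rw [map_smul]
        exact Submodule.smul_mem _ _ ha }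

theorem finrank_primitiveSubmodule (t : IsSl2Triple h e f) {m : M} {n : ℕ}
    (P : t.HasPrimitiveVectorWith m (n : K))
    (hs : ∀ x : L, ∃ a b c : K, x = a • h + b • e + c • f) :
    finrank K (primitiveSubmodule t P hs) = n + 1 := by
  have := finrank_span_eq_card (linearIndependent_pow_toEnd_f t P)
  rw [Fintype.card_fin] at this
  exact this

variable [FiniteDimensional K L] [LieAlgebra.IsKilling K L]

/-- The string of a primitive vector of weight `n` has dimension `n + 1`. The case `n = 0` gives an
invariant, and `n + 2 = dim M` leaves a one-dimensional, hence trivial, complement. -/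
theorem exists_primitive_of_noInvariants (K : Type*) {L : Type*} (M : Type*) [Field K]
    [CharZero K] [LieRing L] [LieAlgebra K L] [AddCommGroup M] [Module K M] [LieRingModule L M]
    [LieModule K L M] [FiniteDimensional K M] [FiniteDimensional K L] [LieAlgebra.IsKilling K L]
    {h e f : L} (t : IsSl2Triple h e f) (hs : ∀ x : L, ∃ a b c : K, x = a • h + b • e + c • f)
    (hM : ∀ m : M, (∀ x : L, ⁅x, m⁆ = 0) → m = 0) (hd : finrank K M = 2 ∨ finrank K M = 4) :
    ∃ (m : M) (n : ℕ), t.HasPrimitiveVectorWith m (n : K) ∧ (n = 1 ∨ n = 3 ∧ finrank K M = 4) := by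
  have : Nontrivial M := Module.nontrivial_of_finrank_pos (R := K) (by omega)
  obtain ⟨m, n, P⟩ := exists_hasPrimitiveVectorWith K M t
  refine ⟨m, n, P, ?_⟩
  have h1 := (linearIndependent_pow_toEnd_f t P).fintype_card_le_finrank
  rw [Fintype.card_fin] at h1
  have h0 : n ≠ 0 := by
    rintro rfl
    refine P.ne_zero (hM m fun x => ?_)
    obtain ⟨a, b, c, rfl⟩ := hs x
    have hf : ⁅f, m⁆ = 0 := by
      simpa using P.pow_toEnd_f_eq_zero_of_eq_nat rfl
    simp [P.lie_h, P.lie_e, hf]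
  have h2 : n + 2 ≠ finrank K M := by
    intro hn
    obtain ⟨C, hC⟩ := exists_isCompl_lieSubmodule (K := K) (primitiveSubmodule t P hs)
    have h3 := finrank_add_finrank_of_compl hC.sup_eq_top hC.inf_eq_bot
    rw [finrank_primitiveSubmodule] at h3
    have h4 : finrank K (⊤ : LieSubmodule K L M) = finrank K M := finrank_top K M
    exact finrank_lieSubmodule_ne_one (K := K) (W := C) (fun m _ => hM m) (by omega)
  omega

end HighestWeight

/-! ### Bases of `sl(2)`-modules of dimension two and four. -/

section SlTwoModules

variable {L M : Type*} [LieRing L] [LieAlgebra ℝ L]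
  [AddCommGroup M] [Module ℝ M] [LieRingModule L M] [LieModule ℝ L M]
  {h e f : L}

theorem IsSl2Basis.isSl2Triple (b : IsSl2Basis h e f) (h0 : h ≠ 0) : IsSl2Triple h e f where
  h_ne_zero := h0
  lie_e_f := b.lie_e_f
  lie_h_e_nsmul := by rw [b.lie_h_e, ofNat_smul_eq_nsmul]
  lie_h_f_nsmul := by rw [b.lie_h_f, neg_smul, ofNat_smul_eq_nsmul]

/-- The action of `sl(2)` on the standard basis of its standard module. -/
structure IsStandardPair (h e f : L) (v w : M) : Prop where
  lie_h_v : ⁅h, v⁆ = v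
  lie_h_w : ⁅h, w⁆ = -w
  lie_e_v : ⁅e, v⁆ = 0
  lie_e_w : ⁅e, w⁆ = v
  lie_f_v : ⁅f, v⁆ = w
  lie_f_w : ⁅f, w⁆ = 0

/-- The action of `sl(2)` on the standard basis of its four-dimensional irreducible module. -/
structure IsCubicBasis (h e f : L) (v₁ v₂ v₃ v₄ : M) : Prop where
  lie_h_1 : ⁅h, v₁⁆ = (3 : ℝ) • v₁
  lie_h_2 : ⁅h, v₂⁆ = v₂
  lie_h_3 : ⁅h, v₃⁆ = -v₃
  lie_h_4 : ⁅h, v₄⁆ = -(3 : ℝ) • v₄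
  lie_e_1 : ⁅e, v₁⁆ = 0
  lie_e_2 : ⁅e, v₂⁆ = (3 : ℝ) • v₁
  lie_e_3 : ⁅e, v₃⁆ = (2 : ℝ) • v₂
  lie_e_4 : ⁅e, v₄⁆ = v₃
  lie_f_1 : ⁅f, v₁⁆ = v₂
  lie_f_2 : ⁅f, v₂⁆ = (2 : ℝ) • v₃
  lie_f_3 : ⁅f, v₃⁆ = (3 : ℝ) • v₄
  lie_f_4 : ⁅f, v₄⁆ = 0

theorem IsStandardPair.of_primitive [FiniteDimensional ℝ M] (t : IsSl2Triple h e f) {v : M}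
    (P : t.HasPrimitiveVectorWith v ((1 : ℕ) : ℝ)) : IsStandardPair h e f v ⁅f, v⁆ where
  lie_h_v := by simpa using P.lie_h
  lie_h_w := by
    have := P.lie_h_pow_toEnd_f 1
    norm_num at this
    exact this
  lie_e_v := P.lie_e
  lie_e_w := by
    have := P.lie_e_pow_succ_toEnd_f 0
    norm_num at this
    exact this
  lie_f_v := rfl
  lie_f_w := by
    have := P.pow_toEnd_f_eq_zero_of_eq_nat (n := 1) (by norm_num)
    simpa [pow_succ] using this

variable [FiniteDimensional ℝ M] [FiniteDimensional ℝ L] [LieAlgebra.IsKilling ℝ L]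

theorem exists_isStandardPair (b : IsSl2Basis h e f) (h0 : h ≠ 0)
    (hM : ∀ m : M, (∀ x : L, ⁅x, m⁆ = 0) → m = 0) (hd : finrank ℝ M = 2) :
    ∃ v w : M, IsStandardPair h e f v w ∧ ∀ m, ∃ a b : ℝ, m = a • v + b • w := by
  have t := b.isSl2Triple h0
  obtain ⟨v, n, P, hn⟩ := exists_primitive_of_noInvariants ℝ M t b.spans hM (Or.inl hd)
  obtain rfl : n = 1 := by omega
  refine ⟨v, _, IsStandardPair.of_primitive t P, fun m => ?_⟩
  have hli := linearIndependent_pow_toEnd_f t P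
  have hsp := hli.span_eq_top_of_card_eq_finrank' (by simp [hd])
  obtain ⟨c, hc⟩ := (Submodule.mem_span_range_iff_exists_fun ℝ).mp
    (hsp ▸ Submodule.mem_top : m ∈ Submodule.span ℝ _)
  refine ⟨c 0, c 1, ?_⟩
  rw [← hc, Fin.sum_univ_two]
  simp

/-- A primitive vector of weight 3 generates everything. One of weight 1 generates a plane whose
complement has no invariants either and is again a standard module. -/
theorem exists_isStandardPair_or_isCubicBasis (b : IsSl2Basis h e f) (h0 : h ≠ 0)
    (hM : ∀ m : M, (∀ x : L, ⁅x, m⁆ = 0) → m = 0) (hd : finrank ℝ M = 4) :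
    (∃ v w v' w' : M, IsStandardPair h e f v w ∧ IsStandardPair h e f v' w' ∧
      LinearIndependent ℝ ![v, v'] ∧
      ∀ m, ∃ a b c d : ℝ, m = a • v + b • w + c • v' + d • w') ∨
    (∃ v₁ v₂ v₃ v₄ : M, IsCubicBasis h e f v₁ v₂ v₃ v₄ ∧ v₁ ≠ 0 ∧
      ∀ m, ∃ a b c d : ℝ, m = a • v₁ + b • v₂ + c • v₃ + d • v₄) := by
  have t := b.isSl2Triple h0
  obtain ⟨v, n, P, hn⟩ := exists_primitive_of_noInvariants ℝ M t b.spans hM (Or.inr hd)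
  have hli := linearIndependent_pow_toEnd_f t P
  rcases hn with rfl | ⟨rfl, -⟩
  · left
    obtain ⟨C, hC⟩ := exists_isCompl_lieSubmodule (K := ℝ) (primitiveSubmodule t P b.spans)
    have h3 := finrank_add_finrank_of_compl hC.sup_eq_top hC.inf_eq_bot
    rw [finrank_primitiveSubmodule] at h3
    have h4 : finrank ℝ (⊤ : LieSubmodule ℝ L M) = finrank ℝ M := finrank_top ℝ M
    have hC2 : finrank ℝ C = 2 := by omega
    obtain ⟨v', w', h', hspan⟩ := exists_isStandardPair (M := C) b h0
      (fun m hm => Subtype.ext (hM m fun x => congrArg Subtype.val (hm x))) hC2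
    have hp := IsStandardPair.of_primitive t P
    have hp' : IsStandardPair h e f (v' : M) (w' : M) :=
      ⟨congrArg Subtype.val h'.1, congrArg Subtype.val h'.2, congrArg Subtype.val h'.3,
        congrArg Subtype.val h'.4, congrArg Subtype.val h'.5, congrArg Subtype.val h'.6⟩
    have hmemP (m : M) (hm : m ∈ primitiveSubmodule t P b.spans) :
        ∃ a b : ℝ, m = a • v + b • ⁅f, v⁆ := by
      obtain ⟨c, hc⟩ := (Submodule.mem_span_range_iff_exists_fun ℝ).mp hm
      refine ⟨c 0, c 1, ?_⟩
      rw [← hc, Fin.sum_univ_two]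
      simp
    have hmemC (m : M) (hm : m ∈ C) : ∃ a b : ℝ, m = a • (v' : M) + b • (w' : M) := by
      obtain ⟨a, b, hab⟩ := hspan ⟨m, hm⟩
      exact ⟨a, b, congrArg Subtype.val hab⟩
    have hspan4 (m : M) :
        ∃ a b c d : ℝ, m = a • v + b • ⁅f, v⁆ + c • (v' : M) + d • (w' : M) := by
      have hm : m ∈ primitiveSubmodule t P b.spans ⊔ C := by
        rw [hC.sup_eq_top]; exact LieSubmodule.mem_top _
      obtain ⟨x, hx, y, hy, rfl⟩ := (LieSubmodule.mem_sup _ _ m).mp hm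
      obtain ⟨a, b, rfl⟩ := hmemP x hx
      obtain ⟨c, d, rfl⟩ := hmemC y hy
      exact ⟨a, b, c, d, by abel⟩
    refine ⟨v, _, v', w', hp, hp', ?_, hspan4⟩
    have h4 : LinearIndependent ℝ ![v, ⁅f, v⁆, (v' : M), (w' : M)] := by
      refine linearIndependent_of_top_le_span_of_card_eq_finrank ?_ (by simp [hd])
      intro m _
      obtain ⟨a, b, c, d, rfl⟩ := hspan4 m
      refine (Submodule.mem_span_range_iff_exists_fun ℝ).mpr ⟨![a, b, c, d], ?_⟩
      simp [Fin.sum_univ_four]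
    have := h4.comp ![0, 2] (by decide)
    convert this using 1
    ext i
    fin_cases i <;> rfl
  · right
    have hsp := hli.span_eq_top_of_card_eq_finrank' (by simp [hd])
    have e1 := P.lie_e_pow_succ_toEnd_f 0
    have e2 := P.lie_e_pow_succ_toEnd_f 1
    have e3 := P.lie_e_pow_succ_toEnd_f 2
    have h1 := P.lie_h_pow_toEnd_f 1
    have h2 := P.lie_h_pow_toEnd_f 2
    have h3 := P.lie_h_pow_toEnd_f 3
    have f3 := P.pow_toEnd_f_eq_zero_of_eq_nat (n := 3) (by norm_num)
    simp only [pow_succ, pow_zero, one_mul, Module.End.mul_apply, toEnd_apply_apply,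
      Module.End.one_apply, zero_add] at e1 e2 e3 h1 h2 h3 f3
    norm_num at e1 e2 e3 h1 h2 h3
    -- The divided powers `f^k v / k!`, which give the integral structure constants of the table.
    refine ⟨v, ⁅f, v⁆, (1 / 2 : ℝ) • ⁅f, ⁅f, v⁆⁆, (1 / 6 : ℝ) • ⁅f, ⁅f, ⁅f, v⁆⁆⁆,
      ⟨by simpa using P.lie_h, h1, ?_, ?_, P.lie_e, e1, ?_, ?_, rfl, ?_, ?_, ?_⟩, P.ne_zero,
      fun m => ?_⟩
    · rw [lie_smul, h2, smul_neg]
    · rw [lie_smul, h3]; module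
    · rw [lie_smul, e2]; module
    · rw [lie_smul, e3]; module
    · module
    · rw [lie_smul]; module
    · rw [lie_smul, f3, smul_zero]
    obtain ⟨c, hc⟩ := (Submodule.mem_span_range_iff_exists_fun ℝ).mp
      (hsp ▸ Submodule.mem_top : m ∈ Submodule.span ℝ _)
    refine ⟨c 0, c 1, c 2 * 2, c 3 * 6, ?_⟩
    rw [← hc, Fin.sum_univ_four]
    simp only [pow_succ, pow_zero, one_mul, Module.End.mul_apply, toEnd_apply_apply,
      Module.End.one_apply, Fin.val_zero, Fin.val_one, Fin.val_two]
    have : ((3 : Fin (3 + 1)) : ℕ) = 3 := rfl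
    rw [this]
    simp only [pow_succ, pow_zero, one_mul, Module.End.mul_apply, toEnd_apply_apply]
    module

end SlTwoModules

/-! ### Complexification of Lie algebras and modules. -/

section BaseChange

/-- The Gram determinant of the Killing form is the image of the original one. -/
theorem isKilling_baseChange (K A L : Type*) [Field K] [Field A] [Algebra K A] [LieRing L]
    [LieAlgebra K L] [FiniteDimensional K L] [LieAlgebra.IsKilling K L] :
    LieAlgebra.IsKilling A (A ⊗[K] L) := by
  let b := Module.finBasis K L
  have h1 : (LinearMap.BilinForm.toMatrix b (killingForm K L)).det ≠ 0 :=
    (LinearMap.BilinForm.nondegenerate_iff_det_ne_zero b).mp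
      (LieAlgebra.IsKilling.killingForm_nondegenerate K L)
  have h2 : LinearMap.BilinForm.toMatrix (b.baseChange A) (killingForm A (A ⊗[K] L)) =
      (LinearMap.BilinForm.toMatrix b (killingForm K L)).map (algebraMap K A) := by
    ext i j
    rw [Matrix.map_apply, LinearMap.BilinForm.toMatrix_apply,
      LinearMap.BilinForm.toMatrix_apply]
    rw [killingForm, traceForm_baseChange]
    simp [Algebra.algebraMap_eq_smul_one]
  have h3 : (killingForm A (A ⊗[K] L)).Nondegenerate := by
    rw [LinearMap.BilinForm.nondegenerate_iff_det_ne_zero (b.baseChange A), h2,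
      ← RingHom.mapMatrix_apply, ← RingHom.map_det]
    exact (map_ne_zero _).mpr h1
  constructor
  rw [← LieSubmodule.toSubmodule_inj]
  exact (LieIdeal.coe_killingCompl_top A _).trans (LinearMap.separatingLeft_iff_ker_eq_bot.mp h3.1)

variable {M : Type*} [AddCommGroup M] [Module ℝ M]

/-- The real part on the complexification of a real vector space. -/
noncomputable def tensorRe : ℂ ⊗[ℝ] M →ₗ[ℝ] M :=
  TensorProduct.lid ℝ M ∘ₗ TensorProduct.map Complex.reLm LinearMap.id

/-- The imaginary part on the complexification of a real vector space. -/
noncomputable def tensorIm : ℂ ⊗[ℝ] M →ₗ[ℝ] M :=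
  TensorProduct.lid ℝ M ∘ₗ TensorProduct.map Complex.imLm LinearMap.id

/-- Conjugation on the complexification of a real vector space. -/
noncomputable def tensorConj : ℂ ⊗[ℝ] M →ₗ[ℝ] ℂ ⊗[ℝ] M :=
  TensorProduct.map Complex.conjAe.toLinearMap LinearMap.id

@[simp] theorem tensorRe_tmul (z : ℂ) (m : M) : tensorRe (z ⊗ₜ[ℝ] m) = z.re • m := by
  simp [tensorRe]

@[simp] theorem tensorIm_tmul (z : ℂ) (m : M) : tensorIm (z ⊗ₜ[ℝ] m) = z.im • m := by
  simp [tensorIm]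

@[simp] theorem tensorConj_tmul (z : ℂ) (m : M) :
    tensorConj (z ⊗ₜ[ℝ] m) = (starRingEnd ℂ z) ⊗ₜ[ℝ] m := by
  simp [tensorConj]

theorem tensorConj_smul (z : ℂ) (v : ℂ ⊗[ℝ] M) :
    tensorConj (z • v) = (starRingEnd ℂ z) • tensorConj v := by
  induction v with
  | zero => simp
  | tmul w m => simp [TensorProduct.smul_tmul']
  | add x y hx hy => rw [smul_add, map_add, map_add, hx, hy, smul_add]

theorem tensorConj_tensorConj (v : ℂ ⊗[ℝ] M) : tensorConj (tensorConj v) = v := by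
  induction v with
  | zero => simp
  | tmul w m => simp
  | add x y hx hy => rw [map_add, map_add, hx, hy]

theorem eq_tensorRe_add_tensorIm (v : ℂ ⊗[ℝ] M) :
    v = (1 : ℂ) ⊗ₜ[ℝ] tensorRe v + Complex.I ⊗ₜ[ℝ] tensorIm v := by
  induction v with
  | zero => simp
  | tmul z m =>
    rw [tensorRe_tmul, tensorIm_tmul, ← TensorProduct.smul_tmul, ← TensorProduct.smul_tmul,
      ← TensorProduct.add_tmul]
    congr 1
    apply Complex.ext <;> simp
  | add x y hx hy =>
    conv_lhs => rw [hx, hy]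
    simp only [map_add, TensorProduct.tmul_add]
    abel

variable {L : Type*} [LieRing L] [LieAlgebra ℝ L] [LieRingModule L M] [LieModule ℝ L M]

theorem tensor_lie_add (x : ℂ ⊗[ℝ] L) (v w : ℂ ⊗[ℝ] M) : ⁅x, v + w⁆ = ⁅x, v⁆ + ⁅x, w⁆ :=
  map_add (toEnd ℂ (ℂ ⊗[ℝ] L) (ℂ ⊗[ℝ] M) x) v w

theorem tensor_add_lie (x y : ℂ ⊗[ℝ] L) (v : ℂ ⊗[ℝ] M) : ⁅x + y, v⁆ = ⁅x, v⁆ + ⁅y, v⁆ := by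
  exact add_lie x y v

theorem tensor_neg_lie (x : ℂ ⊗[ℝ] L) (v : ℂ ⊗[ℝ] M) : ⁅-x, v⁆ = -⁅x, v⁆ := by
  exact neg_lie x v

theorem tensor_lie_smul (c : ℂ) (x : ℂ ⊗[ℝ] L) (v : ℂ ⊗[ℝ] M) : ⁅x, c • v⁆ = c • ⁅x, v⁆ :=
  map_smul (toEnd ℂ (ℂ ⊗[ℝ] L) (ℂ ⊗[ℝ] M) x) c v

theorem tensor_lie_neg (x : ℂ ⊗[ℝ] L) (v : ℂ ⊗[ℝ] M) : ⁅x, -v⁆ = -⁅x, v⁆ :=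
  map_neg (toEnd ℂ (ℂ ⊗[ℝ] L) (ℂ ⊗[ℝ] M) x) v

theorem tensor_lie_zero (x : ℂ ⊗[ℝ] L) : ⁅x, (0 : ℂ ⊗[ℝ] M)⁆ = 0 :=
  map_zero (toEnd ℂ (ℂ ⊗[ℝ] L) (ℂ ⊗[ℝ] M) x)

theorem tensor_zero_lie (v : ℂ ⊗[ℝ] M) : ⁅(0 : ℂ ⊗[ℝ] L), v⁆ = 0 := by
  exact zero_lie v

theorem tensorRe_tmul_lie (z : ℂ) (x : L) (v : ℂ ⊗[ℝ] M) :
    tensorRe ⁅z ⊗ₜ[ℝ] x, v⁆ = z.re • ⁅x, tensorRe v⁆ - z.im • ⁅x, tensorIm v⁆ := by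
  conv_lhs => rw [eq_tensorRe_add_tensorIm v]
  rw [tensor_lie_add, map_add, LieAlgebra.ExtendScalars.bracket_tmul,
    LieAlgebra.ExtendScalars.bracket_tmul]
  simp [sub_eq_add_neg]

theorem tensorIm_tmul_lie (z : ℂ) (x : L) (v : ℂ ⊗[ℝ] M) :
    tensorIm ⁅z ⊗ₜ[ℝ] x, v⁆ = z.im • ⁅x, tensorRe v⁆ + z.re • ⁅x, tensorIm v⁆ := by
  conv_lhs => rw [eq_tensorRe_add_tensorIm v]
  rw [tensor_lie_add, map_add, LieAlgebra.ExtendScalars.bracket_tmul,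
    LieAlgebra.ExtendScalars.bracket_tmul]
  simp

theorem tensorConj_lie (x : ℂ ⊗[ℝ] L) (v : ℂ ⊗[ℝ] M) :
    tensorConj ⁅x, v⁆ = ⁅tensorConj x, tensorConj v⁆ := by
  induction x with
  | zero => rw [tensor_zero_lie, map_zero, map_zero, tensor_zero_lie]
  | add x y hx hy => rw [tensor_add_lie, map_add, map_add, hx, hy, tensor_add_lie]
  | tmul z x =>
    induction v with
    | zero => rw [tensor_lie_zero, map_zero, tensor_lie_zero]
    | tmul w m => simp [LieAlgebra.ExtendScalars.bracket_tmul]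
    | add x y hx hy => rw [tensor_lie_add, map_add, map_add, hx, hy, tensor_lie_add]

theorem tensor_eq_zero_of_lie_eq_zero (hM : ∀ m : M, (∀ x : L, ⁅x, m⁆ = 0) → m = 0)
    (v : ℂ ⊗[ℝ] M) (hv : ∀ x : ℂ ⊗[ℝ] L, ⁅x, v⁆ = 0) : v = 0 := by
  have h (x : L) : ⁅x, tensorRe v⁆ = 0 ∧ ⁅x, tensorIm v⁆ = 0 := by
    have h1 := hv ((1 : ℂ) ⊗ₜ x)
    rw [eq_tensorRe_add_tensorIm v, tensor_lie_add, LieAlgebra.ExtendScalars.bracket_tmul,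
      LieAlgebra.ExtendScalars.bracket_tmul] at h1
    constructor
    · simpa using congrArg tensorRe h1
    · simpa using congrArg tensorIm h1
  rw [eq_tensorRe_add_tensorIm v, hM _ fun x => (h x).1, hM _ fun x => (h x).2]
  simp

end BaseChange

/-! ### Modules over `so(3)` through the complexification `sl(2)`. -/

section SoThreeModules

variable {L M : Type*} [LieRing L] [LieAlgebra ℝ L]
  [AddCommGroup M] [Module ℝ M] [LieRingModule L M] [LieModule ℝ L M]
  {x₁ x₂ x₃ : L}

theorem IsSo3Basis.lie_3_2 (b : IsSo3Basis x₁ x₂ x₃) : ⁅x₃, x₂⁆ = -x₁ := by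
  rw [← lie_skew, b.lie_2_3]

/-- The complexification of `so(3)` is `sl(2)`. -/
theorem IsSo3Basis.isSl2Triple (b : IsSo3Basis x₁ x₂ x₃) (h0 : x₁ ≠ 0) :
    IsSl2Triple ((2 * Complex.I) ⊗ₜ[ℝ] x₁ : ℂ ⊗[ℝ] L)
      ((1 : ℂ) ⊗ₜ[ℝ] x₂ + Complex.I ⊗ₜ[ℝ] x₃) (-((1 : ℂ) ⊗ₜ[ℝ] x₂) + Complex.I ⊗ₜ[ℝ] x₃) where
  h_ne_zero h := by
    have := congrArg tensorIm h
    simp [h0] at this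
  lie_e_f := by
    simp only [add_lie, lie_add, lie_neg, LieAlgebra.ExtendScalars.bracket_tmul, lie_self,
      b.lie_2_3, b.lie_3_2, zero_add, add_zero, one_mul, mul_one,
      TensorProduct.tmul_neg, neg_neg]
    rw [← TensorProduct.add_tmul, two_mul]
  lie_h_e_nsmul := by
    simp only [lie_add, LieAlgebra.ExtendScalars.bracket_tmul, b.lie_1_2, b.lie_1_3, two_smul,
      mul_one, mul_assoc, Complex.I_mul_I, TensorProduct.tmul_neg]
    simp only [two_mul, TensorProduct.add_tmul, TensorProduct.neg_tmul]
    abel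
  lie_h_f_nsmul := by
    simp only [lie_add, lie_neg, LieAlgebra.ExtendScalars.bracket_tmul, b.lie_1_2, b.lie_1_3,
      two_smul, mul_one, mul_assoc, Complex.I_mul_I, TensorProduct.tmul_neg]
    simp only [two_mul, TensorProduct.add_tmul, TensorProduct.neg_tmul]
    abel

theorem IsSo3Basis.tensor_spans (b : IsSo3Basis x₁ x₂ x₃) (x : ℂ ⊗[ℝ] L) :
    ∃ c₁ c₂ c₃ : ℂ, x = c₁ • ((2 * Complex.I) ⊗ₜ[ℝ] x₁ : ℂ ⊗[ℝ] L) +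
      c₂ • ((1 : ℂ) ⊗ₜ[ℝ] x₂ + Complex.I ⊗ₜ[ℝ] x₃) +
      c₃ • (-((1 : ℂ) ⊗ₜ[ℝ] x₂) + Complex.I ⊗ₜ[ℝ] x₃) := by
  induction x with
  | zero => exact ⟨0, 0, 0, by simp⟩
  | add x y hx hy =>
    obtain ⟨a, b, c, hx⟩ := hx
    obtain ⟨a', b', c', hy⟩ := hy
    exact ⟨a + a', b + b', c + c', by rw [hx, hy]; module⟩
  | tmul z x =>
    obtain ⟨p, q, r, rfl⟩ := b.spans x
    refine ⟨z * p * (-Complex.I / 2), z * (q / 2 - r * Complex.I / 2),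
      z * (-q / 2 - r * Complex.I / 2), ?_⟩
    simp only [TensorProduct.tmul_add, TensorProduct.tmul_smul, smul_add,
      TensorProduct.smul_tmul', ← TensorProduct.neg_tmul, smul_eq_mul]
    have e1 : z * p * (-Complex.I / 2) * (2 * Complex.I) = p • z := by
      rw [Complex.real_smul]
      linear_combination (-z * p) * Complex.I_mul_I
    have e2 : q • z = z * (q / 2 - r * Complex.I / 2) * 1 +
        z * (-q / 2 - r * Complex.I / 2) * -1 := by
      rw [Complex.real_smul]
      ring
    have e3 : r • z = z * (q / 2 - r * Complex.I / 2) * Complex.I +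
        z * (-q / 2 - r * Complex.I / 2) * Complex.I := by
      rw [Complex.real_smul]
      linear_combination (z * r) * Complex.I_mul_I
    rw [e1, e2, e3, TensorProduct.add_tmul, TensorProduct.add_tmul]
    abel

end SoThreeModules

section SoThreeModules

variable {L M : Type*} [LieRing L] [LieAlgebra ℝ L]
  [AddCommGroup M] [Module ℝ M] [LieRingModule L M] [LieModule ℝ L M]
  {x₁ x₂ x₃ : L}

/-- The relations of the quaternionic basis of the four-dimensional real module of `so(3)`. -/
structure IsQuaternionicBasis (x₁ x₂ x₃ : L) (a b p q : M) : Prop where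
  lie_1_a : ⁅x₁, a⁆ = (1 / 2 : ℝ) • b
  lie_1_b : ⁅x₁, b⁆ = -(1 / 2 : ℝ) • a
  lie_1_p : ⁅x₁, p⁆ = -(1 / 2 : ℝ) • q
  lie_1_q : ⁅x₁, q⁆ = (1 / 2 : ℝ) • p
  lie_2_a : ⁅x₂, a⁆ = -(1 / 2 : ℝ) • p
  lie_2_b : ⁅x₂, b⁆ = -(1 / 2 : ℝ) • q
  lie_2_p : ⁅x₂, p⁆ = (1 / 2 : ℝ) • a
  lie_2_q : ⁅x₂, q⁆ = (1 / 2 : ℝ) • b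
  lie_3_a : ⁅x₃, a⁆ = (1 / 2 : ℝ) • q
  lie_3_b : ⁅x₃, b⁆ = -(1 / 2 : ℝ) • p
  lie_3_p : ⁅x₃, p⁆ = (1 / 2 : ℝ) • b
  lie_3_q : ⁅x₃, q⁆ = -(1 / 2 : ℝ) • a

/-- The basis is the orbit of `a` under the unit quaternions `1, i, j, k`. A relation is a
quaternion killing `a`; multiplying by its conjugate leaves the sum of the squares of the
coefficients times `a`. -/
theorem IsQuaternionicBasis.linearIndependent {a b p q : M}
    (h : IsQuaternionicBasis x₁ x₂ x₃ a b p q) (ha : a ≠ 0) :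
    LinearIndependent ℝ ![a, b, p, q] := by
  rw [Fintype.linearIndependent_iff]
  intro c hc
  simp only [Fin.sum_univ_four, Matrix.cons_val] at hc
  have h1 := congrArg (fun m => ⁅x₁, m⁆) hc
  have h2 := congrArg (fun m => ⁅x₂, m⁆) hc
  have h3 := congrArg (fun m => ⁅x₃, m⁆) hc
  simp only [lie_add, lie_smul, lie_zero, h.lie_1_a, h.lie_1_b, h.lie_1_p, h.lie_1_q] at h1
  simp only [lie_add, lie_smul, lie_zero, h.lie_2_a, h.lie_2_b, h.lie_2_p, h.lie_2_q] at h2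
  simp only [lie_add, lie_smul, lie_zero, h.lie_3_a, h.lie_3_b, h.lie_3_p, h.lie_3_q] at h3
  have key : (c 0 * c 0 + c 1 * c 1 + c 2 * c 2 + c 3 * c 3) • a = 0 := by
    have : (c 0 * c 0 + c 1 * c 1 + c 2 * c 2 + c 3 * c 3) • a =
        c 0 • (c 0 • a + c 1 • b + c 2 • p + c 3 • q) -
        (2 * c 1) • (c 0 • (1 / 2 : ℝ) • b + c 1 • -(1 / 2 : ℝ) • a + c 2 • -(1 / 2 : ℝ) • q +
          c 3 • (1 / 2 : ℝ) • p) +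
        (2 * c 2) • (c 0 • -(1 / 2 : ℝ) • p + c 1 • -(1 / 2 : ℝ) • q + c 2 • (1 / 2 : ℝ) • a +
          c 3 • (1 / 2 : ℝ) • b) -
        (2 * c 3) • (c 0 • (1 / 2 : ℝ) • q + c 1 • -(1 / 2 : ℝ) • p + c 2 • (1 / 2 : ℝ) • b +
          c 3 • -(1 / 2 : ℝ) • a) := by module
    rw [this, hc, h1, h2, h3]
    simp
  have key' := (smul_eq_zero.mp key).resolve_right ha
  intro i
  fin_cases i <;> simp only [Fin.zero_eta, Fin.mk_one, Fin.reduceFinMk] <;>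
    nlinarith [sq_nonneg (c 0), sq_nonneg (c 1), sq_nonneg (c 2), sq_nonneg (c 3)]

variable [FiniteDimensional ℝ M] [FiniteDimensional ℝ L] [LieAlgebra.IsKilling ℝ L]

/-- The four-dimensional irreducible `sl(2)`-module is quaternionic for the compact real form, so it
is not the complexification of a four-dimensional real module: the would-be conjugation has negative
square. -/
theorem IsSo3Basis.exists_primitive (b : IsSo3Basis x₁ x₂ x₃) (h0 : x₁ ≠ 0)
    (hM : ∀ m : M, (∀ x : L, ⁅x, m⁆ = 0) → m = 0) (hd : finrank ℝ M = 2 ∨ finrank ℝ M = 4) :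
    ∃ v : ℂ ⊗[ℝ] M, (b.isSl2Triple h0).HasPrimitiveVectorWith v ((1 : ℕ) : ℂ) := by
  have := isKilling_baseChange ℝ ℂ L
  have hfr : finrank ℂ (ℂ ⊗[ℝ] M) = finrank ℝ M := finrank_baseChange
  obtain ⟨v, n, P, hn⟩ := exists_primitive_of_noInvariants ℂ (ℂ ⊗[ℝ] M) (b.isSl2Triple h0)
    b.tensor_spans (tensor_eq_zero_of_lie_eq_zero hM) (by rw [hfr]; exact hd)
  rcases hn with rfl | ⟨rfl, h4⟩
  · exact ⟨v, P⟩
  exfalso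
  have hli := linearIndependent_pow_toEnd_f _ P
  have hsp := hli.span_eq_top_of_card_eq_finrank' (by simp [h4])
  have e1 := P.lie_e_pow_succ_toEnd_f 0
  have e2 := P.lie_e_pow_succ_toEnd_f 1
  have e3 := P.lie_e_pow_succ_toEnd_f 2
  have f3 := P.pow_toEnd_f_eq_zero_of_eq_nat (n := 3) (by norm_num)
  obtain ⟨c, hc⟩ := (Submodule.mem_span_range_iff_exists_fun ℂ).mp
      (hsp ▸ Submodule.mem_top : tensorConj v ∈ Submodule.span ℂ _)
  rw [Fin.sum_univ_four] at hc
  rw [Fintype.linearIndependent_iff] at hli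
  set E : ℂ ⊗[ℝ] L := (1 : ℂ) ⊗ₜ[ℝ] x₂ + Complex.I ⊗ₜ[ℝ] x₃ with hE
  set F : ℂ ⊗[ℝ] L := -((1 : ℂ) ⊗ₜ[ℝ] x₂) + Complex.I ⊗ₜ[ℝ] x₃ with hF
  have hEF : tensorConj E = -F := by
    simp only [hE, hF, map_add, tensorConj_tmul, map_one, Complex.conj_I,
      TensorProduct.neg_tmul, neg_add, neg_neg]
  have hFE : tensorConj F = -E := by
    simp only [hE, hF, map_add, map_neg, tensorConj_tmul, map_one, Complex.conj_I,
      TensorProduct.neg_tmul, neg_add]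
  have hv3 : ((3 : Fin (3 + 1)) : ℕ) = 3 := rfl
  simp only [pow_succ, pow_zero, one_mul, Module.End.mul_apply, toEnd_apply_apply,
      Module.End.one_apply, zero_add, Fin.val_zero, Fin.val_one, Fin.val_two, hv3]
      at e1 e2 e3 f3 hc hli
  norm_num at e1 e2 e3
  have hFc : ⁅F, tensorConj v⁆ = 0 := by
    have h1 := tensorConj_lie E v
    rw [hEF, tensor_neg_lie] at h1
    have h2 : ⁅E, v⁆ = 0 := P.lie_e
    rw [h2, map_zero] at h1
    exact neg_eq_zero.mp h1.symm
  -- Conjugation exchanges `E` and `F` up to sign, so it sends the highest weight line to the kernel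
  -- of `F`, spanned by `F³ v`.
  have hc0 : c 0 = 0 ∧ c 1 = 0 ∧ c 2 = 0 := by
    have h1 := hFc
    rw [← hc] at h1
    simp only [tensor_lie_add, tensor_lie_smul, f3, smul_zero, add_zero] at h1
    have h2 := hli ![0, c 0, c 1, c 2] (by
      rw [Fin.sum_univ_four]
      simpa [hv3, pow_succ] using h1)
    exact ⟨h2 1, h2 2, h2 3⟩
  rw [hc0.1, hc0.2.1, hc0.2.2, zero_smul, zero_smul, zero_smul, zero_add, zero_add,
    zero_add] at hc
  -- `E³ F³ v = 3 · 4 · 3 v = 36 v`, and the three sign changes from `tensorConj F = -E` produce the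
  -- minus sign.
  have h3 : tensorConj (tensorConj v) = (-36 * (starRingEnd ℂ (c 3) * c 3)) • v := by
    rw [← hc, tensorConj_smul, tensorConj_lie, tensorConj_lie, tensorConj_lie, hFE, ← hc,
      tensor_neg_lie, tensor_neg_lie, tensor_neg_lie]
    simp only [tensor_lie_neg, tensor_lie_smul, e1, e2, e3]
    module
  rw [tensorConj_tensorConj, ← Complex.normSq_eq_conj_mul_self] at h3
  have h4 : ((1 : ℂ) + 36 * Complex.normSq (c 3)) • v = 0 := by
    rw [add_smul, one_smul]
    nth_rewrite 1 [h3]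
    module
  have h5 := (smul_eq_zero.mp h4).resolve_right P.ne_zero
  have h6 := congrArg Complex.re h5
  simp at h6
  have := Complex.normSq_nonneg (c 3)
  linarith

/-- Modules of dimension two or four without invariants over `so(3)` are quaternionic. -/
theorem IsSo3Basis.exists_isQuaternionicBasis (hb : IsSo3Basis x₁ x₂ x₃) (h0 : x₁ ≠ 0)
    (hM : ∀ m : M, (∀ x : L, ⁅x, m⁆ = 0) → m = 0) (hd : finrank ℝ M = 2 ∨ finrank ℝ M = 4) :
    finrank ℝ M = 4 ∧ ∃ a b p q : M, IsQuaternionicBasis x₁ x₂ x₃ a b p q ∧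
      ∀ m, ∃ c₁ c₂ c₃ c₄ : ℝ, m = c₁ • a + c₂ • b + c₃ • p + c₄ • q := by
  obtain ⟨v, P⟩ := hb.exists_primitive h0 hM hd
  have hv := eq_tensorRe_add_tensorIm v
  have hh := P.lie_h
  have he := P.lie_e
  have hf := P.pow_toEnd_f_eq_zero_of_eq_nat (n := 1) (by norm_num)
  have hhf := P.lie_h_pow_toEnd_f 1
  have hef := P.lie_e_pow_succ_toEnd_f 0
  norm_num only [pow_succ, pow_zero, one_mul, Module.End.mul_apply, toEnd_apply_apply,
      Module.End.one_apply, zero_add, neg_smul, one_smul] at hf hhf hef hh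
  have hh1 := congrArg tensorRe hh
  have hh2 := congrArg tensorIm hh
  have he1 := congrArg tensorRe he
  have he2 := congrArg tensorIm he
  have hf1 := congrArg tensorRe hf
  have hf2 := congrArg tensorIm hf
  have hhf1 := congrArg tensorRe hhf
  have hhf2 := congrArg tensorIm hhf
  have hef1 := congrArg tensorRe hef
  have hef2 := congrArg tensorIm hef
  simp only [tensor_add_lie, tensor_neg_lie, tensor_lie_add, tensor_lie_neg, map_add, map_neg,
    tensorRe_tmul_lie, tensorIm_tmul_lie, Complex.mul_re, Complex.mul_im, Complex.I_re,
    Complex.I_im, Complex.re_ofNat, Complex.im_ofNat, Complex.one_re, Complex.one_im, mul_zero,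
    mul_one, zero_smul, one_smul, sub_zero, zero_sub, add_zero, zero_add, map_zero] at hh1 hh2 he1 he2 hf1 hf2 hhf1 hhf2 hef1 hef2
  set a := tensorRe v with ha
  set b := tensorIm v with hb'
  -- Real and imaginary parts of `F v` are combinations of `⁅x₂, a⁆`, `⁅x₂, b⁆` and their `x₃`
  -- counterparts, which `E v = 0` identifies. So `a, b, p, q` carry the whole action.
  obtain ⟨p, hp⟩ : ∃ p, ⁅x₂, a⁆ = -(1 / 2 : ℝ) • p := ⟨(-2 : ℝ) • ⁅x₂, a⁆, by module⟩
  obtain ⟨q, hq⟩ : ∃ q, ⁅x₂, b⁆ = -(1 / 2 : ℝ) • q := ⟨(-2 : ℝ) • ⁅x₂, b⁆, by module⟩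
  have hp' : ⁅x₃, b⁆ = -(1 / 2 : ℝ) • p := by
    rw [← hp]; exact (add_neg_eq_zero.mp he1).symm
  have hq' : ⁅x₃, a⁆ = (1 / 2 : ℝ) • q := by
    rw [eq_neg_of_add_eq_zero_right he2, hq]; module
  simp only [hp, hq, hp', hq', lie_smul, lie_neg] at hf1 hf2 hhf1 hhf2 hef1 hef2
  have hQ : IsQuaternionicBasis x₁ x₂ x₃ a b p q :=
    { lie_1_a := by rw [← hh2]; module
      lie_1_b := by rw [← hh1]; module
      lie_1_p := by linear_combination (norm := module) (1 / 2 : ℝ) • hhf2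
      lie_1_q := by linear_combination (norm := module) (-1 / 2 : ℝ) • hhf1
      lie_2_a := hp
      lie_2_b := hq
      lie_2_p := by linear_combination (norm := module) (1 / 2 : ℝ) • hef1 - (1 / 2 : ℝ) • hf1
      lie_2_q := by linear_combination (norm := module) (1 / 2 : ℝ) • hef2 - (1 / 2 : ℝ) • hf2
      lie_3_a := hq'
      lie_3_b := hp'
      lie_3_p := by linear_combination (norm := module) (1 / 2 : ℝ) • hef2 + (1 / 2 : ℝ) • hf2
      lie_3_q := by linear_combination (norm := module) (-1 / 2 : ℝ) • hef1 - (1 / 2 : ℝ) • hf1 }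
  have ha0 : a ≠ 0 := by
    intro h
    have h2 : b = 0 := by rw [← hh2, h, lie_zero, smul_zero]
    exact P.ne_zero (by rw [hv, h, h2]; simp)
  have hli := hQ.linearIndependent ha0
  have h4 : finrank ℝ M = 4 := by
    have := hli.fintype_card_le_finrank
    rw [Fintype.card_fin] at this
    omega
  refine ⟨h4, a, b, p, q, hQ, fun m => ?_⟩
  have hsp := hli.span_eq_top_of_card_eq_finrank' (by simp [h4])
  obtain ⟨c, hc⟩ := (Submodule.mem_span_range_iff_exists_fun ℝ).mp
      (hsp ▸ Submodule.mem_top : m ∈ Submodule.span ℝ _)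
  refine ⟨c 0, c 1, c 2, c 3, ?_⟩
  rw [← hc, Fin.sum_univ_four]
  rfl

end SoThreeModules

/-! ### Isomorphisms with an algebra given by a table. -/

section Tables

variable {g : Type*} [LieRing g] [LieAlgebra ℝ g]

/-- The linear combination of eight vectors with given coefficients. -/
noncomputable def comb (v : Fin 8 → g) : (Fin 8 → ℝ) →ₗ[ℝ] g := Fintype.linearCombination ℝ v

theorem comb_apply (v : Fin 8 → g) (x : Fin 8 → ℝ) : comb v x = ∑ i, x i • v i :=
  Fintype.linearCombination_apply ℝ v x

theorem comb_e (v : Fin 8 → g) (k : Fin 8) : comb v (e ((k : ℕ) + 1)) = v k := by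
  rw [comb_apply, Finset.sum_eq_single k]
  · simp [e]
  · intro j _ hj
    have : (j : ℕ) ≠ k := fun h => hj (Fin.ext h)
    simp [e, this]
  · simp

theorem comb_e_one (v : Fin 8 → g) : comb v (e 1) = v 0 := comb_e v 0
theorem comb_e_two (v : Fin 8 → g) : comb v (e 2) = v 1 := comb_e v 1
theorem comb_e_three (v : Fin 8 → g) : comb v (e 3) = v 2 := comb_e v 2
theorem comb_e_four (v : Fin 8 → g) : comb v (e 4) = v 3 := comb_e v 3
theorem comb_e_five (v : Fin 8 → g) : comb v (e 5) = v 4 := comb_e v 4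
theorem comb_e_six (v : Fin 8 → g) : comb v (e 6) = v 5 := comb_e v 5
theorem comb_e_seven (v : Fin 8 → g) : comb v (e 7) = v 6 := comb_e v 6

/-- Eight vectors which form a basis of an eight-dimensional Lie algebra. -/
structure IsFrame (v : Fin 8 → g) : Prop where
  finrank_eq : finrank ℝ g = 8
  spans : ∀ x, ∃ c : Fin 8 → ℝ, x = comb v c

/-- The basis given by a frame. -/
noncomputable def IsFrame.basis {v : Fin 8 → g} (hv : IsFrame v) : Basis (Fin 8) ℝ g :=
  basisOfTopLeSpanOfCardEqFinrank v
    (fun x _ => (Submodule.mem_span_range_iff_exists_fun ℝ).mpr (by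
      obtain ⟨c, hc⟩ := hv.spans x
      exact ⟨c, by rw [hc, comb_apply]⟩)) (by rw [hv.finrank_eq, Fintype.card_fin])

theorem IsFrame.basis_apply {v : Fin 8 → g} (hv : IsFrame v) (i : Fin 8) : hv.basis i = v i := by
  rw [IsFrame.basis, coe_basisOfTopLeSpanOfCardEqFinrank]

theorem IsFrame.basis_equivFun_symm {v : Fin 8 → g} (hv : IsFrame v) (x : Fin 8 → ℝ) :
    hv.basis.equivFun.symm x = comb v x := by
  rw [Basis.equivFun_symm_apply, comb_apply]
  simp only [hv.basis_apply]

theorem IsFrame.trace_eq {v : Fin 8 → g} (hv : IsFrame v) (f : g →ₗ[ℝ] g)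
    (A : Fin 8 → Fin 8 → ℝ) (h : ∀ i, f (v i) = comb v (A i)) :
    LinearMap.trace ℝ g f = ∑ i, A i i := by
  rw [LinearMap.trace_eq_matrix_trace ℝ hv.basis f, Matrix.trace]
  refine Finset.sum_congr rfl fun i _ => ?_
  rw [Matrix.diag_apply, LinearMap.toMatrix_apply, hv.basis_apply, h, ← hv.basis_equivFun_symm,
    ← Basis.equivFun_apply, LinearEquiv.apply_symm_apply]

theorem IsFrame.comb_injective {v : Fin 8 → g} (hv : IsFrame v) : Function.Injective (comb v) := by
  intro x y hxy
  rw [← hv.basis_equivFun_symm, ← hv.basis_equivFun_symm] at hxy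
  exact hv.basis.equivFun.symm.injective hxy

theorem tableBracket_e_of_ne (T : Table) (v : Fin 8 → g)
    (h : ∀ i j : Fin 8, i < j → ⁅v i, v j⁆ = comb v (T.c ((i : ℕ) + 1) ((j : ℕ) + 1)))
    (i j : Fin 8) :
    comb v (tableBracket T.c (e ((i : ℕ) + 1)) (e ((j : ℕ) + 1))) = ⁅v i, v j⁆ := by
  rcases lt_trichotomy i j with hij | rfl | hij
  · rw [tableBracket_e _ _ _ hij, h i j hij]
  · rw [tableBracket_self, lie_self, map_zero]
  · have hskew (x y : Fin 8 → ℝ) : tableBracket T.c x y = -tableBracket T.c y x :=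
      (lie_skew (show T.Carrier from x) (show T.Carrier from y)).symm
    rw [hskew, map_neg, tableBracket_e _ _ _ hij, ← h j i hij, lie_skew]

/-- A Lie algebra with a basis satisfying the relations of a table is isomorphic to it. -/
theorem IsFrame.nonempty_lieEquiv {v : Fin 8 → g} (hv : IsFrame v) (T : Table)
    (h : ∀ i j : Fin 8, i < j → ⁅v i, v j⁆ = comb v (T.c ((i : ℕ) + 1) ((j : ℕ) + 1))) :
    Nonempty (g ≃ₗ⁅ℝ⁆ T) := by
  let φ : T.Carrier ≃ₗ[ℝ] g := hv.basis.equivFun.symm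
  have hφ (x : Fin 8 → ℝ) : φ x = comb v x := hv.basis_equivFun_symm x
  let B₁ : T.Carrier →ₗ[ℝ] T.Carrier →ₗ[ℝ] g :=
    (LieModule.toEnd ℝ g g : g →ₗ[ℝ] Module.End ℝ g).compl₁₂ φ.toLinearMap φ.toLinearMap
  let B₂ : T.Carrier →ₗ[ℝ] T.Carrier →ₗ[ℝ] g :=
    (LieModule.toEnd ℝ T T : T →ₗ[ℝ] Module.End ℝ T).compr₂ φ.toLinearMap
  have hB : B₁ = B₂ := by
    refine LinearMap.ext_basis (Pi.basisFun ℝ (Fin 8)) (Pi.basisFun ℝ (Fin 8)) fun i j => ?_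
    have he (k : Fin 8) : Pi.basisFun ℝ (Fin 8) k = e ((k : ℕ) + 1) := by
      ext l
      rw [Pi.basisFun_apply, Pi.single_apply]
      simp [e, Fin.ext_iff]
    rw [he, he]
    change ⁅φ (e _), φ (e _)⁆ = φ (tableBracket T.c (e _) (e _))
    rw [hφ, hφ, hφ, comb_e, comb_e, tableBracket_e_of_ne T v h]
  refine ⟨LieEquiv.symm { φ with map_lie' := fun {x y} => ?_ }⟩
  exact (LinearMap.congr_fun (LinearMap.congr_fun hB x) y).symm

end Tables

/-! ### Frames adapted to the Levi decomposition. -/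

section Split

variable {g : Type*} [LieRing g] [LieAlgebra ℝ g]

/-- A frame of an eight-dimensional Lie algebra adapted to a Levi decomposition: the first three
vectors span the Levi factor, the next four the unimodular part `n` of the radical. -/
structure IsSplit (n : LieIdeal ℝ g) (x₁ x₂ x₃ y₁ y₂ y₃ y₄ t : g) : Prop where
  frame : IsFrame ![x₁, x₂, x₃, y₁, y₂, y₃, y₄, t]
  lie_1_t : ⁅x₁, t⁆ = 0
  lie_2_t : ⁅x₂, t⁆ = 0
  lie_3_t : ⁅x₃, t⁆ = 0
  trace_t : traceAd g t ≠ 0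
  mem_iff : ∀ x, x ∈ n ↔ ∃ a b c d : ℝ, x = a • y₁ + b • y₂ + c • y₃ + d • y₄

theorem IsFrame.spans_eight {v : Fin 8 → g} (hv : IsFrame v) (x : g) :
    ∃ c₀ c₁ c₂ c₃ c₄ c₅ c₆ c₇ : ℝ, x = c₀ • v 0 + c₁ • v 1 + c₂ • v 2 + c₃ • v 3 + c₄ • v 4 +
      c₅ • v 5 + c₆ • v 6 + c₇ • v 7 := by
  obtain ⟨c, rfl⟩ := hv.spans x
  exact ⟨c 0, c 1, c 2, c 3, c 4, c 5, c 6, c 7, by rw [comb_apply, Fin.sum_univ_eight]⟩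

theorem isFrame_of_spans_eight {x₁ x₂ x₃ y₁ y₂ y₃ y₄ t : g} (hd : finrank ℝ g = 8)
    (h : ∀ x : g, ∃ c₀ c₁ c₂ c₃ c₄ c₅ c₆ c₇ : ℝ, x = c₀ • x₁ + c₁ • x₂ + c₂ • x₃ + c₃ • y₁ +
      c₄ • y₂ + c₅ • y₃ + c₆ • y₄ + c₇ • t) : IsFrame ![x₁, x₂, x₃, y₁, y₂, y₃, y₄, t] where
  finrank_eq := hd
  spans x := by
    obtain ⟨c₀, c₁, c₂, c₃, c₄, c₅, c₆, c₇, rfl⟩ := h x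
    refine ⟨![c₀, c₁, c₂, c₃, c₄, c₅, c₆, c₇], ?_⟩
    rw [comb_apply, Fin.sum_univ_eight]
    rfl

theorem IsSplit.spans {n : LieIdeal ℝ g} {x₁ x₂ x₃ y₁ y₂ y₃ y₄ t : g}
    (h : IsSplit n x₁ x₂ x₃ y₁ y₂ y₃ y₄ t) (x : g) :
    ∃ c₀ c₁ c₂ c₃ c₄ c₅ c₆ c₇ : ℝ, x = c₀ • x₁ + c₁ • x₂ + c₂ • x₃ + c₃ • y₁ +
      c₄ • y₂ + c₅ • y₃ + c₆ • y₄ + c₇ • t := h.frame.spans_eight x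

theorem IsSplit.mem {n : LieIdeal ℝ g} {x₁ x₂ x₃ y₁ y₂ y₃ y₄ t : g}
    (h : IsSplit n x₁ x₂ x₃ y₁ y₂ y₃ y₄ t) :
    y₁ ∈ n ∧ y₂ ∈ n ∧ y₃ ∈ n ∧ y₄ ∈ n :=
  ⟨(h.mem_iff _).mpr ⟨1, 0, 0, 0, by module⟩, (h.mem_iff _).mpr ⟨0, 1, 0, 0, by module⟩,
    (h.mem_iff _).mpr ⟨0, 0, 1, 0, by module⟩, (h.mem_iff _).mpr ⟨0, 0, 0, 1, by module⟩⟩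

variable {s : LieSubalgebra ℝ g} {n : LieIdeal ℝ g} {t : g}

theorem LeviData.isSplit (h : LeviData s n t) (hdim : finrank ℝ g = 8) {x₁ x₂ x₃ : s}
    (hs : ∀ x : s, ∃ a b c : ℝ, x = a • x₁ + b • x₂ + c • x₃) {y₁ y₂ y₃ y₄ : g}
    (hn : ∀ x, x ∈ n ↔ ∃ a b c d : ℝ, x = a • y₁ + b • y₂ + c • y₃ + d • y₄) :
    IsSplit n (x₁ : g) x₂ x₃ y₁ y₂ y₃ y₄ t where
  frame := isFrame_of_spans_eight hdim fun x => by
    obtain ⟨a, ha, b, hb, c, rfl⟩ := h.spans x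
    obtain ⟨a₁, a₂, a₃, e⟩ := hs ⟨a, ha⟩
    obtain ⟨b₁, b₂, b₃, b₄, rfl⟩ := (hn b).mp hb
    refine ⟨a₁, a₂, a₃, b₁, b₂, b₃, b₄, c, ?_⟩
    have e' : a = a₁ • (x₁ : g) + a₂ • (x₂ : g) + a₃ • (x₃ : g) := congrArg Subtype.val e
    rw [e']
    module
  lie_1_t := h.lie_t _ x₁.2
  lie_2_t := h.lie_t _ x₂.2
  lie_3_t := h.lie_t _ x₃.2
  trace_t := h.trace_t
  mem_iff := hn

/-- Invariants and their complement in the unimodular part of the radical. -/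
theorem LeviData.exists_decomposition [FiniteDimensional ℝ g] (h : LeviData s n t)
    (hg : IsIndecomposable g) (hdim : finrank ℝ g = 8) {ω : LinearMap.BilinForm ℝ g}
    (hω : IsSymplectic ω) : ∃ V W : LieSubmodule ℝ s g, V ≤ idealRestrict s n ∧
      W ≤ idealRestrict s n ∧ (∀ m ∈ W, (∀ x : s, ⁅x, m⁆ = 0) → m = 0) ∧
      (∀ m, m ∈ V ↔ m ∈ n ∧ ∀ x ∈ s, ⁅x, m⁆ = 0) ∧ V ⊔ W = idealRestrict s n ∧
      finrank ℝ V + finrank ℝ W = 4 ∧ (finrank ℝ W = 2 ∨ finrank ℝ W = 4) := by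
  have hsK := h.killing
  obtain ⟨hs3, hn4⟩ := h.finrank_eq_three hg hdim
  let V : LieSubmodule ℝ s g := idealRestrict s n ⊓ LieModule.maxTrivSubmodule ℝ s g
  have hV : ∀ m, m ∈ V ↔ m ∈ n ∧ ∀ x ∈ s, ⁅x, m⁆ = 0 := fun m => by
    rw [LieSubmodule.mem_inf, LieModule.mem_maxTrivSubmodule]
    exact and_congr Iff.rfl ⟨fun h x hx => h ⟨x, hx⟩, fun h x => h x x.2⟩
  have hVn : V ≤ idealRestrict s n := inf_le_left
  obtain ⟨W, hWn, hVW, hVW'⟩ := exists_relative_compl_lieSubmodule (K := ℝ) (L := s) hVn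
  have hW : ∀ m ∈ W, (∀ x : s, ⁅x, m⁆ = 0) → m = 0 := fun m hm hx => by
    have : m ∈ V ⊓ W := ⟨(hV m).mpr ⟨hWn hm, fun x hxs => hx ⟨x, hxs⟩⟩, hm⟩
    rw [hVW'] at this
    simpa using this
  have hsum : finrank ℝ V + finrank ℝ W = 4 := by
    rw [finrank_add_finrank_of_compl hVW hVW']
    exact hn4
  refine ⟨V, W, hVn, hWn, hW, hV, hVW, hsum, ?_⟩
  have h1 := finrank_lieSubmodule_ne_one (K := ℝ) (L := s) (W := W) hW
  have h3 := h.finrank_ne_three hω hn4 hWn hW hV hVW hVW'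
  have h0 : finrank ℝ W ≠ 0 := by
    intro h0
    have hWb : W.toSubmodule = ⊥ := Submodule.finrank_eq_zero.mp h0
    have hWb' : W = ⊥ := (LieSubmodule.toSubmodule_eq_bot W).mp hWb
    rw [hWb', sup_bot_eq] at hVW
    obtain ⟨x, hx, y, hy, hxy⟩ := h.exists_lie_ne_zero hg
    have hyV : y ∈ V := by rw [hVW]; exact hy
    exact hxy (((hV y).mp hyV).2 x hx)
  omega

theorem IsStandardPair.coe {W : LieSubmodule ℝ s g} {h e f : s} {v w : W}
    (hp : IsStandardPair h e f v w) : IsStandardPair (h : g) (e : g) (f : g) (v : g) (w : g) :=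
  ⟨congrArg Subtype.val hp.1, congrArg Subtype.val hp.2, congrArg Subtype.val hp.3,
    congrArg Subtype.val hp.4, congrArg Subtype.val hp.5, congrArg Subtype.val hp.6⟩

theorem IsCubicBasis.coe {W : LieSubmodule ℝ s g} {h e f : s} {v₁ v₂ v₃ v₄ : W}
    (hp : IsCubicBasis h e f v₁ v₂ v₃ v₄) :
    IsCubicBasis (h : g) (e : g) (f : g) (v₁ : g) (v₂ : g) (v₃ : g) (v₄ : g) :=
  ⟨congrArg Subtype.val hp.1, congrArg Subtype.val hp.2, congrArg Subtype.val hp.3,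
    congrArg Subtype.val hp.4, congrArg Subtype.val hp.5, congrArg Subtype.val hp.6,
    congrArg Subtype.val hp.7, congrArg Subtype.val hp.8, congrArg Subtype.val hp.9,
    congrArg Subtype.val hp.10, congrArg Subtype.val hp.11, congrArg Subtype.val hp.12⟩

theorem IsQuaternionicBasis.coe {W : LieSubmodule ℝ s g} {h e f : s} {v₁ v₂ v₃ v₄ : W}
    (hp : IsQuaternionicBasis h e f v₁ v₂ v₃ v₄) :
    IsQuaternionicBasis (h : g) (e : g) (f : g) (v₁ : g) (v₂ : g) (v₃ : g) (v₄ : g) :=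
  ⟨congrArg Subtype.val hp.1, congrArg Subtype.val hp.2, congrArg Subtype.val hp.3,
    congrArg Subtype.val hp.4, congrArg Subtype.val hp.5, congrArg Subtype.val hp.6,
    congrArg Subtype.val hp.7, congrArg Subtype.val hp.8, congrArg Subtype.val hp.9,
    congrArg Subtype.val hp.10, congrArg Subtype.val hp.11, congrArg Subtype.val hp.12⟩

/-- The relations of the standard basis of `sl(2, ℝ)`. -/
structure IsSl2Relations (h e f : g) : Prop where
  lie_h_e : ⁅h, e⁆ = (2 : ℝ) • e
  lie_h_f : ⁅h, f⁆ = -(2 : ℝ) • f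
  lie_e_f : ⁅e, f⁆ = h

/-- The relations of the standard basis of `so(3)`. -/
structure IsSo3Relations (x₁ x₂ x₃ : g) : Prop where
  lie_1_2 : ⁅x₁, x₂⁆ = x₃
  lie_1_3 : ⁅x₁, x₃⁆ = -x₂
  lie_2_3 : ⁅x₂, x₃⁆ = x₁

/-- The four possibilities for the Levi factor and its action on the radical. -/
theorem exists_isSplit (hdim : finrank ℝ g = 8) (hg : IsIndecomposable g)
    (hsol : ¬ LieAlgebra.IsSolvable g) {ω : LinearMap.BilinForm ℝ g} (hω : IsSymplectic ω) :
    ∃ (n : LieIdeal ℝ g) (x₁ x₂ x₃ y₁ y₂ y₃ y₄ t : g), IsSplit n x₁ x₂ x₃ y₁ y₂ y₃ y₄ t ∧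
      ((IsSl2Relations x₁ x₂ x₃ ∧
        ((IsStandardPair x₁ x₂ x₃ y₁ y₂ ∧ (⁅x₁, y₃⁆ = 0 ∧ ⁅x₂, y₃⁆ = 0 ∧ ⁅x₃, y₃⁆ = 0) ∧
            ⁅x₁, y₄⁆ = 0 ∧ ⁅x₂, y₄⁆ = 0 ∧ ⁅x₃, y₄⁆ = 0) ∨
          (IsStandardPair x₁ x₂ x₃ y₁ y₂ ∧ IsStandardPair x₁ x₂ x₃ y₃ y₄) ∨
          IsCubicBasis x₁ x₂ x₃ y₁ y₂ y₃ y₄)) ∨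
      (IsSo3Relations x₁ x₂ x₃ ∧ IsQuaternionicBasis x₁ x₂ x₃ y₁ y₂ y₃ y₄)) := by
  have : FiniteDimensional ℝ g := FiniteDimensional.of_finrank_pos (by omega)
  obtain ⟨s, n, t, h⟩ := exists_leviData hsol hω
  have hsK := h.killing
  obtain ⟨hs3, hn4⟩ := h.finrank_eq_three hg hdim
  obtain ⟨V, W, hVn, hWn, hW, hV, hVW, hsum, hWd⟩ := h.exists_decomposition hg hdim hω
  have hW' : ∀ m : W, (∀ x : s, ⁅x, m⁆ = 0) → m = 0 := fun m hm =>
    Subtype.ext (hW m m.2 fun x => congrArg Subtype.val (hm x))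
  have hmem4 (h4 : finrank ℝ W = 4) (x : g) : x ∈ n ↔ x ∈ W := by
    have hVb : V.toSubmodule = ⊥ :=
      Submodule.finrank_eq_zero.mp (show finrank ℝ V = 0 by omega)
    have hVb' : V = ⊥ := (LieSubmodule.toSubmodule_eq_bot V).mp hVb
    rw [hVb', bot_sup_eq] at hVW
    rw [hVW]
    exact Iff.rfl
  have hspan4 {y₁ y₂ y₃ y₄ : W} (h4 : finrank ℝ W = 4)
      (hy : ∀ m : W, ∃ a b c d : ℝ, m = a • y₁ + b • y₂ + c • y₃ + d • y₄) (x : g) :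
      x ∈ n ↔ ∃ a b c d : ℝ, x = a • (y₁ : g) + b • (y₂ : g) + c • (y₃ : g) + d • (y₄ : g) := by
    rw [hmem4 h4]
    constructor
    · intro hx
      obtain ⟨a, b, c, d, e⟩ := hy ⟨x, hx⟩
      exact ⟨a, b, c, d, congrArg Subtype.val e⟩
    · rintro ⟨a, b, c, d, rfl⟩
      exact (a • y₁ + b • y₂ + c • y₃ + d • y₄).2
  rcases exists_isSl2Basis_or_isSo3Basis hs3 with ⟨x₁, x₂, x₃, hb⟩ | ⟨x₁, x₂, x₃, hb⟩
  · have hr : IsSl2Relations (x₁ : g) (x₂ : g) (x₃ : g) :=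
      ⟨congrArg Subtype.val hb.1, congrArg Subtype.val hb.2, congrArg Subtype.val hb.3⟩
    have h0 : x₁ ≠ 0 := by
      intro h0
      have h1 := hb.lie_h_e
      have h2 := hb.lie_h_f
      rw [h0, zero_lie] at h1 h2
      have h1' : x₂ = 0 := (smul_eq_zero.mp h1.symm).resolve_left (by norm_num)
      have h2' : x₃ = 0 := (smul_eq_zero.mp h2.symm).resolve_left (by norm_num)
      have hn := h.nontrivial
      obtain ⟨x, hx⟩ := exists_ne (0 : s)
      obtain ⟨a, b, c, rfl⟩ := hb.spans x
      rw [h0, h1', h2'] at hx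
      simp at hx
    rcases hWd with h2 | h4
    · obtain ⟨v, w, hp, hvw⟩ := exists_isStandardPair hb h0 hW' h2
      have hV2 : finrank ℝ V = 2 := by omega
      let k := Module.finBasisOfFinrankEq ℝ V hV2
      have hk (i : Fin 2) := ((hV (k i)).mp (k i).2).2
      refine ⟨n, x₁, x₂, x₃, v, w, k 0, k 1, t, h.isSplit hdim hb.spans fun x => ?_,
        Or.inl ⟨hr, Or.inl ⟨hp.coe, ⟨hk 0 _ x₁.2, hk 0 _ x₂.2, hk 0 _ x₃.2⟩,
          hk 1 _ x₁.2, hk 1 _ x₂.2, hk 1 _ x₃.2⟩⟩⟩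
      constructor
      · intro hx
        have hx' : x ∈ V ⊔ W := by rw [hVW]; exact hx
        obtain ⟨a, ha, b, hb, rfl⟩ := (LieSubmodule.mem_sup _ _ x).mp hx'
        obtain ⟨p, q, e⟩ := hvw ⟨b, hb⟩
        have e' : b = p • (v : g) + q • (w : g) := congrArg Subtype.val e
        have e2 := k.sum_repr ⟨a, ha⟩
        rw [Fin.sum_univ_two] at e2
        have e2' : k.repr ⟨a, ha⟩ 0 • (k 0 : g) + k.repr ⟨a, ha⟩ 1 • (k 1 : g) = a :=
          congrArg Subtype.val e2
        refine ⟨p, q, k.repr ⟨a, ha⟩ 0, k.repr ⟨a, ha⟩ 1, ?_⟩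
        rw [e']
        conv_lhs => rw [← e2']
        abel
      · rintro ⟨a, b, c, d, rfl⟩
        exact n.add_mem (n.add_mem (n.add_mem (n.smul_mem _ (hWn v.2)) (n.smul_mem _ (hWn w.2)))
          (n.smul_mem _ (hVn (k 0).2))) (n.smul_mem _ (hVn (k 1).2))
    · rcases exists_isStandardPair_or_isCubicBasis hb h0 hW' h4 with
        ⟨v, w, v', w', hp, hp', -, hsp⟩ | ⟨v₁, v₂, v₃, v₄, hc, -, hsp⟩
      · exact ⟨n, x₁, x₂, x₃, v, w, v', w', t, h.isSplit hdim hb.spans (hspan4 h4 hsp),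
          Or.inl ⟨hr, Or.inr (Or.inl ⟨hp.coe, hp'.coe⟩)⟩⟩
      · exact ⟨n, x₁, x₂, x₃, v₁, v₂, v₃, v₄, t, h.isSplit hdim hb.spans (hspan4 h4 hsp),
          Or.inl ⟨hr, Or.inr (Or.inr hc.coe)⟩⟩
  · have h0 : x₁ ≠ 0 := by
      intro h0
      have h1 := hb.lie_1_2
      have h2 := hb.lie_1_3
      rw [h0, zero_lie] at h1 h2
      have hn := h.nontrivial
      obtain ⟨x, hx⟩ := exists_ne (0 : s)
      obtain ⟨a, b, c, rfl⟩ := hb.spans x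
      rw [h0, ← h1, zero_eq_neg.mp h2] at hx
      simp at hx
    obtain ⟨h4, a, b, p, q, hq, hsp⟩ := hb.exists_isQuaternionicBasis h0 hW' hWd
    exact ⟨n, x₁, x₂, x₃, a, b, p, q, t, h.isSplit hdim hb.spans (hspan4 h4 hsp),
      Or.inr ⟨⟨congrArg Subtype.val hb.1, congrArg Subtype.val hb.2, congrArg Subtype.val hb.3⟩,
        hq.coe⟩⟩

end Split

/-! ### Coordinates in an adapted frame, and the four-dimensional irreducible `sl(2)`-module. -/

section Split

variable {g : Type*} [LieRing g] [LieAlgebra ℝ g] {n : LieIdeal ℝ g}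
  {x₁ x₂ x₃ y₁ y₂ y₃ y₄ t : g}

theorem IsFrame.eq_zero_of_comb_eq_zero {v : Fin 8 → g} (hv : IsFrame v) {c : Fin 8 → ℝ}
    (h : comb v c = 0) : c = 0 := hv.comb_injective (h.trans (map_zero _).symm)

theorem IsSplit.eq_zero (h : IsSplit n x₁ x₂ x₃ y₁ y₂ y₃ y₄ t) {a b c d : ℝ}
    (h0 : a • y₁ + b • y₂ + c • y₃ + d • y₄ = 0) : a = 0 ∧ b = 0 ∧ c = 0 ∧ d = 0 := by
  have h1 := h.frame.eq_zero_of_comb_eq_zero (c := ![0, 0, 0, a, b, c, d, 0]) (by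
    rw [comb_apply, Fin.sum_univ_eight]
    simpa using h0)
  exact ⟨congrFun h1 3, congrFun h1 4, congrFun h1 5, congrFun h1 6⟩

theorem IsSplit.lie_mem (h : IsSplit n x₁ x₂ x₃ y₁ y₂ y₃ y₄ t) {y : g} (hy : y ∈ n) (x : g) :
    ∃ a b c d : ℝ, ⁅y, x⁆ = a • y₁ + b • y₂ + c • y₃ + d • y₄ :=
  (h.mem_iff _).mp (lie_mem_left ℝ g n y x hy)

/-- The rows of `A` describe `-ad t` on `n`, and `ad t` kills the Levi factor and `t`, so the trace
of `A` is `-traceAd g t`. -/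
theorem IsSplit.trace_ne_zero (h : IsSplit n x₁ x₂ x₃ y₁ y₂ y₃ y₄ t) (A : Fin 4 → Fin 4 → ℝ)
    (h₁ : ⁅y₁, t⁆ = A 0 0 • y₁ + A 0 1 • y₂ + A 0 2 • y₃ + A 0 3 • y₄)
    (h₂ : ⁅y₂, t⁆ = A 1 0 • y₁ + A 1 1 • y₂ + A 1 2 • y₃ + A 1 3 • y₄)
    (h₃ : ⁅y₃, t⁆ = A 2 0 • y₁ + A 2 1 • y₂ + A 2 2 • y₃ + A 2 3 • y₄)
    (h₄ : ⁅y₄, t⁆ = A 3 0 • y₁ + A 3 1 • y₂ + A 3 2 • y₃ + A 3 3 • y₄) :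
    A 0 0 + A 1 1 + A 2 2 + A 3 3 ≠ 0 := by
  have key := h.frame.trace_eq (-(LieAlgebra.ad ℝ g t : g →ₗ[ℝ] g))
    ![0, 0, 0, ![0, 0, 0, A 0 0, A 0 1, A 0 2, A 0 3, 0], ![0, 0, 0, A 1 0, A 1 1, A 1 2, A 1 3, 0],
      ![0, 0, 0, A 2 0, A 2 1, A 2 2, A 2 3, 0], ![0, 0, 0, A 3 0, A 3 1, A 3 2, A 3 3, 0], 0] (by
    intro i
    rw [LinearMap.neg_apply, LieAlgebra.ad_apply, lie_skew]
    fin_cases i <;> simp [comb_apply, Fin.sum_univ_eight, h.lie_1_t, h.lie_2_t, h.lie_3_t, h₁, h₂,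
      h₃, h₄])
  rw [map_neg] at key
  intro h0
  apply h.trace_t
  rw [traceAd_apply]
  rw [Fin.sum_univ_eight] at key
  simp at key
  linarith

theorem IsSplit.lie_eq_zero (h : IsSplit n x₁ x₂ x₃ y₁ y₂ y₃ y₄ t)
    (h12 : ⁅y₁, y₂⁆ = 0) (h13 : ⁅y₁, y₃⁆ = 0) (h14 : ⁅y₁, y₄⁆ = 0) (h23 : ⁅y₂, y₃⁆ = 0)
    (h24 : ⁅y₂, y₄⁆ = 0) (h34 : ⁅y₃, y₄⁆ = 0) : ∀ x ∈ n, ∀ y ∈ n, ⁅x, y⁆ = 0 := by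
  intro x hx y hy
  obtain ⟨a, b, c, d, rfl⟩ := (h.mem_iff x).mp hx
  obtain ⟨a', b', c', d', rfl⟩ := (h.mem_iff y).mp hy
  have h21 : ⁅y₂, y₁⁆ = 0 := by rw [← lie_skew, h12, neg_zero]
  have h31 : ⁅y₃, y₁⁆ = 0 := by rw [← lie_skew, h13, neg_zero]
  have h41 : ⁅y₄, y₁⁆ = 0 := by rw [← lie_skew, h14, neg_zero]
  have h32 : ⁅y₃, y₂⁆ = 0 := by rw [← lie_skew, h23, neg_zero]
  have h42 : ⁅y₄, y₂⁆ = 0 := by rw [← lie_skew, h24, neg_zero]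
  have h43 : ⁅y₄, y₃⁆ = 0 := by rw [← lie_skew, h34, neg_zero]
  simp [h12, h13, h14, h23, h24, h34, h21, h31, h41, h32, h42, h43]

theorem IsSplit.lie_lie_t (h : IsSplit n x₁ x₂ x₃ y₁ y₂ y₃ y₄ t) (y : g) :
    ⁅⁅x₁, y⁆, t⁆ = ⁅x₁, ⁅y, t⁆⁆ ∧ ⁅⁅x₂, y⁆, t⁆ = ⁅x₂, ⁅y, t⁆⁆ ∧ ⁅⁅x₃, y⁆, t⁆ = ⁅x₃, ⁅y, t⁆⁆ := by
  simp only [lie_lie, h.lie_1_t, h.lie_2_t, h.lie_3_t, lie_zero, sub_zero, and_self]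

/-- Rescaling the last vector of a frame. -/
theorem IsSplit.smul_frame (h : IsSplit n x₁ x₂ x₃ y₁ y₂ y₃ y₄ t) {c : ℝ} (hc : c ≠ 0) :
    IsFrame ![x₁, x₂, x₃, y₁, y₂, y₃, y₄, c⁻¹ • t] :=
  isFrame_of_spans_eight h.frame.finrank_eq fun x => by
    obtain ⟨c₀, c₁, c₂, c₃, c₄, c₅, c₆, c₇, rfl⟩ := h.spans x
    refine ⟨c₀, c₁, c₂, c₃, c₄, c₅, c₆, c₇ * c, ?_⟩
    rw [smul_smul, mul_assoc, mul_inv_cancel₀ hc, mul_one]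

section Cubic

/-- Weights of `x₁` on `n` are odd, while a bracket of two weight vectors has even weight. -/
theorem IsCubicBasis.lie_eq_zero (h : IsSplit n x₁ x₂ x₃ y₁ y₂ y₃ y₄ t)
    (hc : IsCubicBasis x₁ x₂ x₃ y₁ y₂ y₃ y₄) : ∀ x ∈ n, ∀ y ∈ n, ⁅x, y⁆ = 0 := by
  have key (w : g) (hw : w ∈ n) (μ : ℝ) (hμ : ⁅x₁, w⁆ = μ • w) (h3 : 3 - μ ≠ 0) (h1 : 1 - μ ≠ 0)
      (h1' : -1 - μ ≠ 0) (h3' : -3 - μ ≠ 0) : w = 0 := by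
    obtain ⟨a, b, c, d, rfl⟩ := (h.mem_iff w).mp hw
    simp only [lie_add, lie_smul, hc.lie_h_1, hc.lie_h_2, hc.lie_h_3, hc.lie_h_4] at hμ
    obtain ⟨e1, e2, e3, e4⟩ := h.eq_zero (a := (3 - μ) * a) (b := (1 - μ) * b) (c := (-1 - μ) * c)
      (d := (-3 - μ) * d) (by rw [← sub_eq_zero] at hμ; rw [← hμ]; module)
    rw [(mul_eq_zero.mp e1).resolve_left h3, (mul_eq_zero.mp e2).resolve_left h1,
      (mul_eq_zero.mp e3).resolve_left h1', (mul_eq_zero.mp e4).resolve_left h3']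
    simp
  obtain ⟨m1, m2, m3, m4⟩ := h.mem
  have hl {x y : g} (hy : y ∈ n) : ⁅x, y⁆ ∈ n := lie_mem_right ℝ g n x y hy
  refine h.lie_eq_zero (key _ (hl m2) 4 ?_ ?_ ?_ ?_ ?_) (key _ (hl m3) 2 ?_ ?_ ?_ ?_ ?_)
    (key _ (hl m4) 0 ?_ ?_ ?_ ?_ ?_) (key _ (hl m3) 0 ?_ ?_ ?_ ?_ ?_)
    (key _ (hl m4) (-2) ?_ ?_ ?_ ?_ ?_) (key _ (hl m4) (-4) ?_ ?_ ?_ ?_ ?_)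
  all_goals first
    | (simp only [leibniz_lie x₁, hc.lie_h_1, hc.lie_h_2, hc.lie_h_3, hc.lie_h_4, smul_lie,
        lie_smul, neg_lie, lie_neg]; module)
    | norm_num

theorem IsCubicBasis.nonempty_lieEquiv (hs : IsSl2Relations x₁ x₂ x₃)
    (h : IsSplit n x₁ x₂ x₃ y₁ y₂ y₃ y₄ t) (hc : IsCubicBasis x₁ x₂ x₃ y₁ y₂ y₃ y₄) :
    Nonempty (g ≃ₗ⁅ℝ⁆ L20) := by
  have h0 := hc.lie_eq_zero h
  obtain ⟨m1, m2, m3, m4⟩ := h.mem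
  -- The bracket with `t` commutes with the Levi factor, so it preserves the weight line of `y₁`;
  -- lowering by `x₃` shows that it is one scalar on all of `n`.
  obtain ⟨a, ht1⟩ : ∃ a : ℝ, ⁅y₁, t⁆ = a • y₁ := by
    obtain ⟨a, b, c, d, e⟩ := h.lie_mem m1 t
    have h1 := (h.lie_lie_t y₁).1
    rw [hc.lie_h_1, e] at h1
    simp only [smul_lie, lie_add, lie_smul, hc.lie_h_1, hc.lie_h_2, hc.lie_h_3, hc.lie_h_4, e] at h1
    obtain ⟨-, e2, e3, e4⟩ := h.eq_zero (a := 0) (b := 2 * b) (c := 4 * c) (d := 6 * d)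
      (by rw [← sub_eq_zero] at h1; rw [← h1]; module)
    refine ⟨a, ?_⟩
    rw [e, show b = 0 by linarith, show c = 0 by linarith, show d = 0 by linarith]
    simp
  have ht2 : ⁅y₂, t⁆ = a • y₂ := by
    rw [← hc.lie_f_1, (h.lie_lie_t y₁).2.2, ht1, lie_smul]
  have ht3 : ⁅y₃, t⁆ = a • y₃ := by
    have : y₃ = (1 / 2 : ℝ) • ⁅x₃, y₂⁆ := by rw [hc.lie_f_2]; module
    rw [this, smul_lie, (h.lie_lie_t y₂).2.2, ht2, lie_smul]; module
  have ht4 : ⁅y₄, t⁆ = a • y₄ := by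
    have : y₄ = (1 / 3 : ℝ) • ⁅x₃, y₃⁆ := by rw [hc.lie_f_3]; module
    rw [this, smul_lie, (h.lie_lie_t y₃).2.2, ht3, lie_smul]; module
  have ha : a ≠ 0 := by
    have := h.trace_ne_zero ![![a, 0, 0, 0], ![0, a, 0, 0], ![0, 0, a, 0], ![0, 0, 0, a]]
      (by simp [ht1]) (by simp [ht2]) (by simp [ht3]) (by simp [ht4])
    rintro rfl
    simp at this
  refine (h.smul_frame ha).nonempty_lieEquiv L20 fun i j hij => ?_
  have hT : L20.c = L20Brackets := rfl
  rw [hT]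
  fin_cases i <;> fin_cases j <;> first
    | exact absurd hij (by decide)
    | simp [L20Brackets, comb_e_one, comb_e_two, comb_e_three, comb_e_four, comb_e_five,
        comb_e_six, comb_e_seven, hs.1, hs.2, hs.3, hc.1, hc.2, hc.3, hc.4, hc.5, hc.6,
        hc.7, hc.8, hc.9, hc.10, hc.11, hc.12, h.lie_1_t, h.lie_2_t, h.lie_3_t, ht1, ht2, ht3, ht4,
        smul_smul, inv_mul_cancel₀ ha, h0 _ m1 _ m2, h0 _ m1 _ m3, h0 _ m1 _ m4, h0 _ m2 _ m3,
        h0 _ m2 _ m4, h0 _ m3 _ m4]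

end Cubic

end Split

/-- Normal forms, up to conjugation and scaling, of real two by two matrices with non-zero
trace. -/
theorem exists_normalForm_of_trace_ne_zero (a b c d : ℝ) (htr : a + d ≠ 0) :
    ∃ p q r s l : ℝ, p * s - q * r ≠ 0 ∧ l ≠ 0 ∧
      ((∃ m, -1 < m ∧ m ≤ 1 ∧ p * a + q * b = l * p ∧ p * c + q * d = l * q ∧
          r * a + s * b = l * (m * r) ∧ r * c + s * d = l * (m * s)) ∨
        (p * a + q * b = l * p ∧ p * c + q * d = l * q ∧
          r * a + s * b = l * (p + r) ∧ r * c + s * d = l * (q + s)) ∨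
        (∃ m, 0 < m ∧ p * a + q * b = l * (m * p - r) ∧ p * c + q * d = l * (m * q - s) ∧
          r * a + s * b = l * (p + m * r) ∧ r * c + s * d = l * (q + m * s))) := by
  rcases lt_trichotomy ((a - d) ^ 2 + 4 * b * c) 0 with hΔ | hΔ | hΔ
  -- Eigenvalues `(a + d) / 2 ± iβ`; the sign of `β` is that of the trace, so that after division by
  -- `l = β` the real part is positive. The second row is then forced by the first, `(1, 0)`.
  · obtain ⟨β, hβ, hβ2⟩ : ∃ β : ℝ, 0 < (a + d) / 2 / β ∧ β ^ 2 = -((a - d) ^ 2 + 4 * b * c) / 4 := by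
      have h1 : 0 < √(-((a - d) ^ 2 + 4 * b * c) / 4) := Real.sqrt_pos.mpr (by linarith)
      have h2 := Real.sq_sqrt (show 0 ≤ -((a - d) ^ 2 + 4 * b * c) / 4 by linarith)
      rcases lt_or_gt_of_ne htr with h | h
      · exact ⟨-√(-((a - d) ^ 2 + 4 * b * c) / 4),
          div_pos_of_neg_of_neg (by linarith) (by linarith), by rw [neg_sq, h2]⟩
      · exact ⟨_, div_pos (by linarith) h1, h2⟩
    have hβ0 : β ≠ 0 := by
      rintro rfl
      linarith
    have hc : c ≠ 0 := by
      rintro rfl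
      nlinarith [sq_nonneg (a - d)]
    refine ⟨1, 0, ((a + d) / 2 - a) / β, -c / β, β, ?_, hβ0,
      Or.inr (Or.inr ⟨_, hβ, ?_, ?_, ?_, ?_⟩)⟩
    · simp [hc, hβ0]
    · field_simp; ring
    · field_simp; ring
    · field_simp; linear_combination (-4) * hβ2
    · field_simp; ring
  · have hl : (a + d) / 2 ≠ 0 := div_ne_zero htr two_ne_zero
    by_cases hc : c = 0
    · subst hc
      have had : a = d := by
        have : (a - d) ^ 2 = 0 := by linarith
        exact sub_eq_zero.mp (pow_eq_zero_iff two_ne_zero |>.mp this)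
      subst had
      have ha : a ≠ 0 := fun h => htr (by rw [h, add_zero])
      by_cases hb : b = 0
      · subst hb
        exact ⟨1, 0, 0, 1, a, by norm_num, ha, Or.inl ⟨1, by norm_num, le_rfl, by ring, by ring,
          by ring, by ring⟩⟩
      · exact ⟨b / a, 0, 0, 1, a, by simp [ha, hb], ha, Or.inr (Or.inl ⟨by ring, by ring,
          by field_simp; ring, by ring⟩)⟩
    · refine ⟨(a - (a + d) / 2) / ((a + d) / 2), c / ((a + d) / 2), 1, 0, (a + d) / 2, ?_, hl,
        Or.inr (Or.inl ⟨?_, ?_, ?_, ?_⟩)⟩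
      · simp [hc, htr]
      · field_simp; linear_combination hΔ
      · field_simp; ring
      · field_simp; ring
      · field_simp; ring
  -- Giving `δ` the sign of the trace makes `l` the eigenvalue of larger absolute value. Then `1 + m
  -- / l = (a + d) / l` and `1 - m / l = δ / l` are positive.
  · obtain ⟨δ, hδ, hδ2⟩ : ∃ δ : ℝ, 0 < δ * (a + d) ∧ δ ^ 2 = (a - d) ^ 2 + 4 * b * c := by
      have h1 : 0 < √((a - d) ^ 2 + 4 * b * c) := Real.sqrt_pos.mpr hΔ
      have h2 := Real.sq_sqrt hΔ.le
      rcases lt_or_gt_of_ne htr with h | h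
      · exact ⟨-√((a - d) ^ 2 + 4 * b * c), mul_pos_of_neg_of_neg (by linarith) h,
          by rw [neg_sq, h2]⟩
      · exact ⟨_, mul_pos h1 h, h2⟩
    have hδ0 : δ ≠ 0 := by
      rintro rfl
      simp at hδ
    obtain ⟨l, hl⟩ : ∃ l, l = (a + d + δ) / 2 := ⟨_, rfl⟩
    obtain ⟨m, hm⟩ : ∃ m, m = (a + d - δ) / 2 := ⟨_, rfl⟩
    have hl0 : l ≠ 0 := by
      rintro rfl
      have : δ = -(a + d) := by linarith
      rw [this] at hδ
      nlinarith [sq_nonneg (a + d)]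
    have hml : l * (m / l) = m := mul_div_cancel₀ m hl0
    have h1 : -1 < m / l := by
      have : m / l + 1 = (a + d) * l / l ^ 2 := by field_simp; rw [hl, hm]; ring
      have : 0 < (a + d) * l / l ^ 2 := div_pos (by rw [hl]; nlinarith [sq_nonneg (a + d)])
        (by positivity)
      linarith
    have h2 : m / l ≤ 1 := by
      have : 1 - m / l = δ * l / l ^ 2 := by field_simp; rw [hl, hm]; ring
      have : 0 < δ * l / l ^ 2 := div_pos (by rw [hl]; nlinarith [sq_nonneg δ]) (by positivity)
      linarith
    have hlm : l - m ≠ 0 := by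
      rw [hl, hm]
      intro h
      exact hδ0 (by linarith)
    have el : l * l - (a + d) * l + (a * d - b * c) = 0 := by
      rw [hl]; linear_combination hδ2 / 4
    have em : m * m - (a + d) * m + (a * d - b * c) = 0 := by
      rw [hm]; linear_combination hδ2 / 4
    -- The rows are left eigenvectors of the matrix with rows `(a, c)` and `(b, d)`: `(l - d, c)` if
    -- `c ≠ 0`, otherwise `(b, l - a)` if `b ≠ 0`, otherwise coordinate vectors.
    by_cases hc : c = 0
    · by_cases hb : b = 0
      · subst hb hc
        have hla : (l - a) * (l - d) = 0 := by linear_combination el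
        have hsum : l + m = a + d := by rw [hl, hm]; ring
        rcases mul_eq_zero.mp hla with h | h
        · refine ⟨1, 0, 0, 1, l, by norm_num, hl0, Or.inl ⟨m / l, h1, h2, ?_, ?_, ?_, ?_⟩⟩
          · linarith
          · ring
          · ring
          · rw [mul_one, hml]; linarith
        · refine ⟨0, 1, 1, 0, l, by norm_num, hl0, Or.inl ⟨m / l, h1, h2, ?_, ?_, ?_, ?_⟩⟩
          · ring
          · linarith
          · rw [mul_one, hml]; linarith
          · ring
      · refine ⟨b, l - a, b, m - a, l, ?_, hl0, Or.inl ⟨m / l, h1, h2, ?_, ?_, ?_, ?_⟩⟩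
        · have : b * (m - a) - (l - a) * b = -(b * (l - m)) := by ring
          rw [this]
          exact neg_ne_zero.mpr (mul_ne_zero hb hlm)
        · ring
        · linear_combination -el
        · rw [← mul_assoc, hml]; ring
        · rw [← mul_assoc, hml]; linear_combination -em
    · refine ⟨l - d, c, m - d, c, l, ?_, hl0, Or.inl ⟨m / l, h1, h2, ?_, ?_, ?_, ?_⟩⟩
      · have : (l - d) * c - c * (m - d) = c * (l - m) := by ring
        rw [this]
        exact mul_ne_zero hc hlm
      · linear_combination -el
      · ring
      · rw [← mul_assoc, hml]; linear_combination -em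
      · rw [← mul_assoc, hml]; ring

/-! ### Two copies of the standard `sl(2)`-module. -/

section Split

variable {g : Type*} [LieRing g] [LieAlgebra ℝ g] {n : LieIdeal ℝ g}
  {x₁ x₂ x₃ y₁ y₂ y₃ y₄ t : g}

/-- Again the weights of `n` are ±1, while those of brackets are even. -/
theorem lie_eq_zero_of_isStandardPair (h : IsSplit n x₁ x₂ x₃ y₁ y₂ y₃ y₄ t)
    (hp : IsStandardPair x₁ x₂ x₃ y₁ y₂) (hp' : IsStandardPair x₁ x₂ x₃ y₃ y₄) :
    ∀ x ∈ n, ∀ y ∈ n, ⁅x, y⁆ = 0 := by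
  have key (w : g) (hw : w ∈ n) (μ : ℝ) (hμ : ⁅x₁, w⁆ = μ • w) (h1 : 1 - μ ≠ 0)
      (h1' : -1 - μ ≠ 0) : w = 0 := by
    obtain ⟨a, b, c, d, rfl⟩ := (h.mem_iff w).mp hw
    simp only [lie_add, lie_smul, hp.lie_h_v, hp.lie_h_w, hp'.lie_h_v, hp'.lie_h_w] at hμ
    obtain ⟨e1, e2, e3, e4⟩ := h.eq_zero (a := (1 - μ) * a) (b := (-1 - μ) * b) (c := (1 - μ) * c)
      (d := (-1 - μ) * d) (by rw [← sub_eq_zero] at hμ; rw [← hμ]; module)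
    rw [(mul_eq_zero.mp e1).resolve_left h1, (mul_eq_zero.mp e2).resolve_left h1',
      (mul_eq_zero.mp e3).resolve_left h1, (mul_eq_zero.mp e4).resolve_left h1']
    simp
  obtain ⟨m1, m2, m3, m4⟩ := h.mem
  have hl {x y : g} (hy : y ∈ n) : ⁅x, y⁆ ∈ n := lie_mem_right ℝ g n x y hy
  refine h.lie_eq_zero (key _ (hl m2) 0 ?_ ?_ ?_) (key _ (hl m3) 2 ?_ ?_ ?_)
    (key _ (hl m4) 0 ?_ ?_ ?_) (key _ (hl m3) 0 ?_ ?_ ?_)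
    (key _ (hl m4) (-2) ?_ ?_ ?_) (key _ (hl m4) 0 ?_ ?_ ?_)
  all_goals first
    | (simp only [leibniz_lie x₁, hp.lie_h_v, hp.lie_h_w, hp'.lie_h_v, hp'.lie_h_w, neg_lie,
        lie_neg]; module)
    | norm_num

/-- The combinations of two standard bases. -/
theorem IsStandardPair.comb (hp : IsStandardPair x₁ x₂ x₃ y₁ y₂)
    (hp' : IsStandardPair x₁ x₂ x₃ y₃ y₄) (p q : ℝ) :
    IsStandardPair x₁ x₂ x₃ (p • y₁ + q • y₃) (p • y₂ + q • y₄) := by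
  constructor <;> simp only [lie_add, lie_smul, hp.lie_h_v, hp.lie_h_w, hp.lie_e_v, hp.lie_e_w,
    hp.lie_f_v, hp.lie_f_w, hp'.lie_h_v, hp'.lie_h_w, hp'.lie_e_v, hp'.lie_e_w, hp'.lie_f_v,
    hp'.lie_f_w] <;> module

theorem L16Brackets_eq (i j : ℕ) (hj : j ≠ 8) : L16Brackets i j = sl2Table' i j := by
  unfold L16Brackets
  split <;> first | rfl | exact absurd rfl hj

theorem L17Brackets_eq (p : ℝ) (i j : ℕ) (hj : j ≠ 8) : L17Brackets p i j = sl2Table' i j := by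
  unfold L17Brackets
  split <;> first | rfl | exact absurd rfl hj

theorem L18Brackets_eq (p : ℝ) (i j : ℕ) (hj : j ≠ 8) : L18Brackets p i j = sl2Table' i j := by
  unfold L18Brackets
  split <;> first | rfl | exact absurd rfl hj

theorem IsFrame.nonempty_lieEquiv_of_isStandardPair
    (hF : IsFrame ![x₁, x₂, x₃, y₁, y₂, y₃, y₄, t]) (hs : IsSl2Relations x₁ x₂ x₃)
    (hp : IsStandardPair x₁ x₂ x₃ y₁ y₂) (hp' : IsStandardPair x₁ x₂ x₃ y₃ y₄)
    (h0 : ∀ x ∈ n, ∀ y ∈ n, ⁅x, y⁆ = 0) (m1 : y₁ ∈ n) (m2 : y₂ ∈ n) (m3 : y₃ ∈ n) (m4 : y₄ ∈ n)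
    (k1 : ⁅x₁, t⁆ = 0) (k2 : ⁅x₂, t⁆ = 0) (k3 : ⁅x₃, t⁆ = 0) (T : Table)
    (hT : ∀ i j, j ≠ 8 → T.c i j = sl2Table' i j) (h18 : T.c 1 8 = 0) (h28 : T.c 2 8 = 0)
    (h38 : T.c 3 8 = 0) (h48 : ⁅y₁, t⁆ = comb ![x₁, x₂, x₃, y₁, y₂, y₃, y₄, t] (T.c 4 8))
    (h58 : ⁅y₂, t⁆ = comb ![x₁, x₂, x₃, y₁, y₂, y₃, y₄, t] (T.c 5 8))
    (h68 : ⁅y₃, t⁆ = comb ![x₁, x₂, x₃, y₁, y₂, y₃, y₄, t] (T.c 6 8))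
    (h78 : ⁅y₄, t⁆ = comb ![x₁, x₂, x₃, y₁, y₂, y₃, y₄, t] (T.c 7 8)) :
    Nonempty (g ≃ₗ⁅ℝ⁆ T) := by
  refine hF.nonempty_lieEquiv T fun i j hij => ?_
  fin_cases i <;> fin_cases j <;> first
    | exact absurd hij (by decide)
    | simp [hT, h18, h28, h38, h48, h58, h68, h78, sl2Table', sl2Table, comb_e_one, comb_e_two,
        comb_e_three, comb_e_four, comb_e_five, comb_e_six, comb_e_seven, hs.1, hs.2, hs.3, hp.1,
        hp.2, hp.3, hp.4, hp.5, hp.6, hp'.1, hp'.2, hp'.3, hp'.4, hp'.5, hp'.6, k1, k2, k3,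
        h0 _ m1 _ m2, h0 _ m1 _ m3, h0 _ m1 _ m4, h0 _ m2 _ m3, h0 _ m2 _ m4, h0 _ m3 _ m4]

/-- `n` is the standard module tensored with a plane. The bracket with `t` commutes with `sl(2)`,
hence acts on the plane only, by a real matrix whose trace is non-zero; base changes of the plane
and scalings of `t` bring it to normal form. -/
theorem nonempty_lieEquiv_of_isStandardPair (hs : IsSl2Relations x₁ x₂ x₃)
    (h : IsSplit n x₁ x₂ x₃ y₁ y₂ y₃ y₄ t)
    (hp : IsStandardPair x₁ x₂ x₃ y₁ y₂) (hp' : IsStandardPair x₁ x₂ x₃ y₃ y₄) :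
    Nonempty (g ≃ₗ⁅ℝ⁆ L16) ∨ (∃ p : ℝ, -1 < p ∧ p ≤ 1 ∧ Nonempty (g ≃ₗ⁅ℝ⁆ L17 p)) ∨
      (∃ p : ℝ, 0 < p ∧ Nonempty (g ≃ₗ⁅ℝ⁆ L18 p)) := by
  have h0 := lie_eq_zero_of_isStandardPair h hp hp'
  obtain ⟨m1, m2, m3, m4⟩ := h.mem
  have ht (y : g) (hy : y ∈ n) (hy1 : ⁅x₁, y⁆ = y) : ∃ a c : ℝ, ⁅y, t⁆ = a • y₁ + c • y₃ := by
    obtain ⟨a, b, c, d, e⟩ := h.lie_mem hy t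
    have h1 := (h.lie_lie_t y).1
    rw [hy1, e] at h1
    simp only [lie_add, lie_smul, hp.lie_h_v, hp.lie_h_w, hp'.lie_h_v, hp'.lie_h_w] at h1
    obtain ⟨-, e2, -, e4⟩ := h.eq_zero (a := 0) (b := 2 * b) (c := 0) (d := 2 * d)
      (by rw [← sub_eq_zero] at h1; rw [← h1]; module)
    refine ⟨a, c, ?_⟩
    rw [e, show b = 0 by linarith, show d = 0 by linarith]
    simp
  obtain ⟨a, c, ht1⟩ := ht y₁ m1 hp.lie_h_v
  obtain ⟨b, d, ht3⟩ := ht y₃ m3 hp'.lie_h_v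
  have ht2 : ⁅y₂, t⁆ = a • y₂ + c • y₄ := by
    rw [← hp.lie_f_v, (h.lie_lie_t y₁).2.2, ht1, lie_add, lie_smul, lie_smul, hp'.lie_f_v]
  have ht4 : ⁅y₄, t⁆ = b • y₂ + d • y₄ := by
    rw [← hp'.lie_f_v, (h.lie_lie_t y₃).2.2, ht3, lie_add, lie_smul, lie_smul, hp.lie_f_v]
  have htr : a + d ≠ 0 := by
    have := h.trace_ne_zero ![![a, 0, c, 0], ![0, a, 0, c], ![b, 0, d, 0], ![0, b, 0, d]]
      (by simp [ht1]) (by simp [ht2]) (by simp [ht3]) (by simp [ht4])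
    intro h0
    apply this
    simp
    linarith
  obtain ⟨p, q, r, s, l, hdet, hl, hcases⟩ := exists_normalForm_of_trace_ne_zero a b c d htr
  have hP := hp.comb hp' p q
  have hR := hp.comb hp' r s
  have hn (p q : ℝ) : p • y₁ + q • y₃ ∈ n := n.add_mem (n.smul_mem _ m1) (n.smul_mem _ m3)
  have hn' (p q : ℝ) : p • y₂ + q • y₄ ∈ n := n.add_mem (n.smul_mem _ m2) (n.smul_mem _ m4)
  have hF : IsFrame ![x₁, x₂, x₃, p • y₁ + q • y₃, p • y₂ + q • y₄, r • y₁ + s • y₃,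
      r • y₂ + s • y₄, l⁻¹ • t] := isFrame_of_spans_eight h.frame.finrank_eq fun x => by
    obtain ⟨c₀, c₁, c₂, c₃, c₄, c₅, c₆, c₇, rfl⟩ := h.spans x
    obtain ⟨i, hi⟩ : ∃ i, (p * s - q * r) * i = 1 := ⟨_, mul_inv_cancel₀ hdet⟩
    have e (c : ℝ) : c = (p * s - q * r) * i * c := by rw [hi, one_mul]
    refine ⟨c₀, c₁, c₂, (c₃ * s - c₅ * r) * i, (c₄ * s - c₆ * r) * i,
      (c₅ * p - c₃ * q) * i, (c₆ * p - c₄ * q) * i, c₇ * l, ?_⟩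
    rw [smul_smul (c₇ * l), mul_assoc c₇, mul_inv_cancel₀ hl, mul_one]
    conv_lhs => rw [e c₃, e c₄, e c₅, e c₆]
    module
  have hD (p q : ℝ) : ⁅p • y₁ + q • y₃, l⁻¹ • t⁆ =
      l⁻¹ • ((p * a + q * b) • y₁ + (p * c + q * d) • y₃) := by
    simp only [add_lie, smul_lie, lie_smul, ht1, ht3]
    module
  have hD' (p q : ℝ) : ⁅p • y₂ + q • y₄, l⁻¹ • t⁆ =
      l⁻¹ • ((p * a + q * b) • y₂ + (p * c + q * d) • y₄) := by
    simp only [add_lie, smul_lie, lie_smul, ht2, ht4]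
    module
  have hDp := hD p q
  have hDr := hD r s
  have hDp' := hD' p q
  have hDr' := hD' r s
  have k1 : ⁅x₁, l⁻¹ • t⁆ = 0 := by rw [lie_smul, h.lie_1_t, smul_zero]
  have k2 : ⁅x₂, l⁻¹ • t⁆ = 0 := by rw [lie_smul, h.lie_2_t, smul_zero]
  have k3 : ⁅x₃, l⁻¹ • t⁆ = 0 := by rw [lie_smul, h.lie_3_t, smul_zero]
  rcases hcases with ⟨m, hm1, hm2, e1, e2, e3, e4⟩ | ⟨e1, e2, e3, e4⟩ | ⟨m, hm, e1, e2, e3, e4⟩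
  · right; left
    rw [e1, e2] at hDp hDp'
    rw [e3, e4] at hDr hDr'
    refine ⟨m, hm1, hm2, hF.nonempty_lieEquiv_of_isStandardPair hs hP hR h0 (hn _ _) (hn' _ _)
      (hn _ _) (hn' _ _) k1 k2 k3 _ (L17Brackets_eq m) rfl rfl rfl (hDp.trans ?_) (hDp'.trans ?_)
      (hDr.trans ?_) (hDr'.trans ?_)⟩ <;>
    simp only [L17, L17Brackets, map_smul, comb_e_four, comb_e_five, comb_e_six, comb_e_seven,
      Matrix.cons_val] <;>
    match_scalars <;> field_simp
  · left
    rw [e1, e2] at hDp hDp'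
    rw [e3, e4] at hDr hDr'
    refine hF.nonempty_lieEquiv_of_isStandardPair hs hP hR h0 (hn _ _) (hn' _ _)
      (hn _ _) (hn' _ _) k1 k2 k3 _ L16Brackets_eq rfl rfl rfl (hDp.trans ?_) (hDp'.trans ?_)
      (hDr.trans ?_) (hDr'.trans ?_) <;>
    simp only [L16, L16Brackets, map_add, comb_e_four, comb_e_five, comb_e_six, comb_e_seven,
      Matrix.cons_val] <;>
    match_scalars <;> field_simp
  · right; right
    rw [e1, e2] at hDp hDp'
    rw [e3, e4] at hDr hDr'
    refine ⟨m, hm, hF.nonempty_lieEquiv_of_isStandardPair hs hP hR h0 (hn _ _) (hn' _ _)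
      (hn _ _) (hn' _ _) k1 k2 k3 _ (L18Brackets_eq m) rfl rfl rfl (hDp.trans ?_) (hDp'.trans ?_)
      (hDr.trans ?_) (hDr'.trans ?_)⟩ <;>
    simp only [L18, L18Brackets, map_add, map_sub, map_smul, comb_e_four, comb_e_five, comb_e_six,
      comb_e_seven, Matrix.cons_val] <;>
    match_scalars <;> field_simp

end Split

/-! ### The quaternionic module of `so(3)`. -/

section Split

variable {g : Type*} [LieRing g] [LieAlgebra ℝ g] {n : LieIdeal ℝ g}
  {x₁ x₂ x₃ y₁ y₂ y₃ y₄ t : g}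

/-- The products of the operators of a quaternionic module over `so(3)`. -/
structure IsQuaternionicVector (x₁ x₂ x₃ w : g) : Prop where
  lie_1_1 : ⁅x₁, ⁅x₁, w⁆⁆ = -(1 / 4 : ℝ) • w
  lie_2_2 : ⁅x₂, ⁅x₂, w⁆⁆ = -(1 / 4 : ℝ) • w
  lie_3_3 : ⁅x₃, ⁅x₃, w⁆⁆ = -(1 / 4 : ℝ) • w
  lie_1_2 : ⁅x₁, ⁅x₂, w⁆⁆ = (1 / 2 : ℝ) • ⁅x₃, w⁆
  lie_2_1 : ⁅x₂, ⁅x₁, w⁆⁆ = -(1 / 2 : ℝ) • ⁅x₃, w⁆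
  lie_2_3 : ⁅x₂, ⁅x₃, w⁆⁆ = (1 / 2 : ℝ) • ⁅x₁, w⁆
  lie_3_2 : ⁅x₃, ⁅x₂, w⁆⁆ = -(1 / 2 : ℝ) • ⁅x₁, w⁆
  lie_3_1 : ⁅x₃, ⁅x₁, w⁆⁆ = (1 / 2 : ℝ) • ⁅x₂, w⁆
  lie_1_3 : ⁅x₁, ⁅x₃, w⁆⁆ = -(1 / 2 : ℝ) • ⁅x₂, w⁆

theorem IsQuaternionicBasis.isQuaternionicVector (h : IsSplit n x₁ x₂ x₃ y₁ y₂ y₃ y₄ t)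
    (hq : IsQuaternionicBasis x₁ x₂ x₃ y₁ y₂ y₃ y₄) {w : g} (hw : w ∈ n) :
    IsQuaternionicVector x₁ x₂ x₃ w := by
  obtain ⟨a, b, c, d, rfl⟩ := (h.mem_iff w).mp hw
  constructor <;>
    simp only [lie_add, lie_smul, hq.1, hq.2, hq.3, hq.4, hq.5, hq.6, hq.7, hq.8, hq.9, hq.10,
      hq.11, hq.12] <;>
    module

theorem IsQuaternionicVector.isQuaternionicBasis {w : g} (h : IsQuaternionicVector x₁ x₂ x₃ w) :
    IsQuaternionicBasis x₁ x₂ x₃ w ((2 : ℝ) • ⁅x₁, w⁆) (-(2 : ℝ) • ⁅x₂, w⁆)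
      ((2 : ℝ) • ⁅x₃, w⁆) := by
  constructor <;>
    (try simp only [lie_smul, h.1, h.2, h.3, h.4, h.5, h.6, h.7, h.8, h.9]) <;>
    module

/-- On `n`, and so on brackets of its elements, `x₁` has square −1/4. Expanding the square on `⁅x,
y⁆` gives `⁅x₁ x, x₁ y⁆ = ⅛ ⁅x, y⁆`; applied twice this reads 1/16 = 1/64 on `⁅x, y⁆`. -/
theorem IsQuaternionicBasis.lie_eq_zero (h : IsSplit n x₁ x₂ x₃ y₁ y₂ y₃ y₄ t)
    (hq : IsQuaternionicBasis x₁ x₂ x₃ y₁ y₂ y₃ y₄) : ∀ x ∈ n, ∀ y ∈ n, ⁅x, y⁆ = 0 := by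
  have key (x : g) (hx : x ∈ n) (y : g) (hy : y ∈ n) :
      ⁅⁅x₁, x⁆, ⁅x₁, y⁆⁆ = (1 / 8 : ℝ) • ⁅x, y⁆ := by
    have h1 := (hq.isQuaternionicVector h hx).lie_1_1
    have h2 := (hq.isQuaternionicVector h hy).lie_1_1
    have h3 := (hq.isQuaternionicVector h (lie_mem_right ℝ g n x y hy)).lie_1_1
    rw [leibniz_lie x₁ x y, lie_add, leibniz_lie x₁ _ y, leibniz_lie x₁ x, h1, h2, smul_lie, lie_smul] at h3
    linear_combination (norm := module) (1 / 2 : ℝ) • h3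
  intro x hx y hy
  have h1 := (hq.isQuaternionicVector h hx).lie_1_1
  have h2 := (hq.isQuaternionicVector h hy).lie_1_1
  have h3 := key _ (lie_mem_right ℝ g n x₁ x hx) _ (lie_mem_right ℝ g n x₁ y hy)
  rw [h1, h2, key x hx y hy, smul_lie, lie_smul] at h3
  have h4 : (3 / 64 : ℝ) • ⁅x, y⁆ = 0 := by
    linear_combination (norm := module) h3
  exact (smul_eq_zero.mp h4).resolve_left (by norm_num)

theorem so3Table_eq_of_ne (i j : ℕ) (hj : j ≠ 8) : L3Brackets i j = so3Table i j := by
  unfold L3Brackets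
  split <;> first | rfl | exact absurd rfl hj

theorem L4Brackets_eq (p : ℝ) (i j : ℕ) (hj : j ≠ 8) : L4Brackets p i j = so3Table i j := by
  unfold L4Brackets
  split <;> first | rfl | exact absurd rfl hj

/-- The order and the sign in `y₁, -y₃, y₄, y₂` translate the quaternionic basis into `e 4, …, e 7`
of the table. -/
theorem IsFrame.nonempty_lieEquiv_of_isQuaternionicBasis
    (hF : IsFrame ![x₁, x₂, x₃, y₁, -y₃, y₄, y₂, t]) (hs : IsSo3Relations x₁ x₂ x₃)
    (hq : IsQuaternionicBasis x₁ x₂ x₃ y₁ y₂ y₃ y₄)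
    (h0 : ∀ x ∈ n, ∀ y ∈ n, ⁅x, y⁆ = 0) (m1 : y₁ ∈ n) (m2 : y₂ ∈ n) (m3 : y₃ ∈ n) (m4 : y₄ ∈ n)
    (k1 : ⁅x₁, t⁆ = 0) (k2 : ⁅x₂, t⁆ = 0) (k3 : ⁅x₃, t⁆ = 0) (T : Table)
    (hT : ∀ i j, j ≠ 8 → T.c i j = so3Table i j) (h18 : T.c 1 8 = 0) (h28 : T.c 2 8 = 0)
    (h38 : T.c 3 8 = 0) (h48 : ⁅y₁, t⁆ = comb ![x₁, x₂, x₃, y₁, -y₃, y₄, y₂, t] (T.c 4 8))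
    (h58 : -⁅y₃, t⁆ = comb ![x₁, x₂, x₃, y₁, -y₃, y₄, y₂, t] (T.c 5 8))
    (h68 : ⁅y₄, t⁆ = comb ![x₁, x₂, x₃, y₁, -y₃, y₄, y₂, t] (T.c 6 8))
    (h78 : ⁅y₂, t⁆ = comb ![x₁, x₂, x₃, y₁, -y₃, y₄, y₂, t] (T.c 7 8)) :
    Nonempty (g ≃ₗ⁅ℝ⁆ T) := by
  refine hF.nonempty_lieEquiv T fun i j hij => ?_
  fin_cases i <;> fin_cases j <;> first
    | exact absurd hij (by decide)
    | (simp [hT, h18, h28, h38, h48, h58, h68, h78, so3Table, comb_e_one, comb_e_two,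
        comb_e_three, comb_e_four, comb_e_five, comb_e_six, comb_e_seven, hs.1, hs.2, hs.3, hq.1,
        hq.2, hq.3, hq.4, hq.5, hq.6, hq.7, hq.8, hq.9, hq.10, hq.11, hq.12, k1, k2, k3,
        h0 _ m1 _ m2, h0 _ m1 _ m3, h0 _ m1 _ m4, h0 _ m3 _ m2, h0 _ m4 _ m2, h0 _ m3 _ m4])

/-- If `y₁` is a quaternion multiple of `w₁`, acting with the Levi factor expresses `y₂, y₃, y₄`
through the `w`'s as well. -/
theorem IsQuaternionicBasis.isFrame (h : IsSplit n x₁ x₂ x₃ y₁ y₂ y₃ y₄ t)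
    (hq : IsQuaternionicBasis x₁ x₂ x₃ y₁ y₂ y₃ y₄) {w₁ w₂ w₃ w₄ : g}
    (hw : IsQuaternionicBasis x₁ x₂ x₃ w₁ w₂ w₃ w₄)
    (hyw : ∃ c₁ c₂ c₃ c₄ : ℝ, y₁ = c₁ • w₁ + c₂ • w₂ + c₃ • w₃ + c₄ • w₄) {l : ℝ} (hl : l ≠ 0) :
    IsFrame ![x₁, x₂, x₃, w₁, -w₃, w₄, w₂, l⁻¹ • t] := by
  obtain ⟨c₁, c₂, c₃, c₄, e1⟩ := hyw
  have e2 : y₂ = c₁ • w₂ - c₂ • w₁ - c₃ • w₄ + c₄ • w₃ := by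
    have : y₂ = (2 : ℝ) • ⁅x₁, y₁⁆ := by rw [hq.lie_1_a]; module
    rw [this, e1]
    simp only [lie_add, lie_smul, hw.1, hw.2, hw.3, hw.4]
    module
  have e3 : y₃ = c₁ • w₃ + c₂ • w₄ - c₃ • w₁ - c₄ • w₂ := by
    have : y₃ = (-2 : ℝ) • ⁅x₂, y₁⁆ := by rw [hq.lie_2_a]; module
    rw [this, e1]
    simp only [lie_add, lie_smul, hw.5, hw.6, hw.7, hw.8]
    module
  have e4 : y₄ = c₁ • w₄ - c₂ • w₃ + c₃ • w₂ - c₄ • w₁ := by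
    have : y₄ = (2 : ℝ) • ⁅x₃, y₁⁆ := by rw [hq.lie_3_a]; module
    rw [this, e1]
    simp only [lie_add, lie_smul, hw.9, hw.10, hw.11, hw.12]
    module
  refine isFrame_of_spans_eight h.frame.finrank_eq fun x => ?_
  obtain ⟨d₀, d₁, d₂, d₃, d₄, d₅, d₆, d₇, rfl⟩ := h.spans x
  refine ⟨d₀, d₁, d₂, d₃ * c₁ - d₄ * c₂ - d₅ * c₃ - d₆ * c₄,
    -(d₃ * c₃ + d₄ * c₄ + d₅ * c₁ - d₆ * c₂), d₃ * c₄ - d₄ * c₃ + d₅ * c₂ + d₆ * c₁,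
    d₃ * c₂ + d₄ * c₁ - d₅ * c₄ + d₆ * c₃, d₇ * l, ?_⟩
  rw [smul_smul (d₇ * l), mul_assoc d₇, mul_inv_cancel₀ hl, mul_one, e2, e3, e4, e1]
  module

/-- The bracket with `t` commutes with the quaternionic structure, so it is a multiplication from
the other side by `α + βi + γj + δk`, of trace `4α ≠ 0`. Conjugation turns the imaginary part into a
multiple of one axis; it vanishes for `L3`, and its norm scales `t` for `L4`. -/
theorem IsQuaternionicBasis.nonempty_lieEquiv (hs : IsSo3Relations x₁ x₂ x₃)
    (h : IsSplit n x₁ x₂ x₃ y₁ y₂ y₃ y₄ t) (hq : IsQuaternionicBasis x₁ x₂ x₃ y₁ y₂ y₃ y₄) :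
    Nonempty (g ≃ₗ⁅ℝ⁆ L3) ∨ ∃ p : ℝ, p ≠ 0 ∧ Nonempty (g ≃ₗ⁅ℝ⁆ L4 p) := by
  have h0 := hq.lie_eq_zero h
  obtain ⟨m1, m2, m3, m4⟩ := h.mem
  have hlt {y : g} (w₁ w₂ w₃ w₄ : g) (hw : IsQuaternionicBasis x₁ x₂ x₃ w₁ w₂ w₃ w₄)
      (hy : ⁅w₁, t⁆ = y) : ⁅w₂, t⁆ = (2 : ℝ) • ⁅x₁, y⁆ ∧ ⁅w₃, t⁆ = (-2 : ℝ) • ⁅x₂, y⁆ ∧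
        ⁅w₄, t⁆ = (2 : ℝ) • ⁅x₃, y⁆ := by
    obtain ⟨k1, k2, k3⟩ := h.lie_lie_t w₁
    rw [hw.lie_1_a, hy, smul_lie] at k1
    rw [hw.lie_2_a, hy, smul_lie] at k2
    rw [hw.lie_3_a, hy, smul_lie] at k3
    rw [← k1, ← k2, ← k3]
    refine ⟨by module, by module, by module⟩
  obtain ⟨α, β, γ, δ, ht1⟩ := h.lie_mem m1 t
  obtain ⟨ht2, ht3, ht4⟩ := hlt _ _ _ _ hq ht1
  simp only [lie_add, lie_smul, hq.1, hq.2, hq.3, hq.4] at ht2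
  simp only [lie_add, lie_smul, hq.5, hq.6, hq.7, hq.8] at ht3
  simp only [lie_add, lie_smul, hq.9, hq.10, hq.11, hq.12] at ht4
  have hα : α ≠ 0 := by
    have := h.trace_ne_zero ![![α, β, γ, δ], ![-β, α, δ, -γ], ![-γ, -δ, α, β], ![-δ, γ, -β, α]]
      (by simp [ht1]) (by rw [ht2]; simp; module) (by rw [ht3]; simp; module)
      (by rw [ht4]; simp; module)
    rintro rfl
    simp at this
  have k1 (l : ℝ) : ⁅x₁, l⁻¹ • t⁆ = 0 := by rw [lie_smul, h.lie_1_t, smul_zero]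
  have k2 (l : ℝ) : ⁅x₂, l⁻¹ • t⁆ = 0 := by rw [lie_smul, h.lie_2_t, smul_zero]
  have k3 (l : ℝ) : ⁅x₃, l⁻¹ • t⁆ = 0 := by rw [lie_smul, h.lie_3_t, smul_zero]
  rcases eq_or_ne (β ^ 2 + γ ^ 2 + δ ^ 2) 0 with hN | hN
  · left
    obtain rfl : β = 0 := by nlinarith [sq_nonneg β, sq_nonneg γ, sq_nonneg δ]
    obtain rfl : γ = 0 := by nlinarith [sq_nonneg γ, sq_nonneg δ]
    obtain rfl : δ = 0 := by nlinarith [sq_nonneg δ]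
    have hF := hq.isFrame h hq ⟨1, 0, 0, 0, by module⟩ hα
    refine hF.nonempty_lieEquiv_of_isQuaternionicBasis hs hq h0 m1 m2 m3 m4 (k1 α) (k2 α) (k3 α) _
      so3Table_eq_of_ne rfl rfl rfl ?_ ?_ ?_ ?_ <;>
    simp only [L3, L3Brackets, comb_e_four, comb_e_five, comb_e_six, comb_e_seven,
      Matrix.cons_val, lie_smul, ht1, ht2, ht3, ht4] <;>
    match_scalars <;> field_simp <;> norm_num
  · right
    obtain ⟨σ, hσ0, hσ⟩ : ∃ σ : ℝ, 0 < σ ∧ σ ^ 2 = β ^ 2 + γ ^ 2 + δ ^ 2 := by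
      have : 0 ≤ β ^ 2 + γ ^ 2 + δ ^ 2 := by positivity
      exact ⟨_, Real.sqrt_pos.mpr (lt_of_le_of_ne this hN.symm), Real.sq_sqrt this⟩
    -- The vector sought is a quaternion exchanging the imaginary part `u` with `-σk`. Since `u` and
    -- `σk` have the same square, `u - σk` has this property. It degenerates if `u = σk`, and then
    -- `i` serves.
    obtain ⟨a, b, c, d, hN', hD⟩ : ∃ a b c d : ℝ, a ^ 2 + b ^ 2 + c ^ 2 + d ^ 2 ≠ 0 ∧
        ⁅a • y₁ + b • y₂ + c • y₃ + d • y₄, t⁆ = α • (a • y₁ + b • y₂ + c • y₃ + d • y₄) -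
          σ • (2 : ℝ) • ⁅x₃, a • y₁ + b • y₂ + c • y₃ + d • y₄⁆ := by
      rcases eq_or_ne δ σ with rfl | hδ
      · obtain rfl : β = 0 := by nlinarith [sq_nonneg β, sq_nonneg γ]
        obtain rfl : γ = 0 := by nlinarith [sq_nonneg γ]
        refine ⟨0, 1, 0, 0, by norm_num, ?_⟩
        simp only [zero_smul, one_smul, zero_add, add_zero, ht2, hq.lie_3_b]
        module
      · refine ⟨0, β, γ, δ - σ, ?_, ?_⟩
        · have := sq_pos_of_ne_zero (sub_ne_zero.mpr hδ)
          positivity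
        · simp only [add_lie, smul_lie, ht1, ht2, ht3, ht4, lie_add, lie_smul, hq.9, hq.10, hq.11,
            hq.12]
          have e : (σ * σ) • y₁ = (β ^ 2 + γ ^ 2 + δ ^ 2) • y₁ := by rw [← hσ, sq]
          linear_combination (norm := module) e
    set w := a • y₁ + b • y₂ + c • y₃ + d • y₄ with hw
    have hwn : w ∈ n := (h.mem_iff _).mpr ⟨a, b, c, d, rfl⟩
    have hwq := (hq.isQuaternionicVector h hwn).isQuaternionicBasis
    have hy : ∃ c₁ c₂ c₃ c₄ : ℝ, y₁ = c₁ • w + c₂ • (2 : ℝ) • ⁅x₁, w⁆ +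
        c₃ • (-(2 : ℝ)) • ⁅x₂, w⁆ + c₄ • (2 : ℝ) • ⁅x₃, w⁆ := by
      refine ⟨a / (a ^ 2 + b ^ 2 + c ^ 2 + d ^ 2), -b / (a ^ 2 + b ^ 2 + c ^ 2 + d ^ 2),
        -c / (a ^ 2 + b ^ 2 + c ^ 2 + d ^ 2), -d / (a ^ 2 + b ^ 2 + c ^ 2 + d ^ 2), ?_⟩
      simp only [hw, lie_add, lie_smul, hq.1, hq.2, hq.3, hq.4, hq.5, hq.6, hq.7, hq.8, hq.9,
        hq.10, hq.11, hq.12]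
      match_scalars <;> field_simp <;> ring
    have hF := hq.isFrame h hwq hy hσ0.ne'
    have hsm (u : g) (hu : u ∈ n) (x : g) : (2 : ℝ) • ⁅x, u⁆ ∈ n ∧ -(2 : ℝ) • ⁅x, u⁆ ∈ n :=
      ⟨n.smul_mem _ (lie_mem_right ℝ g n x u hu), n.smul_mem _ (lie_mem_right ℝ g n x u hu)⟩
    obtain ⟨hD2, hD3, hD4⟩ := hlt _ _ _ _ hwq hD
    simp only [lie_sub, lie_smul, (hq.isQuaternionicVector h hwn).lie_1_3,
      (hq.isQuaternionicVector h hwn).lie_2_3, (hq.isQuaternionicVector h hwn).lie_3_3]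
      at hD2 hD3 hD4
    clear_value w
    refine ⟨α / σ, div_ne_zero hα hσ0.ne', hF.nonempty_lieEquiv_of_isQuaternionicBasis hs hwq h0
      hwn (hsm w hwn x₁).1 (hsm w hwn x₂).2 (hsm w hwn x₃).1 (k1 σ) (k2 σ) (k3 σ) _
      (L4Brackets_eq _) rfl rfl rfl ?_ ?_ ?_ ?_⟩ <;>
    simp only [L4, L4Brackets, map_add, map_sub, map_smul, comb_e_four, comb_e_five, comb_e_six,
      comb_e_seven, Matrix.cons_val, lie_smul (σ⁻¹), hD, hD2, hD3, hD4] <;>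
    match_scalars <;> field_simp <;> norm_num

end Split

/-! ### A criterion for decomposability. -/

section Decomposition

variable {g : Type*} [LieRing g] [LieAlgebra ℝ g]

theorem IsFrame.isCompl_span {v : Fin 8 → g} (hv : IsFrame v) (S : Fin 8 → Bool) :
    IsCompl (Submodule.span ℝ (v '' {i | S i = true}))
      (Submodule.span ℝ (v '' {i | S i = false})) := by
  have hb : (hv.basis : Fin 8 → g) = v := funext hv.basis_apply
  have hli : LinearIndependent ℝ v := hb ▸ hv.basis.linearIndependent
  constructor
  · refine hli.disjoint_span_image (Set.disjoint_left.mpr fun i hi hi' => ?_)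
    simp_all
  · rw [codisjoint_iff, ← Submodule.span_union, ← Set.image_union]
    have : {i | S i = true} ∪ {i | S i = false} = Set.univ := by
      ext i
      cases h : S i <;> simp [h]
    rw [this, Set.image_univ, ← hb, hv.basis.span_eq]

/-- A Lie algebra with a frame which splits into two commuting closed parts is decomposable. -/
theorem IsFrame.not_isIndecomposable {v : Fin 8 → g} (hv : IsFrame v) (S : Fin 8 → Bool)
    (hS : ∃ i, S i = true) (hS' : ∃ i, S i = false)
    (h : ∀ (b : Bool) (A : Submodule ℝ g), (∀ k, S k = b → v k ∈ A) →
      ∀ i j, i < j → S i = b → S j = b → ⁅v i, v j⁆ ∈ A)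
    (h0 : ∀ i j, i < j → S i ≠ S j → ⁅v i, v j⁆ = 0) : ¬ IsIndecomposable g := by
  intro hg
  have hne (i : Fin 8) : v i ≠ 0 := by
    rw [← hv.basis_apply]
    exact hv.basis.ne_zero i
  have hclosed (b : Bool) : ∀ x ∈ Submodule.span ℝ (v '' {k | S k = b}),
      ∀ y ∈ Submodule.span ℝ (v '' {k | S k = b}),
        ⁅x, y⁆ ∈ Submodule.span ℝ (v '' {k | S k = b}) := by
    intro x hx y hy
    refine LinearMap.BilinMap.apply_apply_mem_of_mem_span _ _ _
      (LieModule.toEnd ℝ g g : g →ₗ[ℝ] Module.End ℝ g) ?_ x y hx hy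
    rintro _ ⟨i, hi, rfl⟩ _ ⟨j, hj, rfl⟩
    change ⁅v i, v j⁆ ∈ _
    simp only [Set.mem_ofPred_eq] at hi hj
    have hm (k : Fin 8) (hk : S k = b) : v k ∈ Submodule.span ℝ (v '' {k | S k = b}) :=
      Submodule.subset_span ⟨k, hk, rfl⟩
    rcases lt_trichotomy i j with hij | rfl | hij
    · exact h b _ hm i j hij hi hj
    · rw [lie_self]; exact Submodule.zero_mem _
    · rw [← lie_skew]
      exact Submodule.neg_mem _ (h b _ hm j i hij hj hi)
  have hcomm : ∀ x ∈ Submodule.span ℝ (v '' {k | S k = true}),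
      ∀ y ∈ Submodule.span ℝ (v '' {k | S k = false}), ⁅x, y⁆ ∈ (⊥ : Submodule ℝ g) := by
    intro x hx y hy
    refine LinearMap.BilinMap.apply_apply_mem_of_mem_span _ _ _
      (LieModule.toEnd ℝ g g : g →ₗ[ℝ] Module.End ℝ g) ?_ x y hx hy
    rintro _ ⟨i, hi, rfl⟩ _ ⟨j, hj, rfl⟩
    change ⁅v i, v j⁆ ∈ _
    simp only [Set.mem_ofPred_eq] at hi hj
    rw [Submodule.mem_bot]
    rcases lt_trichotomy i j with hij | rfl | hij
    · exact h0 i j hij (by simp [hi, hj])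
    · simp [hi] at hj
    · rw [← lie_skew, h0 j i hij (by simp [hi, hj]), neg_zero]
  obtain ⟨i, hi⟩ := hS
  obtain ⟨j, hj⟩ := hS'
  rcases hg.eq_bot_or_eq_bot _ _ (hv.isCompl_span S) (hclosed true) (hclosed false)
    (fun x hx y hy => (Submodule.mem_bot ℝ).mp (hcomm x hx y hy)) with h | h
  · exact hne i ((Submodule.span_eq_bot.mp h) _ ⟨i, hi, rfl⟩)
  · exact hne j ((Submodule.span_eq_bot.mp h) _ ⟨j, hj, rfl⟩)

end Decomposition

/-! ### One standard `sl(2)`-module and three invariant vectors. -/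

section Adapted

variable {g : Type*} [LieRing g] [LieAlgebra ℝ g] {x₁ x₂ x₃ v w k₁ k₂ u y z : g}

/-- The vector `y` commutes with the three given ones. -/
structure IsInvariant (x₁ x₂ x₃ y : g) : Prop where
  lie_1 : ⁅x₁, y⁆ = 0
  lie_2 : ⁅x₂, y⁆ = 0
  lie_3 : ⁅x₃, y⁆ = 0

theorem IsInvariant.smul (hy : IsInvariant x₁ x₂ x₃ y) (c : ℝ) : IsInvariant x₁ x₂ x₃ (c • y) := by
  constructor <;> simp [hy.1, hy.2, hy.3]

theorem IsInvariant.add (hy : IsInvariant x₁ x₂ x₃ y) (hz : IsInvariant x₁ x₂ x₃ z) :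
    IsInvariant x₁ x₂ x₃ (y + z) := by
  constructor <;> simp [hy.1, hy.2, hy.3, hz.1, hz.2, hz.3]

theorem IsInvariant.sub (hy : IsInvariant x₁ x₂ x₃ y) (hz : IsInvariant x₁ x₂ x₃ z) :
    IsInvariant x₁ x₂ x₃ (y - z) := by
  constructor <;> simp [hy.1, hy.2, hy.3, hz.1, hz.2, hz.3]

theorem IsInvariant.lie (hy : IsInvariant x₁ x₂ x₃ y) (hz : IsInvariant x₁ x₂ x₃ z) :
    IsInvariant x₁ x₂ x₃ ⁅y, z⁆ := by
  constructor <;> rw [leibniz_lie] <;> simp [hy.1, hy.2, hy.3, hz.1, hz.2, hz.3]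

theorem IsStandardPair.isInvariant_lie (hp : IsStandardPair x₁ x₂ x₃ v w) :
    IsInvariant x₁ x₂ x₃ ⁅v, w⁆ := by
  constructor <;> rw [leibniz_lie] <;>
    simp only [hp.1, hp.2, hp.3, hp.4, hp.5, hp.6, lie_neg, lie_self, zero_lie, lie_zero, add_zero,
      add_neg_cancel]

/-- A frame consisting of an `sl(2)`-triple, a basis of its standard representation, and three
invariant vectors. -/
structure IsSl2Frame (x₁ x₂ x₃ v w k₁ k₂ u : g) : Prop where
  frame : IsFrame ![x₁, x₂, x₃, v, w, k₁, k₂, u]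
  rel : IsSl2Relations x₁ x₂ x₃
  pair : IsStandardPair x₁ x₂ x₃ v w
  inv_k₁ : IsInvariant x₁ x₂ x₃ k₁
  inv_k₂ : IsInvariant x₁ x₂ x₃ k₂
  inv_u : IsInvariant x₁ x₂ x₃ u

namespace IsSl2Frame

theorem eq_zero (h : IsSl2Frame x₁ x₂ x₃ v w k₁ k₂ u) {c₀ c₁ c₂ c₃ c₄ c₅ c₆ c₇ : ℝ}
    (h0 : c₀ • x₁ + c₁ • x₂ + c₂ • x₃ + c₃ • v + c₄ • w + c₅ • k₁ + c₆ • k₂ + c₇ • u = 0) :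
    c₀ = 0 ∧ c₁ = 0 ∧ c₂ = 0 ∧ c₃ = 0 ∧ c₄ = 0 ∧ c₅ = 0 ∧ c₆ = 0 ∧ c₇ = 0 := by
  have h1 := h.frame.eq_zero_of_comb_eq_zero (c := ![c₀, c₁, c₂, c₃, c₄, c₅, c₆, c₇]) (by
    rw [comb_apply, Fin.sum_univ_eight]
    exact h0)
  exact ⟨congrFun h1 0, congrFun h1 1, congrFun h1 2, congrFun h1 3, congrFun h1 4, congrFun h1 5,
    congrFun h1 6, congrFun h1 7⟩

theorem spans (h : IsSl2Frame x₁ x₂ x₃ v w k₁ k₂ u) (x : g) :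
    ∃ c₀ c₁ c₂ c₃ c₄ c₅ c₆ c₇ : ℝ, x = c₀ • x₁ + c₁ • x₂ + c₂ • x₃ + c₃ • v +
      c₄ • w + c₅ • k₁ + c₆ • k₂ + c₇ • u := h.frame.spans_eight x

theorem lie_h (h : IsSl2Frame x₁ x₂ x₃ v w k₁ k₂ u) (c₀ c₁ c₂ c₃ c₄ c₅ c₆ c₇ : ℝ) :
    ⁅x₁, c₀ • x₁ + c₁ • x₂ + c₂ • x₃ + c₃ • v + c₄ • w + c₅ • k₁ + c₆ • k₂ + c₇ • u⁆ =
      (0 : ℝ) • x₁ + (2 * c₁) • x₂ + (-2 * c₂) • x₃ + c₃ • v + (-c₄) • w + (0 : ℝ) • k₁ +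
        (0 : ℝ) • k₂ + (0 : ℝ) • u := by
  simp only [lie_add, lie_smul, lie_self, h.rel.1, h.rel.2, h.pair.1, h.pair.2, h.inv_k₁.1,
    h.inv_k₂.1, h.inv_u.1]
  module

/-- Weight zero leaves `x₁, k₁, k₂, u`, and `x₂` does not commute with `x₁`. -/
theorem exists_eq_of_isInvariant (h : IsSl2Frame x₁ x₂ x₃ v w k₁ k₂ u)
    (hy : IsInvariant x₁ x₂ x₃ y) : ∃ a b c : ℝ, y = a • k₁ + b • k₂ + c • u := by
  obtain ⟨c₀, c₁, c₂, c₃, c₄, c₅, c₆, c₇, rfl⟩ := h.spans y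
  have h1 := hy.1
  rw [h.lie_h] at h1
  obtain ⟨-, e1, e2, e3, e4, -, -, -⟩ := h.eq_zero h1
  obtain rfl : c₁ = 0 := by linarith
  obtain rfl : c₂ = 0 := by linarith
  obtain rfl : c₄ = 0 := by linarith
  subst e3
  have h2 := hy.2
  have h21 : ⁅x₂, x₁⁆ = -((2 : ℝ) • x₂) := by rw [← lie_skew, h.rel.1]
  simp only [zero_smul, add_zero, lie_add, lie_smul, h21, h.inv_k₁.2, h.inv_k₂.2, h.inv_u.2,
    smul_zero] at h2
  obtain ⟨-, e0, -⟩ := h.eq_zero (c₀ := 0) (c₁ := -2 * c₀) (c₂ := 0) (c₃ := 0) (c₄ := 0) (c₅ := 0)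
    (c₆ := 0) (c₇ := 0) (by rw [← h2]; module)
  obtain rfl : c₀ = 0 := by linarith
  exact ⟨c₅, c₆, c₇, by module⟩

theorem exists_eq_smul_of_lie_eq (h : IsSl2Frame x₁ x₂ x₃ v w k₁ k₂ u) (hy : ⁅x₁, y⁆ = y) :
    ∃ a : ℝ, y = a • v := by
  obtain ⟨c₀, c₁, c₂, c₃, c₄, c₅, c₆, c₇, rfl⟩ := h.spans y
  rw [h.lie_h, ← sub_eq_zero] at hy
  obtain ⟨e0, e1, e2, -, e4, e5, e6, e7⟩ := h.eq_zero (c₀ := -c₀) (c₁ := c₁) (c₂ := -3 * c₂)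
    (c₃ := 0) (c₄ := -2 * c₄) (c₅ := -c₅) (c₆ := -c₆) (c₇ := -c₇) (by rw [← hy]; module)
  refine ⟨c₃, ?_⟩
  rw [show c₀ = 0 by linarith, show c₁ = 0 by linarith, show c₂ = 0 by linarith,
    show c₄ = 0 by linarith, show c₅ = 0 by linarith, show c₆ = 0 by linarith,
    show c₇ = 0 by linarith]
  module

/-- Schur's lemma: an invariant vector maps `v` to a vector of weight 1, hence to a multiple of `v`,
and lowering by `x₃` gives the same scalar on `w`. -/
theorem exists_lie_eq_smul (h : IsSl2Frame x₁ x₂ x₃ v w k₁ k₂ u) (hy : IsInvariant x₁ x₂ x₃ y) :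
    ∃ l : ℝ, ⁅v, y⁆ = l • v ∧ ⁅w, y⁆ = l • w := by
  obtain ⟨l, hl⟩ := h.exists_eq_smul_of_lie_eq (y := ⁅v, y⁆) (by
    rw [leibniz_lie, h.pair.1, hy.1, lie_zero, add_zero])
  refine ⟨l, hl, ?_⟩
  have : ⁅x₃, ⁅v, y⁆⁆ = ⁅⁅x₃, v⁆, y⁆ + ⁅v, ⁅x₃, y⁆⁆ := leibniz_lie _ _ _
  rw [h.pair.lie_f_v, hy.3, lie_zero, add_zero, hl, lie_smul, h.pair.lie_f_v] at this
  exact this.symm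

theorem change (h : IsSl2Frame x₁ x₂ x₃ v w k₁ k₂ u) {k₁' k₂' u' : g}
    (i₁ : IsInvariant x₁ x₂ x₃ k₁') (i₂ : IsInvariant x₁ x₂ x₃ k₂') (i₃ : IsInvariant x₁ x₂ x₃ u')
    (h₁ : ∃ a b c : ℝ, k₁ = a • k₁' + b • k₂' + c • u')
    (h₂ : ∃ a b c : ℝ, k₂ = a • k₁' + b • k₂' + c • u')
    (h₃ : ∃ a b c : ℝ, u = a • k₁' + b • k₂' + c • u') :
    IsSl2Frame x₁ x₂ x₃ v w k₁' k₂' u' where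
  frame := isFrame_of_spans_eight h.frame.finrank_eq fun x => by
    obtain ⟨c₀, c₁, c₂, c₃, c₄, c₅, c₆, c₇, rfl⟩ := h.spans x
    obtain ⟨a, b, c, rfl⟩ := h₁
    obtain ⟨a', b', c', rfl⟩ := h₂
    obtain ⟨a'', b'', c'', rfl⟩ := h₃
    exact ⟨c₀, c₁, c₂, c₃, c₄, c₅ * a + c₆ * a' + c₇ * a'', c₅ * b + c₆ * b' + c₇ * b'',
      c₅ * c + c₆ * c' + c₇ * c'', by module⟩
  rel := h.rel
  pair := h.pair
  inv_k₁ := i₁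
  inv_k₂ := i₂
  inv_u := i₃

end IsSl2Frame

/-- The Levi factor centralises `y` and is perfect. -/
theorem IsSymplectic.apply_eq_zero_of_isInvariant [FiniteDimensional ℝ g] {ω : LinearMap.BilinForm ℝ g}
    (hω : IsSymplectic ω) (hs : IsSl2Relations x₁ x₂ x₃) (hy : IsInvariant x₁ x₂ x₃ y) :
    ω y x₁ = 0 ∧ ω y x₂ = 0 ∧ ω y x₃ = 0 := by
  have h1 : ⁅y, x₁⁆ = 0 := by rw [← lie_skew, hy.1, neg_zero]
  have h2 : ⁅y, x₂⁆ = 0 := by rw [← lie_skew, hy.2, neg_zero]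
  have h3 : ⁅y, x₃⁆ = 0 := by rw [← lie_skew, hy.3, neg_zero]
  refine ⟨?_, ?_, ?_⟩
  · rw [← hs.lie_e_f]
    exact hω.apply_lie_eq_zero h2 h3
  · have := hω.apply_lie_eq_zero h1 h2
    rw [hs.lie_h_e, map_smul, smul_eq_mul] at this
    linarith
  · have := hω.apply_lie_eq_zero h1 h3
    rw [hs.lie_h_f, map_smul, smul_eq_mul] at this
    linarith

theorem IsSymplectic.apply_pair_eq_zero_of_isInvariant [FiniteDimensional ℝ g] {ω : LinearMap.BilinForm ℝ g}
    (hω : IsSymplectic ω) (hp : IsStandardPair x₁ x₂ x₃ v w) (hy : IsInvariant x₁ x₂ x₃ y)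
    (hv : ⁅v, y⁆ = 0) (hw : ⁅w, y⁆ = 0) : ω y v = 0 ∧ ω y w = 0 ∧ ω y ⁅v, w⁆ = 0 := by
  have h2 : ⁅y, x₂⁆ = 0 := by rw [← lie_skew, hy.2, neg_zero]
  have h3 : ⁅y, x₃⁆ = 0 := by rw [← lie_skew, hy.3, neg_zero]
  have hv' : ⁅y, v⁆ = 0 := by rw [← lie_skew, hv, neg_zero]
  have hw' : ⁅y, w⁆ = 0 := by rw [← lie_skew, hw, neg_zero]
  refine ⟨?_, ?_, hω.apply_lie_eq_zero hv' hw'⟩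
  · rw [← hp.lie_e_w]
    exact hω.apply_lie_eq_zero h2 hw'
  · rw [← hp.lie_f_v]
    exact hω.apply_lie_eq_zero h3 hv'

/-- A frame in which the first two invariant vectors commute with the standard representation and
the third one acts by the identity. -/
structure IsAdapted (x₁ x₂ x₃ v w k₁ k₂ u : g) : Prop extends
    IsSl2Frame x₁ x₂ x₃ v w k₁ k₂ u where
  v_k₁ : ⁅v, k₁⁆ = 0
  w_k₁ : ⁅w, k₁⁆ = 0
  v_k₂ : ⁅v, k₂⁆ = 0
  w_k₂ : ⁅w, k₂⁆ = 0
  v_u : ⁅v, u⁆ = v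
  w_u : ⁅w, u⁆ = w

theorem IsSl2Frame.exists_isAdapted_of_ne (h : IsSl2Frame x₁ x₂ x₃ v w k₁ k₂ u) {l : ℝ}
    (hl : l ≠ 0) (hv : ⁅v, u⁆ = l • v) (hw : ⁅w, u⁆ = l • w) :
    ∃ k₁' k₂' u', IsAdapted x₁ x₂ x₃ v w k₁' k₂' u' := by
  obtain ⟨l₁, hv₁, hw₁⟩ := h.exists_lie_eq_smul h.inv_k₁
  obtain ⟨l₂, hv₂, hw₂⟩ := h.exists_lie_eq_smul h.inv_k₂
  refine ⟨k₁ - (l₁ / l) • u, k₂ - (l₂ / l) • u, l⁻¹ • u,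
    h.change (h.inv_k₁.sub (h.inv_u.smul _)) (h.inv_k₂.sub (h.inv_u.smul _)) (h.inv_u.smul _)
      ⟨1, 0, l₁, ?_⟩ ⟨0, 1, l₂, ?_⟩ ⟨0, 0, l, ?_⟩, ?_, ?_, ?_, ?_, ?_, ?_⟩
  · match_scalars <;> field_simp <;> ring
  · match_scalars <;> field_simp <;> ring
  · match_scalars <;> field_simp <;> ring
  all_goals
    simp only [lie_sub, lie_smul, hv₁, hw₁, hv₂, hw₂, hv, hw]
    match_scalars
    field_simp
    try ring

/-- If some invariant acts on `⟨v, w⟩` by a non-zero scalar, it can be renamed `u`, rescaled, and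
subtracted from the other two. Otherwise the invariants commute with `⟨v, w⟩`, and the algebra
splits into dimensions five and three. -/
theorem IsSl2Frame.exists_isAdapted [FiniteDimensional ℝ g] (h : IsSl2Frame x₁ x₂ x₃ v w k₁ k₂ u)
    (hg : IsIndecomposable g) {ω : LinearMap.BilinForm ℝ g} (hω : IsSymplectic ω) :
    ∃ k₁' k₂' u', IsAdapted x₁ x₂ x₃ v w k₁' k₂' u' := by
  obtain ⟨l₁, hv₁, hw₁⟩ := h.exists_lie_eq_smul h.inv_k₁
  obtain ⟨l₂, hv₂, hw₂⟩ := h.exists_lie_eq_smul h.inv_k₂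
  obtain ⟨l, hv, hw⟩ := h.exists_lie_eq_smul h.inv_u
  by_cases hl : l = 0
  · by_cases hl₁ : l₁ = 0
    · by_cases hl₂ : l₂ = 0
      · exfalso
        subst hl hl₁ hl₂
        rw [zero_smul] at hv hw hv₁ hw₁ hv₂ hw₂
        have hinv := h.pair.isInvariant_lie
        have hcomm {y : g} (hy : IsInvariant x₁ x₂ x₃ y) : ⁅v, y⁆ = 0 ∧ ⁅w, y⁆ = 0 := by
          obtain ⟨a, b, c, rfl⟩ := h.exists_eq_of_isInvariant hy
          simp [hv, hw, hv₁, hw₁, hv₂, hw₂]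
        -- `⁅v, w⁆` is an invariant, hence orthogonal to the Levi factor and to `v`, `w`; other
        -- invariants commute with `v` and `w`, so they are orthogonal to `⁅v, w⁆` too.
        have hz : ⁅v, w⁆ = 0 := by
          refine hω.eq_zero_of_forall fun x => ?_
          obtain ⟨c₀, c₁, c₂, c₃, c₄, c₅, c₆, c₇, rfl⟩ := h.spans x
          obtain ⟨e1, e2, e3⟩ := hω.apply_eq_zero_of_isInvariant h.rel hinv
          obtain ⟨e4, e5, -⟩ := hω.apply_pair_eq_zero_of_isInvariant h.pair hinv (hcomm hinv).1
            (hcomm hinv).2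
          have hk {y : g} (hy : IsInvariant x₁ x₂ x₃ y) : ω ⁅v, w⁆ y = 0 := by
            rw [← hω.neg_apply, (hω.apply_pair_eq_zero_of_isInvariant h.pair hy (hcomm hy).1
              (hcomm hy).2).2.2, neg_zero]
          simp [e1, e2, e3, e4, e5, hk h.inv_k₁, hk h.inv_k₂, hk h.inv_u]
        refine h.frame.not_isIndecomposable
          ![true, true, true, true, true, false, false, false] ⟨0, rfl⟩ ⟨5, rfl⟩ ?_ ?_ hg
        · rintro (_ | _) A hm i j hij hi hj
          · have key {y y' : g} (hy : IsInvariant x₁ x₂ x₃ y) (hy' : IsInvariant x₁ x₂ x₃ y') :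
                ⁅y, y'⁆ ∈ A := by
              obtain ⟨a, b, c, e⟩ := h.exists_eq_of_isInvariant (hy.lie hy')
              rw [e]
              exact A.add_mem (A.add_mem (A.smul_mem _ (hm 5 rfl)) (A.smul_mem _ (hm 6 rfl)))
                (A.smul_mem _ (hm 7 rfl))
            fin_cases i <;> fin_cases j <;> first
              | exact absurd hij (by decide)
              | exact absurd hi (by decide)
              | exact absurd hj (by decide)
              | exact key h.inv_k₁ h.inv_k₂
              | exact key h.inv_k₁ h.inv_u
              | exact key h.inv_k₂ h.inv_u
          · have m0 : x₁ ∈ A := hm 0 rfl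
            have m1 : x₂ ∈ A := hm 1 rfl
            have m2 : x₃ ∈ A := hm 2 rfl
            have m3 : v ∈ A := hm 3 rfl
            have m4 : w ∈ A := hm 4 rfl
            fin_cases i <;> fin_cases j <;> first
              | exact absurd hij (by decide)
              | exact absurd hi (by decide)
              | exact absurd hj (by decide)
              | simp [h.rel.1, h.rel.2, h.rel.3, h.pair.1, h.pair.2, h.pair.3, h.pair.4, h.pair.5,
                  h.pair.6, hz, m0, m1, m2, m3, m4]
        · intro i j hij hS
          fin_cases i <;> fin_cases j <;> first
            | exact absurd hij (by decide)
            | exact absurd rfl hS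
            | simp [h.inv_k₁.1, h.inv_k₁.2, h.inv_k₁.3, h.inv_k₂.1, h.inv_k₂.2, h.inv_k₂.3,
                h.inv_u.1, h.inv_u.2, h.inv_u.3, hv, hw, hv₁, hw₁, hv₂, hw₂]
      · exact (h.change h.inv_k₁ h.inv_u h.inv_k₂ ⟨1, 0, 0, by module⟩ ⟨0, 0, 1, by module⟩
          ⟨0, 1, 0, by module⟩).exists_isAdapted_of_ne hl₂ hv₂ hw₂
    · exact (h.change h.inv_u h.inv_k₂ h.inv_k₁ ⟨0, 0, 1, by module⟩ ⟨0, 1, 0, by module⟩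
        ⟨1, 0, 0, by module⟩).exists_isAdapted_of_ne hl₁ hv₁ hw₁
  · exact h.exists_isAdapted_of_ne hl hv hw

end Adapted

/-! ### The algebra of invariants and the families `L7`, `L8`, `L9`. -/

section Adapted

variable {g : Type*} [LieRing g] [LieAlgebra ℝ g] {x₁ x₂ x₃ v w k₁ k₂ u y z : g}

namespace IsAdapted

theorem exists_eq (h : IsAdapted x₁ x₂ x₃ v w k₁ k₂ u) (hy : IsInvariant x₁ x₂ x₃ y)
    (hv : ⁅v, y⁆ = 0) : ∃ a b : ℝ, y = a • k₁ + b • k₂ := by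
  obtain ⟨a, b, c, rfl⟩ := h.exists_eq_of_isInvariant hy
  simp only [lie_add, lie_smul, h.v_k₁, h.v_k₂, h.v_u, smul_zero, add_zero, zero_add] at hv
  obtain ⟨-, -, -, rfl, -⟩ := h.eq_zero (c₀ := 0) (c₁ := 0) (c₂ := 0) (c₃ := c) (c₄ := 0) (c₅ := 0)
    (c₆ := 0) (c₇ := 0) (by rw [← hv]; module)
  exact ⟨a, b, by module⟩

theorem apply_k_eq_zero [FiniteDimensional ℝ g] (h : IsAdapted x₁ x₂ x₃ v w k₁ k₂ u)
    {ω : LinearMap.BilinForm ℝ g} (hω : IsSymplectic ω) (a b : ℝ)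
    (h₁ : ω (a • k₁ + b • k₂) k₁ = 0) (h₂ : ω (a • k₁ + b • k₂) k₂ = 0)
    (hu : ω (a • k₁ + b • k₂) u = 0) : a • k₁ + b • k₂ = 0 := by
  have hy := (h.inv_k₁.smul a).add (h.inv_k₂.smul b)
  have hv : ⁅v, a • k₁ + b • k₂⁆ = 0 := by simp [h.v_k₁, h.v_k₂]
  have hw : ⁅w, a • k₁ + b • k₂⁆ = 0 := by simp [h.w_k₁, h.w_k₂]
  obtain ⟨e1, e2, e3⟩ := hω.apply_eq_zero_of_isInvariant h.rel hy
  obtain ⟨e4, e5, -⟩ := hω.apply_pair_eq_zero_of_isInvariant h.pair hy hv hw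
  refine hω.eq_zero_of_forall fun x => ?_
  obtain ⟨c₀, c₁, c₂, c₃, c₄, c₅, c₆, c₇, rfl⟩ := h.spans x
  generalize a • k₁ + b • k₂ = y at *
  simp [e1, e2, e3, e4, e5, h₁, h₂, hu]

/-- The vectors `k₁, k₂` are orthogonal to the Levi factor and to `v, w`. If they were also
orthogonal to each other, both would pair with `u` only, and some combination would be in the kernel
of `ω`. -/
theorem apply_k₁_k₂_ne_zero [FiniteDimensional ℝ g] (h : IsAdapted x₁ x₂ x₃ v w k₁ k₂ u)
    {ω : LinearMap.BilinForm ℝ g} (hω : IsSymplectic ω) : ω k₁ k₂ ≠ 0 := by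
  intro h0
  have h0' : ω k₂ k₁ = 0 := by rw [← hω.neg_apply, h0, neg_zero]
  have key := h.apply_k_eq_zero hω (ω k₂ u) (-ω k₁ u) (by simp [h0', hω.alt]) (by simp [h0, hω.alt])
    (by simp; ring)
  obtain ⟨-, -, -, -, -, e1, -⟩ := h.eq_zero (c₀ := 0) (c₁ := 0) (c₂ := 0) (c₃ := 0) (c₄ := 0)
    (c₅ := ω k₂ u) (c₆ := -ω k₁ u) (c₇ := 0) (by rw [← key]; module)
  have key' := h.apply_k_eq_zero hω 0 1 (by simp [h0']) (by simp [hω.alt]) (by simp [e1])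
  obtain ⟨-, -, -, -, -, -, e2, -⟩ := h.eq_zero (c₀ := 0) (c₁ := 0) (c₂ := 0) (c₃ := 0) (c₄ := 0)
    (c₅ := 0) (c₆ := 1) (c₇ := 0) (by rw [← key']; module)
  exact one_ne_zero e2

/-- `⁅v, w⁆` is an invariant commuting with `v`, so it lies in `⟨k₁, k₂⟩`; it is orthogonal to that
plane, on which `ω` is non-degenerate. -/
theorem lie_v_w [FiniteDimensional ℝ g] (h : IsAdapted x₁ x₂ x₃ v w k₁ k₂ u)
    {ω : LinearMap.BilinForm ℝ g} (hω : IsSymplectic ω) : ⁅v, w⁆ = 0 := by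
  have hinv := h.pair.isInvariant_lie
  have hz : ⁅v, ⁅v, w⁆⁆ = 0 := by
    obtain ⟨l, hv, hw⟩ := h.exists_lie_eq_smul hinv
    by_cases hl : l = 0
    · rw [hv, hl, zero_smul]
    -- If `⁅v, w⁆` acted on `v, w` by `l ≠ 0`, the vanishing bracket of `⁅v, w⁆` with itself would
    -- equal `2l ⁅v, w⁆`.
    have h1 : ⁅⁅v, w⁆, ⁅v, w⁆⁆ = (2 * l) • ⁅v, w⁆ := by
      conv_lhs => rw [lie_lie, hv, hw, lie_smul, lie_smul, ← lie_skew v w]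
      rw [← lie_skew v w]
      module
    rw [lie_self, eq_comm, smul_eq_zero_iff_right (by simpa using hl)] at h1
    rw [h1, lie_zero]
  obtain ⟨a, b, e⟩ := h.exists_eq hinv hz
  obtain ⟨-, -, e1⟩ := hω.apply_pair_eq_zero_of_isInvariant h.pair h.inv_k₁ h.v_k₁ h.w_k₁
  obtain ⟨-, -, e2⟩ := hω.apply_pair_eq_zero_of_isInvariant h.pair h.inv_k₂ h.v_k₂ h.w_k₂
  have hne := h.apply_k₁_k₂_ne_zero hω
  rw [e] at e1 e2 ⊢
  simp only [map_add, map_smul, smul_eq_mul, hω.alt, mul_zero, zero_add, add_zero,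
    ← hω.neg_apply k₁ k₂] at e1 e2
  have hb : b = 0 := (mul_eq_zero.mp e1).resolve_right hne
  have ha : a = 0 := (mul_eq_zero.mp e2).resolve_right (neg_ne_zero.mpr hne)
  rw [ha, hb]
  module

theorem exists_lie_k₁_k₂ (h : IsAdapted x₁ x₂ x₃ v w k₁ k₂ u) :
    ∃ a b : ℝ, ⁅k₁, k₂⁆ = a • k₁ + b • k₂ :=
  h.exists_eq (h.inv_k₁.lie h.inv_k₂) (by rw [leibniz_lie, h.v_k₁, h.v_k₂, lie_zero, zero_lie,
    add_zero])

theorem exists_lie_k₁_u (h : IsAdapted x₁ x₂ x₃ v w k₁ k₂ u) :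
    ∃ a b : ℝ, ⁅k₁, u⁆ = a • k₁ + b • k₂ :=
  h.exists_eq (h.inv_k₁.lie h.inv_u) (by rw [leibniz_lie, h.v_k₁, h.v_u, zero_lie, zero_add,
    ← lie_skew, h.v_k₁, neg_zero])

theorem exists_lie_k₂_u (h : IsAdapted x₁ x₂ x₃ v w k₁ k₂ u) :
    ∃ a b : ℝ, ⁅k₂, u⁆ = a • k₁ + b • k₂ :=
  h.exists_eq (h.inv_k₂.lie h.inv_u) (by rw [leibniz_lie, h.v_k₂, h.v_u, zero_lie, zero_add,
    ← lie_skew, h.v_k₂, neg_zero])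

theorem change_k (h : IsAdapted x₁ x₂ x₃ v w k₁ k₂ u) (α β γ δ : ℝ) (hd : α * δ - β * γ ≠ 0) :
    IsAdapted x₁ x₂ x₃ v w (α • k₁ + β • k₂) (γ • k₁ + δ • k₂) u where
  toIsSl2Frame := by
    obtain ⟨i, hi⟩ : ∃ i, (α * δ - β * γ) * i = 1 := ⟨_, mul_inv_cancel₀ hd⟩
    refine h.change ((h.inv_k₁.smul _).add (h.inv_k₂.smul _))
      ((h.inv_k₁.smul _).add (h.inv_k₂.smul _)) h.inv_u ⟨δ * i, -β * i, 0, ?_⟩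
      ⟨-γ * i, α * i, 0, ?_⟩ ⟨0, 0, 1, by module⟩
    · conv_lhs => rw [← one_smul ℝ k₁, ← hi]
      module
    · conv_lhs => rw [← one_smul ℝ k₂, ← hi]
      module
  v_k₁ := by simp [h.v_k₁, h.v_k₂]
  w_k₁ := by simp [h.w_k₁, h.w_k₂]
  v_k₂ := by simp [h.v_k₁, h.v_k₂]
  w_k₂ := by simp [h.w_k₁, h.w_k₂]
  v_u := h.v_u
  w_u := h.w_u

theorem sub_u (h : IsAdapted x₁ x₂ x₃ v w k₁ k₂ u) (a b : ℝ) :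
    IsAdapted x₁ x₂ x₃ v w k₁ k₂ (u - (a • k₁ + b • k₂)) where
  toIsSl2Frame := h.change h.inv_k₁ h.inv_k₂
    (h.inv_u.sub ((h.inv_k₁.smul _).add (h.inv_k₂.smul _))) ⟨1, 0, 0, by module⟩
    ⟨0, 1, 0, by module⟩ ⟨a, b, 1, by module⟩
  v_k₁ := h.v_k₁
  w_k₁ := h.w_k₁
  v_k₂ := h.v_k₂
  w_k₂ := h.w_k₂
  v_u := by simp [h.v_k₁, h.v_k₂, h.v_u]
  w_u := by simp [h.w_k₁, h.w_k₂, h.w_u]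

theorem not_isIndecomposable (h : IsAdapted x₁ x₂ x₃ v w k₁ k₂ u) (hvw : ⁅v, w⁆ = 0)
    (h₁ : ⁅k₁, u⁆ = 0) (h₂ : ⁅k₂, u⁆ = 0) : ¬ IsIndecomposable g := by
  refine h.frame.not_isIndecomposable
    ![true, true, true, true, true, false, false, true] ⟨0, rfl⟩ ⟨5, rfl⟩ ?_ ?_
  · rintro (_ | _) A hm i j hij hi hj
    · obtain ⟨a, b, e⟩ := h.exists_lie_k₁_k₂
      have m5 : k₁ ∈ A := hm 5 rfl
      have m6 : k₂ ∈ A := hm 6 rfl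
      fin_cases i <;> fin_cases j <;> first
        | exact absurd hij (by decide)
        | exact absurd hi (by decide)
        | exact absurd hj (by decide)
        | exact e ▸ A.add_mem (A.smul_mem _ m5) (A.smul_mem _ m6)
    · have m0 : x₁ ∈ A := hm 0 rfl
      have m1 : x₂ ∈ A := hm 1 rfl
      have m2 : x₃ ∈ A := hm 2 rfl
      have m3 : v ∈ A := hm 3 rfl
      have m4 : w ∈ A := hm 4 rfl
      fin_cases i <;> fin_cases j <;> first
        | exact absurd hij (by decide)
        | exact absurd hi (by decide)
        | exact absurd hj (by decide)
        | simp [h.rel.1, h.rel.2, h.rel.3, h.pair.1, h.pair.2, h.pair.3, h.pair.4, h.pair.5,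
            h.pair.6, hvw, h.inv_u.1, h.inv_u.2, h.inv_u.3, h.v_u, h.w_u, m0, m1, m2, m3, m4]
  · intro i j hij hS
    fin_cases i <;> fin_cases j <;> first
      | exact absurd hij (by decide)
      | exact absurd rfl hS
      | simp [h.inv_k₁.1, h.inv_k₁.2, h.inv_k₁.3, h.inv_k₂.1, h.inv_k₂.2, h.inv_k₂.3, h₁, h₂,
          h.v_k₁, h.v_k₂, h.w_k₁, h.w_k₂]

/-- The non-abelian two-dimensional Lie algebra has only inner derivations. If `⟨k₁, k₂⟩` were of
this type, subtracting an element from `u` would make `u` commute with it, and it would split off as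
an ideal. -/
theorem lie_k₁_k₂ [FiniteDimensional ℝ g] (h : IsAdapted x₁ x₂ x₃ v w k₁ k₂ u)
    (hg : IsIndecomposable g) {ω : LinearMap.BilinForm ℝ g} (hω : IsSymplectic ω) :
    ⁅k₁, k₂⁆ = 0 := by
  obtain ⟨a, b, e⟩ := h.exists_lie_k₁_k₂
  obtain ⟨p, q, e₁⟩ := h.exists_lie_k₁_u
  obtain ⟨r, s, e₂⟩ := h.exists_lie_k₂_u
  by_contra hne
  have e' : ⁅k₂, k₁⁆ = -(a • k₁ + b • k₂) := by rw [← lie_skew, e]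
  have hJ : ⁅⁅k₁, k₂⁆, u⁆ = ⁅k₁, ⁅k₂, u⁆⁆ - ⁅k₂, ⁅k₁, u⁆⁆ := lie_lie _ _ _
  simp only [e, e', e₁, e₂, add_lie, smul_lie, lie_add, lie_smul, lie_self, smul_zero, add_zero,
    zero_add] at hJ
  rw [← sub_eq_zero] at hJ
  obtain ⟨-, -, -, -, -, f₁, f₂, -⟩ := h.eq_zero (c₀ := 0) (c₁ := 0) (c₂ := 0) (c₃ := 0) (c₄ := 0)
    (c₅ := b * r - s * a) (c₆ := a * q - p * b) (c₇ := 0) (by rw [← hJ]; module)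
  -- The equations from the Jacobi identity say that `⁅k₁, u⁆` and `⁅k₂, u⁆` are proportional to
  -- `⁅k₁, k₂⁆`, which determines the inner derivation.
  have key (x y : ℝ) (g₁ : p = y * a) (g₂ : q = y * b) (g₃ : r = -x * a) (g₄ : s = -x * b) :
      False := by
    refine (h.sub_u x y).not_isIndecomposable (h.lie_v_w hω) ?_ ?_ hg
    · simp only [lie_sub, lie_add, lie_smul, lie_self, e, e₁, g₁, g₂]
      module
    · simp only [lie_sub, lie_add, lie_smul, lie_self, e', e₂, g₃, g₄]
      module
  by_cases ha : a = 0
  · by_cases hb : b = 0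
    · exact hne (by rw [e, ha, hb]; module)
    · refine key (-s / b) (q / b) ?_ ?_ ?_ ?_ <;> field_simp <;> linarith
  · refine key (-r / a) (p / a) ?_ ?_ ?_ ?_ <;> field_simp <;> linarith

theorem nonempty_lieEquiv_of_table [FiniteDimensional ℝ g] (h : IsAdapted x₁ x₂ x₃ v w k₁ k₂ u)
    (hvw : ⁅v, w⁆ = 0) (hk : ⁅k₁, k₂⁆ = 0) (T : Table)
    (hT : ∀ i j, j ≠ 8 → T.c i j = sl2Table i j) (h18 : T.c 1 8 = 0) (h28 : T.c 2 8 = 0)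
    (h38 : T.c 3 8 = 0) (h48 : T.c 4 8 = e 4) (h58 : T.c 5 8 = e 5)
    (h68 : ⁅k₁, u⁆ = comb ![x₁, x₂, x₃, v, w, k₁, k₂, u] (T.c 6 8))
    (h78 : ⁅k₂, u⁆ = comb ![x₁, x₂, x₃, v, w, k₁, k₂, u] (T.c 7 8)) :
    Nonempty (g ≃ₗ⁅ℝ⁆ T) := by
  refine h.frame.nonempty_lieEquiv T fun i j hij => ?_
  fin_cases i <;> fin_cases j <;> first
    | exact absurd hij (by decide)
    | simp [hT, h18, h28, h38, h48, h58, h68, h78, sl2Table, comb_e_one, comb_e_two,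
        comb_e_three, comb_e_four, comb_e_five, h.rel.1, h.rel.2, h.rel.3, h.pair.1, h.pair.2,
        h.pair.3, h.pair.4, h.pair.5, h.pair.6, hvw, hk, h.inv_k₁.1, h.inv_k₁.2, h.inv_k₁.3,
        h.inv_k₂.1, h.inv_k₂.2, h.inv_k₂.3, h.inv_u.1, h.inv_u.2, h.inv_u.3, h.v_k₁, h.v_k₂,
        h.w_k₁, h.w_k₂, h.v_u, h.w_u]

end IsAdapted

theorem L7Brackets_eq (p q : ℝ) (i j : ℕ) (hj : j ≠ 8) : L7Brackets p q i j = sl2Table i j := by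
  unfold L7Brackets
  split <;> first | rfl | exact absurd rfl hj

theorem L8Brackets_eq (p : ℝ) (i j : ℕ) (hj : j ≠ 8) : L8Brackets p i j = sl2Table i j := by
  unfold L8Brackets
  split <;> first | rfl | exact absurd rfl hj

theorem L9Brackets_eq (p q : ℝ) (i j : ℕ) (hj : j ≠ 8) : L9Brackets p q i j = sl2Table i j := by
  unfold L9Brackets
  split <;> first | rfl | exact absurd rfl hj

/-- Normal forms, up to conjugation, of non-zero real two by two matrices of trace zero. -/
theorem exists_normalForm_of_trace_eq_zero (p q r : ℝ) (h : ¬ (p = 0 ∧ q = 0 ∧ r = 0)) :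
    ∃ α β γ δ : ℝ, α * δ - β * γ ≠ 0 ∧
      ((∃ m, m ≠ 0 ∧ α * p + β * r = m * α ∧ α * q - β * p = m * β ∧
          γ * p + δ * r = -m * γ ∧ γ * q - δ * p = -m * δ) ∨
        (α * p + β * r = 0 ∧ α * q - β * p = 0 ∧ γ * p + δ * r = α ∧ γ * q - δ * p = β) ∨
        (∃ m, m ≠ 0 ∧ α * p + β * r = -m * γ ∧ α * q - β * p = -m * δ ∧
          γ * p + δ * r = m * α ∧ γ * q - δ * p = m * β)) := by
  rcases lt_trichotomy (p ^ 2 + q * r) 0 with hΔ | hΔ | hΔ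
  · have h1 : 0 < √(-(p ^ 2 + q * r)) := Real.sqrt_pos.mpr (by linarith)
    have h2 := Real.sq_sqrt (show 0 ≤ -(p ^ 2 + q * r) by linarith)
    generalize √(-(p ^ 2 + q * r)) = σ at h1 h2
    have hq : q ≠ 0 := by
      rintro rfl
      nlinarith [sq_nonneg p]
    have hσ := h1.ne'
    -- Eigenvalues `±iσ`: the second new vector is `k₂' = k₁`, and the first is its image divided by
    -- `σ`.
    refine ⟨p / σ, q / σ, 1, 0, by simp [hq, hσ], Or.inr (Or.inr ⟨σ, hσ, ?_, ?_, ?_, ?_⟩)⟩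
    · field_simp; linarith
    · field_simp; ring
    · field_simp; ring
    · field_simp; ring
  · by_cases hq : q = 0
    · subst hq
      obtain rfl : p = 0 := by
        have : p ^ 2 = 0 := by linarith
        simpa using this
      have hr : r ≠ 0 := fun hr => h ⟨rfl, rfl, hr⟩
      exact ⟨r, 0, 0, 1, by simpa using hr, Or.inr (Or.inl ⟨by ring, by ring, by ring, by ring⟩)⟩
    · exact ⟨p, q, 1, 0, by simpa using hq,
        Or.inr (Or.inl ⟨by linarith, by ring, by ring, by ring⟩)⟩
  · by_cases hq : q = 0
    · subst hq
      have hp : p ≠ 0 := by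
        rintro rfl
        simp at hΔ
      exact ⟨1, 0, r, -2 * p, by simpa using hp, Or.inl ⟨p, hp, by ring, by ring, by ring, by ring⟩⟩
    · have h1 : 0 < √(p ^ 2 + q * r) := Real.sqrt_pos.mpr hΔ
      have h2 := Real.sq_sqrt hΔ.le
      generalize √(p ^ 2 + q * r) = σ at h1 h2
      -- Left eigenvectors for `σ` and `-σ`.
      refine ⟨σ + p, q, -σ + p, q, ?_, Or.inl ⟨σ, h1.ne', ?_, ?_, ?_, ?_⟩⟩
      · have : (σ + p) * q - q * (-σ + p) = 2 * σ * q := by ring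
        rw [this]
        exact mul_ne_zero (mul_ne_zero two_ne_zero h1.ne') hq
      all_goals linarith

/-- Closedness at `k₁, k₂, u` says that the action of `u` on `⟨k₁, k₂⟩` preserves the area form `ω`,
so it has trace zero. It is not zero, since the plane would then split off. -/
theorem IsAdapted.nonempty_lieEquiv [FiniteDimensional ℝ g]
    (h : IsAdapted x₁ x₂ x₃ v w k₁ k₂ u) (hg : IsIndecomposable g)
    {ω : LinearMap.BilinForm ℝ g} (hω : IsSymplectic ω) :
    (∃ p : ℝ, p ≠ 0 ∧ Nonempty (g ≃ₗ⁅ℝ⁆ L7 p (-p))) ∨ Nonempty (g ≃ₗ⁅ℝ⁆ L8 0) ∨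
      (∃ q : ℝ, q ≠ 0 ∧ Nonempty (g ≃ₗ⁅ℝ⁆ L9 0 q)) := by
  obtain ⟨p, q, e₁⟩ := h.exists_lie_k₁_u
  obtain ⟨r, s, e₂⟩ := h.exists_lie_k₂_u
  have hk := h.lie_k₁_k₂ hg hω
  have hvw := h.lie_v_w hω
  obtain rfl : s = -p := by
    have hc := hω.closed k₁ k₂ u
    rw [hk, e₂, ← lie_skew, e₁] at hc
    simp only [map_add, map_neg, map_smul, map_zero, LinearMap.add_apply, LinearMap.neg_apply,
      LinearMap.smul_apply, LinearMap.zero_apply, smul_eq_mul, hω.alt, ← hω.neg_apply k₁ k₂] at hc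
    have : (s + p) * ω k₁ k₂ = 0 := by linarith
    linarith [(mul_eq_zero.mp this).resolve_right (h.apply_k₁_k₂_ne_zero hω)]
  have hne : ¬ (p = 0 ∧ q = 0 ∧ r = 0) := by
    rintro ⟨rfl, rfl, rfl⟩
    exact h.not_isIndecomposable hvw (by rw [e₁]; module) (by rw [e₂]; module) hg
  obtain ⟨α, β, γ, δ, hd, hcases⟩ := exists_normalForm_of_trace_eq_zero p q r hne
  have h' := h.change_k α β γ δ hd
  have hk' : ⁅α • k₁ + β • k₂, γ • k₁ + δ • k₂⁆ = 0 := by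
    have hk2 : ⁅k₂, k₁⁆ = 0 := by rw [← lie_skew, hk, neg_zero]
    simp [hk, hk2]
  have hD (α β : ℝ) : ⁅α • k₁ + β • k₂, u⁆ = (α * p + β * r) • k₁ + (α * q - β * p) • k₂ := by
    simp only [add_lie, smul_lie, e₁, e₂]
    module
  have hD₁ := hD α β
  have hD₂ := hD γ δ
  rcases hcases with ⟨m, hm, f₁, f₂, f₃, f₄⟩ | ⟨f₁, f₂, f₃, f₄⟩ | ⟨m, hm, f₁, f₂, f₃, f₄⟩
  · left
    rw [f₁, f₂] at hD₁
    rw [f₃, f₄] at hD₂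
    refine ⟨m, hm, h'.nonempty_lieEquiv_of_table hvw hk' _ (L7Brackets_eq m (-m)) rfl rfl rfl rfl rfl
      (hD₁.trans ?_) (hD₂.trans ?_)⟩ <;>
    simp only [L7, L7Brackets, map_smul, comb_e_six, comb_e_seven, Matrix.cons_val] <;> module
  · right; left
    rw [f₁, f₂] at hD₁
    rw [f₃, f₄] at hD₂
    refine h'.nonempty_lieEquiv_of_table hvw hk' _ (L8Brackets_eq 0) rfl rfl rfl rfl rfl
      (hD₁.trans ?_) (hD₂.trans ?_) <;>
    simp only [L8, L8Brackets, map_add, map_smul, comb_e_six, comb_e_seven, Matrix.cons_val] <;>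
    module
  · right; right
    rw [f₁, f₂] at hD₁
    rw [f₃, f₄] at hD₂
    refine ⟨m, hm, h'.nonempty_lieEquiv_of_table hvw hk' _ (L9Brackets_eq 0 m) rfl rfl rfl rfl rfl
      (hD₁.trans ?_) (hD₂.trans ?_)⟩ <;>
    simp only [L9, L9Brackets, map_add, map_sub, map_smul, comb_e_six, comb_e_seven,
      Matrix.cons_val] <;>
    module

end Adapted

/-! ### The classification: every algebra in question is in the list. -/

section Classification

variable {g : Type*} [LieRing g] [LieAlgebra ℝ g]

/-- An eight-dimensional indecomposable non-solvable symplectic Lie algebra occurs in the list. -/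
theorem nonempty_lieEquiv_of_isSymplectic (hdim : finrank ℝ g = 8) (hg : IsIndecomposable g)
    (hsol : ¬ LieAlgebra.IsSolvable g) {ω : LinearMap.BilinForm ℝ g} (hω : IsSymplectic ω) :
    Nonempty (g ≃ₗ⁅ℝ⁆ L3) ∨
      (∃ p : ℝ, p ≠ 0 ∧ Nonempty (g ≃ₗ⁅ℝ⁆ L4 p)) ∨
      (∃ p : ℝ, p ≠ 0 ∧ Nonempty (g ≃ₗ⁅ℝ⁆ L7 p (-p))) ∨
      Nonempty (g ≃ₗ⁅ℝ⁆ L8 0) ∨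
      (∃ q : ℝ, q ≠ 0 ∧ Nonempty (g ≃ₗ⁅ℝ⁆ L9 0 q)) ∨
      Nonempty (g ≃ₗ⁅ℝ⁆ L16) ∨
      (∃ p : ℝ, -1 < p ∧ p ≤ 1 ∧ Nonempty (g ≃ₗ⁅ℝ⁆ L17 p)) ∨
      (∃ p : ℝ, 0 < p ∧ Nonempty (g ≃ₗ⁅ℝ⁆ L18 p)) ∨
      Nonempty (g ≃ₗ⁅ℝ⁆ L20) := by
  have : FiniteDimensional ℝ g := FiniteDimensional.of_finrank_pos (by omega)
  obtain ⟨n, x₁, x₂, x₃, y₁, y₂, y₃, y₄, t, h, ⟨hs, ⟨hp, ⟨a1, a2, a3⟩, b1, b2, b3⟩ | ⟨hp, hp'⟩ | hc⟩ |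
    ⟨hs, hq⟩⟩ := exists_isSplit hdim hg hsol hω
  · have hF : IsSl2Frame x₁ x₂ x₃ y₁ y₂ y₃ y₄ t :=
      ⟨h.frame, hs, hp, ⟨a1, a2, a3⟩, ⟨b1, b2, b3⟩, ⟨h.lie_1_t, h.lie_2_t, h.lie_3_t⟩⟩
    obtain ⟨k₁, k₂, u, hA⟩ := hF.exists_isAdapted hg hω
    rcases hA.nonempty_lieEquiv hg hω with e | e | e
    · exact .inr (.inr (.inl e))
    · exact .inr (.inr (.inr (.inl e)))
    · exact .inr (.inr (.inr (.inr (.inl e))))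
  · rcases nonempty_lieEquiv_of_isStandardPair hs h hp hp' with e | e | e
    · exact .inr (.inr (.inr (.inr (.inr (.inl e)))))
    · exact .inr (.inr (.inr (.inr (.inr (.inr (.inl e))))))
    · exact .inr (.inr (.inr (.inr (.inr (.inr (.inr (.inl e)))))))
  · exact .inr (.inr (.inr (.inr (.inr (.inr (.inr (.inr (hc.nonempty_lieEquiv hs h))))))))
  · rcases hq.nonempty_lieEquiv hs h with e | e
    · exact .inl e
    · exact .inr (.inl e)

end Classification

/-! ### Non-solvability and indecomposability of the algebras in the list. -/

section SimpleTriple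

variable {g : Type*} [LieRing g] [LieAlgebra ℝ g] {c : ℝ} {x₁ x₂ x₃ : g}

/-- Relations which hold both in `sl(2, ℝ)` (with `c = 4`) and in `so(3)` (with `c = -1`). -/
structure IsSimpleTriple (c : ℝ) (x₁ x₂ x₃ : g) : Prop where
  ne_zero : x₁ ≠ 0
  scalar_ne_zero : c ≠ 0
  lie_lie_2 : ⁅x₁, ⁅x₁, x₂⁆⁆ = c • x₂
  lie_lie_3 : ⁅x₁, ⁅x₁, x₃⁆⁆ = c • x₃
  lie_2_3 : ⁅x₂, x₃⁆ = x₁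

/-- Each of the three vectors is a multiple of a bracket of elements in their span closure, so all
of them survive in every derived ideal. -/
theorem IsSimpleTriple.not_isSolvable (h : IsSimpleTriple c x₁ x₂ x₃) :
    ¬ LieAlgebra.IsSolvable g := by
  have key (k : ℕ) : x₁ ∈ LieAlgebra.derivedSeries ℝ g k ∧
      x₂ ∈ LieAlgebra.derivedSeries ℝ g k ∧ x₃ ∈ LieAlgebra.derivedSeries ℝ g k := by
    induction k with
    | zero => simp
    | succ k ih =>
      obtain ⟨h1, h2, h3⟩ := ih
      rw [LieAlgebra.derivedSeries_def, LieAlgebra.derivedSeriesOfIdeal_succ]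
      have hm {x y : g} (hx : x ∈ LieAlgebra.derivedSeries ℝ g k)
          (hy : y ∈ LieAlgebra.derivedSeries ℝ g k) :
          ⁅x, y⁆ ∈ ⁅LieAlgebra.derivedSeries ℝ g k, LieAlgebra.derivedSeries ℝ g k⁆ :=
        LieSubmodule.lie_mem_lie hx hy
      have hsc {y : g} (hy : y ∈ LieAlgebra.derivedSeries ℝ g k) (e : ⁅x₁, ⁅x₁, y⁆⁆ = c • y) :
          y ∈ ⁅LieAlgebra.derivedSeries ℝ g k, LieAlgebra.derivedSeries ℝ g k⁆ := by
        have := hm h1 (lie_mem_right ℝ g (LieAlgebra.derivedSeries ℝ g k) x₁ y hy)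
        rw [e] at this
        have h' := (⁅LieAlgebra.derivedSeries ℝ g k, LieAlgebra.derivedSeries ℝ g k⁆).smul_mem c⁻¹ this
        rwa [smul_smul, inv_mul_cancel₀ h.scalar_ne_zero, one_smul] at h'
      exact ⟨by simpa only [h.lie_2_3] using hm h2 h3, hsc h2 h.lie_lie_2, hsc h3 h.lie_lie_3⟩
  intro hsol
  obtain ⟨k, hk⟩ := (LieAlgebra.isSolvable_iff ℝ g).mp hsol
  have := (key k).1
  rw [hk, LieSubmodule.mem_bot] at this
  exact h.ne_zero this

theorem lie_eq_zero_of_isCompl {I J : LieIdeal ℝ g} (hIJ : IsCompl I J) {x y : g} (hx : x ∈ I)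
    (hy : y ∈ J) : ⁅x, y⁆ = 0 := by
  have : ⁅x, y⁆ ∈ I ⊓ J := ⟨lie_mem_left ℝ g I x y hx, lie_mem_right ℝ g J x y hy⟩
  rw [hIJ.inf_eq_bot] at this
  simpa using this

theorem eq_zero_of_add_eq_zero {I J : LieIdeal ℝ g} (hIJ : IsCompl I J) {x y : g} (hx : x ∈ I)
    (hy : y ∈ J) (h : x + y = 0) : x = 0 := by
  have : x ∈ I ⊓ J := ⟨hx, by rw [eq_neg_of_add_eq_zero_left h]; exact J.neg_mem hy⟩
  rw [hIJ.inf_eq_bot] at this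
  simpa using this

theorem exists_add_eq_of_isCompl {I J : LieIdeal ℝ g} (hIJ : IsCompl I J) (x : g) :
    ∃ i ∈ I, ∃ j ∈ J, i + j = x := by
  have : x ∈ I ⊔ J := by
    rw [hIJ.sup_eq_top]
    exact LieSubmodule.mem_top x
  exact (LieSubmodule.mem_sup _ _ _).mp this

/-- The components of `x₂` in the two ideals satisfy the same equations as `x₂`, so by `hx` they are
multiples of `x₂`. One of the ideals thus contains `x₂`, and with it `x₁ = ⁅x₂, x₃⁆`. -/
theorem IsSimpleTriple.mem_or_mem (h : IsSimpleTriple c x₁ x₂ x₃)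
    (hx : ∀ y : g, ⁅x₁, ⁅x₁, y⁆⁆ = c • y → ⁅x₂, y⁆ = 0 → ∃ a : ℝ, y = a • x₂)
    {I J : LieIdeal ℝ g} (hIJ : IsCompl I J) : x₁ ∈ I ∨ x₁ ∈ J := by
  obtain ⟨i, hi, j, hj, hij⟩ := exists_add_eq_of_isCompl hIJ x₂
  have key {I J : LieIdeal ℝ g} (hIJ : IsCompl I J) {i j : g} (hi : i ∈ I) (hj : j ∈ J)
      (hij : i + j = x₂) : ∃ a : ℝ, i = a • x₂ := by
    have hmem (K : LieIdeal ℝ g) {y : g} (hy : y ∈ K) (z : g) : ⁅z, y⁆ ∈ K :=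
      lie_mem_right ℝ g K z y hy
    refine hx i ?_ ?_
    · have := eq_zero_of_add_eq_zero hIJ
        (I.sub_mem (hmem I (hmem I hi x₁) x₁) (I.smul_mem c hi))
        (J.sub_mem (hmem J (hmem J hj x₁) x₁) (J.smul_mem c hj)) (by
          have h2 := h.lie_lie_2
          rw [← hij, lie_add, lie_add, smul_add, ← sub_eq_zero] at h2
          rw [← h2]
          abel)
      exact sub_eq_zero.mp this
    · rw [← hij, add_lie, lie_self, zero_add, ← lie_skew, lie_eq_zero_of_isCompl hIJ hi hj,
        neg_zero]
  have mem (K : LieIdeal ℝ g) {a : ℝ} (ha : a ≠ 0) (hK : a • x₂ ∈ K) : x₁ ∈ K := by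
    have h2 := K.smul_mem a⁻¹ hK
    rw [smul_smul, inv_mul_cancel₀ ha, one_smul] at h2
    rw [← h.lie_2_3]
    exact lie_mem_left ℝ g K x₂ x₃ h2
  obtain ⟨a, rfl⟩ := key hIJ hi hj hij
  obtain ⟨b, rfl⟩ := key hIJ.symm hj hi (by rw [add_comm, hij])
  by_cases ha : a = 0
  · by_cases hb : b = 0
    · exfalso
      apply h.ne_zero
      rw [← h.lie_2_3, ← hij, ha, hb]
      simp
    · exact Or.inr (mem J hb hj)
  · exact Or.inl (mem I ha hi)

/-- `K` is to contain whatever commutes with the image of `ad x₁`, hence the ideal not containing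
`x₁`. The condition on `t` says that on `K` the kernel of the bracket with `t` lies in its image. -/
theorem IsSimpleTriple.isIndecomposable (h : IsSimpleTriple c x₁ x₂ x₃)
    (hx : ∀ y : g, ⁅x₁, ⁅x₁, y⁆⁆ = c • y → ⁅x₂, y⁆ = 0 → ∃ a : ℝ, y = a • x₂)
    (K : Submodule ℝ g) (t : g) (hK : ∀ y : g, (∀ z : g, ⁅y, ⁅x₁, z⁆⁆ = 0) → y ∈ K)
    (hKK : ∀ y ∈ K, ∀ z ∈ K, ⁅y, z⁆ = 0)
    (hKt : ∀ y ∈ K, y ≠ 0 → ⁅y, t⁆ = 0 → ∃ k ∈ K, y = ⁅k, t⁆) : IsIndecomposable g := by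
  refine ⟨⟨x₁, 0, h.ne_zero⟩, fun I J hIJ => ?_⟩
  have key {I J : LieIdeal ℝ g} (hIJ : IsCompl I J) (hI : x₁ ∈ I) : J = ⊥ := by
    have hJK (y : g) (hy : y ∈ J) : y ∈ K := hK y fun z => by
      rw [← lie_skew, lie_eq_zero_of_isCompl hIJ (lie_mem_left ℝ g I x₁ z hI) hy, neg_zero]
    have hJt (y : g) (hy : y ∈ J) : ⁅y, t⁆ = 0 := by
      obtain ⟨i, hi, j, hj, rfl⟩ := exists_add_eq_of_isCompl hIJ t
      rw [lie_add, hKK y (hJK y hy) j (hJK j hj), ← lie_skew, lie_eq_zero_of_isCompl hIJ hi hy,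
        neg_zero, add_zero]
    rw [LieSubmodule.eq_bot_iff]
    intro y hy
    by_contra hne
    obtain ⟨k, -, hk⟩ := hKt y (hJK y hy) hne (hJt y hy)
    obtain ⟨i, hi, j, hj, rfl⟩ := exists_add_eq_of_isCompl hIJ k
    -- Only the `I`-component of `k` contributes to `y = ⁅k, t⁆`, so `y` lies in both ideals.
    rw [add_lie, hJt j hj, add_zero] at hk
    refine hne (eq_zero_of_add_eq_zero hIJ (y := -y) ?_ (J.neg_mem hy) (add_neg_cancel y))
    rw [hk]
    exact lie_mem_left ℝ g I i t hi
  rcases h.mem_or_mem hx hIJ with h1 | h1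
  · exact Or.inr (key hIJ h1)
  · exact Or.inl (key hIJ.symm h1)

end SimpleTriple

/-! ### Transport along isomorphisms. -/

section Transport

variable {g g' : Type*} [LieRing g] [LieAlgebra ℝ g] [LieRing g'] [LieAlgebra ℝ g']

theorem IsIndecomposable.of_lieEquiv (h : IsIndecomposable g') (φ : g ≃ₗ⁅ℝ⁆ g') :
    IsIndecomposable g := by
  have := h.1
  refine ⟨φ.toLinearEquiv.toEquiv.nontrivial, fun I J hIJ => ?_⟩
  let ψ : g ≃ₗ[ℝ] g' := φ.toLinearEquiv
  have hψ (x y : g) : ψ ⁅x, y⁆ = ⁅ψ x, ψ y⁆ := φ.map_lie x y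
  have hcl (I : LieIdeal ℝ g) : ∀ x ∈ I.toSubmodule.map (ψ : g →ₗ[ℝ] g'),
      ∀ y ∈ I.toSubmodule.map (ψ : g →ₗ[ℝ] g'), ⁅x, y⁆ ∈ I.toSubmodule.map (ψ : g →ₗ[ℝ] g') := by
    rintro _ ⟨x, hx, rfl⟩ _ ⟨y, hy, rfl⟩
    exact ⟨⁅x, y⁆, lie_mem_left ℝ g I x y hx, hψ x y⟩
  have hbot (I : LieIdeal ℝ g) (hI : I.toSubmodule.map (ψ : g →ₗ[ℝ] g') = ⊥) : I = ⊥ := by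
    rw [← LieSubmodule.toSubmodule_eq_bot]
    exact (Submodule.map_eq_bot_iff (e := ψ)).mp hI
  refine (h.eq_bot_or_eq_bot (I.toSubmodule.map (ψ : g →ₗ[ℝ] g'))
    (J.toSubmodule.map (ψ : g →ₗ[ℝ] g')) ?_ (hcl I) (hcl J) ?_).imp (hbot I) (hbot J)
  · exact (Submodule.orderIsoMapComap ψ).isCompl (LieSubmodule.isCompl_toSubmodule.mpr hIJ)
  · rintro _ ⟨x, hx, rfl⟩ _ ⟨y, hy, rfl⟩
    change ⁅ψ x, ψ y⁆ = 0
    rw [← hψ, lie_eq_zero_of_isCompl hIJ hx hy, map_zero]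

theorem AdmitsSymplectic.of_lieEquiv (h : AdmitsSymplectic g') (φ : g ≃ₗ⁅ℝ⁆ g') :
    AdmitsSymplectic g := by
  obtain ⟨ω, hω⟩ := h
  let ψ : g ≃ₗ[ℝ] g' := φ.toLinearEquiv
  have hψ (x y : g) : ψ ⁅x, y⁆ = ⁅ψ x, ψ y⁆ := φ.map_lie x y
  refine ⟨ω.compl₁₂ (ψ : g →ₗ[ℝ] g') (ψ : g →ₗ[ℝ] g'), fun x => hω.alt _, ⟨fun x hx => ?_,
    fun x hx => ?_⟩, fun x y z => ?_⟩
  · refine ψ.map_eq_zero_iff.mp (hω.nondegenerate.1 _ fun y => ?_)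
    simpa using hx (ψ.symm y)
  · refine ψ.map_eq_zero_iff.mp (hω.nondegenerate.2 _ fun y => ?_)
    simpa using hx (ψ.symm y)
  · simp only [LinearMap.compl₁₂_apply, LinearEquiv.coe_coe, hψ]
    exact hω.closed _ _ _

end Transport

/-! ### Exactness of symplectic forms and the Frobenius property. -/

section Exactness

variable {g : Type*} [LieRing g] [LieAlgebra ℝ g]

theorem lie_lie_cyclic (x y z : g) : ⁅⁅x, y⁆, z⁆ + ⁅⁅y, z⁆, x⁆ + ⁅⁅z, x⁆, y⁆ = 0 := by
  have := lie_jacobi x y z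
  rw [← lie_skew x ⁅y, z⁆, ← lie_skew y ⁅z, x⁆, ← lie_skew z ⁅x, y⁆] at this
  rw [← neg_eq_zero, ← this]
  abel

theorem IsSymplectic.of_isExactForm {ω : LinearMap.BilinForm ℝ g} (hω : IsExactForm ω)
    (h : ω.Nondegenerate) : IsSymplectic ω where
  alt x := by
    obtain ⟨f, hf⟩ := hω
    rw [hf, lie_self, map_zero]
  nondegenerate := h
  closed x y z := by
    obtain ⟨f, hf⟩ := hω
    rw [hf, hf, hf, ← map_add, ← map_add, lie_lie_cyclic, map_zero]

theorem IsFrobenius.admitsSymplectic (h : IsFrobenius g) : AdmitsSymplectic g := by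
  obtain ⟨ω, h, hω⟩ := h
  exact ⟨ω, .of_isExactForm hω h⟩

theorem nondegenerate_of_alt {ω : LinearMap.BilinForm ℝ g} (ha : ∀ x, ω x x = 0)
    (h : ∀ x, (∀ y, ω x y = 0) → x = 0) : ω.Nondegenerate :=
  ⟨h, fun x hx => h x fun y => by
    have := LinearMap.IsAlt.neg (B := ω) ha y x
    rw [← this, hx, neg_zero]⟩

/-- If a bilinear form is invariant under an operator satisfying `D² = a D - b`, with `a` and `b`
different from zero, then it vanishes. -/
theorem apply_eq_zero_of_quadratic {β : LinearMap.BilinForm ℝ g} {V : Submodule ℝ g}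
    {D : g →ₗ[ℝ] g} {a b : ℝ} (ha : a ≠ 0) (hb : b ≠ 0) (hDV : ∀ y ∈ V, D y ∈ V)
    (hD : ∀ y ∈ V, D (D y) = a • D y - b • y)
    (hβ : ∀ y ∈ V, ∀ z ∈ V, β (D y) z + β y (D z) = 0) :
    ∀ y ∈ V, ∀ z ∈ V, β y z = 0 := by
  intro y hy z hz
  have h1 := hβ y hy z hz
  have h2 := hβ _ (hDV y hy) z hz
  have h3 := hβ y hy _ (hDV z hz)
  have h4 := hβ _ (hDV y hy) _ (hDV z hz)
  rw [hD y hy] at h2 h4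
  rw [hD z hz] at h3 h4
  simp only [map_sub, map_smul, LinearMap.sub_apply, LinearMap.smul_apply, smul_eq_mul] at h2 h3 h4
  -- `D` is skew for `β`, so `D² = a D - b` is symmetric, and so is `a D`; being both skew and
  -- symmetric, it gives zero. Here `a` and `b` are the sum and product of the roots.
  have e1 : a * β (D y) z = 0 := by linear_combination (h2 - h3 + a * h1) / 2
  have e2 : a * β (D y) (D z) = 0 := by linear_combination (h4 + b * h1) / 2
  have e1' := (mul_eq_zero.mp e1).resolve_left ha
  have e2' := (mul_eq_zero.mp e2).resolve_left ha
  rw [e1', e2'] at h2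
  exact (mul_eq_zero.mp (show b * β y z = 0 by linarith)).resolve_left hb

/-- A closed form is exact as soon as it is so on a perfect subspace `S` and between `V` and `t`,
where `t` commutes with `S` and acts on the commutative ideal `V` without eigenvalues of sum
zero. -/
theorem IsSymplectic.isExactForm {ω : LinearMap.BilinForm ℝ g} (hω : IsSymplectic ω)
    {S V : Submodule ℝ g} {t : g} {a b : ℝ} (ha : a ≠ 0) (hb : b ≠ 0)
    (hspan : ∀ z : g, ∃ x ∈ S, ∃ y ∈ V, ∃ c : ℝ, z = x + y + c • t)
    (hSt : ∀ x ∈ S, ⁅x, t⁆ = 0) (hSV : ∀ x ∈ S, ∀ y ∈ V, ⁅x, y⁆ ∈ V)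
    (hVt : ∀ y ∈ V, ⁅y, t⁆ ∈ V) (hVV : ∀ y ∈ V, ∀ z ∈ V, ⁅y, z⁆ = 0)
    (hD : ∀ y ∈ V, ⁅⁅y, t⁆, t⁆ = a • ⁅y, t⁆ - b • y)
    (hSS : ∀ x ∈ S, x ∈ Submodule.span ℝ {z | ∃ y ∈ S, ∃ y' ∈ S, ⁅y, y'⁆ = z})
    (f : Module.Dual ℝ g) (hfS : ∀ x ∈ S, ∀ y ∈ S, ω x y = f ⁅x, y⁆)
    (hft : ∀ y ∈ V, ω y t = f ⁅y, t⁆) : IsExactForm ω := by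
  refine ⟨f, ?_⟩
  -- The closed form `η = ω - df` vanishes on `S × S` and `V × t` by the choice of `f`; closedness
  -- must dispose of the blocks `S × t`, `V × V` and `S × V`.
  obtain ⟨η, hη⟩ : ∃ η : LinearMap.BilinForm ℝ g, η = ω - exactForm f := ⟨_, rfl⟩
  have hηa (x y : g) : η x y = ω x y - f ⁅x, y⁆ := by rw [hη]; rfl
  have halt (x : g) : η x x = 0 := by rw [hηa, hω.alt, lie_self, map_zero, sub_zero]
  have hskew (x y : g) : η x y = -η y x := (LinearMap.IsAlt.neg (B := η) halt y x).symm
  have hcl (x y z : g) : η ⁅x, y⁆ z + η ⁅y, z⁆ x + η ⁅z, x⁆ y = 0 := by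
    have h1 := hω.closed x y z
    have h2 : f ⁅⁅x, y⁆, z⁆ + f ⁅⁅y, z⁆, x⁆ + f ⁅⁅z, x⁆, y⁆ = 0 := by
      rw [← map_add, ← map_add, lie_lie_cyclic, map_zero]
    rw [hηa, hηa, hηa]
    linarith
  have hVt0 (y : g) (hy : y ∈ V) : η y t = 0 := by rw [hηa, hft y hy, sub_self]
  have hSS0 (x : g) (hx : x ∈ S) (y : g) (hy : y ∈ S) : η x y = 0 := by
    rw [hηa, hfS x hx y hy, sub_self]
  have hSt0 (x : g) (hx : x ∈ S) : η x t = 0 := by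
    have : Submodule.span ℝ {z | ∃ y ∈ S, ∃ y' ∈ S, ⁅y, y'⁆ = z} ≤ LinearMap.ker (η.flip t) := by
      rw [Submodule.span_le]
      rintro _ ⟨y, hy, y', hy', rfl⟩
      have := hcl y y' t
      rw [hSt y' hy', ← lie_skew t, hSt y hy] at this
      simpa using this
    exact this (hSS x hx)
  have hVV0 : ∀ y ∈ V, ∀ z ∈ V, η y z = 0 := by
    let D : g →ₗ[ℝ] g := -(LieAlgebra.ad ℝ g t : g →ₗ[ℝ] g)
    have hDy (y : g) : D y = ⁅y, t⁆ := by
      rw [LinearMap.neg_apply, LieAlgebra.ad_apply, lie_skew]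
    refine apply_eq_zero_of_quadratic ha hb (D := D) (fun y hy => ?_) (fun y hy => ?_)
      fun y hy z hz => ?_
    · rw [hDy]; exact hVt y hy
    · rw [hDy, hDy]; exact hD y hy
    · rw [hDy, hDy]
      have := hcl y z t
      rw [hVV y hy z hz, ← lie_skew t y, hskew _ y] at this
      simp only [map_zero, LinearMap.zero_apply, map_neg, LinearMap.neg_apply] at this
      linarith
  -- Closedness at `x, y, t` kills `η x ⁅y, t⁆`, and the bracket with `t` is invertible on `V`
  -- because `b ≠ 0`.
  have hSV0 (x : g) (hx : x ∈ S) (y : g) (hy : y ∈ V) : η x y = 0 := by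
    have key (y : g) (hy : y ∈ V) : η x ⁅y, t⁆ = 0 := by
      have := hcl x y t
      rw [hVt0 _ (hSV x hx y hy), ← lie_skew t x, hSt x hx, hskew ⁅y, t⁆] at this
      simpa using this
    have h1 := key _ (hVt y hy)
    rw [hD y hy, map_sub, map_smul, map_smul, key y hy] at h1
    simpa [hb] using h1
  intro x y
  rw [← sub_eq_zero, ← hηa]
  obtain ⟨x, hx, x', hx', c, rfl⟩ := hspan x
  obtain ⟨y, hy, y', hy', d, rfl⟩ := hspan y
  simp only [map_add, map_smul, LinearMap.add_apply, LinearMap.smul_apply, smul_eq_mul,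
    hSS0 x hx y hy, hSV0 x hx y' hy', hSt0 x hx, hskew x' y, hSV0 y hy x' hx', hVV0 x' hx' y' hy',
    hVt0 x' hx', hskew t y, hskew t y', hSt0 y hy, hVt0 y' hy', halt]
  ring

/-- If two independent vectors act only on a single vector `t`, then the Lie algebra is not
Frobenius. -/
theorem not_isFrobenius {k₁ k₂ t : g} (hk : ∀ a b : ℝ, a • k₁ + b • k₂ = 0 → a = 0 ∧ b = 0)
    (l : g → ℝ) (h₁ : ∀ z, ⁅k₁, z⁆ = l z • ⁅k₁, t⁆) (h₂ : ∀ z, ⁅k₂, z⁆ = l z • ⁅k₂, t⁆) :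
    ¬ IsFrobenius g := by
  rintro ⟨ω, hω, f, hf⟩
  -- A combination of `k₁, k₂` whose bracket with `t` is killed by `f` lies in the kernel of the
  -- exact form.
  have key (a b : ℝ) (h : a * f ⁅k₁, t⁆ + b * f ⁅k₂, t⁆ = 0) : a = 0 ∧ b = 0 := by
    refine hk a b (hω.1 _ fun z => ?_)
    rw [hf, add_lie, smul_lie, smul_lie, h₁, h₂]
    simp only [map_add, map_smul, smul_eq_mul]
    linear_combination l z * h
  obtain ⟨e1, -⟩ := key (f ⁅k₂, t⁆) (-f ⁅k₁, t⁆) (by ring)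
  exact one_ne_zero (key 0 1 (by rw [e1]; ring)).2

end Exactness

/-! ### Criteria for algebras given by a table. -/

section General

theorem Table.isSimpleTriple (T : Table) {c : ℝ} (hc : c ≠ 0)
    (h2 : tableBracket T.c (e 1) (tableBracket T.c (e 1) (e 2)) = c • e 2)
    (h3 : tableBracket T.c (e 1) (tableBracket T.c (e 1) (e 3)) = c • e 3)
    (h23 : tableBracket T.c (e 2) (e 3) = e 1) :
    IsSimpleTriple (g := T.Carrier) c (e 1) (e 2) (e 3) where
  ne_zero h := by simpa [e] using congrFun (show e 1 = 0 from h) 0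
  scalar_ne_zero := hc
  lie_lie_2 := h2
  lie_lie_3 := h3
  lie_2_3 := h23

/-- The case `K = 0`, where the condition on `t` is empty. -/
theorem Table.isIndecomposable (T : Table) {c : ℝ}
    (h : IsSimpleTriple (g := T.Carrier) c (e 1) (e 2) (e 3))
    (hx : ∀ y, tableBracket T.c (e 1) (tableBracket T.c (e 1) y) = c • y →
      tableBracket T.c (e 2) y = 0 → ∃ a : ℝ, y = a • e 2)
    (hK : ∀ y, (∀ z, tableBracket T.c y (tableBracket T.c (e 1) z) = 0) → y = 0) :
    IsIndecomposable T.Carrier :=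
  h.isIndecomposable hx ⊥ 0 (fun y hy => (Submodule.mem_bot ℝ).mpr (hK y hy))
    (fun y hy z _ => by rw [(Submodule.mem_bot ℝ).mp hy, zero_lie])
    fun y hy hy0 => absurd ((Submodule.mem_bot ℝ).mp hy) hy0

/-- The span of `e 6` and `e 7`. -/
def span67 : Submodule ℝ (Fin 8 → ℝ) where
  carrier := {x | ∃ a b : ℝ, x = a • e 6 + b • e 7}
  zero_mem' := ⟨0, 0, by module⟩
  add_mem' := by
    rintro _ _ ⟨a, b, rfl⟩ ⟨a', b', rfl⟩
    exact ⟨a + a', b + b', by module⟩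
  smul_mem' := by
    rintro c _ ⟨a, b, rfl⟩
    exact ⟨c * a, c * b, by module⟩

theorem Table.isIndecomposable_of_span67 (T : Table) {c : ℝ}
    (h : IsSimpleTriple (g := T.Carrier) c (e 1) (e 2) (e 3))
    (hx : ∀ y, tableBracket T.c (e 1) (tableBracket T.c (e 1) y) = c • y →
      tableBracket T.c (e 2) y = 0 → ∃ a : ℝ, y = a • e 2)
    (hK : ∀ y, (∀ z, tableBracket T.c y (tableBracket T.c (e 1) z) = 0) →
      ∃ a b : ℝ, y = a • e 6 + b • e 7)
    (hKK : ∀ a b a' b' : ℝ, tableBracket T.c (a • e 6 + b • e 7) (a' • e 6 + b' • e 7) = 0)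
    (hKt : ∀ a b : ℝ, a • e 6 + b • e 7 ≠ 0 → tableBracket T.c (a • e 6 + b • e 7) (e 8) = 0 →
      ∃ a' b' : ℝ, a • e 6 + b • e 7 = tableBracket T.c (a' • e 6 + b' • e 7) (e 8)) :
    IsIndecomposable T.Carrier := by
  refine h.isIndecomposable hx span67 (e 8) hK ?_ ?_
  · rintro _ ⟨a, b, rfl⟩ _ ⟨a', b', rfl⟩
    exact hKK a b a' b'
  · rintro _ ⟨a, b, rfl⟩ hne h0
    obtain ⟨a', b', h'⟩ := hKt a b hne h0
    exact ⟨_, ⟨a', b', rfl⟩, h'⟩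

/-- The coordinates of an element of the Lie algebra given by a table. -/
def Table.coord (T : Table) : T.Carrier →ₗ[ℝ] (Fin 8 → ℝ) where
  toFun x := x
  map_add' _ _ := rfl
  map_smul' _ _ := rfl

theorem Table.coord_lie (T : Table) (x y : T.Carrier) :
    T.coord ⁅x, y⁆ = tableBracket T.c (T.coord x) (T.coord y) := rfl

theorem Table.coord_injective (T : Table) {x y : T.Carrier} (h : T.coord x = T.coord y) : x = y := h

theorem Table.isFrobenius (T : Table) (φ : Dual ℝ (Fin 8 → ℝ))
    (h : ∀ x, (∀ y, φ (tableBracket T.c x y) = 0) → x = 0) : IsFrobenius T.Carrier :=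
  ⟨exactForm (φ ∘ₗ T.coord), nondegenerate_of_alt
    (fun x => by rw [exactForm_apply, lie_self, map_zero]) h, φ ∘ₗ T.coord, fun _ _ => rfl⟩

/-- The sum of two coordinates. -/
def coordSum (i j : Fin 8) : Dual ℝ (Fin 8 → ℝ) :=
  (LinearMap.proj i : Dual ℝ (Fin 8 → ℝ)) + (LinearMap.proj j : Dual ℝ (Fin 8 → ℝ))

theorem coordSum_apply (i j : Fin 8) (x : Fin 8 → ℝ) : coordSum i j x = x i + x j := rfl

theorem Table.not_isFrobenius (T : Table)
    (h6 : ∀ z, tableBracket T.c (e 6) z = z 7 • tableBracket T.c (e 6) (e 8))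
    (h7 : ∀ z, tableBracket T.c (e 7) z = z 7 • tableBracket T.c (e 7) (e 8)) :
    ¬ IsFrobenius T.Carrier :=
  SympLie.not_isFrobenius (g := T.Carrier) (k₁ := e 6) (k₂ := e 7) (t := e 8)
    (fun a b h => by
      have h' : a • e 6 + b • e 7 = 0 := h
      exact ⟨by simpa [e] using congrFun h' 5, by simpa [e] using congrFun h' 6⟩)
    (fun z => (show Fin 8 → ℝ from z) 7) h6 h7

/-- The two-form `e⁶ ∧ e⁷`. -/
def wedge67 : LinearMap.BilinForm ℝ (Fin 8 → ℝ) :=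
  LinearMap.smulRight (LinearMap.proj 5 : Dual ℝ (Fin 8 → ℝ))
      (LinearMap.proj 6 : Dual ℝ (Fin 8 → ℝ)) -
    LinearMap.smulRight (LinearMap.proj 6 : Dual ℝ (Fin 8 → ℝ))
      (LinearMap.proj 5 : Dual ℝ (Fin 8 → ℝ))

theorem wedge67_apply (x y : Fin 8 → ℝ) : wedge67 x y = x 5 * y 6 - x 6 * y 5 := by
  simp [wedge67]

/-- The two-form `d φ + e⁶ ∧ e⁷`. -/
def Table.wedgeForm (T : Table) (φ : Dual ℝ (Fin 8 → ℝ)) : LinearMap.BilinForm ℝ T.Carrier :=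
  exactForm (φ ∘ₗ T.coord) + wedge67.compl₁₂ T.coord T.coord

theorem Table.wedgeForm_apply (T : Table) (φ : Dual ℝ (Fin 8 → ℝ)) (x y : T.Carrier) :
    T.wedgeForm φ x y = φ (T.coord ⁅x, y⁆) + wedge67 (T.coord x) (T.coord y) := rfl

theorem Table.isSymplectic_wedgeForm (T : Table) (φ : Dual ℝ (Fin 8 → ℝ))
    (hc : ∀ x y z, wedge67 (tableBracket T.c x y) z + wedge67 (tableBracket T.c y z) x +
      wedge67 (tableBracket T.c z x) y = 0)
    (h : ∀ x, (∀ y, φ (tableBracket T.c x y) + wedge67 x y = 0) → x = 0) :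
    IsSymplectic (T.wedgeForm φ) := by
  have ha (x : T.Carrier) : T.wedgeForm φ x x = 0 := by
    rw [T.wedgeForm_apply, lie_self, map_zero, map_zero, wedge67_apply]
    ring
  refine ⟨ha, nondegenerate_of_alt ha h, fun x y z => ?_⟩
  have h1 := hc (T.coord x) (T.coord y) (T.coord z)
  have h2 := congrArg (φ ∘ₗ T.coord) (lie_lie_cyclic x y z)
  simp only [map_add, map_zero, LinearMap.comp_apply] at h2
  simp only [T.wedgeForm_apply, T.coord_lie] at h2 ⊢
  linarith

/-- An exact form vanishes on commuting vectors, but this one takes the value 1 at `e 6, e 7`. -/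
theorem Table.exists_isSymplectic_not_isExactForm (T : Table) (φ : Dual ℝ (Fin 8 → ℝ))
    (h : IsSymplectic (T.wedgeForm φ)) (h67 : tableBracket T.c (e 6) (e 7) = 0) :
    ∃ ω : LinearMap.BilinForm ℝ T.Carrier, IsSymplectic ω ∧ ¬ IsExactForm ω := by
  refine ⟨_, h, fun ⟨f, hf⟩ => ?_⟩
  obtain ⟨x, hx⟩ : ∃ x : T.Carrier, T.coord x = e 6 := ⟨(e 6 : Fin 8 → ℝ), rfl⟩
  obtain ⟨y, hy⟩ : ∃ y : T.Carrier, T.coord y = e 7 := ⟨(e 7 : Fin 8 → ℝ), rfl⟩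
  have hxy : ⁅x, y⁆ = 0 := T.coord_injective (by rw [T.coord_lie, hx, hy, h67, map_zero])
  have := hf x y
  rw [T.wedgeForm_apply, hxy, map_zero, map_zero, map_zero, wedge67_apply, hx, hy] at this
  simp [e] at this

/-- The coordinate subspace of the first three basis vectors. -/
def leviPart : Submodule ℝ (Fin 8 → ℝ) where
  carrier := {x | x 3 = 0 ∧ x 4 = 0 ∧ x 5 = 0 ∧ x 6 = 0 ∧ x 7 = 0}
  zero_mem' := by simp
  add_mem' := by
    rintro x y ⟨h1, h2, h3, h4, h5⟩ ⟨k1, k2, k3, k4, k5⟩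
    simp [h1, h2, h3, h4, h5, k1, k2, k3, k4, k5]
  smul_mem' := by
    rintro c x ⟨h1, h2, h3, h4, h5⟩
    simp [h1, h2, h3, h4, h5]

theorem eq_of_mem_leviPart {x : Fin 8 → ℝ} (hx : x ∈ leviPart) :
    x = x 0 • e 1 + x 1 • e 2 + x 2 • e 3 := by
  obtain ⟨h1, h2, h3, h4, h5⟩ := hx
  ext k
  fin_cases k <;> simp [e, h1, h2, h3, h4, h5]

/-- The coordinate subspace of the fourth to seventh basis vectors. -/
def modulePart : Submodule ℝ (Fin 8 → ℝ) where
  carrier := {x | x 0 = 0 ∧ x 1 = 0 ∧ x 2 = 0 ∧ x 7 = 0}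
  zero_mem' := by simp
  add_mem' := by
    rintro x y ⟨h1, h2, h3, h4⟩ ⟨k1, k2, k3, k4⟩
    simp [h1, h2, h3, h4, k1, k2, k3, k4]
  smul_mem' := by
    rintro c x ⟨h1, h2, h3, h4⟩
    simp [h1, h2, h3, h4]

/-- The projection onto the coordinate subspace of the fourth to seventh basis vectors. -/
def moduleProj : (Fin 8 → ℝ) →ₗ[ℝ] (Fin 8 → ℝ) where
  toFun x := ![0, 0, 0, x 3, x 4, x 5, x 6, 0]
  map_add' x y := by
    ext k
    fin_cases k <;> simp
  map_smul' c x := by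
    ext k
    fin_cases k <;> simp

theorem moduleProj_apply (x : Fin 8 → ℝ) : moduleProj x = ![0, 0, 0, x 3, x 4, x 5, x 6, 0] := rfl

theorem moduleProj_mem (x : Fin 8 → ℝ) : moduleProj x ∈ modulePart := ⟨rfl, rfl, rfl, rfl⟩

theorem moduleProj_of_mem_leviPart {x : Fin 8 → ℝ} (hx : x ∈ leviPart) : moduleProj x = 0 := by
  obtain ⟨h1, h2, h3, h4, h5⟩ := hx
  ext k
  fin_cases k <;> simp [moduleProj_apply, h1, h2, h3, h4]

theorem moduleProj_of_mem_modulePart {x : Fin 8 → ℝ} (hx : x ∈ modulePart) : moduleProj x = x := by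
  obtain ⟨h1, h2, h3, h4⟩ := hx
  ext k
  fin_cases k <;> simp [moduleProj_apply, h1, h2, h3, h4]

theorem Table.isExactForm (T : Table) {c : ℝ}
    (h : IsSimpleTriple (g := T.Carrier) c (e 1) (e 2) (e 3))
    {a b : ℝ} (ha : a ≠ 0) (hb : b ≠ 0)
    (hSS : ∀ x ∈ leviPart, ∀ y ∈ leviPart, tableBracket T.c x y ∈ leviPart)
    (hSt : ∀ x ∈ leviPart, tableBracket T.c x (e 8) = 0)
    (hSV : ∀ x ∈ leviPart, ∀ y ∈ modulePart, tableBracket T.c x y ∈ modulePart)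
    (hVt : ∀ y ∈ modulePart, tableBracket T.c y (e 8) ∈ modulePart)
    (hVV : ∀ y ∈ modulePart, ∀ z ∈ modulePart, tableBracket T.c y z = 0)
    (hD : ∀ y ∈ modulePart, tableBracket T.c (tableBracket T.c y (e 8)) (e 8) =
      a • tableBracket T.c y (e 8) - b • y)
    {ω : LinearMap.BilinForm ℝ T.Carrier} (hω : IsSymplectic ω)
    (hfS : ∃ φ : Dual ℝ (Fin 8 → ℝ), (∀ y ∈ modulePart, φ y = 0) ∧
      ∀ x y : T.Carrier, T.coord x ∈ leviPart → T.coord y ∈ leviPart → ω x y = φ (T.coord ⁅x, y⁆)) :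
    IsExactForm ω := by
  obtain ⟨φ, hφ, hfS⟩ := hfS
  obtain ⟨t, ht⟩ : ∃ t : T.Carrier, T.coord t = e 8 := ⟨(e 8 : Fin 8 → ℝ), rfl⟩
  obtain ⟨P, hP⟩ : ∃ P : T.Carrier →ₗ[ℝ] T.Carrier, ∀ x, T.coord (P x) = moduleProj (T.coord x) :=
    ⟨{ toFun := fun x => moduleProj (T.coord x)
       map_add' := fun x y => map_add moduleProj (T.coord x) (T.coord y)
       map_smul' := fun c x => map_smul moduleProj c (T.coord x) }, fun _ => rfl⟩
  let D : T.Carrier →ₗ[ℝ] T.Carrier := -(LieAlgebra.ad ℝ T.Carrier t : T.Carrier →ₗ[ℝ] T.Carrier)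
  have hDy (y : T.Carrier) : D y = ⁅y, t⁆ := by
    rw [LinearMap.neg_apply, LieAlgebra.ad_apply, lie_skew]
  refine hω.isExactForm (S := leviPart.comap T.coord) (V := modulePart.comap T.coord) (t := t) ha hb
    ?_ ?_ ?_ ?_ ?_ ?_ ?_
    -- With `D y = ⁅y, t⁆` one has `(a - D) D = b` on the module part, so the second summand takes
    -- the value `ω y t` at `⁅y, t⁆`. The projection `P` makes it vanish on the Levi factor.
    (φ ∘ₗ T.coord + b⁻¹ • ((ω.flip t) ∘ₗ (a • LinearMap.id - D) ∘ₗ P)) ?_ ?_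
  · intro z
    obtain ⟨x, hx⟩ : ∃ x : T.Carrier, T.coord x = ![T.coord z 0, T.coord z 1, T.coord z 2, 0, 0, 0,
      0, 0] := ⟨_, rfl⟩
    refine ⟨x, ?_, P z, ?_, T.coord z 7, T.coord_injective ?_⟩
    · rw [Submodule.mem_comap, hx]
      exact ⟨rfl, rfl, rfl, rfl, rfl⟩
    · rw [Submodule.mem_comap, hP]
      exact moduleProj_mem _
    · rw [map_add, map_add, map_smul, hx, hP, ht]
      ext k
      fin_cases k <;> simp [e, moduleProj_apply]
  · intro x hx
    exact T.coord_injective (by rw [T.coord_lie, ht, hSt (T.coord x) hx, map_zero])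
  · intro x hx y hy
    rw [Submodule.mem_comap, T.coord_lie]
    exact hSV _ hx _ hy
  · intro y hy
    rw [Submodule.mem_comap, T.coord_lie, ht]
    exact hVt _ hy
  · intro y hy z hz
    exact T.coord_injective (by rw [T.coord_lie, hVV (T.coord y) hy (T.coord z) hz, map_zero])
  · intro y hy
    exact T.coord_injective (by
      rw [T.coord_lie, T.coord_lie, ht, hD (T.coord y) hy, map_sub, map_smul, map_smul, T.coord_lie, ht])
  · intro x hx
    obtain ⟨x₁, h₁⟩ : ∃ x : T.Carrier, T.coord x = e 1 := ⟨(e 1 : Fin 8 → ℝ), rfl⟩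
    obtain ⟨x₂, h₂⟩ : ∃ x : T.Carrier, T.coord x = e 2 := ⟨(e 2 : Fin 8 → ℝ), rfl⟩
    obtain ⟨x₃, h₃⟩ : ∃ x : T.Carrier, T.coord x = e 3 := ⟨(e 3 : Fin 8 → ℝ), rfl⟩
    have h' : IsSimpleTriple c x₁ x₂ x₃ := by
      rw [show x₁ = _ from T.coord_injective h₁, show x₂ = _ from T.coord_injective h₂,
        show x₃ = _ from T.coord_injective h₃]
      exact h
    have m₁ : T.coord x₁ ∈ leviPart := by rw [h₁]; simp [leviPart, e]
    have m₂ : T.coord x₂ ∈ leviPart := by rw [h₂]; simp [leviPart, e]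
    have m₃ : T.coord x₃ ∈ leviPart := by rw [h₃]; simp [leviPart, e]
    have e0 : x = T.coord x 0 • x₁ + T.coord x 1 • x₂ + T.coord x 2 • x₃ := T.coord_injective (by
      simp only [map_add, map_smul, h₁, h₂, h₃]
      exact eq_of_mem_leviPart hx)
    have e2 : x₂ = c⁻¹ • ⁅x₁, ⁅x₁, x₂⁆⁆ := by
      rw [h'.lie_lie_2, smul_smul, inv_mul_cancel₀ h.scalar_ne_zero, one_smul]
    have e3 : x₃ = c⁻¹ • ⁅x₁, ⁅x₁, x₃⁆⁆ := by
      rw [h'.lie_lie_3, smul_smul, inv_mul_cancel₀ h.scalar_ne_zero, one_smul]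
    have hm {y z : T.Carrier} (hy : T.coord y ∈ leviPart) (hz : T.coord z ∈ leviPart) :
        ⁅y, z⁆ ∈ Submodule.span ℝ
          {z | ∃ y ∈ leviPart.comap T.coord, ∃ y' ∈ leviPart.comap T.coord, ⁅y, y'⁆ = z} :=
      Submodule.subset_span ⟨y, hy, z, hz, rfl⟩
    have n₁ := hm m₂ m₃
    have n₂ := Submodule.smul_mem _ c⁻¹ (hm m₁ (y := x₁) (z := ⁅x₁, x₂⁆) (hSS _ m₁ _ m₂))
    have n₃ := Submodule.smul_mem _ c⁻¹ (hm m₁ (y := x₁) (z := ⁅x₁, x₃⁆) (hSS _ m₁ _ m₃))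
    rw [h'.lie_2_3] at n₁
    rw [← e2] at n₂
    rw [← e3] at n₃
    rw [e0]
    exact Submodule.add_mem _ (Submodule.add_mem _ (Submodule.smul_mem _ _ n₁)
      (Submodule.smul_mem _ _ n₂)) (Submodule.smul_mem _ _ n₃)
  · intro x hx y hy
    have h0 : P ⁅x, y⁆ = 0 := T.coord_injective (by
      rw [hP, T.coord_lie, moduleProj_of_mem_leviPart (hSS (T.coord x) hx (T.coord y) hy), map_zero])
    simp [hfS x y hx hy, h0]
  · intro y hy
    have h0 : P ⁅y, t⁆ = ⁅y, t⁆ := T.coord_injective (by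
      rw [hP, T.coord_lie, ht, moduleProj_of_mem_modulePart (hVt (T.coord y) hy)])
    have h1 : ⁅⁅y, t⁆, t⁆ = a • ⁅y, t⁆ - b • y := T.coord_injective (by
      rw [T.coord_lie, T.coord_lie, ht, hD (T.coord y) hy, map_sub, map_smul, map_smul, T.coord_lie, ht])
    have h2 : φ (T.coord ⁅y, t⁆) = 0 := hφ _ (by
      rw [T.coord_lie, ht]
      exact hVt _ hy)
    simp only [LinearMap.add_apply, LinearMap.smul_apply, LinearMap.comp_apply, h0, h2,
      LinearMap.sub_apply, hDy, h1, LinearMap.id_apply, sub_sub_cancel, map_smul, smul_eq_mul, zero_add]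
    rw [← mul_assoc, inv_mul_cancel₀ hb, one_mul]
    rfl

/-- On the Levi factor every two-form is exact. -/
theorem Table.exists_dual_of_isSymplectic (T : Table) {ω : LinearMap.BilinForm ℝ T.Carrier}
    (hω : IsSymplectic ω)
    (h : (∀ x ∈ leviPart, ∀ y ∈ leviPart, tableBracket T.c x y = ![x 1 * y 2 - x 2 * y 1,
        2 * (x 0 * y 1 - x 1 * y 0), -2 * (x 0 * y 2 - x 2 * y 0), 0, 0, 0, 0, 0]) ∨
      (∀ x ∈ leviPart, ∀ y ∈ leviPart, tableBracket T.c x y = ![x 1 * y 2 - x 2 * y 1,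
        -(x 0 * y 2 - x 2 * y 0), x 0 * y 1 - x 1 * y 0, 0, 0, 0, 0, 0])) :
    ∃ φ : Dual ℝ (Fin 8 → ℝ), (∀ y ∈ modulePart, φ y = 0) ∧
      ∀ x y : T.Carrier, T.coord x ∈ leviPart → T.coord y ∈ leviPart →
        ω x y = φ (T.coord ⁅x, y⁆) := by
  obtain ⟨x₁, h₁⟩ : ∃ x : T.Carrier, T.coord x = e 1 := ⟨(e 1 : Fin 8 → ℝ), rfl⟩
  obtain ⟨x₂, h₂⟩ : ∃ x : T.Carrier, T.coord x = e 2 := ⟨(e 2 : Fin 8 → ℝ), rfl⟩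
  obtain ⟨x₃, h₃⟩ : ∃ x : T.Carrier, T.coord x = e 3 := ⟨(e 3 : Fin 8 → ℝ), rfl⟩
  have hφ (α β γ : ℝ) : ∃ φ : Dual ℝ (Fin 8 → ℝ), ∀ z, φ z = z 0 * α + z 1 * β + z 2 * γ :=
    ⟨α • LinearMap.proj 0 + β • LinearMap.proj 1 + γ • LinearMap.proj 2, fun z => by
      simp [mul_comm]⟩
  have e0 (x : T.Carrier) (hx : T.coord x ∈ leviPart) :
      x = T.coord x 0 • x₁ + T.coord x 1 • x₂ + T.coord x 2 • x₃ := T.coord_injective (by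
    simp only [map_add, map_smul, h₁, h₂, h₃]
    exact eq_of_mem_leviPart hx)
  have key (x y : T.Carrier) (hx : T.coord x ∈ leviPart) (hy : T.coord y ∈ leviPart) :
      ω x y = (T.coord x 0 * T.coord y 1 - T.coord x 1 * T.coord y 0) * ω x₁ x₂ +
        (T.coord x 0 * T.coord y 2 - T.coord x 2 * T.coord y 0) * ω x₁ x₃ +
        (T.coord x 1 * T.coord y 2 - T.coord x 2 * T.coord y 1) * ω x₂ x₃ := by
    conv_lhs => rw [e0 x hx, e0 y hy]
    simp only [map_add, map_smul, LinearMap.add_apply, LinearMap.smul_apply, smul_eq_mul, hω.alt,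
      ← hω.neg_apply x₁ x₂, ← hω.neg_apply x₁ x₃, ← hω.neg_apply x₂ x₃]
    ring
  rcases h with h | h
  · obtain ⟨φ, hφ⟩ := hφ (ω x₂ x₃) (ω x₁ x₂ / 2) (-ω x₁ x₃ / 2)
    refine ⟨φ, fun y hy => by rw [hφ, hy.1, hy.2.1, hy.2.2.1]; ring, fun x y hx hy => ?_⟩
    rw [key x y hx hy, hφ, T.coord_lie, h _ hx _ hy]
    simp
    ring
  · obtain ⟨φ, hφ⟩ := hφ (ω x₂ x₃) (-ω x₁ x₃) (ω x₁ x₂)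
    refine ⟨φ, fun y hy => by rw [hφ, hy.1, hy.2.1, hy.2.2.1]; ring, fun x y hx hy => ?_⟩
    rw [key x y hx hy, hφ, T.coord_lie, h _ hx _ hy]
    simp
    ring

end General

/-! ### Verification for the individual algebras. -/

section Tables

variable (p q : ℝ)

theorem L3_c : L3.c = L3Brackets := rfl

theorem L3_isSimpleTriple :
    IsSimpleTriple (g := L3.Carrier) (-1) (e 1) (e 2) (e 3) := by
  refine Table.isSimpleTriple _ (by norm_num) ?_ ?_ ?_ <;>
    simp only [L3_c, L3_formula] <;> ext k <;> fin_cases k <;> simp [e]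

theorem L3_isIndecomposable : IsIndecomposable L3.Carrier := by
  refine Table.isIndecomposable _ L3_isSimpleTriple (fun y h h' => ⟨y 1, ?_⟩) fun y h => ?_
  · simp only [L3_c, L3_formula] at h h'
    simp [funext_iff, Fin.forall_fin_succ, e] at h h'
    ext k
    fin_cases k <;> simp [e] <;> linarith
  · have h2 := h (e 2)
    have h3 := h (e 3)
    have h4 := h (e 4)
    have h5 := h (e 5)
    have h6 := h (e 6)
    have h7 := h (e 7)
    simp only [L3_c, L3_formula] at h2 h3 h4 h5 h6 h7
    simp [funext_iff, Fin.forall_fin_succ, e] at h2 h3 h4 h5 h6 h7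
    ext k
    fin_cases k <;> simp <;> linarith

/-- The form `d e⁴` pairs `⟨e 1, e 2, e 3, e 8⟩` with `⟨e 4, …, e 7⟩`: up to scalars `e 1, e 2, e 3,
e 8` give `e⁷, e⁵, e⁶, e⁴`. Note that `proj 3` is the coordinate of `e 4`. -/
theorem L3_isFrobenius : IsFrobenius L3.Carrier := by
  refine Table.isFrobenius _ (LinearMap.proj 3) fun x h => ?_
  have h1 := h (e 1)
  have h2 := h (e 2)
  have h3 := h (e 3)
  have h4 := h (e 4)
  have h5 := h (e 5)
  have h6 := h (e 6)
  have h7 := h (e 7)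
  have h8 := h (e 8)
  simp only [L3_c, L3_formula] at h1 h2 h3 h4 h5 h6 h7 h8
  simp [e] at h1 h2 h3 h4 h5 h6 h7 h8
  ext k
  fin_cases k <;> simp <;> linarith

theorem L3_isExactForm {ω : LinearMap.BilinForm ℝ L3.Carrier}
    (hω : IsSymplectic ω) : IsExactForm ω := by
  -- Here `D` is the identity, regarded as a root of `(D - 1)² = 0`.
  refine Table.isExactForm _ L3_isSimpleTriple (a := 2) (b := 1) two_ne_zero one_ne_zero
    ?_ ?_ ?_ ?_ ?_ ?_ hω (Table.exists_dual_of_isSymplectic _ hω (Or.inr ?_))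
  · rintro x ⟨h3, h4, h5, h6, h7⟩ y ⟨k3, k4, k5, k6, k7⟩
    simp only [L3_c, L3_formula, h3, h4, h5, h6, h7, k3, k4, k5, k6, k7]
    simp [leviPart]
  · rintro x ⟨h3, h4, h5, h6, h7⟩
    simp only [L3_c, L3_formula, h3, h4, h5, h6, h7]
    ext k
    fin_cases k <;> simp [e]
  · rintro x ⟨h3, h4, h5, h6, h7⟩ y ⟨k0, k1, k2, k7⟩
    simp only [L3_c, L3_formula, h3, h4, h5, h6, h7, k0, k1, k2, k7]
    simp [modulePart]
  · rintro y ⟨k0, k1, k2, k7⟩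
    simp only [L3_c, L3_formula, k0, k1, k2, k7]
    simp [modulePart, e]
  · rintro y ⟨k0, k1, k2, k7⟩ z ⟨l0, l1, l2, l7⟩
    simp only [L3_c, L3_formula, k0, k1, k2, k7, l0, l1, l2, l7]
    ext k
    fin_cases k <;> simp
  · rintro y ⟨k0, k1, k2, k7⟩
    simp only [L3_c, L3_formula]
    ext k
    fin_cases k <;> simp [e, k0, k1, k2, k7] <;> ring
  · rintro x ⟨h3, h4, h5, h6, h7⟩ y ⟨k3, k4, k5, k6, k7⟩
    simp only [L3_c, L3_formula, h3, h4, h5, h6, h7, k3, k4, k5, k6, k7]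
    simp

theorem L16_c : L16.c = L16Brackets := rfl

theorem L16_isSimpleTriple :
    IsSimpleTriple (g := L16.Carrier) 4 (e 1) (e 2) (e 3) := by
  refine Table.isSimpleTriple _ (by norm_num) ?_ ?_ ?_ <;>
    simp only [L16_c, L16_formula] <;> ext k <;> fin_cases k <;> simp [e] <;> norm_num

theorem L16_isIndecomposable : IsIndecomposable L16.Carrier := by
  refine Table.isIndecomposable _ L16_isSimpleTriple (fun y h h' => ⟨y 1, ?_⟩) fun y h => ?_
  · simp only [L16_c, L16_formula] at h h'
    simp [funext_iff, Fin.forall_fin_succ, e] at h h'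
    ext k
    fin_cases k <;> simp [e] <;> linarith
  · have h2 := h (e 2)
    have h3 := h (e 3)
    have h4 := h (e 4)
    have h5 := h (e 5)
    have h6 := h (e 6)
    have h7 := h (e 7)
    simp only [L16_c, L16_formula] at h2 h3 h4 h5 h6 h7
    simp [funext_iff, Fin.forall_fin_succ, e] at h2 h3 h4 h5 h6 h7
    ext k
    fin_cases k <;> simp <;> linarith

/-- For `e⁴ + e⁷`, the vectors `e 1, e 2, e 3` induce `e⁴ - e⁷`, `e⁵`, `e⁶` on the module part; `e
8` induces a form independent of these. The same functional serves for `L17`, `L18` and `L20`. -/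
theorem L16_isFrobenius : IsFrobenius L16.Carrier := by
  refine Table.isFrobenius _ (coordSum 3 6) fun x h => ?_
  have h1 := h (e 1)
  have h2 := h (e 2)
  have h3 := h (e 3)
  have h4 := h (e 4)
  have h5 := h (e 5)
  have h6 := h (e 6)
  have h7 := h (e 7)
  have h8 := h (e 8)
  simp only [L16_c, L16_formula] at h1 h2 h3 h4 h5 h6 h7 h8
  simp [e, coordSum_apply] at h1 h2 h3 h4 h5 h6 h7 h8
  ext k
  fin_cases k <;> simp <;> linarith

theorem L16_isExactForm {ω : LinearMap.BilinForm ℝ L16.Carrier}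
    (hω : IsSymplectic ω) : IsExactForm ω := by
  refine Table.isExactForm _ L16_isSimpleTriple (a := 2) (b := 1) two_ne_zero one_ne_zero
    ?_ ?_ ?_ ?_ ?_ ?_ hω (Table.exists_dual_of_isSymplectic _ hω (Or.inl ?_))
  · rintro x ⟨h3, h4, h5, h6, h7⟩ y ⟨k3, k4, k5, k6, k7⟩
    simp only [L16_c, L16_formula, h3, h4, h5, h6, h7, k3, k4, k5, k6, k7]
    simp [leviPart]
  · rintro x ⟨h3, h4, h5, h6, h7⟩
    simp only [L16_c, L16_formula, h3, h4, h5, h6, h7]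
    ext k
    fin_cases k <;> simp [e]
  · rintro x ⟨h3, h4, h5, h6, h7⟩ y ⟨k0, k1, k2, k7⟩
    simp only [L16_c, L16_formula, h3, h4, h5, h6, h7, k0, k1, k2, k7]
    simp [modulePart]
  · rintro y ⟨k0, k1, k2, k7⟩
    simp only [L16_c, L16_formula, k0, k1, k2, k7]
    simp [modulePart, e]
  · rintro y ⟨k0, k1, k2, k7⟩ z ⟨l0, l1, l2, l7⟩
    simp only [L16_c, L16_formula, k0, k1, k2, k7, l0, l1, l2, l7]
    ext k
    fin_cases k <;> simp
  · rintro y ⟨k0, k1, k2, k7⟩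
    simp only [L16_c, L16_formula]
    ext k
    fin_cases k <;> simp [e, k0, k1, k2, k7] <;> ring
  · rintro x ⟨h3, h4, h5, h6, h7⟩ y ⟨k3, k4, k5, k6, k7⟩
    simp only [L16_c, L16_formula, h3, h4, h5, h6, h7, k3, k4, k5, k6, k7]
    simp

theorem L20_c : L20.c = L20Brackets := rfl

theorem L20_isSimpleTriple :
    IsSimpleTriple (g := L20.Carrier) 4 (e 1) (e 2) (e 3) := by
  refine Table.isSimpleTriple _ (by norm_num) ?_ ?_ ?_ <;>
    simp only [L20_c, L20_formula] <;> ext k <;> fin_cases k <;> simp [e] <;> norm_num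

theorem L20_isIndecomposable : IsIndecomposable L20.Carrier := by
  refine Table.isIndecomposable _ L20_isSimpleTriple (fun y h h' => ⟨y 1, ?_⟩) fun y h => ?_
  · simp only [L20_c, L20_formula] at h h'
    simp [funext_iff, Fin.forall_fin_succ, e] at h h'
    ext k
    fin_cases k <;> simp [e] <;> linarith
  · have h2 := h (e 2)
    have h3 := h (e 3)
    have h4 := h (e 4)
    have h5 := h (e 5)
    have h6 := h (e 6)
    have h7 := h (e 7)
    simp only [L20_c, L20_formula] at h2 h3 h4 h5 h6 h7
    simp [funext_iff, Fin.forall_fin_succ, e] at h2 h3 h4 h5 h6 h7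
    ext k
    fin_cases k <;> simp <;> linarith

theorem L20_isFrobenius : IsFrobenius L20.Carrier := by
  refine Table.isFrobenius _ (coordSum 3 6) fun x h => ?_
  have h1 := h (e 1)
  have h2 := h (e 2)
  have h3 := h (e 3)
  have h4 := h (e 4)
  have h5 := h (e 5)
  have h6 := h (e 6)
  have h7 := h (e 7)
  have h8 := h (e 8)
  simp only [L20_c, L20_formula] at h1 h2 h3 h4 h5 h6 h7 h8
  simp [e, coordSum_apply] at h1 h2 h3 h4 h5 h6 h7 h8
  ext k
  fin_cases k <;> simp <;> linarith

theorem L20_isExactForm {ω : LinearMap.BilinForm ℝ L20.Carrier}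
    (hω : IsSymplectic ω) : IsExactForm ω := by
  refine Table.isExactForm _ L20_isSimpleTriple (a := 2) (b := 1) two_ne_zero one_ne_zero
    ?_ ?_ ?_ ?_ ?_ ?_ hω (Table.exists_dual_of_isSymplectic _ hω (Or.inl ?_))
  · rintro x ⟨h3, h4, h5, h6, h7⟩ y ⟨k3, k4, k5, k6, k7⟩
    simp only [L20_c, L20_formula, h3, h4, h5, h6, h7, k3, k4, k5, k6, k7]
    simp [leviPart]
  · rintro x ⟨h3, h4, h5, h6, h7⟩
    simp only [L20_c, L20_formula, h3, h4, h5, h6, h7]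
    ext k
    fin_cases k <;> simp [e]
  · rintro x ⟨h3, h4, h5, h6, h7⟩ y ⟨k0, k1, k2, k7⟩
    simp only [L20_c, L20_formula, h3, h4, h5, h6, h7, k0, k1, k2, k7]
    simp [modulePart]
  · rintro y ⟨k0, k1, k2, k7⟩
    simp only [L20_c, L20_formula, k0, k1, k2, k7]
    simp [modulePart, e]
  · rintro y ⟨k0, k1, k2, k7⟩ z ⟨l0, l1, l2, l7⟩
    simp only [L20_c, L20_formula, k0, k1, k2, k7, l0, l1, l2, l7]
    ext k
    fin_cases k <;> simp
  · rintro y ⟨k0, k1, k2, k7⟩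
    simp only [L20_c, L20_formula]
    ext k
    fin_cases k <;> simp [e, k0, k1, k2, k7] <;> ring
  · rintro x ⟨h3, h4, h5, h6, h7⟩ y ⟨k3, k4, k5, k6, k7⟩
    simp only [L20_c, L20_formula, h3, h4, h5, h6, h7, k3, k4, k5, k6, k7]
    simp

theorem L4_c : (L4 p).c = L4Brackets p := rfl

theorem L4_isSimpleTriple :
    IsSimpleTriple (g := (L4 p).Carrier) (-1) (e 1) (e 2) (e 3) := by
  refine Table.isSimpleTriple _ (by norm_num) ?_ ?_ ?_ <;>
    simp only [L4_c, L4_formula] <;> ext k <;> fin_cases k <;> simp [e]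

theorem L4_isIndecomposable : IsIndecomposable (L4 p).Carrier := by
  refine Table.isIndecomposable _ (L4_isSimpleTriple p) (fun y h h' => ⟨y 1, ?_⟩) fun y h => ?_
  · simp only [L4_c, L4_formula] at h h'
    simp [funext_iff, Fin.forall_fin_succ, e] at h h'
    ext k
    fin_cases k <;> simp [e] <;> linarith
  · have h2 := h (e 2)
    have h3 := h (e 3)
    have h4 := h (e 4)
    have h5 := h (e 5)
    have h6 := h (e 6)
    have h7 := h (e 7)
    simp only [L4_c, L4_formula] at h2 h3 h4 h5 h6 h7
    simp [funext_iff, Fin.forall_fin_succ, e] at h2 h3 h4 h5 h6 h7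
    ext k
    fin_cases k <;> simp <;> linarith

theorem L4_isFrobenius (hp : p ≠ 0) : IsFrobenius (L4 p).Carrier := by
  refine Table.isFrobenius _ (LinearMap.proj 3) fun x h => ?_
  have h1 := h (e 1)
  have h2 := h (e 2)
  have h3 := h (e 3)
  have h4 := h (e 4)
  have h5 := h (e 5)
  have h6 := h (e 6)
  have h7 := h (e 7)
  have h8 := h (e 8)
  simp only [L4_c, L4_formula] at h1 h2 h3 h4 h5 h6 h7 h8
  simp [e] at h1 h2 h3 h4 h5 h6 h7 h8
  have e7 := h4.resolve_left hp
  have e3 : x 3 = 0 := (mul_eq_zero.mp (show p * x 3 = 0 by linarith)).resolve_left hp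
  ext k
  fin_cases k <;> simp <;> linarith

theorem L4_isExactForm (hp : p ≠ 0) {ω : LinearMap.BilinForm ℝ (L4 p).Carrier}
    (hω : IsSymplectic ω) : IsExactForm ω := by
  -- The roots of `D` are `p ± i`.
  refine Table.isExactForm _ (L4_isSimpleTriple p) (a := 2 * p) (b := p ^ 2 + 1) (mul_ne_zero two_ne_zero hp) (by positivity)
    ?_ ?_ ?_ ?_ ?_ ?_ hω (Table.exists_dual_of_isSymplectic _ hω (Or.inr ?_))
  · rintro x ⟨h3, h4, h5, h6, h7⟩ y ⟨k3, k4, k5, k6, k7⟩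
    simp only [L4_c, L4_formula, h3, h4, h5, h6, h7, k3, k4, k5, k6, k7]
    simp [leviPart]
  · rintro x ⟨h3, h4, h5, h6, h7⟩
    simp only [L4_c, L4_formula, h3, h4, h5, h6, h7]
    ext k
    fin_cases k <;> simp [e]
  · rintro x ⟨h3, h4, h5, h6, h7⟩ y ⟨k0, k1, k2, k7⟩
    simp only [L4_c, L4_formula, h3, h4, h5, h6, h7, k0, k1, k2, k7]
    simp [modulePart]
  · rintro y ⟨k0, k1, k2, k7⟩
    simp only [L4_c, L4_formula, k0, k1, k2, k7]
    simp [modulePart, e]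
  · rintro y ⟨k0, k1, k2, k7⟩ z ⟨l0, l1, l2, l7⟩
    simp only [L4_c, L4_formula, k0, k1, k2, k7, l0, l1, l2, l7]
    ext k
    fin_cases k <;> simp
  · rintro y ⟨k0, k1, k2, k7⟩
    simp only [L4_c, L4_formula]
    ext k
    fin_cases k <;> simp [e, k0, k1, k2, k7] <;> ring
  · rintro x ⟨h3, h4, h5, h6, h7⟩ y ⟨k3, k4, k5, k6, k7⟩
    simp only [L4_c, L4_formula, h3, h4, h5, h6, h7, k3, k4, k5, k6, k7]
    simp

theorem L17_c : (L17 p).c = L17Brackets p := rfl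

theorem L17_isSimpleTriple :
    IsSimpleTriple (g := (L17 p).Carrier) 4 (e 1) (e 2) (e 3) := by
  refine Table.isSimpleTriple _ (by norm_num) ?_ ?_ ?_ <;>
    simp only [L17_c, L17_formula] <;> ext k <;> fin_cases k <;> simp [e] <;> norm_num

theorem L17_isIndecomposable : IsIndecomposable (L17 p).Carrier := by
  refine Table.isIndecomposable _ (L17_isSimpleTriple p) (fun y h h' => ⟨y 1, ?_⟩) fun y h => ?_
  · simp only [L17_c, L17_formula] at h h'
    simp [funext_iff, Fin.forall_fin_succ, e] at h h'
    ext k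
    fin_cases k <;> simp [e] <;> linarith
  · have h2 := h (e 2)
    have h3 := h (e 3)
    have h4 := h (e 4)
    have h5 := h (e 5)
    have h6 := h (e 6)
    have h7 := h (e 7)
    simp only [L17_c, L17_formula] at h2 h3 h4 h5 h6 h7
    simp [funext_iff, Fin.forall_fin_succ, e] at h2 h3 h4 h5 h6 h7
    ext k
    fin_cases k <;> simp <;> linarith

/-- Up to sign `e 8` induces `e⁴ + p e⁷`, which is independent of `e⁴ - e⁷` exactly when `1 + p ≠
0`. -/
theorem L17_isFrobenius (hp : 1 + p ≠ 0) : IsFrobenius (L17 p).Carrier := by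
  refine Table.isFrobenius _ (coordSum 3 6) fun x h => ?_
  have h1 := h (e 1)
  have h2 := h (e 2)
  have h3 := h (e 3)
  have h4 := h (e 4)
  have h5 := h (e 5)
  have h6 := h (e 6)
  have h7 := h (e 7)
  have h8 := h (e 8)
  simp only [L17_c, L17_formula] at h1 h2 h3 h4 h5 h6 h7 h8
  simp [e, coordSum_apply] at h1 h2 h3 h4 h5 h6 h7 h8
  have e7 : x 7 = 0 := (mul_eq_zero.mp (show (1 + p) * x 7 = 0 by linarith)).resolve_left hp
  have e6 : x 6 = 0 := (mul_eq_zero.mp (show (1 + p) * x 6 = 0 by linarith)).resolve_left hp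
  ext k
  fin_cases k <;> simp <;> linarith

theorem L17_isExactForm (hp : 1 + p ≠ 0) (hp' : p ≠ 0) {ω : LinearMap.BilinForm ℝ (L17 p).Carrier}
    (hω : IsSymplectic ω) : IsExactForm ω := by
  -- `(D - 1)(D - p) = 0`; a root zero, that is `p = 0`, is where exactness breaks down.
  refine Table.isExactForm _ (L17_isSimpleTriple p) (a := 1 + p) (b := p) hp hp'
    ?_ ?_ ?_ ?_ ?_ ?_ hω (Table.exists_dual_of_isSymplectic _ hω (Or.inl ?_))
  · rintro x ⟨h3, h4, h5, h6, h7⟩ y ⟨k3, k4, k5, k6, k7⟩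
    simp only [L17_c, L17_formula, h3, h4, h5, h6, h7, k3, k4, k5, k6, k7]
    simp [leviPart]
  · rintro x ⟨h3, h4, h5, h6, h7⟩
    simp only [L17_c, L17_formula, h3, h4, h5, h6, h7]
    ext k
    fin_cases k <;> simp [e]
  · rintro x ⟨h3, h4, h5, h6, h7⟩ y ⟨k0, k1, k2, k7⟩
    simp only [L17_c, L17_formula, h3, h4, h5, h6, h7, k0, k1, k2, k7]
    simp [modulePart]
  · rintro y ⟨k0, k1, k2, k7⟩
    simp only [L17_c, L17_formula, k0, k1, k2, k7]
    simp [modulePart, e]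
  · rintro y ⟨k0, k1, k2, k7⟩ z ⟨l0, l1, l2, l7⟩
    simp only [L17_c, L17_formula, k0, k1, k2, k7, l0, l1, l2, l7]
    ext k
    fin_cases k <;> simp
  · rintro y ⟨k0, k1, k2, k7⟩
    simp only [L17_c, L17_formula]
    ext k
    fin_cases k <;> simp [e, k0, k1, k2, k7] <;> ring
  · rintro x ⟨h3, h4, h5, h6, h7⟩ y ⟨k3, k4, k5, k6, k7⟩
    simp only [L17_c, L17_formula, h3, h4, h5, h6, h7, k3, k4, k5, k6, k7]
    simp

theorem L18_c : (L18 p).c = L18Brackets p := rfl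

theorem L18_isSimpleTriple :
    IsSimpleTriple (g := (L18 p).Carrier) 4 (e 1) (e 2) (e 3) := by
  refine Table.isSimpleTriple _ (by norm_num) ?_ ?_ ?_ <;>
    simp only [L18_c, L18_formula] <;> ext k <;> fin_cases k <;> simp [e] <;> norm_num

theorem L18_isIndecomposable : IsIndecomposable (L18 p).Carrier := by
  refine Table.isIndecomposable _ (L18_isSimpleTriple p) (fun y h h' => ⟨y 1, ?_⟩) fun y h => ?_
  · simp only [L18_c, L18_formula] at h h'
    simp [funext_iff, Fin.forall_fin_succ, e] at h h'
    ext k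
    fin_cases k <;> simp [e] <;> linarith
  · have h2 := h (e 2)
    have h3 := h (e 3)
    have h4 := h (e 4)
    have h5 := h (e 5)
    have h6 := h (e 6)
    have h7 := h (e 7)
    simp only [L18_c, L18_formula] at h2 h3 h4 h5 h6 h7
    simp [funext_iff, Fin.forall_fin_succ, e] at h2 h3 h4 h5 h6 h7
    ext k
    fin_cases k <;> simp <;> linarith

theorem L18_isFrobenius (hp : p ≠ 0) : IsFrobenius (L18 p).Carrier := by
  refine Table.isFrobenius _ (coordSum 3 6) fun x h => ?_
  have h1 := h (e 1)
  have h2 := h (e 2)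
  have h3 := h (e 3)
  have h4 := h (e 4)
  have h5 := h (e 5)
  have h6 := h (e 6)
  have h7 := h (e 7)
  have h8 := h (e 8)
  simp only [L18_c, L18_formula] at h1 h2 h3 h4 h5 h6 h7 h8
  simp [e, coordSum_apply] at h1 h2 h3 h4 h5 h6 h7 h8
  have e7 : x 7 = 0 := (mul_eq_zero.mp (show p * x 7 = 0 by linarith)).resolve_left hp
  rw [show x 3 = x 6 by linarith] at h8
  have e6 : x 6 = 0 := (mul_eq_zero.mp (show p * x 6 = 0 by linarith)).resolve_left hp
  ext k
  fin_cases k <;> simp <;> linarith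

theorem L18_isExactForm (hp : p ≠ 0) {ω : LinearMap.BilinForm ℝ (L18 p).Carrier}
    (hω : IsSymplectic ω) : IsExactForm ω := by
  refine Table.isExactForm _ (L18_isSimpleTriple p) (a := 2 * p) (b := p ^ 2 + 1) (mul_ne_zero two_ne_zero hp) (by positivity)
    ?_ ?_ ?_ ?_ ?_ ?_ hω (Table.exists_dual_of_isSymplectic _ hω (Or.inl ?_))
  · rintro x ⟨h3, h4, h5, h6, h7⟩ y ⟨k3, k4, k5, k6, k7⟩
    simp only [L18_c, L18_formula, h3, h4, h5, h6, h7, k3, k4, k5, k6, k7]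
    simp [leviPart]
  · rintro x ⟨h3, h4, h5, h6, h7⟩
    simp only [L18_c, L18_formula, h3, h4, h5, h6, h7]
    ext k
    fin_cases k <;> simp [e]
  · rintro x ⟨h3, h4, h5, h6, h7⟩ y ⟨k0, k1, k2, k7⟩
    simp only [L18_c, L18_formula, h3, h4, h5, h6, h7, k0, k1, k2, k7]
    simp [modulePart]
  · rintro y ⟨k0, k1, k2, k7⟩
    simp only [L18_c, L18_formula, k0, k1, k2, k7]
    simp [modulePart, e]
  · rintro y ⟨k0, k1, k2, k7⟩ z ⟨l0, l1, l2, l7⟩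
    simp only [L18_c, L18_formula, k0, k1, k2, k7, l0, l1, l2, l7]
    ext k
    fin_cases k <;> simp
  · rintro y ⟨k0, k1, k2, k7⟩
    simp only [L18_c, L18_formula]
    ext k
    fin_cases k <;> simp [e, k0, k1, k2, k7] <;> ring
  · rintro x ⟨h3, h4, h5, h6, h7⟩ y ⟨k3, k4, k5, k6, k7⟩
    simp only [L18_c, L18_formula, h3, h4, h5, h6, h7, k3, k4, k5, k6, k7]
    simp

/-- For `p = 0` the area form `e⁶ ∧ e⁷` is invariant under `sl(2)` and under `e 8`, hence closed;
adding it preserves non-degeneracy. -/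
theorem L17_zero_isSymplectic :
    IsSymplectic ((L17 0).wedgeForm (coordSum 3 6)) := by
  refine Table.isSymplectic_wedgeForm _ _ (fun x y z => ?_) fun x h => ?_
  · simp only [L17_c, L17_formula, wedge67_apply]
    simp
    ring
  · have h1 := h (e 1)
    have h2 := h (e 2)
    have h3 := h (e 3)
    have h4 := h (e 4)
    have h5 := h (e 5)
    have h6 := h (e 6)
    have h7 := h (e 7)
    have h8 := h (e 8)
    simp only [L17_c, L17_formula, wedge67_apply] at h1 h2 h3 h4 h5 h6 h7 h8
    simp [e, coordSum_apply] at h1 h2 h3 h4 h5 h6 h7 h8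
    ext k
    fin_cases k <;> simp <;> linarith

theorem L7_c : (L7 p q).c = L7Brackets p q := rfl

theorem L7_isSimpleTriple :
    IsSimpleTriple (g := (L7 p q).Carrier) 4 (e 1) (e 2) (e 3) := by
  refine Table.isSimpleTriple _ (by norm_num) ?_ ?_ ?_ <;>
    simp only [L7_c, L7_formula] <;> ext k <;> fin_cases k <;> simp [e] <;> norm_num

theorem L7_isIndecomposable (hp : p ≠ 0) (hq : q ≠ 0) : IsIndecomposable (L7 p q).Carrier := by
  refine Table.isIndecomposable_of_span67 _ (L7_isSimpleTriple p q) (fun y h h' => ⟨y 1, ?_⟩)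
    (fun y h => ⟨y 5, y 6, ?_⟩) (fun a b a' b' => ?_) fun a b hne h => ?_
  · simp only [L7_c, L7_formula] at h h'
    simp [funext_iff, Fin.forall_fin_succ, e] at h h'
    ext k
    fin_cases k <;> simp [e] <;> linarith
  · have h2 := h (e 2)
    have h3 := h (e 3)
    have h4 := h (e 4)
    have h5 := h (e 5)
    simp only [L7_c, L7_formula] at h2 h3 h4 h5
    simp [funext_iff, Fin.forall_fin_succ, e] at h2 h3 h4 h5
    ext k
    fin_cases k <;> simp [e] <;> linarith
  · simp only [L7_c, L7_formula]
    ext k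
    fin_cases k <;> simp [e]
  · simp only [L7_c, L7_formula] at h ⊢
    simp [funext_iff, Fin.forall_fin_succ, e] at h
    refine absurd ?_ hne
    rw [h.1.resolve_left hp, h.2.resolve_left hq]
    module

/-- `e⁶ ∧ e⁷` is closed because `e 8` acts on `⟨e 6, e 7⟩` with trace zero. The exact part `d(e³ +
e⁴)` is non-degenerate on the span of `e 1, …, e 5, e 8`: its non-zero pairings are `e 1` with `e 3`
and `e 4`, `e 2` with `e 5`, and `e 4` with `e 8`. -/
theorem L7_isSymplectic :
    IsSymplectic ((L7 p (-p)).wedgeForm (coordSum 2 3)) := by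
  refine Table.isSymplectic_wedgeForm _ _ (fun x y z => ?_) fun x h => ?_
  · simp only [L7_c, L7_formula, wedge67_apply]
    simp
    ring
  · have h1 := h (e 1)
    have h2 := h (e 2)
    have h3 := h (e 3)
    have h4 := h (e 4)
    have h5 := h (e 5)
    have h6 := h (e 6)
    have h7 := h (e 7)
    have h8 := h (e 8)
    simp only [L7_c, L7_formula, wedge67_apply] at h1 h2 h3 h4 h5 h6 h7 h8
    simp [e, coordSum_apply] at h1 h2 h3 h4 h5 h6 h7 h8
    ext k
    fin_cases k <;> simp <;> linarith

theorem L7_not_isFrobenius : ¬ IsFrobenius (L7 p (-p)).Carrier := by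
  refine Table.not_isFrobenius _ (fun z => ?_) fun z => ?_ <;>
    simp only [L7_c, L7_formula] <;> ext k <;> fin_cases k <;> simp [e] <;> ring

theorem L8_c : (L8 p).c = L8Brackets p := rfl

theorem L8_isSimpleTriple :
    IsSimpleTriple (g := (L8 p).Carrier) 4 (e 1) (e 2) (e 3) := by
  refine Table.isSimpleTriple _ (by norm_num) ?_ ?_ ?_ <;>
    simp only [L8_c, L8_formula] <;> ext k <;> fin_cases k <;> simp [e] <;> norm_num

theorem L8_isIndecomposable : IsIndecomposable (L8 0).Carrier := by
  refine Table.isIndecomposable_of_span67 _ (L8_isSimpleTriple 0) (fun y h h' => ⟨y 1, ?_⟩)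
    (fun y h => ⟨y 5, y 6, ?_⟩) (fun a b a' b' => ?_) fun a b hne h => ?_
  · simp only [L8_c, L8_formula] at h h'
    simp [funext_iff, Fin.forall_fin_succ, e] at h h'
    ext k
    fin_cases k <;> simp [e] <;> linarith
  · have h2 := h (e 2)
    have h3 := h (e 3)
    have h4 := h (e 4)
    have h5 := h (e 5)
    simp only [L8_c, L8_formula] at h2 h3 h4 h5
    simp [funext_iff, Fin.forall_fin_succ, e] at h2 h3 h4 h5
    ext k
    fin_cases k <;> simp [e] <;> linarith
  · simp only [L8_c, L8_formula]
    ext k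
    fin_cases k <;> simp [e]
  · simp only [L8_c, L8_formula] at h ⊢
    simp [funext_iff, Fin.forall_fin_succ, e] at h
    subst h
    -- The block is nilpotent: its kernel is spanned by `e 6`, which is also its image `⁅e 7, e 8⁆`.
    exact ⟨0, a, by ext k; fin_cases k <;> simp [e]⟩

theorem L8_isSymplectic :
    IsSymplectic ((L8 0).wedgeForm (coordSum 2 3)) := by
  refine Table.isSymplectic_wedgeForm _ _ (fun x y z => ?_) fun x h => ?_
  · simp only [L8_c, L8_formula, wedge67_apply]
    simp
    ring
  · have h1 := h (e 1)
    have h2 := h (e 2)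
    have h3 := h (e 3)
    have h4 := h (e 4)
    have h5 := h (e 5)
    have h6 := h (e 6)
    have h7 := h (e 7)
    have h8 := h (e 8)
    simp only [L8_c, L8_formula, wedge67_apply] at h1 h2 h3 h4 h5 h6 h7 h8
    simp [e, coordSum_apply] at h1 h2 h3 h4 h5 h6 h7 h8
    ext k
    fin_cases k <;> simp <;> linarith

theorem L8_not_isFrobenius : ¬ IsFrobenius (L8 0).Carrier := by
  refine Table.not_isFrobenius _ (fun z => ?_) fun z => ?_ <;>
    simp only [L8_c, L8_formula] <;> ext k <;> fin_cases k <;> simp [e]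

theorem L9_c : (L9 p q).c = L9Brackets p q := rfl

theorem L9_isSimpleTriple :
    IsSimpleTriple (g := (L9 p q).Carrier) 4 (e 1) (e 2) (e 3) := by
  refine Table.isSimpleTriple _ (by norm_num) ?_ ?_ ?_ <;>
    simp only [L9_c, L9_formula] <;> ext k <;> fin_cases k <;> simp [e] <;> norm_num

theorem L9_isIndecomposable (hq : q ≠ 0) : IsIndecomposable (L9 0 q).Carrier := by
  refine Table.isIndecomposable_of_span67 _ (L9_isSimpleTriple 0 q) (fun y h h' => ⟨y 1, ?_⟩)
    (fun y h => ⟨y 5, y 6, ?_⟩) (fun a b a' b' => ?_) fun a b hne h => ?_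
  · simp only [L9_c, L9_formula] at h h'
    simp [funext_iff, Fin.forall_fin_succ, e] at h h'
    ext k
    fin_cases k <;> simp [e] <;> linarith
  · have h2 := h (e 2)
    have h3 := h (e 3)
    have h4 := h (e 4)
    have h5 := h (e 5)
    simp only [L9_c, L9_formula] at h2 h3 h4 h5
    simp [funext_iff, Fin.forall_fin_succ, e] at h2 h3 h4 h5
    ext k
    fin_cases k <;> simp [e] <;> linarith
  · simp only [L9_c, L9_formula]
    ext k
    fin_cases k <;> simp [e]
  · simp only [L9_c, L9_formula] at h ⊢
    simp [funext_iff, Fin.forall_fin_succ, e] at h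
    refine absurd ?_ hne
    rw [h.1.resolve_left hq, h.2.resolve_left hq]
    module

theorem L9_isSymplectic :
    IsSymplectic ((L9 0 q).wedgeForm (coordSum 2 3)) := by
  refine Table.isSymplectic_wedgeForm _ _ (fun x y z => ?_) fun x h => ?_
  · simp only [L9_c, L9_formula, wedge67_apply]
    simp
    ring
  · have h1 := h (e 1)
    have h2 := h (e 2)
    have h3 := h (e 3)
    have h4 := h (e 4)
    have h5 := h (e 5)
    have h6 := h (e 6)
    have h7 := h (e 7)
    have h8 := h (e 8)
    simp only [L9_c, L9_formula, wedge67_apply] at h1 h2 h3 h4 h5 h6 h7 h8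
    simp [e, coordSum_apply] at h1 h2 h3 h4 h5 h6 h7 h8
    ext k
    fin_cases k <;> simp <;> linarith

theorem L9_not_isFrobenius : ¬ IsFrobenius (L9 0 q).Carrier := by
  refine Table.not_isFrobenius _ (fun z => ?_) fun z => ?_ <;>
    simp only [L9_c, L9_formula] <;> ext k <;> fin_cases k <;> simp [e] <;> ring

end Tables

/-! ### Assembly of the proposition. -/

theorem IsSimpleTriple.properties_of_lieEquiv {g g' : Type*} [LieRing g] [LieAlgebra ℝ g]
    [LieRing g'] [LieAlgebra ℝ g'] {c : ℝ} {x₁ x₂ x₃ : g'} (h : IsSimpleTriple c x₁ x₂ x₃)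
    (hi : IsIndecomposable g') (hω : AdmitsSymplectic g') (φ : g ≃ₗ⁅ℝ⁆ g') :
    IsIndecomposable g ∧ ¬ LieAlgebra.IsSolvable g ∧ AdmitsSymplectic g :=
  ⟨hi.of_lieEquiv φ, fun hs => h.not_isSolvable
    ((LieAlgebra.solvable_iff_equiv_solvable φ.symm).mpr hs), hω.of_lieEquiv φ⟩

end SympLie

theorem proposition3p2 :
    -- the classification
    (∀ (g : Type u) [LieRing g] [LieAlgebra ℝ g], Module.finrank ℝ g = 8 →
      ((SympLie.IsIndecomposable g ∧ ¬ LieAlgebra.IsSolvable g ∧ SympLie.AdmitsSymplectic g) ↔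
        (Nonempty (g ≃ₗ⁅ℝ⁆ SympLie.L3) ∨
          (∃ p : ℝ, p ≠ 0 ∧ Nonempty (g ≃ₗ⁅ℝ⁆ SympLie.L4 p)) ∨
          (∃ p : ℝ, p ≠ 0 ∧ Nonempty (g ≃ₗ⁅ℝ⁆ SympLie.L7 p (-p))) ∨
          Nonempty (g ≃ₗ⁅ℝ⁆ SympLie.L8 0) ∨
          (∃ q : ℝ, q ≠ 0 ∧ Nonempty (g ≃ₗ⁅ℝ⁆ SympLie.L9 0 q)) ∨
          Nonempty (g ≃ₗ⁅ℝ⁆ SympLie.L16) ∨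
          (∃ p : ℝ, -1 < p ∧ p ≤ 1 ∧ Nonempty (g ≃ₗ⁅ℝ⁆ SympLie.L17 p)) ∨
          (∃ p : ℝ, 0 < p ∧ Nonempty (g ≃ₗ⁅ℝ⁆ SympLie.L18 p)) ∨
          Nonempty (g ≃ₗ⁅ℝ⁆ SympLie.L20)))) ∧
    -- the Frobenius ones
    (SympLie.IsFrobenius SympLie.L3 ∧
      (∀ p : ℝ, p ≠ 0 → SympLie.IsFrobenius (SympLie.L4 p)) ∧
      SympLie.IsFrobenius SympLie.L16 ∧
      (∀ p : ℝ, -1 < p → p ≤ 1 → SympLie.IsFrobenius (SympLie.L17 p)) ∧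
      (∀ p : ℝ, 0 < p → SympLie.IsFrobenius (SympLie.L18 p)) ∧
      SympLie.IsFrobenius SympLie.L20) ∧
    -- all of their symplectic forms are exact, with one exception
    ((∀ ω : LinearMap.BilinForm ℝ SympLie.L3, SympLie.IsSymplectic ω → SympLie.IsExactForm ω) ∧
      (∀ p : ℝ, p ≠ 0 → ∀ ω : LinearMap.BilinForm ℝ (SympLie.L4 p),
        SympLie.IsSymplectic ω → SympLie.IsExactForm ω) ∧
      (∀ ω : LinearMap.BilinForm ℝ SympLie.L16,
        SympLie.IsSymplectic ω → SympLie.IsExactForm ω) ∧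
      (∀ p : ℝ, -1 < p → p ≤ 1 → p ≠ 0 → ∀ ω : LinearMap.BilinForm ℝ (SympLie.L17 p),
        SympLie.IsSymplectic ω → SympLie.IsExactForm ω) ∧
      (∀ p : ℝ, 0 < p → ∀ ω : LinearMap.BilinForm ℝ (SympLie.L18 p),
        SympLie.IsSymplectic ω → SympLie.IsExactForm ω) ∧
      (∀ ω : LinearMap.BilinForm ℝ SympLie.L20,
        SympLie.IsSymplectic ω → SympLie.IsExactForm ω) ∧
      (∃ ω : LinearMap.BilinForm ℝ (SympLie.L17 0),
        SympLie.IsSymplectic ω ∧ ¬ SympLie.IsExactForm ω)) ∧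
    -- the non-Frobenius ones
    ((∀ p : ℝ, p ≠ 0 → ¬ SympLie.IsFrobenius (SympLie.L7 p (-p))) ∧
      ¬ SympLie.IsFrobenius (SympLie.L8 0) ∧
      (∀ q : ℝ, q ≠ 0 → ¬ SympLie.IsFrobenius (SympLie.L9 0 q))) := by
  refine ⟨fun g _ _ hdim => ⟨fun ⟨hg, hsol, ω, hω⟩ => ?_, fun h => ?_⟩,
    ⟨SympLie.L3_isFrobenius, fun p hp => SympLie.L4_isFrobenius p hp, SympLie.L16_isFrobenius,
      fun p hp _ => SympLie.L17_isFrobenius p (by linarith),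
      fun p hp => SympLie.L18_isFrobenius p hp.ne', SympLie.L20_isFrobenius⟩,
    ⟨fun ω hω => SympLie.L3_isExactForm hω, fun p hp ω hω => SympLie.L4_isExactForm p hp hω,
      fun ω hω => SympLie.L16_isExactForm hω,
      fun p hp _ hp0 ω hω => SympLie.L17_isExactForm p (by linarith) hp0 hω,
      fun p hp ω hω => SympLie.L18_isExactForm p hp.ne' hω,
      fun ω hω => SympLie.L20_isExactForm hω,
      SympLie.Table.exists_isSymplectic_not_isExactForm _ _ SympLie.L17_zero_isSymplectic ?_⟩,
    ⟨fun p _ => SympLie.L7_not_isFrobenius p, SympLie.L8_not_isFrobenius,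
      fun q _ => SympLie.L9_not_isFrobenius q⟩⟩
  · exact SympLie.nonempty_lieEquiv_of_isSymplectic hdim hg hsol hω
  · rcases h with ⟨⟨φ⟩⟩ | ⟨p, hp, ⟨φ⟩⟩ | ⟨p, hp, ⟨φ⟩⟩ | ⟨⟨φ⟩⟩ | ⟨q, hq, ⟨φ⟩⟩ | ⟨⟨φ⟩⟩ |
      ⟨p, hp, -, ⟨φ⟩⟩ | ⟨p, hp, ⟨φ⟩⟩ | ⟨⟨φ⟩⟩
    · exact SympLie.L3_isSimpleTriple.properties_of_lieEquiv SympLie.L3_isIndecomposable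
        SympLie.L3_isFrobenius.admitsSymplectic φ
    · exact (SympLie.L4_isSimpleTriple p).properties_of_lieEquiv (SympLie.L4_isIndecomposable p)
        (SympLie.L4_isFrobenius p hp).admitsSymplectic φ
    · exact (SympLie.L7_isSimpleTriple p (-p)).properties_of_lieEquiv
        (SympLie.L7_isIndecomposable p (-p) hp (neg_ne_zero.mpr hp))
        ⟨_, SympLie.L7_isSymplectic p⟩ φ
    · exact (SympLie.L8_isSimpleTriple 0).properties_of_lieEquiv SympLie.L8_isIndecomposable
        ⟨_, SympLie.L8_isSymplectic⟩ φ
    · exact (SympLie.L9_isSimpleTriple 0 q).properties_of_lieEquiv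
        (SympLie.L9_isIndecomposable q hq) ⟨_, SympLie.L9_isSymplectic q⟩ φ
    · exact SympLie.L16_isSimpleTriple.properties_of_lieEquiv SympLie.L16_isIndecomposable
        SympLie.L16_isFrobenius.admitsSymplectic φ
    · exact (SympLie.L17_isSimpleTriple p).properties_of_lieEquiv (SympLie.L17_isIndecomposable p)
        (SympLie.L17_isFrobenius p (by linarith)).admitsSymplectic φ
    · exact (SympLie.L18_isSimpleTriple p).properties_of_lieEquiv (SympLie.L18_isIndecomposable p)
        (SympLie.L18_isFrobenius p hp.ne').admitsSymplectic φ
    · exact SympLie.L20_isSimpleTriple.properties_of_lieEquiv SympLie.L20_isIndecomposable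
        SympLie.L20_isFrobenius.admitsSymplectic φ
  · rw [SympLie.L17_c, SympLie.L17_formula]
    ext k
    fin_cases k <;> simp [SympLie.e]
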